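/- Let $\mathbb{Z}_+=\{0,1,2,\dots\}$, $\mathbb{X}=\mathbb{Z}_+^2$, and let $\|\cdot\|$ be the Euclidean norm and $B_r=\{z\in\mathbb{R}^2:\|z\|\le r\}$. Let $Z=(Z_n)_{n\ge 0}$ be a time-homogeneous Markov chain on $\mathbb{X}$ with transition function $p$, and write $\mathbb{P}_z$ for its law started from $Z_0=z$. For $A\subseteq\mathbb{X}$ put $\tau(A)=\inf\{n\ge 0: Z_n\in A\}\in\mathbb{Z}_+\cup\{\infty\}$, and $\tau(r)=\tau(B_r\cap\mathbb{X})$. Fix $R\in\mathbb{Z}_+$, let $I_R=\{0,\dots,R-1\}$ and $I_R^c=\{R,R+1,\dots\}$, and define the interior $\mathbb{X}_\circ=I_R^c\times I_R^c$, the horizontal boundary $\mathbb{X}_1=I_R^c\times I_R$, the vertical boundary $\mathbb{X}_2=I_R\times I_R^c$ and the corner $\mathbb{X}_c=I_R\times I_R$. Assume the following. (H) There are probability mass functions $p_\circ$, $p_1(y;\cdot)$ $(y\in I_R)$ and $p_2(x;\cdot)$ $(x\in I_R)$ on $\mathbb{Z}^2$ such that, for all $w\in\mathbb{X}$ and $z=(x,y)\in\mathbb{X}$,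 $p(z,w)=p_\circ(w-z)$ if $z\in\mathbb{X}_\circ$, $p(z,w)=p_1(y;w-z)$ if $z\in\mathbb{X}_1$, and $p(z,w)=p_2(x;w-z)$ if $z\in\mathbb{X}_2$. (I) For all $z,w\in\mathbb{X}_\circ\cup\mathbb{X}_1$ there is $n\ge1$ with $\mathbb{P}_z(Z_n=w,\ n<\tau(\mathbb{X}_2\cup\mathbb{X}_c))>0$, and for all $z,w\in\mathbb{X}_\circ\cup\mathbb{X}_2$ there is $n\ge1$ with $\mathbb{P}_z(Z_n=w,\ n<\tau(\mathbb{X}_1\cup\mathbb{X}_c))>0$. (M) There are $\nu_\circ>2$ and $\nu_1,\nu_2>1$ with $\sum_z\|z\|^{\nu_\circ}p_\circ(z)<\infty$, and $\sum_z\|z\|^{\nu_1}p_1(y;z)<\infty$ and $\sum_z\|z\|^{\nu_2}p_2(x;z)<\infty$ for all $x,y\in I_R$. Put $\nu=\min(\nu_\circ,\nu_1,\nu_2)$. (D) $\sum_{z\in\mathbb{Z}^2}z\,p_\circ(z)=\mathbf{0}$. ($\Sigma$) The matrix $\Sigma=\sum_{z\in\mathbb{Z}^2}p_\circ(z)\,zz^{\top}$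 is positive definite. Define transition functions on $\mathbb{Z}_+$ by $q_1(i,j)=\sum_{x\in\mathbb{Z}}p_1(i;(x,j-i))$ if $i<R$ and $q_1(i,j)=\sum_{x\in\mathbb{Z}}p_\circ((x,j-i))$ if $i\ge R$; and $q_2(i,j)=\sum_{y\in\mathbb{Z}}p_2(i;(j-i,y))$ if $i<R$ and $q_2(i,j)=\sum_{y\in\mathbb{Z}}p_\circ((j-i,y))$ if $i\ge R$. For $k\in\{1,2\}$ let $\pi_k$ be the positive measure on $\mathbb{Z}_+$ that is invariant under $q_k$ and has $\pi_k(I_R)=1$, and let $\overline\mu_k=\sum_{i\in I_R}\pi_k(i)\sum_{z\in\mathbb{Z}^2}z\,p_k(i;z)\in\mathbb{R}^2$. Let $T$ be the real $2\times2$ matrix with $T\Sigma T^{\top}=I$, $T_{11}>0$, $T_{22}>0$ and $T_{21}=0$. Write $R_\theta$ for the anti-clockwise rotation of $\mathbb{R}^2$ by $\theta$, and say that $\theta$ is the angle between the non-zero vectors $w$ and $z$ if $R_\theta(w)/\|w\|=z/\|z\|$. Let $\varphi_0\in(0,\pi)$ be the angle between $Te_1$ and $Te_2$, let $\varphi_1\in(-\pi/2,\pi/2)$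 be the angle between $R_{\pi/2}(Te_1)$ and $T\overline\mu_1$, let $\varphi_2\in(-\pi/2,\pi/2)$ be the angle between $T\overline\mu_2$ and $R_{-\pi/2}(Te_2)$, and let $$\chi=\frac{\varphi_1+\varphi_2}{\varphi_0}.$$ Then $\chi$ is well defined (exactly one real number arises in this way), and the following hold. (i) If $\chi>0$, then $Z$ is recurrent: $\mathbb{P}_z(\tau(r)<\infty)=1$ for all $r>R\sqrt2$ and all $z\in\mathbb{X}$. If $\chi<0$, then $Z$ is transient: for every $r>R\sqrt2$ there is $r_0>r$ such that $\mathbb{P}_z(\tau(r)=\infty)>0$ for all $z\in\mathbb{X}\setminus B_{r_0}$. (ii) Suppose $\chi>0$. Then for all $r>R\sqrt2$, $\varepsilon>0$ and $z\in\mathbb{X}$ there is $C<\infty$ such that $$\mathbb{P}_z(\tau(r)>n)\le C\,n^{-\frac{\min(\nu,\chi)}{2}+\varepsilon}\quad\text{for all integers } n\ge1.$$ (iii) Suppose $\nu>\max(2,\chi)$. Then for every $r>0$ there is $r_0>r$ such that for every $\varepsilon>0$ with $\frac{\chi}{2}+\varepsilon\ge0$ (no restriction if $\chi\ge0$) there is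 $c>0$ such that, for all $z\in\mathbb{X}\setminus B_{r_0}$, $$\mathbb{P}_z(\tau(r)>n)\ge c\,n^{-\frac{\chi}{2}-\varepsilon}\quad\text{for all integers } n\ge1.$$ -/

import Mathlib

open MeasureTheory
open scoped ENNReal NNReal

noncomputable section

namespace QuadrantWalk

/-- The Euclidean plane. -/
abbrev Plane : Type := EuclideanSpace ℝ (Fin 2)

/-- A vector of `ℤ²` as a vector of the Euclidean plane. -/
def vec (z : ℤ × ℤ) : Plane := !₂[(z.1 : ℝ), (z.2 : ℝ)]

/-- The state space `ℤ₊²` inside `ℤ²`. -/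
def toInt (z : ℕ × ℕ) : ℤ × ℤ := ((z.1 : ℤ), (z.2 : ℤ))

/-- The Euclidean norm of a state. -/
def stateNorm (z : ℕ × ℕ) : ℝ := ‖vec (toInt z)‖

/-! ### The four regions of the quadrant -/

def interiorRegion (R : ℕ) : Set (ℕ × ℕ) := {z | R ≤ z.1 ∧ R ≤ z.2}

def horizontalBoundary (R : ℕ) : Set (ℕ × ℕ) := {z | R ≤ z.1 ∧ z.2 < R}

def verticalBoundary (R : ℕ) : Set (ℕ × ℕ) := {z | z.1 < R ∧ R ≤ z.2}

def corner (R : ℕ) : Set (ℕ × ℕ) := {z | z.1 < R ∧ z.2 < R}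

/-- The states in the closed Euclidean ball of radius `r` about the origin. -/
def ball (r : ℝ) : Set (ℕ × ℕ) := {z | stateNorm z ≤ r}

/-! ### The Markov chain and its passage times -/

/-- The process `Z` is, under the family of laws `P z`, the time-homogeneous Markov chain on `ℤ₊²`
with one-step transition function `p`, started from `z`. -/
structure IsMarkovChain {Ω : Type*} [MeasurableSpace Ω] (p : ℕ × ℕ → PMF (ℕ × ℕ))
    (P : ℕ × ℕ → Measure Ω) (Z : ℕ → Ω → ℕ × ℕ) : Prop where
  isProbabilityMeasure : ∀ z, IsProbabilityMeasure (P z)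
  measurable : ∀ n, Measurable (Z n)
  law : ∀ (z : ℕ × ℕ) (n : ℕ) (w : ℕ → ℕ × ℕ),
    P z {ω | ∀ i ≤ n, Z i ω = w i} =
      if w 0 = z then ∏ i ∈ Finset.range n, p (w i) (w (i + 1)) else 0

/-- First passage time of `Z` into `A` (equal to `⊤` if `A` is never visited). -/
def passageTime {Ω : Type*} (Z : ℕ → Ω → ℕ × ℕ) (A : Set (ℕ × ℕ)) (ω : Ω) : ℕ∞ :=
  sInf {t : ℕ∞ | ∃ n : ℕ, t = n ∧ Z n ω ∈ A}

/-! ### The assumptions -/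

/-- (H) Partial homogeneity. -/
structure PartialHomogeneity (R : ℕ) (p : ℕ × ℕ → PMF (ℕ × ℕ)) (p₀ : PMF (ℤ × ℤ))
    (p₁ p₂ : Fin R → PMF (ℤ × ℤ)) : Prop where
  interior : ∀ z w : ℕ × ℕ, z ∈ interiorRegion R → p z w = p₀ (toInt w - toInt z)
  horizontal : ∀ (x : ℕ) (y : Fin R) (w : ℕ × ℕ), R ≤ x →
    p (x, (y : ℕ)) w = p₁ y (toInt w - toInt (x, (y : ℕ)))
  vertical : ∀ (x : Fin R) (y : ℕ) (w : ℕ × ℕ), R ≤ y →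
    p ((x : ℕ), y) w = p₂ x (toInt w - toInt ((x : ℕ), y))

/-- (I) Irreducibility, separately in the quadrant without the vertical boundary and the corner,
and without the horizontal boundary and the corner. -/
structure Irreducibility {Ω : Type*} [MeasurableSpace Ω] (R : ℕ)
    (P : ℕ × ℕ → Measure Ω) (Z : ℕ → Ω → ℕ × ℕ) : Prop where
  avoid_vertical : ∀ z ∈ interiorRegion R ∪ horizontalBoundary R,
    ∀ w ∈ interiorRegion R ∪ horizontalBoundary R, ∃ n : ℕ, 1 ≤ n ∧
      0 < P z {ω | Z n ω = w ∧ (n : ℕ∞) < passageTime Z (verticalBoundary R ∪ corner R) ω}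
  avoid_horizontal : ∀ z ∈ interiorRegion R ∪ verticalBoundary R,
    ∀ w ∈ interiorRegion R ∪ verticalBoundary R, ∃ n : ℕ, 1 ≤ n ∧
      0 < P z {ω | Z n ω = w ∧ (n : ℕ∞) < passageTime Z (horizontalBoundary R ∪ corner R) ω}

/-- Finiteness of the moment of order `ν` of the increment distribution `q`. -/
def FiniteMoment (q : PMF (ℤ × ℤ)) (ν : ℝ) : Prop :=
  Summable fun z : ℤ × ℤ => ‖vec z‖ ^ ν * (q z).toReal

/-- (M) Bounded moments, with exponents `ν₀ > 2` in the interior and `ν₁, ν₂ > 1` at the two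
boundaries. -/
structure BoundedMoments {R : ℕ} (p₀ : PMF (ℤ × ℤ)) (p₁ p₂ : Fin R → PMF (ℤ × ℤ))
    (ν₀ ν₁ ν₂ : ℝ) : Prop where
  two_lt : 2 < ν₀
  one_lt₁ : 1 < ν₁
  one_lt₂ : 1 < ν₂
  interior : FiniteMoment p₀ ν₀
  horizontal : ∀ y, FiniteMoment (p₁ y) ν₁
  vertical : ∀ x, FiniteMoment (p₂ x) ν₂

/-- (D) Zero interior drift. -/
def ZeroDrift (p₀ : PMF (ℤ × ℤ)) : Prop :=
  HasSum (fun z : ℤ × ℤ => (p₀ z).toReal • vec z) 0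

/-- The interior covariance matrix `Σ = ∑ p₀(z) z zᵀ`; hypothesis (Σ) is its positive
definiteness. -/
def covMatrix (p₀ : PMF (ℤ × ℤ)) : Matrix (Fin 2) (Fin 2) ℝ :=
  Matrix.of fun i j => ∑' z : ℤ × ℤ, (p₀ z).toReal * (vec z i * vec z j)

/-! ### The characteristic parameter -/

/-- Vertical projection of the transition rule near the horizontal boundary. -/
def verticalProjection {R : ℕ} (p₀ : PMF (ℤ × ℤ)) (p₁ : Fin R → PMF (ℤ × ℤ)) (i j : ℕ) : ℝ≥0∞ :=
  if h : i < R then ∑' x : ℤ, p₁ ⟨i, h⟩ (x, (j : ℤ) - i) else ∑' x : ℤ, p₀ (x, (j : ℤ) - i)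

/-- Horizontal projection of the transition rule near the vertical boundary. -/
def horizontalProjection {R : ℕ} (p₀ : PMF (ℤ × ℤ)) (p₂ : Fin R → PMF (ℤ × ℤ)) (i j : ℕ) : ℝ≥0∞ :=
  if h : i < R then ∑' y : ℤ, p₂ ⟨i, h⟩ ((j : ℤ) - i, y) else ∑' y : ℤ, p₀ ((j : ℤ) - i, y)

/-- `π` is a positive measure on `ℤ₊`, invariant under the transition function `q`, with
`π({0, …, R - 1}) = 1`. -/
structure IsNormalizedInvariant (R : ℕ) (q : ℕ → ℕ → ℝ≥0∞) (π : ℕ → ℝ≥0) : Prop where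
  pos : ∀ i, 0 < π i
  invariant : ∀ j, ∑' i, (π i : ℝ≥0∞) * q i j = π j
  normalized : ∑ i ∈ Finset.range R, π i = 1

/-- The mean of an increment distribution. -/
def drift (q : PMF (ℤ × ℤ)) : Plane := ∑' z : ℤ × ℤ, (q z).toReal • vec z

/-- Effective boundary drift: the average under `π` of the boundary drifts. -/
def effectiveDrift {R : ℕ} (q : Fin R → PMF (ℤ × ℤ)) (π : ℕ → ℝ≥0) : Plane :=
  ∑ i : Fin R, (π i : ℝ) • drift (q i)

/-- `T` is the linear transformation `T_Σ`: it transforms the covariance `S` to the identity, maps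
`e₁` to a positive multiple of itself, and `T e₂` has positive inner product with `e₂`. -/
structure IsNormalizingMap (S T : Matrix (Fin 2) (Fin 2) ℝ) : Prop where
  whiten : T * S * T.transpose = 1
  pos₁ : 0 < T 0 0
  pos₂ : 0 < T 1 1
  zero : T 1 0 = 0

/-- Anti-clockwise rotation by the angle `θ`. -/
def rot (θ : ℝ) (v : Plane) : Plane :=
  !₂[v 0 * Real.cos θ - v 1 * Real.sin θ, v 0 * Real.sin θ + v 1 * Real.cos θ]

/-- `θ` is an oriented angle between the non-zero vectors `w` and `z`: rotation by `θ` takes the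
direction of `w` to that of `z`. -/
def IsAngle (θ : ℝ) (w z : Plane) : Prop :=
  w ≠ 0 ∧ z ≠ 0 ∧ ‖w‖⁻¹ • rot θ w = ‖z‖⁻¹ • z

/-- `χ = (φ₁ + φ₂) / φ₀`, where `φ₀` is the angle of the transformed quadrant, and `φ₁`, `φ₂` are
the angles between the transformed effective boundary drifts and the inward normals. -/
def IsCharacteristicParameter {R : ℕ} (p₀ : PMF (ℤ × ℤ)) (p₁ p₂ : Fin R → PMF (ℤ × ℤ))
    (χ : ℝ) : Prop :=
  ∃ (π₁ π₂ : ℕ → ℝ≥0) (T : Matrix (Fin 2) (Fin 2) ℝ) (φ₀ φ₁ φ₂ : ℝ),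
    IsNormalizedInvariant R (verticalProjection p₀ p₁) π₁ ∧
    IsNormalizedInvariant R (horizontalProjection p₀ p₂) π₂ ∧
    IsNormalizingMap (covMatrix p₀) T ∧
    φ₀ ∈ Set.Ioo 0 Real.pi ∧
    φ₁ ∈ Set.Ioo (-(Real.pi / 2)) (Real.pi / 2) ∧
    φ₂ ∈ Set.Ioo (-(Real.pi / 2)) (Real.pi / 2) ∧
    IsAngle φ₀ (T.toEuclideanLin !₂[1, 0]) (T.toEuclideanLin !₂[0, 1]) ∧
    IsAngle φ₁ (rot (Real.pi / 2) (T.toEuclideanLin !₂[1, 0]))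
      (T.toEuclideanLin (effectiveDrift p₁ π₁)) ∧
    IsAngle φ₂ (T.toEuclideanLin (effectiveDrift p₂ π₂))
      (rot (-(Real.pi / 2)) (T.toEuclideanLin !₂[0, 1])) ∧
    χ = (φ₁ + φ₂) / φ₀

/-! ### Recurrence and transience -/

/-- Every ball of radius `r > R√2` is reached almost surely from every state. -/
def Recurrent {Ω : Type*} [MeasurableSpace Ω] (R : ℕ) (P : ℕ × ℕ → Measure Ω)
    (Z : ℕ → Ω → ℕ × ℕ) : Prop :=
  ∀ r : ℝ, R * √2 < r → ∀ z : ℕ × ℕ, P z {ω | passageTime Z (ball r) ω < ⊤} = 1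

/-- Every ball of radius `r > R√2` is, with positive probability, never reached from any state
outside a suitable larger ball. (A larger ball is needed: the walk may be forced to jump into the
ball of radius `r` from some of the states just outside it.) -/
def Transient {Ω : Type*} [MeasurableSpace Ω] (R : ℕ) (P : ℕ × ℕ → Measure Ω)
    (Z : ℕ → Ω → ℕ × ℕ) : Prop :=
  ∀ r : ℝ, R * √2 < r → ∃ r₀ : ℝ, r < r₀ ∧ ∀ z : ℕ × ℕ, z ∉ ball r₀ →
    0 < P z {ω | passageTime Z (ball r) ω = ⊤}

end QuadrantWalk

end

open QuadrantWalk

noncomputable section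

namespace QuadrantWalk

open Complex ComplexConjugate

/-! ### Homogeneous functions on the upper half-plane -/

/-! The normalising map turns the quadrant into a wedge of opening φ = `e₂.arg` in the upper
half-plane. There the interior jumps are centred with identity covariance, so the interior drift of
a smooth function is, to leading order, half its Laplacian. For a function homogeneous of degree γ
this is of order ‖ζ‖^(γ-2). In the boundary layers the drift is the derivative along the mean jump,
of order ‖ζ‖^(γ-1), and only its average over the layers should count.

The function ‖ζ‖^γ cos(γ arg ζ - α) is harmonic. With α = (φ₁ - φ₂)/2 + γφ/2, its derivatives along
the two effective boundary drifts are positive multiples of γ sin((γ - χ)φ/2), which vanishes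
exactly at the critical exponent γ = χ in the range that matters. Subtracting a small multiple of
‖ζ‖^γ makes the Laplacian strictly negative as well. Thus orders strictly between 0 and χ give
supermartingales, and orders slightly above χ ≥ 0 give submartingales (`exists_lyapunov_radial`).

The passage from averaged to actual boundary drifts is made by correctors. Off the opposite boundary
and the corner, the transverse coordinate is a Markov chain on ℕ, homogeneous and centred above
height R. The chain it induces on {0, …, R-1} has a stationary vector, and its Poisson equation is
solvable (`exists_stationary`). A term G(ζ)K(y), with G homogeneous of degree γ - 1 and K the
bounded harmonic extension of a Poisson solution, replaces the drift of each layer by the common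
average. In the interior this term costs an amount of order γ - 2, the same order as the useful
drift. The cost is made small because a bounded harmonic K has vanishing increments at infinity,
while close to the axis a strictly superharmonic addition to K gains the larger order γ - 1. This is
the content of `exists_corrector`, `corrector_drift` and `boundary_drift`, assembled in
`exists_perturbation`.

All probabilities are then estimated through the kernel killed on entering the ball. For the upper
bound, two supermartingales of orders near 0 and near min ν χ are interpolated by Hölder's
inequality; the result is the recursion u(n+1) ≤ u(n) - c u(n)^(1+β), hence polynomial decay
(`survival_upper_bound`). Its drift condition must hold everywhere off the ball, which
irreducibility provides (`exists_drift_extension`). Recurrence is a consequence of this decay. For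
transience, a supermartingale of negative order tends to zero at infinity and optional stopping
applies (`one_le_survival_add`). For the lower bound with χ ≥ 0, a submartingale of order slightly
above χ is capped at distance about ‖z‖ + n^(1/2) by subtracting a small multiple of a function of
higher order; a mean that stays large while the values are bounded forces survival
(`survival_lower_bound`).

The parameter χ is well defined because the normalising map is a triangular factorisation, the
invariant measures are determined on {0, …, R-1} by the Poisson equation, and the averaged boundary
drifts point inwards (`mean_pos`), so that the two reflection angles exist in (-π/2, π/2). -/

/-- The closed upper half-plane without the non-positive reals. -/
def upper : Set ℂ := {ζ | 0 < ζ.im ∨ (ζ.im = 0 ∧ 0 < ζ.re)}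

lemma upper_subset_slitPlane {ζ : ℂ} (h : ζ ∈ upper) : ζ ∈ slitPlane := by
  rcases h with h | ⟨_, h⟩
  · exact Or.inr h.ne'
  · exact Or.inl h

lemma upper_ne_zero {ζ : ℂ} (h : ζ ∈ upper) : ζ ≠ 0 :=
  slitPlane_ne_zero (upper_subset_slitPlane h)

/-- Convexity of `upper` keeps the whole segment of a jump inside the slit plane, where `log` is
differentiable. -/
lemma upper_segment {ζ ω : ℂ} (h : ζ ∈ upper) (h' : ζ + ω ∈ upper) {t : ℝ} (h0 : 0 ≤ t)
    (h1 : t ≤ 1) : ζ + t * ω ∈ upper := by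
  simp only [upper, Set.mem_ofPred_eq, add_im, mul_im, ofReal_re, ofReal_im, zero_mul, add_zero,
    add_re, mul_re, sub_zero] at *
  rcases eq_or_lt_of_le h1 with rfl | h1
  · simpa using h'
  · rcases h with h | ⟨h, h2⟩ <;> rcases h' with h' | ⟨h', h3⟩
    · left; nlinarith
    · left; nlinarith
    · rcases eq_or_lt_of_le h0 with rfl | h0
      · right; constructor <;> linarith
      · left; nlinarith
    · right; constructor
      · rw [h] at h' ⊢; rw [show ω.im = 0 by linarith]; ring
      · nlinarith

lemma upper_smul {ζ : ℂ} (h : ζ ∈ upper) {t : ℝ} (ht : 0 < t) : (t : ℂ) * ζ ∈ upper := by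
  simp only [upper, Set.mem_ofPred_eq, mul_im, ofReal_re, ofReal_im, zero_mul, add_zero,
    mul_re, sub_zero] at *
  rcases h with h | ⟨h, h2⟩
  · left; positivity
  · right; exact ⟨by rw [h]; ring, by positivity⟩

/-- `epow a b ζ = ζ ^ a * conj ζ ^ b`, the basic homogeneous function. -/
def epow (a b ζ : ℂ) : ℂ := exp (a * log ζ + b * conj (log ζ))

/-- The sum of the exponents governs the modulus and their difference the angular factor. A real sum
therefore makes `epow` homogeneous of real degree, with an angular part that is bounded because
arguments are. -/
lemma epow_eq_polar (a b ζ : ℂ) (hζ : ζ ≠ 0) (γ : ℝ) (hab : a + b = γ) :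
    epow a b ζ = (‖ζ‖ ^ γ : ℝ) * exp ((a - b) * I * arg ζ) := by
  have h : 0 < ‖ζ‖ := norm_pos_iff.2 hζ
  rw [Real.rpow_def_of_pos h, ofReal_exp, ← Complex.exp_add, epow]
  congr 1
  have h1 : log ζ = (Real.log ‖ζ‖ : ℂ) + arg ζ * I := by
    apply Complex.ext <;> simp [log_re, log_im]
  rw [h1]
  simp only [map_add, map_mul, conj_ofReal, conj_I]
  push_cast
  rw [← hab]; ring

lemma norm_epow_le (a b : ℂ) (γ : ℝ) (hab : a + b = γ) :
    ∃ C : ℝ, 0 ≤ C ∧ ∀ ζ : ℂ, ζ ≠ 0 → ‖epow a b ζ‖ ≤ C * ‖ζ‖ ^ γ := by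
  refine ⟨Real.exp (‖a - b‖ * Real.pi), (Real.exp_pos _).le, fun ζ hζ => ?_⟩
  rw [epow_eq_polar a b ζ hζ γ hab, norm_mul, mul_comm]
  have h : 0 < ‖ζ‖ := norm_pos_iff.2 hζ
  rw [Complex.norm_of_nonneg (Real.rpow_nonneg h.le _), Complex.norm_exp]
  gcongr
  refine (Complex.re_le_norm _).trans ?_
  rw [norm_mul, norm_mul, norm_I, mul_one]
  gcongr
  rw [Complex.norm_real]
  exact Complex.abs_arg_le_pi ζ

lemma epow_smul (a b ζ : ℂ) (hζ : ζ ≠ 0) (γ : ℝ) (hab : a + b = γ) {t : ℝ} (ht : 0 < t) :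
    epow a b (t * ζ) = (t ^ γ : ℝ) * epow a b ζ := by
  rw [epow_eq_polar a b ζ hζ γ hab, epow_eq_polar a b _ (by simp [ht.ne', hζ]) γ hab,
    arg_real_mul _ ht, norm_mul, Complex.norm_of_nonneg ht.le,
    Real.mul_rpow ht.le (norm_nonneg _)]
  push_cast; ring

lemma epow_sub_one_left (a b ζ : ℂ) (hζ : ζ ≠ 0) : epow (a - 1) b ζ = epow a b ζ * ζ⁻¹ := by
  rw [epow, epow, show (a - 1) * log ζ + b * conj (log ζ)
    = (a * log ζ + b * conj (log ζ)) + -log ζ by ring, Complex.exp_add, Complex.exp_neg,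
    Complex.exp_log hζ]

lemma epow_sub_one_right (a b ζ : ℂ) (hζ : ζ ≠ 0) :
    epow a (b - 1) ζ = epow a b ζ * (conj ζ)⁻¹ := by
  rw [epow, epow, show a * log ζ + (b - 1) * conj (log ζ)
    = (a * log ζ + b * conj (log ζ)) + -conj (log ζ) by ring, Complex.exp_add, Complex.exp_neg,
    Complex.exp_conj, Complex.exp_log hζ]

/-- The derivative of `epow a b` at `ζ` in direction `ω`. -/
def epowD (a b ω ζ : ℂ) : ℂ := a * ω * epow (a - 1) b ζ + b * conj ω * epow a (b - 1) ζ

/-- The second derivative of `epow a b` at `ζ` in direction `ω`. -/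
def epowD2 (a b ω ζ : ℂ) : ℂ := a * ω * epowD (a - 1) b ω ζ + b * conj ω * epowD a (b - 1) ω ζ

lemma epowD_smul (a b ω ζ : ℂ) (t : ℝ) : epowD a b (t * ω) ζ = t * epowD a b ω ζ := by
  simp [epowD]; ring

/-- The exponents act as Wirtinger exponents: each derivative lowers one of them by one, so
derivatives stay in the same family and Taylor estimates can be proved by induction on the order. -/
lemma hasDerivAt_epow (a b ζ ω : ℂ) (t : ℝ) (h : ζ + t * ω ∈ slitPlane) :
    HasDerivAt (fun t : ℝ => epow a b (ζ + t * ω)) (epowD a b ω (ζ + t * ω)) t := by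
  have h0 : ζ + t * ω ≠ 0 := slitPlane_ne_zero h
  have h1 : HasDerivAt (fun t : ℝ => ζ + t * ω) ω t := by
    have := ((Complex.ofRealCLM.hasDerivAt (x := t)).mul_const ω).const_add ζ
    simpa using this
  have h2 : HasDerivAt (fun t : ℝ => log (ζ + t * ω)) (ω / (ζ + t * ω)) t := h1.clog_real h
  have h3 : HasDerivAt (fun t : ℝ => conj (log (ζ + t * ω))) (conj (ω / (ζ + t * ω))) t := by
    exact h2.star
  have h4 := ((h2.const_mul a).add (h3.const_mul b)).cexp
  refine h4.congr_deriv ?_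
  rw [epowD, epow_sub_one_left _ _ _ h0, epow_sub_one_right _ _ _ h0, epow]
  simp only [Pi.add_apply, map_div₀]
  field_simp

lemma rpow_le_of_comparable {x y : ℝ} (hx : 0 < x) (h1 : x / 2 ≤ y) (h2 : y ≤ 2 * x) (γ : ℝ) :
    y ^ γ ≤ 2 ^ |γ| * x ^ γ := by
  have hy : 0 < y := by linarith
  rcases le_total 0 γ with h | h
  · rw [abs_of_nonneg h, ← Real.mul_rpow (by norm_num) hx.le]
    exact Real.rpow_le_rpow hy.le h2 h
  · rw [abs_of_nonpos h, Real.rpow_neg (by norm_num), ← Real.inv_rpow (by norm_num),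
      ← Real.mul_rpow (by norm_num) hx.le]
    exact Real.rpow_le_rpow_of_nonpos (by positivity) (by linarith) h

lemma norm_segment_bounds {ζ ω : ℂ} (h : ‖ω‖ ≤ ‖ζ‖ / 2) {t : ℝ} (h0 : 0 ≤ t) (h1 : t ≤ 1) :
    ‖ζ‖ / 2 ≤ ‖ζ + t * ω‖ ∧ ‖ζ + t * ω‖ ≤ 2 * ‖ζ‖ := by
  have h2 : ‖(t : ℂ) * ω‖ ≤ ‖ζ‖ / 2 := by
    rw [norm_mul, Complex.norm_of_nonneg h0]; nlinarith [norm_nonneg ω]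
  have h3 := norm_sub_le (ζ + t * ω) (t * ω)
  have h4 := norm_add_le ζ (t * ω)
  rw [add_sub_cancel_right] at h3
  constructor <;> linarith [norm_nonneg ζ]

/-- A function along a segment whose derivative is controlled. -/
lemma norm_sub_le_of_segment {φ φ' : ℝ → ℂ} (hφ : ∀ t ∈ Set.Icc (0 : ℝ) 1, HasDerivAt φ (φ' t) t)
    {C : ℝ} (hC : ∀ t ∈ Set.Icc (0 : ℝ) 1, ‖φ' t‖ ≤ C) : ‖φ 1 - φ 0‖ ≤ C :=
  norm_image_sub_le_of_norm_deriv_le_segment_01' (fun t ht => (hφ t ht).hasDerivWithinAt)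
    fun t ht => hC t ⟨ht.1, ht.2.le⟩

/-- Domain of the local expansions: a small step inside `upper`. -/
def SmallStep (ζ ω : ℂ) : Prop := ζ ∈ upper ∧ ζ + ω ∈ upper ∧ ‖ω‖ ≤ ‖ζ‖ / 2

lemma SmallStep.smul {ζ ω : ℂ} (h : SmallStep ζ ω) {t : ℝ} (ht : t ∈ Set.Icc (0 : ℝ) 1) :
    SmallStep ζ (t * ω) := by
  refine ⟨h.1, upper_segment h.1 h.2.1 ht.1 ht.2, ?_⟩
  rw [norm_mul, Complex.norm_of_nonneg ht.1]
  exact (mul_le_of_le_one_left (norm_nonneg _) ht.2).trans h.2.2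

lemma SmallStep.norm_pos {ζ ω : ℂ} (h : SmallStep ζ ω) : 0 < ‖ζ‖ :=
  norm_pos_iff.2 (upper_ne_zero h.1)

lemma norm_epowD_le (a b : ℂ) (γ : ℝ) (hab : a + b = γ) :
    ∃ C : ℝ, 0 ≤ C ∧ ∀ ζ : ℂ, ζ ≠ 0 → ∀ ω, ‖epowD a b ω ζ‖ ≤ C * ‖ζ‖ ^ (γ - 1) * ‖ω‖ := by
  obtain ⟨C₁, h₁, hC₁⟩ := norm_epow_le (a - 1) b (γ - 1) (by push_cast; rw [← hab]; ring)
  obtain ⟨C₂, h₂, hC₂⟩ := norm_epow_le a (b - 1) (γ - 1) (by push_cast; rw [← hab]; ring)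
  refine ⟨‖a‖ * C₁ + ‖b‖ * C₂, by positivity, fun ζ hζ ω => ?_⟩
  refine (norm_add_le _ _).trans ?_
  simp only [norm_mul, RCLike.norm_conj]
  calc _ ≤ ‖a‖ * ‖ω‖ * (C₁ * ‖ζ‖ ^ (γ - 1)) + ‖b‖ * ‖ω‖ * (C₂ * ‖ζ‖ ^ (γ - 1)) := by
        gcongr
        · exact hC₁ ζ hζ
        · exact hC₂ ζ hζ
    _ = _ := by ring

lemma epow_lipschitz (a b : ℂ) (γ : ℝ) (hab : a + b = γ) :
    ∃ C : ℝ, 0 ≤ C ∧ ∀ ζ ω, SmallStep ζ ω →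
      ‖epow a b (ζ + ω) - epow a b ζ‖ ≤ C * ‖ζ‖ ^ (γ - 1) * ‖ω‖ := by
  obtain ⟨C, h, hC⟩ := norm_epowD_le a b γ hab
  refine ⟨C * 2 ^ |γ - 1|, by positivity, fun ζ ω hs => ?_⟩
  have := norm_sub_le_of_segment (φ := fun t : ℝ => epow a b (ζ + t * ω))
    (fun t ht => hasDerivAt_epow a b ζ ω t (upper_subset_slitPlane (hs.smul ht).2.1))
    (C := C * 2 ^ |γ - 1| * ‖ζ‖ ^ (γ - 1) * ‖ω‖) (fun t ht => ?_)
  · simpa using this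
  · obtain ⟨h1, h2⟩ := norm_segment_bounds hs.2.2 ht.1 ht.2
    refine (hC _ (upper_ne_zero (hs.smul ht).2.1) ω).trans ?_
    have := rpow_le_of_comparable hs.norm_pos h1 h2 (γ - 1)
    rw [mul_assoc C (2 ^ _)]
    gcongr

/-- The derivative along the segment of the remainder is a combination of the remainders of one
order less for the two lowered exponents. The mean value inequality then raises the order; the
second-order estimate repeats the argument. -/
lemma epow_taylor_one (a b : ℂ) (γ : ℝ) (hab : a + b = γ) :
    ∃ C : ℝ, 0 ≤ C ∧ ∀ ζ ω, SmallStep ζ ω →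
      ‖epow a b (ζ + ω) - epow a b ζ - epowD a b ω ζ‖ ≤ C * ‖ζ‖ ^ (γ - 2) * ‖ω‖ ^ 2 := by
  obtain ⟨C₁, h₁, hC₁⟩ := epow_lipschitz (a - 1) b (γ - 1) (by push_cast; rw [← hab]; ring)
  obtain ⟨C₂, h₂, hC₂⟩ := epow_lipschitz a (b - 1) (γ - 1) (by push_cast; rw [← hab]; ring)
  refine ⟨‖a‖ * C₁ + ‖b‖ * C₂, by positivity, fun ζ ω hs => ?_⟩
  have := norm_sub_le_of_segment (φ := fun t : ℝ => epow a b (ζ + t * ω) - t * epowD a b ω ζ)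
    (fun t ht => (hasDerivAt_epow a b ζ ω t (upper_subset_slitPlane (hs.smul ht).2.1)).sub
      ((Complex.ofRealCLM.hasDerivAt (x := t)).mul_const (epowD a b ω ζ)))
    (C := (‖a‖ * C₁ + ‖b‖ * C₂) * ‖ζ‖ ^ (γ - 2) * ‖ω‖ ^ 2) (fun t ht => ?_)
  · refine le_trans (le_of_eq ?_) this
    congr 1; simp; ring
  · have e : epowD a b ω (ζ + t * ω) - ofRealCLM 1 * epowD a b ω ζ
        = a * ω * (epow (a - 1) b (ζ + t * ω) - epow (a - 1) b ζ)
          + b * conj ω * (epow a (b - 1) (ζ + t * ω) - epow a (b - 1) ζ) := by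
      simp [epowD]; ring
    rw [e]
    refine (norm_add_le _ _).trans ?_
    have hs' := hs.smul ht
    have ht' : ‖(t : ℂ) * ω‖ ≤ ‖ω‖ := by
      rw [norm_mul, Complex.norm_of_nonneg ht.1]
      exact mul_le_of_le_one_left (norm_nonneg _) ht.2
    simp only [norm_mul, RCLike.norm_conj] at ht' ⊢
    have hz := hs.norm_pos
    have b1 := hC₁ _ _ hs'
    have b2 := hC₂ _ _ hs'
    rw [show γ - 1 - 1 = γ - 2 by ring, norm_mul] at b1 b2
    calc _ ≤ ‖a‖ * ‖ω‖ * (C₁ * ‖ζ‖ ^ (γ - 2) * ‖ω‖) + ‖b‖ * ‖ω‖ * (C₂ * ‖ζ‖ ^ (γ - 2) * ‖ω‖) := by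
          gcongr
          · exact b1.trans (by gcongr)
          · exact b2.trans (by gcongr)
      _ = _ := by ring

lemma epow_taylor_two (a b : ℂ) (γ : ℝ) (hab : a + b = γ) :
    ∃ C : ℝ, 0 ≤ C ∧ ∀ ζ ω, SmallStep ζ ω →
      ‖epow a b (ζ + ω) - epow a b ζ - epowD a b ω ζ - epowD2 a b ω ζ / 2‖
        ≤ C * ‖ζ‖ ^ (γ - 3) * ‖ω‖ ^ 3 := by
  obtain ⟨C₁, h₁, hC₁⟩ := epow_taylor_one (a - 1) b (γ - 1) (by push_cast; rw [← hab]; ring)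
  obtain ⟨C₂, h₂, hC₂⟩ := epow_taylor_one a (b - 1) (γ - 1) (by push_cast; rw [← hab]; ring)
  refine ⟨‖a‖ * C₁ + ‖b‖ * C₂, by positivity, fun ζ ω hs => ?_⟩
  have hd : ∀ t : ℝ, HasDerivAt (fun t : ℝ => (t : ℂ) ^ 2 / 2 * epowD2 a b ω ζ)
      (t * epowD2 a b ω ζ) t := fun t => by
    have := ((((Complex.ofRealCLM.hasDerivAt (x := t)).pow 2).div_const 2).mul_const
      (epowD2 a b ω ζ))
    refine (this.congr_deriv ?_)
    simp
  have := norm_sub_le_of_segment (φ := fun t : ℝ => epow a b (ζ + t * ω) - t * epowD a b ω ζ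
      - (t : ℂ) ^ 2 / 2 * epowD2 a b ω ζ)
    (fun t ht => ((hasDerivAt_epow a b ζ ω t (upper_subset_slitPlane (hs.smul ht).2.1)).sub
      ((Complex.ofRealCLM.hasDerivAt (x := t)).mul_const (epowD a b ω ζ))).sub (hd t))
    (C := (‖a‖ * C₁ + ‖b‖ * C₂) * ‖ζ‖ ^ (γ - 3) * ‖ω‖ ^ 3) (fun t ht => ?_)
  · refine le_trans (le_of_eq ?_) this
    congr 1; simp; ring
  · have e : epowD a b ω (ζ + t * ω) - ofRealCLM 1 * epowD a b ω ζ - t * epowD2 a b ω ζ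
        = a * ω * (epow (a - 1) b (ζ + t * ω) - epow (a - 1) b ζ - epowD (a - 1) b (t * ω) ζ)
          + b * conj ω * (epow a (b - 1) (ζ + t * ω) - epow a (b - 1) ζ
            - epowD a (b - 1) (t * ω) ζ) := by
      simp only [epowD_smul]
      simp [epowD2, epowD]; ring
    rw [e]
    refine (norm_add_le _ _).trans ?_
    have hs' := hs.smul ht
    have ht' : ‖(t : ℂ) * ω‖ ≤ ‖ω‖ := by
      rw [norm_mul, Complex.norm_of_nonneg ht.1]
      exact mul_le_of_le_one_left (norm_nonneg _) ht.2
    have hz := hs.norm_pos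
    have b1 := hC₁ _ _ hs'
    have b2 := hC₂ _ _ hs'
    rw [show γ - 1 - 2 = γ - 3 by ring] at b1 b2
    rw [norm_mul, norm_mul, norm_mul, norm_mul, RCLike.norm_conj]
    calc _ ≤ ‖a‖ * ‖ω‖ * (C₁ * ‖ζ‖ ^ (γ - 3) * ‖ω‖ ^ 2)
          + ‖b‖ * ‖ω‖ * (C₂ * ‖ζ‖ ^ (γ - 3) * ‖ω‖ ^ 2) := by
          gcongr
          · exact b1.trans (by gcongr)
          · exact b2.trans (by gcongr)
      _ = _ := by ring

/-! ### Taylor data of real homogeneous functions -/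

/-- A real function on `upper`, homogeneous of degree `γ`, with gradient `A` and second-order terms
`B`, `Λ`: its expansion at `ζ` is `Re (A ζ * ω) + Re (B ζ * ω ^ 2) + Λ ζ * ‖ω‖ ^ 2`. -/
structure TaylorData (γ : ℝ) (f : ℂ → ℝ) (A B : ℂ → ℂ) (Λ : ℂ → ℝ) : Prop where
  growth : ∃ C : ℝ, 0 ≤ C ∧ ∀ ζ ∈ upper, |f ζ| ≤ C * ‖ζ‖ ^ γ
  growth_gradient : ∃ C : ℝ, 0 ≤ C ∧ ∀ ζ ∈ upper, ‖A ζ‖ ≤ C * ‖ζ‖ ^ (γ - 1)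
  growth_hessian : ∃ C : ℝ, 0 ≤ C ∧ ∀ ζ ∈ upper, ‖B ζ‖ ≤ C * ‖ζ‖ ^ (γ - 2)
  growth_laplacian : ∃ C : ℝ, 0 ≤ C ∧ ∀ ζ ∈ upper, |Λ ζ| ≤ C * ‖ζ‖ ^ (γ - 2)
  lipschitz : ∃ C : ℝ, 0 ≤ C ∧ ∀ ζ ω, SmallStep ζ ω →
    |f (ζ + ω) - f ζ| ≤ C * ‖ζ‖ ^ (γ - 1) * ‖ω‖
  gradient_lipschitz : ∃ C : ℝ, 0 ≤ C ∧ ∀ ζ ω, SmallStep ζ ω →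
    ‖A (ζ + ω) - A ζ‖ ≤ C * ‖ζ‖ ^ (γ - 2) * ‖ω‖
  first_order : ∃ C : ℝ, 0 ≤ C ∧ ∀ ζ ω, SmallStep ζ ω →
    |f (ζ + ω) - f ζ - (A ζ * ω).re| ≤ C * ‖ζ‖ ^ (γ - 2) * ‖ω‖ ^ 2
  second_order : ∃ C : ℝ, 0 ≤ C ∧ ∀ ζ ω, SmallStep ζ ω →
    |f (ζ + ω) - f ζ - (A ζ * ω).re - (B ζ * ω ^ 2).re - Λ ζ * ‖ω‖ ^ 2|
      ≤ C * ‖ζ‖ ^ (γ - 3) * ‖ω‖ ^ 3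
  homogeneous : ∀ ζ ∈ upper, ∀ t : ℝ, 0 < t → f (t * ζ) = t ^ γ * f ζ
  gradient_homogeneous : ∀ ζ ∈ upper, ∀ t : ℝ, 0 < t → A (t * ζ) = (t ^ (γ - 1) : ℝ) * A ζ

lemma bound_add {ι : Type*} {S : ι → Prop} {g : ι → ℝ} {u v w : ι → ℝ}
    (h₁ : ∃ C : ℝ, 0 ≤ C ∧ ∀ i, S i → u i ≤ C * g i)
    (h₂ : ∃ C : ℝ, 0 ≤ C ∧ ∀ i, S i → v i ≤ C * g i) (h : ∀ i, w i ≤ u i + v i) :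
    ∃ C : ℝ, 0 ≤ C ∧ ∀ i, S i → w i ≤ C * g i := by
  obtain ⟨C₁, h₁, hC₁⟩ := h₁
  obtain ⟨C₂, h₂, hC₂⟩ := h₂
  refine ⟨C₁ + C₂, by positivity, fun i hi => ?_⟩
  have := hC₁ i hi; have := hC₂ i hi; have := h i
  rw [add_mul]; linarith

lemma TaylorData.add {γ : ℝ} {f₁ f₂ : ℂ → ℝ} {A₁ A₂ B₁ B₂ : ℂ → ℂ} {Λ₁ Λ₂ : ℂ → ℝ}
    (h₁ : TaylorData γ f₁ A₁ B₁ Λ₁) (h₂ : TaylorData γ f₂ A₂ B₂ Λ₂) :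
    TaylorData γ (fun ζ => f₁ ζ + f₂ ζ) (fun ζ => A₁ ζ + A₂ ζ) (fun ζ => B₁ ζ + B₂ ζ)
      (fun ζ => Λ₁ ζ + Λ₂ ζ) where
  growth := bound_add h₁.growth h₂.growth fun ζ => abs_add_le _ _
  growth_gradient := bound_add h₁.growth_gradient h₂.growth_gradient fun ζ => norm_add_le _ _
  growth_hessian := bound_add h₁.growth_hessian h₂.growth_hessian fun ζ => norm_add_le _ _
  growth_laplacian := bound_add h₁.growth_laplacian h₂.growth_laplacian fun ζ => abs_add_le _ _
  lipschitz := by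
    obtain ⟨C₁, h₁, hC₁⟩ := h₁.lipschitz
    obtain ⟨C₂, h₂, hC₂⟩ := h₂.lipschitz
    refine ⟨C₁ + C₂, by positivity, fun ζ ω hs => ?_⟩
    rw [add_mul, add_mul, show f₁ (ζ + ω) + f₂ (ζ + ω) - (f₁ ζ + f₂ ζ)
      = (f₁ (ζ + ω) - f₁ ζ) + (f₂ (ζ + ω) - f₂ ζ) by ring]
    exact (abs_add_le _ _).trans (add_le_add (hC₁ _ _ hs) (hC₂ _ _ hs))
  gradient_lipschitz := by
    obtain ⟨C₁, h₁, hC₁⟩ := h₁.gradient_lipschitz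
    obtain ⟨C₂, h₂, hC₂⟩ := h₂.gradient_lipschitz
    refine ⟨C₁ + C₂, by positivity, fun ζ ω hs => ?_⟩
    rw [add_mul, add_mul, show A₁ (ζ + ω) + A₂ (ζ + ω) - (A₁ ζ + A₂ ζ)
      = (A₁ (ζ + ω) - A₁ ζ) + (A₂ (ζ + ω) - A₂ ζ) by ring]
    exact (norm_add_le _ _).trans (add_le_add (hC₁ _ _ hs) (hC₂ _ _ hs))
  first_order := by
    obtain ⟨C₁, h₁, hC₁⟩ := h₁.first_order
    obtain ⟨C₂, h₂, hC₂⟩ := h₂.first_order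
    refine ⟨C₁ + C₂, by positivity, fun ζ ω hs => ?_⟩
    rw [add_mul, add_mul, add_mul, Complex.add_re,
      show f₁ (ζ + ω) + f₂ (ζ + ω) - (f₁ ζ + f₂ ζ) - ((A₁ ζ * ω).re + (A₂ ζ * ω).re)
      = (f₁ (ζ + ω) - f₁ ζ - (A₁ ζ * ω).re) + (f₂ (ζ + ω) - f₂ ζ - (A₂ ζ * ω).re) by ring]
    exact (abs_add_le _ _).trans (add_le_add (hC₁ _ _ hs) (hC₂ _ _ hs))
  second_order := by
    obtain ⟨C₁, h₁, hC₁⟩ := h₁.second_order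
    obtain ⟨C₂, h₂, hC₂⟩ := h₂.second_order
    refine ⟨C₁ + C₂, by positivity, fun ζ ω hs => ?_⟩
    rw [add_mul C₁, add_mul (C₁ * _), add_mul (A₁ ζ), add_mul (B₁ ζ), Complex.add_re,
      Complex.add_re,
      show f₁ (ζ + ω) + f₂ (ζ + ω) - (f₁ ζ + f₂ ζ) - ((A₁ ζ * ω).re + (A₂ ζ * ω).re)
        - ((B₁ ζ * ω ^ 2).re + (B₂ ζ * ω ^ 2).re) - (Λ₁ ζ + Λ₂ ζ) * ‖ω‖ ^ 2
      = (f₁ (ζ + ω) - f₁ ζ - (A₁ ζ * ω).re - (B₁ ζ * ω ^ 2).re - Λ₁ ζ * ‖ω‖ ^ 2)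
        + (f₂ (ζ + ω) - f₂ ζ - (A₂ ζ * ω).re - (B₂ ζ * ω ^ 2).re - Λ₂ ζ * ‖ω‖ ^ 2) by ring]
    exact (abs_add_le _ _).trans (add_le_add (hC₁ _ _ hs) (hC₂ _ _ hs))
  homogeneous ζ hζ t ht := by
    rw [h₁.homogeneous ζ hζ t ht, h₂.homogeneous ζ hζ t ht]; ring
  gradient_homogeneous ζ hζ t ht := by
    rw [h₁.gradient_homogeneous ζ hζ t ht, h₂.gradient_homogeneous ζ hζ t ht]; ring

/-- The gradient of `Re (c * epow a b)`. -/
def gradE (c a b ζ : ℂ) : ℂ := c * a * epow (a - 1) b ζ + conj (c * b * epow a (b - 1) ζ)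

/-- The trace-free second-order coefficient of `Re (c * epow a b)`. -/
def hessE (c a b ζ : ℂ) : ℂ :=
  (c * a * (a - 1) * epow (a - 1 - 1) b ζ + conj (c * b * (b - 1) * epow a (b - 1 - 1) ζ)) / 2

/-- The Laplacian coefficient of `Re (c * epow a b)`. -/
def lapE (c a b ζ : ℂ) : ℝ := (c * a * b * epow (a - 1) (b - 1) ζ).re

/-- Since Re(u conj ω) = Re(conj u · ω), the antiholomorphic part can be folded into a single
complex coefficient of ω. -/
lemma re_mul_epowD (c a b ω ζ : ℂ) : (c * epowD a b ω ζ).re = (gradE c a b ζ * ω).re := by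
  have h : ∀ u : ℂ, (u * conj ω).re = (conj u * ω).re := fun u => by
    rw [← Complex.conj_re (u * _)]; simp only [map_mul, Complex.conj_conj]
  have : c * epowD a b ω ζ = c * a * epow (a - 1) b ζ * ω + c * b * epow a (b - 1) ζ * conj ω := by
    rw [epowD]; ring
  rw [this, Complex.add_re, h, ← Complex.add_re, gradE]; ring_nf

/-- The quadratic form is separated into a trace-free part in ω² and a multiple of ‖ω‖². For jumps
with identity covariance ω² has mean zero, so only the second part contributes to the drift. -/
lemma re_mul_epowD2 (c a b ω ζ : ℂ) : (c * (epowD2 a b ω ζ / 2)).re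
    = (hessE c a b ζ * ω ^ 2).re + lapE c a b ζ * ‖ω‖ ^ 2 := by
  have h : ∀ u : ℂ, (u * conj ω ^ 2).re = (conj u * ω ^ 2).re := fun u => by
    rw [← Complex.conj_re (u * _)]; simp only [map_mul, map_pow, Complex.conj_conj]
  have hn : (‖ω‖ : ℂ) ^ 2 = ω * conj ω := by
    rw [Complex.mul_conj, Complex.normSq_eq_norm_sq, Complex.ofReal_pow]
  have e : c * (epowD2 a b ω ζ / 2) = c * a * (a - 1) * epow (a - 1 - 1) b ζ / 2 * ω ^ 2
      + c * b * (b - 1) * epow a (b - 1 - 1) ζ / 2 * conj ω ^ 2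
      + c * a * b * epow (a - 1) (b - 1) ζ * (‖ω‖ : ℂ) ^ 2 := by
    rw [hn, epowD2, epowD, epowD]; ring
  rw [e, Complex.add_re, Complex.add_re, h, ← Complex.add_re, hessE, lapE]
  congr 1
  · congr 1
    have h2 : conj (2 : ℂ) = 2 := Complex.conj_ofNat 2
    rw [map_div₀, h2]; ring
  · rw [← Complex.ofReal_pow, Complex.re_mul_ofReal]

lemma bound_re {ι : Type*} {S : ι → Prop} {g : ι → ℝ} {u : ι → ℂ} {w : ι → ℝ} (c : ℂ)
    (h₁ : ∃ C : ℝ, 0 ≤ C ∧ ∀ i, S i → ‖u i‖ ≤ C * g i) (h : ∀ i, w i = (c * u i).re) :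
    ∃ C : ℝ, 0 ≤ C ∧ ∀ i, S i → |w i| ≤ C * g i := by
  obtain ⟨C₁, h₁, hC₁⟩ := h₁
  refine ⟨‖c‖ * C₁, by positivity, fun i hi => ?_⟩
  rw [h, mul_assoc]
  refine (Complex.abs_re_le_norm _).trans ?_
  rw [norm_mul]
  gcongr
  exact hC₁ i hi

lemma taylorData_re_epow (c a b : ℂ) (γ : ℝ) (hab : a + b = γ) :
    TaylorData γ (fun ζ => (c * epow a b ζ).re) (gradE c a b) (hessE c a b) (lapE c a b) where
  growth := by
    obtain ⟨C, h, hC⟩ := norm_epow_le a b γ hab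
    exact bound_re (S := fun ζ => ζ ∈ upper) (g := fun ζ => ‖ζ‖ ^ γ) c
      ⟨C, h, fun ζ hζ => hC ζ (upper_ne_zero hζ)⟩ fun _ => rfl
  growth_gradient := by
    obtain ⟨C₁, h₁, hC₁⟩ := norm_epow_le (a - 1) b (γ - 1) (by push_cast; rw [← hab]; ring)
    obtain ⟨C₂, h₂, hC₂⟩ := norm_epow_le a (b - 1) (γ - 1) (by push_cast; rw [← hab]; ring)
    refine ⟨‖c * a‖ * C₁ + ‖c * b‖ * C₂, by positivity, fun ζ hζ => ?_⟩
    refine (norm_add_le _ _).trans ?_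
    rw [RCLike.norm_conj, norm_mul (c * a), norm_mul (c * b), add_mul, mul_assoc, mul_assoc]
    gcongr
    · exact hC₁ ζ (upper_ne_zero hζ)
    · exact hC₂ ζ (upper_ne_zero hζ)
  growth_hessian := by
    obtain ⟨C₁, h₁, hC₁⟩ := norm_epow_le (a - 1 - 1) b (γ - 2) (by push_cast; rw [← hab]; ring)
    obtain ⟨C₂, h₂, hC₂⟩ := norm_epow_le a (b - 1 - 1) (γ - 2) (by push_cast; rw [← hab]; ring)
    refine ⟨‖c * a * (a - 1)‖ * C₁ + ‖c * b * (b - 1)‖ * C₂, by positivity, fun ζ hζ => ?_⟩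
    rw [hessE, norm_div, RCLike.norm_ofNat]
    refine (div_le_self (norm_nonneg _) (by norm_num)).trans ?_
    refine (norm_add_le _ _).trans ?_
    rw [RCLike.norm_conj, norm_mul (c * a * (a - 1)), norm_mul (c * b * (b - 1)), add_mul,
      mul_assoc ‖c * a * (a - 1)‖, mul_assoc ‖c * b * (b - 1)‖]
    gcongr
    · exact hC₁ ζ (upper_ne_zero hζ)
    · exact hC₂ ζ (upper_ne_zero hζ)
  growth_laplacian := by
    obtain ⟨C, h, hC⟩ := norm_epow_le (a - 1) (b - 1) (γ - 2) (by push_cast; rw [← hab]; ring)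
    exact bound_re (S := fun ζ => ζ ∈ upper) (g := fun ζ => ‖ζ‖ ^ (γ - 2)) (c * a * b)
      ⟨C, h, fun ζ hζ => hC ζ (upper_ne_zero hζ)⟩ fun _ => rfl
  lipschitz := by
    obtain ⟨C, h, hC⟩ := epow_lipschitz a b γ hab
    refine ⟨‖c‖ * C, by positivity, fun ζ ω hs => ?_⟩
    rw [← Complex.sub_re, ← mul_sub, mul_assoc, mul_assoc]
    refine (Complex.abs_re_le_norm _).trans ?_
    rw [norm_mul, ← mul_assoc C]
    gcongr
    exact hC _ _ hs
  gradient_lipschitz := by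
    obtain ⟨C₁, h₁, hC₁⟩ := epow_lipschitz (a - 1) b (γ - 1) (by push_cast; rw [← hab]; ring)
    obtain ⟨C₂, h₂, hC₂⟩ := epow_lipschitz a (b - 1) (γ - 1) (by push_cast; rw [← hab]; ring)
    rw [show γ - 1 - 1 = γ - 2 by ring] at hC₁ hC₂
    refine ⟨‖c * a‖ * C₁ + ‖c * b‖ * C₂, by positivity, fun ζ ω hs => ?_⟩
    have e : gradE c a b (ζ + ω) - gradE c a b ζ
        = c * a * (epow (a - 1) b (ζ + ω) - epow (a - 1) b ζ)
          + conj (c * b * (epow a (b - 1) (ζ + ω) - epow a (b - 1) ζ)) := by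
      simp [gradE]; ring
    rw [e]
    refine (norm_add_le _ _).trans ?_
    rw [RCLike.norm_conj, norm_mul (c * a), norm_mul (c * b)]
    calc _ ≤ ‖c * a‖ * (C₁ * ‖ζ‖ ^ (γ - 2) * ‖ω‖) + ‖c * b‖ * (C₂ * ‖ζ‖ ^ (γ - 2) * ‖ω‖) := by
          gcongr
          · exact hC₁ _ _ hs
          · exact hC₂ _ _ hs
      _ = _ := by ring
  first_order := by
    obtain ⟨C, h, hC⟩ := epow_taylor_one a b γ hab
    refine ⟨‖c‖ * C, by positivity, fun ζ ω hs => ?_⟩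
    rw [← re_mul_epowD, ← Complex.sub_re, ← Complex.sub_re, ← mul_sub, ← mul_sub, mul_assoc,
      mul_assoc]
    refine (Complex.abs_re_le_norm _).trans ?_
    rw [norm_mul, ← mul_assoc C]
    gcongr
    exact hC _ _ hs
  second_order := by
    obtain ⟨C, h, hC⟩ := epow_taylor_two a b γ hab
    refine ⟨‖c‖ * C, by positivity, fun ζ ω hs => ?_⟩
    rw [sub_sub _ (hessE c a b ζ * ω ^ 2).re, ← re_mul_epowD2, ← re_mul_epowD, ← Complex.sub_re,
      ← Complex.sub_re, ← Complex.sub_re, ← mul_sub, ← mul_sub, ← mul_sub, mul_assoc, mul_assoc]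
    refine (Complex.abs_re_le_norm _).trans ?_
    rw [norm_mul, ← mul_assoc C]
    gcongr
    exact hC _ _ hs
  homogeneous ζ hζ t ht := by
    rw [epow_smul a b ζ (upper_ne_zero hζ) γ hab ht, mul_left_comm, Complex.re_ofReal_mul]
  gradient_homogeneous ζ hζ t ht := by
    rw [gradE, epow_smul (a - 1) b ζ (upper_ne_zero hζ) (γ - 1) (by push_cast; rw [← hab]; ring) ht,
      epow_smul a (b - 1) ζ (upper_ne_zero hζ) (γ - 1) (by push_cast; rw [← hab]; ring) ht, gradE]
    simp only [map_mul, Complex.conj_ofReal]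
    ring

end QuadrantWalk

namespace QuadrantWalk

open Complex ComplexConjugate

/-! ### Expansions along arbitrary jumps of the lattice -/

/-- The image of a state under the linear map with columns `e₁`, `e₂`. -/
def lin (e₁ e₂ : ℂ) (z : ℕ × ℕ) : ℂ := z.1 * e₁ + z.2 * e₂

/-- The images of the coordinate axes: a positive real and a point of the open upper half-plane. -/
structure IsCone (e₁ e₂ : ℂ) : Prop where
  im₁ : e₁.im = 0
  re₁ : 0 < e₁.re
  im₂ : 0 < e₂.im

section Cone

variable {e₁ e₂ : ℂ}

lemma lin_im (h : IsCone e₁ e₂) (z : ℕ × ℕ) : (lin e₁ e₂ z).im = z.2 * e₂.im := by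
  simp [lin, h.im₁]

lemma lin_re (z : ℕ × ℕ) : (lin e₁ e₂ z).re = z.1 * e₁.re + z.2 * e₂.re := by
  simp [lin]

lemma lin_mem_upper (h : IsCone e₁ e₂) {z : ℕ × ℕ} (hz : z ≠ 0) : lin e₁ e₂ z ∈ upper := by
  simp only [upper, Set.mem_ofPred_eq, lin_im h, lin_re]
  rcases Nat.eq_zero_or_pos z.2 with h2 | h2
  · right
    have h1 : 0 < z.1 := by
      rcases Nat.eq_zero_or_pos z.1 with h1 | h1
      · exact absurd (Prod.ext h1 h2) hz
      · exact h1
    have h1' : (0 : ℝ) < z.1 := by exact_mod_cast h1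
    have := h.re₁
    rw [h2]; simp only [Nat.cast_zero, zero_mul, true_and, add_zero]; positivity
  · left
    have h2' : (0 : ℝ) < z.2 := by exact_mod_cast h2
    have := h.im₂
    positivity

lemma IsCone.mem₁ (h : IsCone e₁ e₂) : e₁ ∈ upper := Or.inr ⟨h.im₁, h.re₁⟩

lemma IsCone.mem₂ (h : IsCone e₁ e₂) : e₂ ∈ upper := Or.inl h.im₂

lemma norm_lin_le (e₁ e₂ : ℂ) (z : ℕ × ℕ) :
    ‖lin e₁ e₂ z‖ ≤ (‖e₁‖ + ‖e₂‖) * (z.1 + z.2 : ℝ) := by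
  refine (norm_add_le _ _).trans ?_
  rw [norm_mul, norm_mul, Complex.norm_natCast, Complex.norm_natCast]
  nlinarith [norm_nonneg e₁, norm_nonneg e₂, Nat.cast_nonneg (α := ℝ) z.1,
    Nat.cast_nonneg (α := ℝ) z.2, mul_nonneg (norm_nonneg e₁) (Nat.cast_nonneg (α := ℝ) z.2),
    mul_nonneg (norm_nonneg e₂) (Nat.cast_nonneg (α := ℝ) z.1)]

lemma exists_norm_lin_ge (h : IsCone e₁ e₂) :
    ∃ c : ℝ, 0 < c ∧ ∀ z : ℕ × ℕ, c * (z.1 + z.2 : ℝ) ≤ ‖lin e₁ e₂ z‖ := by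
  have ha := h.re₁
  have hd := h.im₂
  -- The imaginary part bounds the second coordinate and then the real part bounds the first; `K` is
  -- the sum of the two constants.
  set K := (1 + |e₂.re| / e₂.im) / e₁.re + 1 / e₂.im with hK
  have hKpos : 0 < K := by positivity
  refine ⟨K⁻¹, by positivity, fun z => ?_⟩
  rw [inv_mul_le_iff₀ hKpos]
  have h1 := Complex.abs_im_le_norm (lin e₁ e₂ z)
  have h2 := Complex.abs_re_le_norm (lin e₁ e₂ z)
  rw [lin_im h, abs_of_nonneg (by positivity)] at h1
  rw [lin_re] at h2
  set N := ‖lin e₁ e₂ z‖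
  have hy : (z.2 : ℝ) ≤ 1 / e₂.im * N := by
    rw [div_mul_eq_mul_div, one_mul, le_div_iff₀ hd]; exact h1
  have hx' : z.1 * e₁.re ≤ N + z.2 * |e₂.re| := by
    have h3 := le_abs_self (z.1 * e₁.re + z.2 * e₂.re)
    have h4 := mul_le_mul_of_nonneg_left (neg_abs_le e₂.re) (Nat.cast_nonneg (α := ℝ) z.2)
    linarith
  have hx : (z.1 : ℝ) ≤ (1 + |e₂.re| / e₂.im) / e₁.re * N := by
    rw [div_mul_eq_mul_div, le_div_iff₀ ha]
    refine hx'.trans ?_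
    have := mul_le_mul_of_nonneg_right hy (abs_nonneg e₂.re)
    have e : 1 / e₂.im * N * |e₂.re| = |e₂.re| / e₂.im * N := by ring
    rw [add_mul, one_mul]; linarith
  rw [hK, add_mul]; linarith

lemma exists_norm_lin_ge' (h : IsCone e₁ e₂) :
    ∃ c : ℝ, 0 < c ∧ ∀ z : ℕ × ℕ, z ≠ 0 → c ≤ ‖lin e₁ e₂ z‖ := by
  obtain ⟨c, hc, hc'⟩ := exists_norm_lin_ge h
  refine ⟨c, hc, fun z hz => le_trans ?_ (hc' z)⟩
  have : 1 ≤ z.1 + z.2 := by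
    by_contra h0
    exact hz (Prod.ext (by simp; omega) (by simp; omega))
  have : (1 : ℝ) ≤ z.1 + z.2 := by exact_mod_cast this
  nlinarith

end Cone

/-- Taylor exponents are traded for available moments: for a short jump the exponent of the jump may
be lowered freely, for a long one it may be raised at the cost of a constant, as in
`rpow_mul_rpow_le_of_ge`. -/
lemma rpow_mul_rpow_le_of_le {x w γ s t : ℝ} (hx : 0 < x) (hw : 0 ≤ w) (hwx : w ≤ x) (hs : 0 < s)
    (hst : s ≤ t) : x ^ (γ - t) * w ^ t ≤ x ^ (γ - s) * w ^ s := by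
  rcases eq_or_lt_of_le hw with rfl | hw
  · rw [Real.zero_rpow hs.ne', Real.zero_rpow (by linarith)]; simp
  · have e1 : x ^ (γ - t) = x ^ (γ - s) * x ^ (s - t) := by rw [← Real.rpow_add hx]; ring_nf
    have e2 : w ^ s = w ^ (s - t) * w ^ t := by rw [← Real.rpow_add hw]; ring_nf
    have h := Real.rpow_le_rpow_of_nonpos hw hwx (show s - t ≤ 0 by linarith)
    rw [e1, e2, mul_assoc]
    gcongr

lemma rpow_mul_rpow_le_of_ge {x w γ s t : ℝ} (hx : 0 < x) (hwx : x / 2 ≤ w)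
    (hst : s ≤ t) : x ^ (γ - s) * w ^ s ≤ 2 ^ (t - s) * (x ^ (γ - t) * w ^ t) := by
  have hw : 0 < w := by linarith
  have e1 : x ^ (γ - s) = x ^ (γ - t) * x ^ (t - s) := by rw [← Real.rpow_add hx]; ring_nf
  have e2 : w ^ t = w ^ (t - s) * w ^ s := by rw [← Real.rpow_add hw]; ring_nf
  have h : x ^ (t - s) ≤ 2 ^ (t - s) * w ^ (t - s) := by
    rw [← Real.mul_rpow (by norm_num) hw.le]
    exact Real.rpow_le_rpow hx.le (by linarith) (by linarith)
  rw [e1, e2]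
  calc _ = x ^ (γ - t) * w ^ s * x ^ (t - s) := by ring
    _ ≤ x ^ (γ - t) * w ^ s * (2 ^ (t - s) * w ^ (t - s)) := by gcongr
    _ = _ := by ring

/-- The error allowed for a jump `ω` from `ζ`. -/
def jumpError (γ s Γ ν : ℝ) (ζ ω : ℂ) : ℝ := ‖ζ‖ ^ (γ - s) * ‖ω‖ ^ s + ‖ζ‖ ^ (Γ - ν) * ‖ω‖ ^ ν

section Jumps

variable {e₁ e₂ : ℂ} {γ Γ ν : ℝ} {f : ℂ → ℝ} {A B : ℂ → ℂ} {Λ : ℂ → ℝ}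

/-- A long jump may land anywhere, even at 0, where `f` is arbitrary. Non-zero states have norm
bounded below, so a possibly negative degree γ can be replaced by Γ ≥ 0; the value is then at most a
multiple of the Γ-th power of the jump, which is converted to the ν-th power. -/
lemma exists_bound_big_jump (he : IsCone e₁ e₂) (hf : ∃ C : ℝ, 0 ≤ C ∧ ∀ ζ ∈ upper, |f ζ| ≤ C * ‖ζ‖ ^ γ)
    (hΓ : 0 ≤ Γ) (hγΓ : γ ≤ Γ) (hν : Γ ≤ ν) :
    ∃ C : ℝ, 0 ≤ C ∧ ∀ z w : ℕ × ℕ, z ≠ 0 →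
      ‖lin e₁ e₂ z‖ / 2 ≤ ‖lin e₁ e₂ w - lin e₁ e₂ z‖ →
      |f (lin e₁ e₂ w)| ≤ C * (‖lin e₁ e₂ z‖ ^ (Γ - ν) * ‖lin e₁ e₂ w - lin e₁ e₂ z‖ ^ ν) := by
  obtain ⟨C, hC0, hC⟩ := hf
  obtain ⟨c, hc, hc'⟩ := exists_norm_lin_ge' he
  refine ⟨(C * c ^ (γ - Γ) * 3 ^ Γ + |f 0| * (2 / c) ^ Γ) * 2 ^ (ν - Γ), by positivity,
    fun z w hz hw => ?_⟩
  set ζ := lin e₁ e₂ z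
  set ζ' := lin e₁ e₂ w
  have hζ : c ≤ ‖ζ‖ := hc' z hz
  set d := ‖ζ' - ζ‖
  have hd : 0 < d := by linarith
  have h1 : d ^ Γ ≤ 2 ^ (ν - Γ) * (‖ζ‖ ^ (Γ - ν) * d ^ ν) := by
    have := rpow_mul_rpow_le_of_ge (γ := Γ) (hc.trans_le hζ) hw hν
    simpa using this
  have h2 : |f ζ'| ≤ (C * c ^ (γ - Γ) * 3 ^ Γ + |f 0| * (2 / c) ^ Γ) * d ^ Γ := by
    by_cases hw0 : w = 0
    · have : ζ' = 0 := by simp [ζ', hw0, lin]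
      rw [this, add_mul, mul_assoc |f 0|, ← Real.mul_rpow (by positivity) hd.le]
      have h3 : 1 ≤ (2 / c * d) ^ Γ := by
        apply Real.one_le_rpow _ hΓ
        rw [div_mul_eq_mul_div, le_div_iff₀ hc]; linarith
      have h4 : 0 ≤ C * c ^ (γ - Γ) * 3 ^ Γ * d ^ Γ := by positivity
      nlinarith [abs_nonneg (f 0)]
    · have hζ'c : c ≤ ‖ζ'‖ := hc' w hw0
      have hζ'0 : 0 < ‖ζ'‖ := hc.trans_le hζ'c
      have h3 : ‖ζ'‖ ^ γ ≤ c ^ (γ - Γ) * ‖ζ'‖ ^ Γ := by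
        have e : ‖ζ'‖ ^ γ = ‖ζ'‖ ^ (γ - Γ) * ‖ζ'‖ ^ Γ := by
          rw [← Real.rpow_add hζ'0]; ring_nf
        have h := Real.rpow_le_rpow_of_nonpos hc hζ'c (show γ - Γ ≤ 0 by linarith)
        rw [e]
        gcongr
      have h4 : ‖ζ'‖ ≤ 3 * d := by
        have : ‖ζ'‖ ≤ ‖ζ' - ζ‖ + ‖ζ‖ := norm_le_norm_sub_add _ _
        linarith
      have h5 : ‖ζ'‖ ^ Γ ≤ 3 ^ Γ * d ^ Γ := by
        rw [← Real.mul_rpow (by norm_num) hd.le]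
        exact Real.rpow_le_rpow hζ'0.le h4 hΓ
      calc _ ≤ C * ‖ζ'‖ ^ γ := hC _ (lin_mem_upper he hw0)
        _ ≤ C * (c ^ (γ - Γ) * (3 ^ Γ * d ^ Γ)) := by
            gcongr
            exact h3.trans (by gcongr)
        _ = C * c ^ (γ - Γ) * 3 ^ Γ * d ^ Γ + 0 := by ring
        _ ≤ _ := by
            rw [add_mul]
            gcongr
            positivity
  refine h2.trans ?_
  rw [mul_assoc (C * c ^ (γ - Γ) * 3 ^ Γ + |f 0| * (2 / c) ^ Γ)]
  gcongr

/-- From a local expansion to an expansion along all jumps. -/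
lemma exists_bound_jump (hf : ∃ C : ℝ, 0 ≤ C ∧ ∀ ζ ∈ upper, |f ζ| ≤ C * ‖ζ‖ ^ γ)
    (he : IsCone e₁ e₂) (hΓ : 0 ≤ Γ) (hγΓ : γ ≤ Γ) (hν : Γ ≤ ν) {s t : ℝ} (hs : 0 < s) (hst : s ≤ t)
    (poly : ℂ → ℂ → ℝ)
    (hsmall : ∃ C : ℝ, 0 ≤ C ∧ ∀ ζ ω, SmallStep ζ ω →
      |f (ζ + ω) - f ζ - poly ζ ω| ≤ C * ‖ζ‖ ^ (γ - t) * ‖ω‖ ^ t)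
    (hbig : ∃ C : ℝ, 0 ≤ C ∧ ∀ ζ ω, ζ ∈ upper → ‖ζ‖ / 2 ≤ ‖ω‖ →
      |poly ζ ω| ≤ C * (‖ζ‖ ^ (γ - s) * ‖ω‖ ^ s)) :
    ∃ C : ℝ, 0 ≤ C ∧ ∀ z w : ℕ × ℕ, z ≠ 0 →
      |f (lin e₁ e₂ w) - f (lin e₁ e₂ z) - poly (lin e₁ e₂ z) (lin e₁ e₂ w - lin e₁ e₂ z)|
        ≤ C * jumpError γ s Γ ν (lin e₁ e₂ z) (lin e₁ e₂ w - lin e₁ e₂ z) := by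
  obtain ⟨C₁, h₁, hC₁⟩ := exists_bound_big_jump he hf hΓ hγΓ hν
  obtain ⟨C₂, h₂, hC₂⟩ := hf
  obtain ⟨C₃, h₃, hC₃⟩ := hsmall
  obtain ⟨C₄, h₄, hC₄⟩ := hbig
  refine ⟨C₁ + C₂ * 2 ^ s + C₃ + C₄, by positivity, fun z w hz => ?_⟩
  have hU := lin_mem_upper he hz
  set ζ := lin e₁ e₂ z
  set ζ' := lin e₁ e₂ w with hζ'
  have hζ : 0 < ‖ζ‖ := norm_pos_iff.2 (upper_ne_zero hU)
  set X := ‖ζ‖ ^ (γ - s) * ‖ζ' - ζ‖ ^ s with hX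
  set Y := ‖ζ‖ ^ (Γ - ν) * ‖ζ' - ζ‖ ^ ν with hY
  have hX0 : 0 ≤ X := by positivity
  have hY0 : 0 ≤ Y := by positivity
  have hE : jumpError γ s Γ ν ζ (ζ' - ζ) = X + Y := rfl
  rw [hE]
  -- A jump shorter than half the norm cannot reach 0 and is covered by the local expansion; for a
  -- longer one there is no cancellation and the three terms are bounded separately.
  rcases lt_or_ge ‖ζ' - ζ‖ (‖ζ‖ / 2) with h | h
  · have hw : w ≠ 0 := by
      rintro rfl
      have : ζ' = 0 := by simp [hζ', lin]
      rw [this, zero_sub, norm_neg] at h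
      linarith
    have hs' : SmallStep ζ (ζ' - ζ) := ⟨hU, by
      rw [add_sub_cancel]; exact lin_mem_upper he hw, h.le⟩
    have := hC₃ ζ (ζ' - ζ) hs'
    rw [add_sub_cancel] at this
    refine this.trans ?_
    rw [mul_assoc]
    have h5 := rpow_mul_rpow_le_of_le (γ := γ) hζ (norm_nonneg (ζ' - ζ)) (by linarith) hs hst
    calc _ ≤ C₃ * X := by gcongr
      _ ≤ _ := by
        have : 0 ≤ (C₁ + C₂ * 2 ^ s + C₃ + C₄) * Y := by positivity
        have : 0 ≤ (C₁ + C₂ * 2 ^ s + C₄) * X := by positivity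
        nlinarith
  · have b1 := hC₁ z w hz h
    have b2 := hC₂ ζ hU
    have b4 := hC₄ ζ (ζ' - ζ) hU h
    have b3 : ‖ζ‖ ^ γ ≤ 2 ^ s * X := by
      have := rpow_mul_rpow_le_of_ge (γ := γ) hζ h hs.le
      simpa using this
    have b5 : |f ζ| ≤ C₂ * 2 ^ s * X := b2.trans (by rw [mul_assoc]; gcongr)
    have b6 : |f ζ' - f ζ - poly ζ (ζ' - ζ)| ≤ |f ζ'| + |f ζ| + |poly ζ (ζ' - ζ)| :=
      (abs_sub _ _).trans (add_le_add_left (abs_sub _ _) _)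
    change |f ζ'| ≤ C₁ * Y at b1
    change |poly ζ (ζ' - ζ)| ≤ C₄ * X at b4
    have : 0 ≤ (C₂ * 2 ^ s + C₃ + C₄) * Y := by positivity
    have : 0 ≤ (C₁ + C₃) * X := by positivity
    nlinarith

lemma TaylorData.jump_zero (hf : TaylorData γ f A B Λ) (he : IsCone e₁ e₂) (hΓ : 0 ≤ Γ)
    (hγΓ : γ ≤ Γ) (hν : Γ ≤ ν) :
    ∃ C : ℝ, 0 ≤ C ∧ ∀ z w : ℕ × ℕ, z ≠ 0 → |f (lin e₁ e₂ w) - f (lin e₁ e₂ z)|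
        ≤ C * jumpError γ 1 Γ ν (lin e₁ e₂ z) (lin e₁ e₂ w - lin e₁ e₂ z) := by
  have := exists_bound_jump hf.growth he hΓ hγΓ hν one_pos le_rfl (fun _ _ => 0)
    (by simpa using hf.lipschitz) ⟨0, le_rfl, by simp⟩
  simpa using this

lemma TaylorData.jump_one (hf : TaylorData γ f A B Λ) (he : IsCone e₁ e₂) (hΓ : 0 ≤ Γ)
    (hγΓ : γ ≤ Γ) (hν : Γ ≤ ν) {s : ℝ} (hs1 : 1 ≤ s) (hs2 : s ≤ 2) :
    ∃ C : ℝ, 0 ≤ C ∧ ∀ z w : ℕ × ℕ, z ≠ 0 → |f (lin e₁ e₂ w) - f (lin e₁ e₂ z)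
        - (A (lin e₁ e₂ z) * (lin e₁ e₂ w - lin e₁ e₂ z)).re|
        ≤ C * jumpError γ s Γ ν (lin e₁ e₂ z) (lin e₁ e₂ w - lin e₁ e₂ z) := by
  refine exists_bound_jump hf.growth he hΓ hγΓ hν (by linarith) hs2 (fun ζ ω => (A ζ * ω).re)
    (by simpa using hf.first_order) ?_
  obtain ⟨C, h, hC⟩ := hf.growth_gradient
  refine ⟨C * 2 ^ (s - 1), by positivity, fun ζ ω hζ hω => ?_⟩
  have := rpow_mul_rpow_le_of_ge (γ := γ) (norm_pos_iff.2 (upper_ne_zero hζ)) hω hs1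
  rw [Real.rpow_one] at this
  refine (Complex.abs_re_le_norm _).trans ?_
  rw [norm_mul]
  calc _ ≤ C * ‖ζ‖ ^ (γ - 1) * ‖ω‖ := by gcongr; exact hC ζ hζ
    _ ≤ _ := by rw [mul_assoc, mul_assoc]; gcongr

lemma TaylorData.jump_two (hf : TaylorData γ f A B Λ) (he : IsCone e₁ e₂) (hΓ : 0 ≤ Γ)
    (hγΓ : γ ≤ Γ) (hν : Γ ≤ ν) {s : ℝ} (hs1 : 2 ≤ s) (hs2 : s ≤ 3) :
    ∃ C : ℝ, 0 ≤ C ∧ ∀ z w : ℕ × ℕ, z ≠ 0 → |f (lin e₁ e₂ w) - f (lin e₁ e₂ z)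
        - ((A (lin e₁ e₂ z) * (lin e₁ e₂ w - lin e₁ e₂ z)).re
          + (B (lin e₁ e₂ z) * (lin e₁ e₂ w - lin e₁ e₂ z) ^ 2).re
          + Λ (lin e₁ e₂ z) * ‖lin e₁ e₂ w - lin e₁ e₂ z‖ ^ 2)|
        ≤ C * jumpError γ s Γ ν (lin e₁ e₂ z) (lin e₁ e₂ w - lin e₁ e₂ z) := by
  refine exists_bound_jump hf.growth he hΓ hγΓ hν (by linarith) hs2
    (fun ζ ω => (A ζ * ω).re + (B ζ * ω ^ 2).re + Λ ζ * ‖ω‖ ^ 2) ?_ ?_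
  · obtain ⟨C, h, hC⟩ := hf.second_order
    refine ⟨C, h, fun ζ ω hs => ?_⟩
    have := hC ζ ω hs
    rw [show (3 : ℝ) = ((3 : ℕ) : ℝ) by norm_num, Real.rpow_natCast, Nat.cast_ofNat]
    refine le_trans (le_of_eq ?_) this
    congr 1; ring
  obtain ⟨C₁, h₁, hC₁⟩ := hf.growth_gradient
  obtain ⟨C₂, h₂, hC₂⟩ := hf.growth_hessian
  obtain ⟨C₃, h₃, hC₃⟩ := hf.growth_laplacian
  refine ⟨C₁ * 2 ^ (s - 1) + C₂ * 2 ^ (s - 2) + C₃ * 2 ^ (s - 2), by positivity,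
    fun ζ ω hζ hω => ?_⟩
  have hp := norm_pos_iff.2 (upper_ne_zero hζ)
  have k1 := rpow_mul_rpow_le_of_ge (γ := γ) hp hω (show 1 ≤ s by linarith)
  have k2 := rpow_mul_rpow_le_of_ge (γ := γ) hp hω hs1
  rw [Real.rpow_one] at k1
  rw [Real.rpow_two] at k2
  have a1 : |(A ζ * ω).re| ≤ C₁ * (‖ζ‖ ^ (γ - 1) * ‖ω‖) := by
    refine (Complex.abs_re_le_norm _).trans ?_
    rw [norm_mul, ← mul_assoc]; gcongr; exact hC₁ ζ hζ
  have a2 : |(B ζ * ω ^ 2).re| ≤ C₂ * (‖ζ‖ ^ (γ - 2) * ‖ω‖ ^ 2) := by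
    refine (Complex.abs_re_le_norm _).trans ?_
    rw [norm_mul, norm_pow, ← mul_assoc]; gcongr; exact hC₂ ζ hζ
  have a3 : |Λ ζ * ‖ω‖ ^ 2| ≤ C₃ * (‖ζ‖ ^ (γ - 2) * ‖ω‖ ^ 2) := by
    rw [abs_mul, abs_of_nonneg (sq_nonneg ‖ω‖), ← mul_assoc]; gcongr; exact hC₃ ζ hζ
  refine (abs_add_three _ _ _).trans ?_
  rw [add_mul, add_mul, mul_assoc, mul_assoc, mul_assoc]
  have b1 := a1.trans (mul_le_mul_of_nonneg_left k1 h₁)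
  have b2 := a2.trans (mul_le_mul_of_nonneg_left k2 h₂)
  have b3 := a3.trans (mul_le_mul_of_nonneg_left k2 h₃)
  linarith

end Jumps

/-! ### Integration against a jump law with moments -/

/-- The jump from `z` with law `μ` has moment of order `ν` at most `M`. -/
def JumpMoment (e₁ e₂ : ℂ) (μ : Measure (ℕ × ℕ)) (z : ℕ × ℕ) (ν M : ℝ) : Prop :=
  Integrable (fun w => ‖lin e₁ e₂ w - lin e₁ e₂ z‖ ^ ν) μ ∧
    ∫ w, ‖lin e₁ e₂ w - lin e₁ e₂ z‖ ^ ν ∂μ ≤ M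

lemma aesm {E : Type*} [TopologicalSpace E] [TopologicalSpace.PseudoMetrizableSpace E]
    {α : Type*} [MeasurableSpace α] [Countable α] [MeasurableSingletonClass α] (μ : Measure α)
    (f : α → E) : AEStronglyMeasurable f μ :=
  (StronglyMeasurable.of_discrete (f := f)).aestronglyMeasurable

lemma JumpMoment.mono {e₁ e₂ : ℂ} {μ : Measure (ℕ × ℕ)} [IsProbabilityMeasure μ] {z : ℕ × ℕ}
    {ν M : ℝ} (h : JumpMoment e₁ e₂ μ z ν M) {s : ℝ} (hs : 0 ≤ s) (hsν : s ≤ ν) :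
    JumpMoment e₁ e₂ μ z s (1 + M) := by
  have hle : ∀ w, ‖lin e₁ e₂ w - lin e₁ e₂ z‖ ^ s ≤ 1 + ‖lin e₁ e₂ w - lin e₁ e₂ z‖ ^ ν := by
    intro w
    set d := ‖lin e₁ e₂ w - lin e₁ e₂ z‖
    have hd : 0 ≤ d := norm_nonneg _
    rcases le_total d 1 with h1 | h1
    · have := Real.rpow_le_one hd h1 hs
      have := Real.rpow_nonneg hd ν
      linarith
    · have := Real.rpow_le_rpow_of_exponent_le h1 hsν
      linarith
  have hi : Integrable (fun w => 1 + ‖lin e₁ e₂ w - lin e₁ e₂ z‖ ^ ν) μ :=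
    (integrable_const 1).add h.1
  have hi' : Integrable (fun w => ‖lin e₁ e₂ w - lin e₁ e₂ z‖ ^ s) μ := by
    refine hi.mono' (aesm _ _) (Filter.Eventually.of_forall fun w => ?_)
    rw [Real.norm_of_nonneg (by positivity)]
    exact hle w
  refine ⟨hi', (integral_mono hi' hi hle).trans ?_⟩
  rw [integral_add (integrable_const 1) h.1]
  have := h.2
  simp only [integral_const, smul_eq_mul, mul_one, probReal_univ]
  linarith

/-- The integrated error. -/
lemma integral_jumpError_le {e₁ e₂ : ℂ} {μ : Measure (ℕ × ℕ)} [IsProbabilityMeasure μ] {z : ℕ × ℕ}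
    {ν M : ℝ} (h : JumpMoment e₁ e₂ μ z ν M) {γ s Γ : ℝ} (hs : 0 ≤ s) (hsν : s ≤ ν) :
    Integrable (fun w => jumpError γ s Γ ν (lin e₁ e₂ z) (lin e₁ e₂ w - lin e₁ e₂ z)) μ ∧
    ∫ w, jumpError γ s Γ ν (lin e₁ e₂ z) (lin e₁ e₂ w - lin e₁ e₂ z) ∂μ ≤
      (1 + M) * (‖lin e₁ e₂ z‖ ^ (γ - s) + ‖lin e₁ e₂ z‖ ^ (Γ - ν)) := by
  have h' := h.mono hs hsν
  have i1 := h'.1.const_mul (‖lin e₁ e₂ z‖ ^ (γ - s))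
  have i2 := h.1.const_mul (‖lin e₁ e₂ z‖ ^ (Γ - ν))
  refine ⟨i1.add i2, ?_⟩
  unfold jumpError
  rw [integral_add i1 i2, integral_const_mul, integral_const_mul]
  have a1 := h'.2
  have a2 := h.2
  have p1 : 0 ≤ ‖lin e₁ e₂ z‖ ^ (γ - s) := by positivity
  have p2 : 0 ≤ ‖lin e₁ e₂ z‖ ^ (Γ - ν) := by positivity
  nlinarith

/-! ### Probability mass functions as measures -/

section Pmf

set_option linter.unusedSectionVars false

variable {α β : Type*} [MeasurableSpace α] [Countable α] [MeasurableSingletonClass α]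
  [MeasurableSpace β] [Countable β] [MeasurableSingletonClass β]

lemma pmf_lintegral (p : PMF α) (f : α → ℝ≥0∞) : ∫⁻ a, f a ∂p.toMeasure = ∑' a, p a * f a := by
  rw [lintegral_countable']
  refine tsum_congr fun a => ?_
  rw [p.toMeasure_apply_singleton a (measurableSet_singleton a), mul_comm]

lemma pmf_of_ae {p : PMF α} {P : α → Prop} (h : ∀ᵐ a ∂p.toMeasure, P a) {a : α} (ha : p a ≠ 0) :
    P a := by
  by_contra hP
  apply ha
  rw [← p.toMeasure_apply_singleton a (measurableSet_singleton a)]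
  exact measure_mono_null (by simpa using hP) (ae_iff.1 h)

lemma pmf_ae_iff {p : PMF α} {P : α → Prop} : (∀ᵐ a ∂p.toMeasure, P a) ↔ ∀ a, p a ≠ 0 → P a := by
  refine ⟨fun h a => pmf_of_ae h, fun h => ?_⟩
  rw [ae_iff, p.toMeasure_apply_eq_zero_iff (Set.to_countable _).measurableSet]
  exact Set.disjoint_left.2 fun a ha hP => hP (h a ha)

lemma integrable_bdd (p : PMF α) {K : α → ℝ} {C : ℝ} (hK : ∀ a, |K a| ≤ C) :
    Integrable K p.toMeasure :=
  Integrable.of_bound (aesm _ _) C (Filter.Eventually.of_forall hK)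

lemma pmf_integral_map (p : PMF α) (g : α → β) (hg : Measurable g) {E : Type*}
    [NormedAddCommGroup E] [NormedSpace ℝ E] (φ : β → E) :
    ∫ b, φ b ∂(p.map g).toMeasure = ∫ a, φ (g a) ∂p.toMeasure := by
  rw [← PMF.toMeasure_map g p hg, integral_map hg.aemeasurable (aesm _ _)]

lemma pmf_integrable_map (p : PMF α) (g : α → β) (hg : Measurable g) {E : Type*}
    [NormedAddCommGroup E] {φ : β → E} :
    Integrable φ (p.map g).toMeasure ↔ Integrable (fun a => φ (g a)) p.toMeasure := by
  rw [← PMF.toMeasure_map g p hg, integrable_map_measure (aesm _ _) hg.aemeasurable]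
  rfl

/-- The image of `p` is dominated by `s` pointwise and both have total mass one, so `s` has no mass
off the image. In the application this says that an increment law charges no jump leaving the
quadrant. -/
lemma pmf_eq_map {α β : Type*} (p : PMF α) (s : PMF β) (g : α → β) (hg : Function.Injective g)
    (h : ∀ a, p a = s (g a)) : s = p.map g := by
  classical
  have hle : ∀ b, p.map g b ≤ s b := by
    intro b
    rw [PMF.map_apply]
    by_cases hb : ∃ a, b = g a
    · obtain ⟨a, rfl⟩ := hb
      rw [tsum_eq_single a (fun a' ha' => if_neg fun e => ha' (hg e).symm), if_pos rfl, h]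
    · rw [ENNReal.tsum_eq_zero.2 fun a => if_neg fun e => hb ⟨a, e⟩]
      exact bot_le
  refine PMF.ext fun b => ?_
  by_contra hne
  have := ENNReal.tsum_lt_tsum (p.map g).tsum_coe_ne_top hle
    (lt_of_le_of_ne (hle b) (Ne.symm hne))
  rw [PMF.tsum_coe, PMF.tsum_coe] at this
  exact lt_irrefl _ this

/-- A non-negative function with non-positive mean vanishes on the support. -/
lemma pmf_eq_zero_of_integral_nonpos {p : PMF α} {f : α → ℝ} (hf : Integrable f p.toMeasure)
    (h0 : ∀ a, p a ≠ 0 → 0 ≤ f a) (h : ∫ a, f a ∂p.toMeasure ≤ 0) {a : α} (ha : p a ≠ 0) :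
    f a = 0 := by
  have hae : 0 ≤ᵐ[p.toMeasure] f := pmf_ae_iff.2 h0
  have h1 : ∫ a, f a ∂p.toMeasure = 0 := le_antisymm h (integral_nonneg_of_ae hae)
  exact pmf_of_ae ((integral_eq_zero_iff_of_nonneg_ae hae hf).1 h1) ha

/-- One atom of the integral of a non-negative function. -/
lemma pmf_atom_le_integral {p : PMF α} {f : α → ℝ} (hf : Integrable f p.toMeasure)
    (h0 : ∀ a, p a ≠ 0 → 0 ≤ f a) (a : α) : (p a).toReal * f a ≤ ∫ a, f a ∂p.toMeasure := by
  have hae : 0 ≤ᵐ[p.toMeasure] f := pmf_ae_iff.2 h0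
  have := setIntegral_le_integral (s := {a}) hf hae
  rwa [integral_singleton, measureReal_def,
    p.toMeasure_apply_singleton a (measurableSet_singleton a), smul_eq_mul] at this

end Pmf

/-! ### Chains on the half-line, homogeneous off a finite set -/

/-- `q` is an irreducible chain on `ℕ` which, at heights at least `R`, moves by increments of law
`s` with mean zero. -/
structure IsBoundaryChain (R : ℕ) (q : ℕ → PMF ℕ) (s : PMF ℤ) : Prop where
  pos : 0 < R
  hom : ∀ i, R ≤ i → ∀ j : ℕ, q i j = s ((j : ℤ) - i)
  integrable : Integrable (fun j : ℤ => (j : ℝ)) s.toMeasure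
  mean : ∫ j, (j : ℝ) ∂s.toMeasure = 0
  irred : ∀ i j, Relation.ReflTransGen (fun a b => q a b ≠ 0) i j

namespace IsBoundaryChain

variable {R : ℕ} {q : ℕ → PMF ℕ} {s : PMF ℤ}

lemma eq_map (h : IsBoundaryChain R q s) {i : ℕ} (hi : R ≤ i) : s = (q i).map (fun j : ℕ => (j : ℤ) - i) :=
  pmf_eq_map _ _ _ (fun a b hab => by simpa using hab) (h.hom i hi)

lemma integral_shift (h : IsBoundaryChain R q s) {i : ℕ} (hi : R ≤ i) (φ : ℤ → ℝ) :
    ∫ j, φ ((j : ℤ) - i) ∂(q i).toMeasure = ∫ j, φ j ∂s.toMeasure := by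
  conv_rhs => rw [h.eq_map hi]
  rw [pmf_integral_map _ _ .of_discrete]

/-- A step taken from height `R` must end in ℕ. -/
lemma support_ge (h : IsBoundaryChain R q s) {j : ℤ} (hj : s j ≠ 0) : -(R : ℤ) ≤ j := by
  rw [h.eq_map le_rfl, ← PMF.mem_support_iff, PMF.mem_support_map_iff] at hj
  obtain ⟨a, -, rfl⟩ := hj
  omega

lemma integrable_height (h : IsBoundaryChain R q s) {i : ℕ} (hi : R ≤ i) :
    Integrable (fun j : ℕ => (j : ℝ)) (q i).toMeasure := by
  have h1 := h.integrable
  rw [h.eq_map hi, pmf_integrable_map _ _ .of_discrete] at h1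
  have := h1.add (integrable_const (i : ℝ))
  refine this.congr (Filter.Eventually.of_forall fun j => ?_)
  simp

lemma integral_height (h : IsBoundaryChain R q s) {i : ℕ} (hi : R ≤ i) : ∫ j, (j : ℝ) ∂(q i).toMeasure = i := by
  have h1 := h.integral_shift hi (fun j => (j : ℝ))
  rw [h.mean] at h1
  have h2 : ∫ j : ℕ, ((j : ℝ) - i) ∂(q i).toMeasure = 0 := by
    rw [← h1]; congr 1; ext j; push_cast; rfl
  rw [integral_sub (h.integrable_height hi) (integrable_const _)] at h2
  simp at h2
  linarith

/-- Without positive steps, mean zero would make every step zero; the chain would then be stuck at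
`R` and could not reach 0, which differs from `R` because `R` is positive. -/
lemma exists_pos_step (h : IsBoundaryChain R q s) : ∃ k : ℤ, 0 < k ∧ s k ≠ 0 := by
  by_contra hcon
  push Not at hcon
  have h0 : ∀ k, s k ≠ 0 → k = 0 := by
    intro k hk
    have := pmf_eq_zero_of_integral_nonpos (p := s) (f := fun j : ℤ => -(j : ℝ)) h.integrable.neg
      (fun a ha => by
        have : a ≤ 0 := by
          by_contra hc
          exact ha (hcon a (by omega))
        have : (a : ℝ) ≤ 0 := by exact_mod_cast this
        linarith) (by rw [integral_neg, h.mean]; simp) hk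
    have : (k : ℝ) = 0 := by linarith
    exact_mod_cast this
  have h1 : ∀ b, Relation.ReflTransGen (fun a b => q a b ≠ 0) R b → b = R := by
    intro b hb
    induction hb with
    | refl => rfl
    | tail _ hbc ih =>
      subst ih
      rw [h.hom _ le_rfl] at hbc
      have := h0 _ hbc
      omega
  have := h1 0 (h.irred R 0)
  have := h.pos
  omega

/-- A bounded function that is subharmonic off `{0, …, R - 1}` is bounded by its values there. -/
theorem max_principle (h : IsBoundaryChain R q s) {K : ℕ → ℝ} {C : ℝ} (hC : ∀ y, |K y| ≤ C) {c : ℝ} (hI : ∀ i < R, K i ≤ c)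
    (hsub : ∀ i, R ≤ i → K i ≤ ∫ j, K j ∂(q i).toMeasure) (i : ℕ) : K i ≤ c := by
  by_contra hi
  push Not at hi
  -- Height is harmonic above `R`, so subtracting ε times it preserves subharmonicity there and
  -- forces a maximum to be attained. This ε is small enough to keep the value at `i` above `c`.
  set ε := (K i - c) / (2 * (i + 1)) with hε
  have hε0 : 0 < ε := by have : 0 < K i - c := by linarith
                         positivity
  set g : ℕ → ℝ := fun y => K y - ε * y with hg
  have hgi : c < g i := by
    have h1 : ε * (2 * (i + 1)) = K i - c := by rw [hε]; field_simp
    simp only [hg]; nlinarith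
  obtain ⟨N, hN⟩ := exists_nat_gt ((C - c) / ε)
  have hbig : ∀ y, N ≤ y → g y < g i := by
    intro y hy
    have h1 : (N : ℝ) ≤ y := by exact_mod_cast hy
    have h2 : (C - c) / ε < y := by linarith
    rw [div_lt_iff₀ hε0] at h2
    have := (abs_le.1 (hC y)).2
    simp only [hg] at hgi ⊢; nlinarith
  obtain ⟨m, hm, hmax⟩ := Finset.exists_max_image (Finset.range (max N (i + 1))) g
    ⟨i, by simp⟩
  have hmax' : ∀ y, g y ≤ g m := by
    intro y
    by_cases hy : y < max N (i + 1)
    · exact hmax y (by simpa using hy)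
    · exact (hbig y (by omega)).le.trans (hmax i (by simp))
  have hbdd : ∀ y, g m ≤ g y → y < N := by
    intro y hy
    by_contra hc
    exact absurd (hbig y (by omega)) (not_lt.2 ((hmax' i).trans hy))
  obtain ⟨k, hk0, hk⟩ := h.exists_pos_step
  -- A maximum point lies above `R`, since below it `g` is at most `c`. There the mean inequality
  -- spreads the maximum to all possible targets, in particular `k` upwards, and iteration
  -- contradicts the decay of `g`.
  have hstep : ∀ y, g m ≤ g y → g m ≤ g (y + k.toNat) := by
    intro y hy
    have hyR : R ≤ y := by
      by_contra hc
      have h1 := hI y (by omega)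
      have h2 : c < g y := hgi.trans_le ((hmax' i).trans hy)
      have : (0 : ℝ) ≤ ε * y := by positivity
      simp only [hg] at h2; linarith
    have hKi : Integrable K (q y).toMeasure := integrable_bdd _ hC
    have hgI : Integrable g (q y).toMeasure := hKi.sub ((h.integrable_height hyR).const_mul ε)
    have hgint : ∫ j, g j ∂(q y).toMeasure ≥ g y := by
      have : ∫ j, g j ∂(q y).toMeasure = ∫ j, K j ∂(q y).toMeasure - ε * y := by
        simp only [hg]
        rw [integral_sub hKi ((h.integrable_height hyR).const_mul ε), integral_const_mul,
          h.integral_height hyR]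
      rw [this]
      have := hsub y hyR
      simp only [hg]; linarith
    have hq : q y (y + k.toNat) ≠ 0 := by
      rw [h.hom y hyR]
      convert hk using 2
      omega
    have hz := pmf_eq_zero_of_integral_nonpos (p := q y) (f := fun j => g y - g j)
      ((integrable_const _).sub hgI) (fun a _ => by have := hmax' a; linarith)
      (by rw [integral_sub (integrable_const _) hgI]; simpa using hgint) hq
    linarith
  have hall : ∀ n : ℕ, g m ≤ g (m + n * k.toNat) := by
    intro n
    induction n with
    | zero => simp
    | succ n ih =>
      have := hstep _ ih
      convert this using 2
      ring
  have := hbdd _ (hall N)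
  have : 1 ≤ k.toNat := by omega
  nlinarith

/-- A bounded subharmonic function is constant. -/
theorem eq_const_of_subharmonic (h : IsBoundaryChain R q s) {K : ℕ → ℝ} {C : ℝ} (hC : ∀ y, |K y| ≤ C)
    (hsub : ∀ i, K i ≤ ∫ j, K j ∂(q i).toMeasure) (i : ℕ) : K i = K 0 := by
  -- By the maximum principle the maximum over the finite set is global; it then propagates along
  -- paths from `m` to every state.
  obtain ⟨m, hm, hmax⟩ := Finset.exists_max_image (Finset.range R) K ⟨0, by simp [h.pos]⟩
  have hle : ∀ y, K y ≤ K m :=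
    h.max_principle hC (fun i hi => hmax i (by simpa using hi)) fun i _ => hsub i
  have key : ∀ y, Relation.ReflTransGen (fun a b => q a b ≠ 0) m y → K y = K m := by
    intro y hy
    induction hy with
    | refl => rfl
    | @tail b c _ hbc ih =>
      have hKi : Integrable K (q b).toMeasure := integrable_bdd _ hC
      have hz := pmf_eq_zero_of_integral_nonpos (p := q b) (f := fun j => K m - K j)
        ((integrable_const _).sub hKi) (fun a _ => by have := hle a; linarith)
        (by rw [integral_sub (integrable_const _) hKi]; have := hsub b; simp; linarith) hbc
      linarith
  rw [key i (h.irred m i), key 0 (h.irred m 0)]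

/-! ### Bounded harmonic extensions and the induced chain -/

/-- Contribution to the harmonic extension of first visits to `{0, …, R - 1}` at time `n`. -/
def taboo (R : ℕ) (q : ℕ → PMF ℕ) (u : ℕ → ℝ≥0∞) : ℕ → ℕ → ℝ≥0∞
  | 0 => fun y => if y < R then u y else 0
  | n + 1 => fun y => if y < R then 0 else ∑' j, q y j * taboo R q u n j

/-- The harmonic extension off `{0, …, R - 1}`. -/
def hext (R : ℕ) (q : ℕ → PMF ℕ) (u : ℕ → ℝ≥0∞) (y : ℕ) : ℝ≥0∞ := ∑' n, taboo R q u n y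

lemma hext_of_lt (u : ℕ → ℝ≥0∞) {y : ℕ} (hy : y < R) : hext R q u y = u y := by
  rw [hext, tsum_eq_single 0]
  · simp [taboo, hy]
  · intro n hn
    obtain ⟨n, rfl⟩ := Nat.exists_eq_succ_of_ne_zero hn
    simp [taboo, hy]

lemma hext_of_ge (u : ℕ → ℝ≥0∞) {y : ℕ} (hy : R ≤ y) :
    hext R q u y = ∑' j, q y j * hext R q u j := by
  have hy' : ¬ y < R := by omega
  rw [hext, tsum_eq_zero_add' ENNReal.summable]
  simp only [taboo, hy', if_false, zero_add, hext]
  rw [ENNReal.tsum_comm]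
  refine tsum_congr fun j => ?_
  rw [ENNReal.tsum_mul_left]

/-- The terms belong to disjoint first-visit times; conditioning on the first step gives the bound
for partial sums by induction. -/
lemma hext_le {u : ℕ → ℝ≥0∞} {C : ℝ≥0∞} (hu : ∀ i < R, u i ≤ C) (y : ℕ) : hext R q u y ≤ C := by
  have key : ∀ N y, ∑ n ∈ Finset.range N, taboo R q u n y ≤ C := by
    intro N
    induction N with
    | zero => simp
    | succ N ih =>
      intro y
      rw [Finset.sum_range_succ']
      by_cases hy : y < R
      · simpa [taboo, hy] using hu y hy
      · simp only [taboo, hy, if_false, add_zero]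
        rw [← Summable.tsum_finsetSum (fun _ _ => ENNReal.summable)]
        calc _ = ∑' j, q y j * ∑ n ∈ Finset.range N, taboo R q u n j := by
              simp_rw [Finset.mul_sum]
          _ ≤ ∑' j, q y j * C := by
              gcongr with j
              exact ih j
          _ = C := by rw [ENNReal.tsum_mul_right, PMF.tsum_coe, one_mul]
  rw [hext, ENNReal.tsum_eq_iSup_nat]
  exact iSup_le fun N => key N y

lemma hext_toReal {u : ℕ → ℝ≥0∞} {C : ℝ≥0∞} (hC : C ≠ ∞) (hu : ∀ i < R, u i ≤ C) (i : ℕ) :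
    ∫ j, (hext R q u j).toReal ∂(q i).toMeasure = (∑' j, q i j * hext R q u j).toReal := by
  rw [integral_toReal (measurable_of_countable _).aemeasurable
    (Filter.Eventually.of_forall fun j => (hext_le hu j).trans_lt hC.lt_top), pmf_lintegral]

lemma exists_harmonic (u : ℕ → ℝ) : ∃ K : ℕ → ℝ, (∃ C, ∀ y, |K y| ≤ C) ∧ (∀ i < R, K i = u i) ∧
    ∀ i, R ≤ i → ∫ j, K j ∂(q i).toMeasure = K i := by
  -- Adding `b` makes the boundary data non-negative so that the series of first visits applies.
  -- Constants are harmonic, so `b` can be subtracted again without knowing that the chain returns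
  -- almost surely.
  set b := ∑ i ∈ Finset.range R, |u i| with hb
  have hub : ∀ i < R, |u i| ≤ b := fun i hi =>
    Finset.single_le_sum (f := fun i => |u i|) (fun _ _ => abs_nonneg _) (by simpa using hi)
  set v : ℕ → ℝ≥0∞ := fun i => ENNReal.ofReal (u i + b) with hv
  have hvC : ∀ i < R, v i ≤ ENNReal.ofReal (b + b) := fun i hi =>
    ENNReal.ofReal_le_ofReal (by linarith [(abs_le.1 (hub i hi)).2])
  have hb0 : 0 ≤ b := Finset.sum_nonneg fun _ _ => abs_nonneg _
  have hle : ∀ y, (hext R q v y).toReal ≤ b + b := fun y =>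
    ENNReal.toReal_le_of_le_ofReal (by linarith) (hext_le hvC y)
  refine ⟨fun y => (hext R q v y).toReal - b, ⟨b, fun y => ?_⟩, fun i hi => ?_, fun i hi => ?_⟩
  · rw [abs_le]
    constructor
    · linarith [ENNReal.toReal_nonneg (a := hext R q v y)]
    · linarith [hle y]
  · change (hext R q v i).toReal - b = u i
    rw [hext_of_lt v hi, hv, ENNReal.toReal_ofReal (by linarith [(abs_le.1 (hub i hi)).1])]
    ring
  · rw [integral_sub (integrable_bdd (C := b + b) _ fun y => ?_) (integrable_const _),
      hext_toReal ENNReal.ofReal_ne_top hvC, ← hext_of_ge v hi]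
    · simp
    · rw [abs_of_nonneg ENNReal.toReal_nonneg]; exact hle y

lemma harmonic_unique (h : IsBoundaryChain R q s) {K K' : ℕ → ℝ} (hK : ∃ C, ∀ y, |K y| ≤ C) (hK' : ∃ C, ∀ y, |K' y| ≤ C)
    (heq : ∀ i < R, K i = K' i) (h1 : ∀ i, R ≤ i → ∫ j, K j ∂(q i).toMeasure = K i)
    (h2 : ∀ i, R ≤ i → ∫ j, K' j ∂(q i).toMeasure = K' i) : K = K' := by
  have key : ∀ {K K' : ℕ → ℝ}, (∃ C, ∀ y, |K y| ≤ C) → (∃ C, ∀ y, |K' y| ≤ C) →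
      (∀ i < R, K i = K' i) → (∀ i, R ≤ i → ∫ j, K j ∂(q i).toMeasure = K i) →
      (∀ i, R ≤ i → ∫ j, K' j ∂(q i).toMeasure = K' i) → ∀ y, K y ≤ K' y := by
    intro K K' hK hK' heq h1 h2 y
    obtain ⟨C, hC⟩ := hK
    obtain ⟨C', hC'⟩ := hK'
    have := h.max_principle (K := fun y => K y - K' y) (C := C + C')
      (fun y => (abs_sub _ _).trans (add_le_add (hC y) (hC' y))) (c := 0)
      (fun i hi => by simp [heq i hi])
      (fun i hi => by
        rw [integral_sub (integrable_bdd _ hC) (integrable_bdd _ hC'), h1 i hi, h2 i hi]) y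
    linarith
  exact funext fun y => le_antisymm (key hK hK' heq h1 h2 y)
    (key hK' hK (fun i hi => (heq i hi).symm) h2 h1 y)

/-- The bounded harmonic extension of a function on `{0, …, R - 1}`. -/
def harm (q : ℕ → PMF ℕ) (u : Fin R → ℝ) : ℕ → ℝ :=
  (exists_harmonic (R := R) (q := q) fun i => if hi : i < R then u ⟨i, hi⟩ else 0).choose

lemma harm_bdd (u : Fin R → ℝ) : ∃ C, ∀ y, |harm q u y| ≤ C :=
  (exists_harmonic (R := R) (q := q) fun i => if hi : i < R then u ⟨i, hi⟩ else 0).choose_spec.1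

lemma harm_apply (u : Fin R → ℝ) (i : Fin R) : harm q u i = u i := by
  have := (exists_harmonic (R := R) (q := q)
    fun i => if hi : i < R then u ⟨i, hi⟩ else 0).choose_spec.2.1 i i.2
  rw [dif_pos i.2] at this
  exact this

lemma harm_harmonic (u : Fin R → ℝ) {i : ℕ} (hi : R ≤ i) :
    ∫ j, harm q u j ∂(q i).toMeasure = harm q u i :=
  (exists_harmonic (R := R) (q := q)
    fun i => if hi : i < R then u ⟨i, hi⟩ else 0).choose_spec.2.2 i hi

lemma harm_integrable (u : Fin R → ℝ) (i : ℕ) : Integrable (harm q u) (q i).toMeasure := by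
  obtain ⟨C, hC⟩ := harm_bdd (q := q) u
  exact integrable_bdd _ hC

lemma harm_eq (h : IsBoundaryChain R q s) {u : Fin R → ℝ} {K : ℕ → ℝ} (hK : ∃ C, ∀ y, |K y| ≤ C)
    (heq : ∀ i : Fin R, K i = u i) (h1 : ∀ i, R ≤ i → ∫ j, K j ∂(q i).toMeasure = K i) :
    harm q u = K :=
  h.harmonic_unique (harm_bdd u) hK (fun i hi => by
    rw [heq ⟨i, hi⟩]; exact harm_apply u ⟨i, hi⟩) (fun _ hi => harm_harmonic u hi) h1

lemma harm_add (h : IsBoundaryChain R q s) (u v : Fin R → ℝ) : harm q (u + v) = fun y => harm q u y + harm q v y := by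
  obtain ⟨C, hC⟩ := harm_bdd (q := q) u
  obtain ⟨C', hC'⟩ := harm_bdd (q := q) v
  refine h.harm_eq ⟨C + C', fun y => (abs_add_le _ _).trans (add_le_add (hC y) (hC' y))⟩
    (fun i => by simp [harm_apply]) fun i hi => ?_
  rw [integral_add (harm_integrable u i) (harm_integrable v i), harm_harmonic u hi,
    harm_harmonic v hi]

lemma harm_smul (h : IsBoundaryChain R q s) (c : ℝ) (u : Fin R → ℝ) : harm q (c • u) = fun y => c * harm q u y := by
  obtain ⟨C, hC⟩ := harm_bdd (q := q) u
  refine h.harm_eq ⟨|c| * C, fun y => by rw [abs_mul]; gcongr; exact hC y⟩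
    (fun i => by simp [harm_apply]) fun i hi => ?_
  rw [integral_const_mul, harm_harmonic u hi]

lemma harm_const (h : IsBoundaryChain R q s) (c : ℝ) : harm q (fun _ : Fin R => c) = fun _ => c :=
  h.harm_eq ⟨|c|, fun _ => le_rfl⟩ (fun _ => rfl) fun i _ => by simp

/-- The generator of the chain induced on `{0, …, R - 1}`. -/
def gen (h : IsBoundaryChain R q s) : (Fin R → ℝ) →ₗ[ℝ] (Fin R → ℝ) where
  toFun u i := ∫ j, harm q u j ∂(q i).toMeasure - u i
  map_add' u v := by
    ext i
    simp only [h.harm_add, Pi.add_apply]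
    rw [integral_add (harm_integrable u i) (harm_integrable v i)]; ring
  map_smul' c u := by
    ext i
    simp only [h.harm_smul, Pi.smul_apply, RingHom.id_apply, smul_eq_mul]
    rw [integral_const_mul]; ring

lemma gen_apply (h : IsBoundaryChain R q s) (u : Fin R → ℝ) (i : Fin R) :
    h.gen u i = ∫ j, harm q u j ∂(q i).toMeasure - u i := rfl

lemma gen_const (h : IsBoundaryChain R q s) (c : ℝ) : h.gen (fun _ => c) = 0 := by
  ext i; simp [gen_apply, h.harm_const]

/-- A non-negative generator makes the harmonic extension subharmonic on the finite set too, hence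
everywhere, and bounded subharmonic functions are constant. -/
lemma const_of_gen_nonneg (h : IsBoundaryChain R q s) {u : Fin R → ℝ} (hu : ∀ i, 0 ≤ h.gen u i) : ∃ c, u = fun _ => c := by
  obtain ⟨C, hC⟩ := harm_bdd (q := q) u
  refine ⟨harm q u 0, funext fun i => ?_⟩
  rw [← harm_apply (q := q) u i]
  refine h.eq_const_of_subharmonic hC (fun j => ?_) i
  by_cases hj : j < R
  · have := hu ⟨j, hj⟩
    rw [gen_apply] at this
    have h2 := harm_apply (q := q) u ⟨j, hj⟩
    simp only at h2 this
    linarith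
  · exact (harm_harmonic u (by omega)).ge

/-- Stationary vector of the induced chain, with solvability of the Poisson equation. -/
theorem exists_stationary (h : IsBoundaryChain R q s) : ∃ π : Fin R → ℝ, (∀ i, 0 < π i) ∧ ∑ i, π i = 1 ∧
    (∀ u, ∑ i, π i * h.gen u i = 0) ∧ ∀ b : Fin R → ℝ, ∑ i, π i * b i = 0 → ∃ u, h.gen u = b := by
  classical
  -- The kernel consists of the constants, so the range has codimension one and is the kernel of a
  -- functional `φ`. The normalised coefficients of `φ` are the stationary vector, and solvability
  -- is the equality of range and kernel; what remains is that the coefficients have one strict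
  -- sign.
  have hker : ∀ u, h.gen u = 0 → ∃ c : ℝ, u = fun _ => c := fun u hu =>
    h.const_of_gen_nonneg fun i => by rw [hu]; simp
  have hkereq : LinearMap.ker h.gen = Submodule.span ℝ {(fun _ => 1 : Fin R → ℝ)} := by
    ext u
    rw [LinearMap.mem_ker, Submodule.mem_span_singleton]
    constructor
    · intro hu
      obtain ⟨c, rfl⟩ := hker u hu
      exact ⟨c, by ext; simp⟩
    · rintro ⟨c, rfl⟩
      have := h.gen_const c
      convert this using 2
      ext; simp
  have h1ne : (fun _ => 1 : Fin R → ℝ) ≠ 0 := fun e => by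
    have := congrFun e ⟨0, h.pos⟩; simp at this
  have hfk : Module.finrank ℝ (LinearMap.ker h.gen) = 1 := by
    rw [hkereq]; exact finrank_span_singleton h1ne
  have hfr := LinearMap.finrank_range_add_finrank_ker h.gen
  have hlt : LinearMap.range h.gen < ⊤ := by
    refine lt_top_iff_ne_top.2 fun e => ?_
    rw [e, finrank_top, hfk] at hfr
    omega
  obtain ⟨φ, hφ0, hφ⟩ := Submodule.exists_le_ker_of_lt_top _ hlt
  have hφk := LinearMap.finrank_range_add_finrank_ker φ
  have hφr : Module.finrank ℝ (LinearMap.range φ) = 1 := by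
    rw [LinearMap.range_eq_top.2 (LinearMap.surjective hφ0), finrank_top, Module.finrank_self]
  have heq : LinearMap.range h.gen = LinearMap.ker φ :=
    Submodule.eq_of_le_of_finrank_eq hφ (by omega)
  have hpos : ∀ b : Fin R → ℝ, (∀ i, 0 ≤ b i) → φ b = 0 → b = 0 := by
    intro b hb hφb
    have : b ∈ LinearMap.range h.gen := by rw [heq]; exact hφb
    obtain ⟨u, rfl⟩ := this
    obtain ⟨c, rfl⟩ := h.const_of_gen_nonneg hb
    exact h.gen_const c
  set e : Fin R → Fin R → ℝ := fun i => Pi.single i 1 with he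
  have hexp : ∀ b, φ b = ∑ i, φ (e i) * b i := by
    intro b
    conv_lhs => rw [← Finset.univ_sum_single b, map_sum]
    refine Finset.sum_congr rfl fun i _ => ?_
    have : (Pi.single i (b i) : Fin R → ℝ) = b i • e i := by
      ext j; by_cases hj : j = i
      · subst hj; simp [he]
      · simp [he, hj]
    rw [this, map_smul, smul_eq_mul, mul_comm]
  have hne : ∀ i, φ (e i) ≠ 0 := fun i hi => by
    have := hpos (e i) (fun j => by by_cases hj : j = i <;> simp [he, hj]) hi
    have := congrFun this i; simp [he] at this
  -- Coefficients of opposite signs would allow a non-zero, non-negative combination of two basis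
  -- vectors annihilated by `φ`, contradicting `hpos`.
  have hsign : ∀ i j, 0 < φ (e i) * φ (e j) := by
    intro i j
    by_contra hc
    have hc' : φ (e i) * φ (e j) < 0 := lt_of_le_of_ne (not_lt.1 hc) (mul_ne_zero (hne i) (hne j))
    have key : ∀ i j, 0 < φ (e i) → φ (e j) < 0 → False := by
      intro i j hi hj
      have := hpos (-φ (e j) • e i + φ (e i) • e j) (fun k => by
        have h1 : 0 ≤ e i k := by by_cases hk : k = i <;> simp [he, hk]
        have h2 : 0 ≤ e j k := by by_cases hk : k = j <;> simp [he, hk]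
        simp only [Pi.add_apply, Pi.smul_apply, smul_eq_mul]
        nlinarith [mul_nonneg hi.le h2, mul_nonneg (neg_nonneg.2 hj.le) h1])
        (by simp; ring)
      have h3 := congrFun this i
      have h2 : 0 ≤ e j i := by by_cases hk : i = j <;> simp [he, hk]
      simp only [Pi.add_apply, Pi.smul_apply, smul_eq_mul, Pi.zero_apply] at h3
      have h4 : e i i = 1 := by simp [he]
      rw [h4] at h3
      nlinarith [mul_nonneg hi.le h2]
    rcases lt_or_gt_of_ne (hne i) with h1 | h1
    · exact key j i (by nlinarith) h1
    · exact key i j h1 (by nlinarith)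
  set S := ∑ i, φ (e i) with hS
  have hS1 : ∀ i, 0 < φ (e i) * S := fun i => by
    rw [hS, Finset.mul_sum]
    exact Finset.sum_pos (fun j _ => hsign i j) ⟨i, Finset.mem_univ i⟩
  have hS0 : S ≠ 0 := fun h0 => by
    have := hS1 ⟨0, h.pos⟩; rw [h0, mul_zero] at this; exact lt_irrefl _ this
  refine ⟨fun i => φ (e i) / S, fun i => ?_, ?_, fun u => ?_, fun b hb => ?_⟩
  · have h2 : φ (e i) / S = φ (e i) * S / S ^ 2 := by field_simp
    have := hS1 i
    change 0 < φ (e i) / S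
    rw [h2]
    positivity
  · rw [← Finset.sum_div, ← hS, div_self hS0]
  · have h2 : φ (h.gen u) = 0 := hφ ⟨u, rfl⟩
    rw [hexp] at h2
    simp_rw [div_mul_eq_mul_div]
    rw [← Finset.sum_div, h2, zero_div]
  · have h2 : φ b = 0 := by
      rw [hexp]
      simp_rw [div_mul_eq_mul_div] at hb
      rw [← Finset.sum_div, div_eq_zero_iff] at hb
      exact hb.resolve_right hS0
    have : b ∈ LinearMap.range h.gen := by rw [heq]; exact h2
    exact this

end IsBoundaryChain

namespace IsBoundaryChain

variable {R : ℕ} {q : ℕ → PMF ℕ} {s : PMF ℤ}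

/-! ### Invariant measures -/

lemma tsum_split (a : ℕ → ℝ≥0∞) :
    ∑' i, a i = ∑ i ∈ Finset.range R, a i + ∑' i, if i < R then 0 else a i := by
  have : ∀ i, a i = (if i < R then a i else 0) + if i < R then 0 else a i := fun i => by
    by_cases hi : i < R <;> simp [hi]
  conv_lhs => rw [tsum_congr this]
  rw [ENNReal.tsum_add]
  congr 1
  rw [tsum_eq_sum (s := Finset.range R) (fun i hi => if_neg (by simpa using hi))]
  exact Finset.sum_congr rfl fun i hi => if_pos (by simpa using hi)

lemma tsum_invariant {π : ℕ → ℝ≥0∞} (hπ : ∀ j, ∑' i, π i * q i j = π j) (t : ℕ → ℝ≥0∞) :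
    ∑' i, π i * t i = ∑' i, π i * ∑' j, q i j * t j := by
  simp_rw [← ENNReal.tsum_mul_left]
  rw [ENNReal.tsum_comm]
  refine tsum_congr fun j => ?_
  rw [← hπ j, ← ENNReal.tsum_mul_right]
  exact tsum_congr fun i => by ring

/-- By invariance the mass of `u` can be followed one step back at a time; at each step the part
coming from {0, …, R-1} is recorded and the rest carried on. Discarding the non-negative remainder
after N steps leaves an inequality, which suffices. -/
lemma sum_hext_le {π : ℕ → ℝ≥0∞} (hπ : ∀ j, ∑' i, π i * q i j = π j) (u : ℕ → ℝ≥0∞) :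
    ∑ i ∈ Finset.range R, π i * ∑' j, q i j * hext R q u j ≤ ∑ i ∈ Finset.range R, π i * u i := by
  have key : ∀ N, ∑' i, π i * taboo R q u 0 i
      = ∑ n ∈ Finset.range N, ∑ i ∈ Finset.range R, π i * ∑' j, q i j * taboo R q u n j
        + ∑' i, π i * taboo R q u N i := by
    intro N
    induction N with
    | zero => simp
    | succ N ih =>
      rw [ih, Finset.sum_range_succ, add_assoc]
      congr 1
      rw [tsum_invariant hπ, tsum_split (R := R)]
      congr 1
      refine tsum_congr fun i => ?_
      by_cases hi : i < R <;> simp [hi, taboo]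
  have h0 : ∑' i, π i * taboo R q u 0 i = ∑ i ∈ Finset.range R, π i * u i := by
    rw [tsum_eq_sum (s := Finset.range R)]
    · exact Finset.sum_congr rfl fun i hi => by
        have hi' : i < R := by simpa using hi
        simp [taboo, hi']
    · intro i hi
      have hi' : ¬ i < R := by simpa using hi
      simp [taboo, hi']
  rw [← h0]
  have e : ∑ i ∈ Finset.range R, π i * ∑' j, q i j * hext R q u j
      = ∑' n, ∑ i ∈ Finset.range R, π i * ∑' j, q i j * taboo R q u n j := by
    rw [Summable.tsum_finsetSum (fun _ _ => ENNReal.summable)]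
    refine Finset.sum_congr rfl fun i _ => ?_
    rw [ENNReal.tsum_mul_left, ENNReal.tsum_comm]
    simp_rw [ENNReal.tsum_mul_left, hext]
  rw [e, ENNReal.tsum_eq_iSup_nat]
  refine iSup_le fun N => ?_
  rw [key N]
  exact le_self_add

lemma hext_eq_harm (h : IsBoundaryChain R q s) (u : Fin R → ℝ) (hu : ∀ i, 0 ≤ u i) :
    ∃ v : ℕ → ℝ≥0∞, (∀ i : Fin R, v i = ENNReal.ofReal (u i)) ∧
      ∃ C : ℝ≥0∞, C ≠ ∞ ∧ (∀ i < R, v i ≤ C) ∧ ∀ y, (hext R q v y).toReal = harm q u y := by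
  set v : ℕ → ℝ≥0∞ := fun i => if hi : i < R then ENNReal.ofReal (u ⟨i, hi⟩) else 0 with hv
  set C : ℝ≥0∞ := ∑ i : Fin R, ENNReal.ofReal (u i) with hC
  have hCt : C ≠ ∞ := ENNReal.sum_ne_top.2 fun _ _ => ENNReal.ofReal_ne_top
  have hvC : ∀ i < R, v i ≤ C := fun i hi => by
    simp only [hv, hi, dif_pos]
    exact Finset.single_le_sum (f := fun i : Fin R => ENNReal.ofReal (u i))
      (fun _ _ => bot_le) (Finset.mem_univ (⟨i, hi⟩ : Fin R))
  refine ⟨v, fun i => by simp [hv], C, hCt, hvC, fun y => ?_⟩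
  have := h.harm_eq (u := u) (K := fun y => (hext R q v y).toReal)
    ⟨C.toReal, fun y => by
      rw [abs_of_nonneg ENNReal.toReal_nonneg]
      exact ENNReal.toReal_mono hCt (hext_le hvC y)⟩
    (fun i => by
      rw [hext_of_lt v i.2]
      simp [hv, ENNReal.toReal_ofReal (hu i)])
    (fun i hi => by rw [hext_toReal hCt hvC, ← hext_of_ge v hi])
  rw [this]

lemma toReal_tsum_hext {v : ℕ → ℝ≥0∞} {C : ℝ≥0∞} (hCt : C ≠ ∞) (hvC : ∀ i < R, v i ≤ C) (i : ℕ) :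
    ∑' j, q i j * hext R q v j ≠ ∞ := by
  refine ne_top_of_le_ne_top hCt ?_
  calc _ ≤ ∑' j, q i j * C := by gcongr with j; exact hext_le hvC j
    _ = C := by rw [ENNReal.tsum_mul_right, PMF.tsum_coe, one_mul]

/-- An invariant measure of the chain restricts to an invariant vector of the induced chain. -/
theorem sum_gen_of_invariant (h : IsBoundaryChain R q s) {π : ℕ → ℝ≥0}
    (hπ : ∀ j, ∑' i, (π i : ℝ≥0∞) * q i j = π j) (u : Fin R → ℝ) :
    ∑ i : Fin R, (π i : ℝ) * h.gen u i = 0 := by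
  have key0 : ∀ u : Fin R → ℝ, (∀ i, 0 ≤ u i) → ∑ i : Fin R, (π i : ℝ) * h.gen u i ≤ 0 := by
    intro u hu
    obtain ⟨v, hv, C, hCt, hvC, hharm⟩ := h.hext_eq_harm u hu
    have h1 := sum_hext_le (R := R) hπ v
    rw [Finset.sum_range, Finset.sum_range] at h1
    have h2 := ENNReal.toReal_mono (ENNReal.sum_ne_top.2 fun (i : Fin R) _ =>
      ENNReal.mul_ne_top ENNReal.coe_ne_top (ne_top_of_le_ne_top hCt (hvC i i.2))) h1
    have hA : ∀ i : Fin R, (π i : ℝ≥0∞) * ∑' j, q i j * hext R q v j ≠ ∞ := fun i =>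
      ENNReal.mul_ne_top ENNReal.coe_ne_top (toReal_tsum_hext hCt hvC i)
    rw [ENNReal.toReal_sum fun i _ => hA i,
      ENNReal.toReal_sum fun (i : Fin R) _ => ENNReal.mul_ne_top ENNReal.coe_ne_top
        (ne_top_of_le_ne_top hCt (hvC i i.2))] at h2
    have e : ∑ i : Fin R, (π i : ℝ) * h.gen u i
        = ∑ i : Fin R, ((π i : ℝ≥0∞) * ∑' j, q i j * hext R q v j).toReal
          - ∑ i : Fin R, ((π i : ℝ≥0∞) * v i).toReal := by
      rw [← Finset.sum_sub_distrib]
      refine Finset.sum_congr rfl fun i _ => ?_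
      rw [ENNReal.toReal_mul, ENNReal.toReal_mul, ← hext_toReal hCt hvC, hv,
        ENNReal.toReal_ofReal (hu i), gen_apply, ← mul_sub]
      simp_rw [hharm]
      rfl
    rw [e]; linarith
  -- The generator kills constants, so a shift removes the sign condition on `u`. Applying the
  -- inequality to `-u` as well gives equality.
  have key : ∀ u : Fin R → ℝ, ∑ i : Fin R, (π i : ℝ) * h.gen u i ≤ 0 := by
    intro u
    set b := ∑ i, |u i|
    have := key0 (u + fun _ => b) (fun i => by
      have h1 : |u i| ≤ b := Finset.single_le_sum (f := fun i => |u i|)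
        (fun _ _ => abs_nonneg _) (Finset.mem_univ i)
      have h2 := (abs_le.1 h1).1
      simp only [Pi.add_apply]; linarith)
    rwa [map_add, h.gen_const, add_zero] at this
  refine le_antisymm (key u) ?_
  have := key (-u)
  simp only [map_neg, Pi.neg_apply, mul_neg, Finset.sum_neg_distrib] at this
  linarith

/-- Two invariant measures of mass one on `{0, …, R - 1}` agree there. -/
theorem invariant_unique (h : IsBoundaryChain R q s) {π π' : ℕ → ℝ≥0}
    (hπ : IsNormalizedInvariant R (fun i j => q i j) π)
    (hπ' : IsNormalizedInvariant R (fun i j => q i j) π') (i : Fin R) : π i = π' i := by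
  classical
  obtain ⟨ρ, -, hρ1, -, hρ⟩ := h.exists_stationary
  have key : ∀ {π : ℕ → ℝ≥0}, IsNormalizedInvariant R (fun i j => q i j) π → (π i : ℝ) = ρ i := by
    intro π hπ
    -- Testing invariance against the Poisson solution for the centred indicator of `i` reads off
    -- the mass at `i`.
    obtain ⟨u, hu⟩ := hρ (fun j => (Pi.single i 1 : Fin R → ℝ) j - ρ i) (by
      simp only [mul_sub, Finset.sum_sub_distrib, ← Finset.sum_mul, hρ1]
      simp [Pi.single_apply])
    have h1 := h.sum_gen_of_invariant hπ.invariant u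
    rw [hu] at h1
    have h2 : ∑ j : Fin R, (π j : ℝ) = 1 := by
      have := hπ.normalized
      rw [Finset.sum_range] at this
      exact_mod_cast this
    simp only [mul_sub, Finset.sum_sub_distrib, ← Finset.sum_mul, h2] at h1
    simp [Pi.single_apply] at h1
    linarith
  have heq : (π i : ℝ) = π' i := by rw [key hπ, key hπ']
  exact_mod_cast heq

/-- Occupation measures of excursions off `{0, …, R - 1}`, started from `ρ`. -/
def excursion (R : ℕ) (q : ℕ → PMF ℕ) (ρ : Fin R → ℝ≥0∞) : ℕ → ℕ → ℝ≥0∞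
  | 0 => fun j => ∑ i, ρ i * q i j
  | n + 1 => fun j => ∑' y, if y < R then 0 else excursion R q ρ n y * q y j

/-- Both sides weigh the same excursions of given length; a step taken off the finite set can be
counted in either factor. -/
lemma excursion_taboo (ρ : Fin R → ℝ≥0∞) (u : ℕ → ℝ≥0∞) (n : ℕ) : ∀ k,
    ∑' y, excursion R q ρ k y * taboo R q u n y
      = ∑' y, excursion R q ρ (k + n) y * taboo R q u 0 y := by
  induction n with
  | zero => simp
  | succ n ih =>
    intro k
    have : ∑' y, excursion R q ρ k y * taboo R q u (n + 1) y
        = ∑' y, excursion R q ρ (k + 1) y * taboo R q u n y := by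
      simp only [excursion, ← ENNReal.tsum_mul_right]
      rw [ENNReal.tsum_comm]
      refine tsum_congr fun y => ?_
      by_cases hy : y < R
      · simp [taboo, hy]
      · simp only [taboo, hy, if_false]
        rw [← ENNReal.tsum_mul_left]
        exact tsum_congr fun j => by ring
    rw [this, ih (k + 1), show k + 1 + n = k + (n + 1) by ring]

/-- The positive invariant measure. -/
theorem exists_invariant (h : IsBoundaryChain R q s) :
    ∃ π : ℕ → ℝ≥0, IsNormalizedInvariant R (fun i j => q i j) π := by
  classical
  obtain ⟨ρ, hρ0, hρ1, hρg, -⟩ := h.exists_stationary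
  set r : Fin R → ℝ≥0∞ := fun i => ENNReal.ofReal (ρ i) with hr
  set Q : ℕ → ℝ≥0∞ := fun j => ∑' n, excursion R q r n j with hQ
  -- The mass that excursions bring back to `i` is the `ρ`-average of the harmonic extension of the
  -- indicator of `i`; stationarity of `ρ` for the induced chain makes it `r i`.
  have hQlow : ∀ i : Fin R, Q i = r i := by
    intro i
    obtain ⟨v, hv, C, hCt, hvC, hharm⟩ := h.hext_eq_harm (Pi.single i 1)
      (fun j => by by_cases hj : j = i <;> simp [hj])
    have e1 : ∀ n, excursion R q r n i = ∑' y, excursion R q r 0 y * taboo R q v n y := by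
      intro n
      rw [excursion_taboo r v n 0, zero_add, tsum_eq_single (i : ℕ)]
      · simp [taboo, hv]
      · intro y hy
        by_cases hyR : y < R
        · have := hv ⟨y, hyR⟩
          simp only at this
          simp only [taboo, hyR, if_true, this]
          rw [Pi.single_apply, if_neg (fun e => hy (by rw [← e]))]
          simp
        · simp [taboo, hyR]
    have e2 : Q i = ∑ k : Fin R, r k * ∑' y, q k y * hext R q v y := by
      simp only [hQ, e1]
      rw [ENNReal.tsum_comm]
      have e0 : ∀ y, ∑' n, excursion R q r 0 y * taboo R q v n y
          = ∑ k : Fin R, r k * q k y * hext R q v y := fun y => by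
        rw [ENNReal.tsum_mul_left]
        simp only [excursion, Finset.sum_mul]
        rfl
      rw [tsum_congr e0, Summable.tsum_finsetSum (fun _ _ => ENNReal.summable)]
      refine Finset.sum_congr rfl fun k _ => ?_
      rw [← ENNReal.tsum_mul_left]
      exact tsum_congr fun y => by ring
    have e3 := hρg (Pi.single i 1)
    simp only [gen_apply, mul_sub, Finset.sum_sub_distrib] at e3
    have hA : ∀ k : Fin R, r k * ∑' y, q k y * hext R q v y ≠ ∞ := fun k =>
      ENNReal.mul_ne_top ENNReal.ofReal_ne_top (toReal_tsum_hext hCt hvC k)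
    have e4 : (Q i).toReal = ρ i := by
      rw [e2, ENNReal.toReal_sum fun k _ => hA k]
      simp_rw [ENNReal.toReal_mul, ← hext_toReal hCt hvC, hharm, hr,
        ENNReal.toReal_ofReal (hρ0 _).le]
      simp [Pi.single_apply] at e3
      linarith
    have e5 : Q i ≠ ∞ := by
      rw [e2]
      exact ENNReal.sum_ne_top.2 fun k _ => hA k
    rw [← ENNReal.ofReal_toReal e5, e4]
  have hinv : ∀ j, ∑' i, Q i * q i j = Q j := by
    intro j
    rw [tsum_split (R := R), Finset.sum_range]
    simp only [hQlow]
    have : Q j = excursion R q r 0 j + ∑' n, excursion R q r (n + 1) j :=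
      tsum_eq_zero_add' ENNReal.summable
    rw [this]
    refine congrArg (excursion R q r 0 j + ·) ?_
    have e0 : ∀ n, excursion R q r (n + 1) j
      = ∑' y, if y < R then 0 else excursion R q r n y * q y j := fun n => rfl
    rw [tsum_congr e0, ENNReal.tsum_comm]
    refine tsum_congr fun y => ?_
    by_cases hy : y < R
    · simp [hy]
    · simp only [hy, if_false, hQ]
      rw [ENNReal.tsum_mul_right]
  have hstep : ∀ a b, Q a * q a b ≤ Q b := fun a b => by
    rw [← hinv b]; exact ENNReal.le_tsum a
  have hQ0 : Q 0 = r ⟨0, h.pos⟩ := hQlow ⟨0, h.pos⟩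
  -- Finiteness is pulled back along a path from `j` to 0; positivity below is pushed forward along
  -- a path from 0 to `j`.
  have hfin : ∀ j, Q j ≠ ∞ := by
    intro j
    induction h.irred j 0 using Relation.ReflTransGen.head_induction_on with
    | refl => rw [hQ0]; exact ENNReal.ofReal_ne_top
    | @head a c hab _ ih =>
      intro htop
      have := hstep a c
      rw [htop, ENNReal.top_mul hab] at this
      exact ih (top_le_iff.1 this)
  have hpos : ∀ j, Q j ≠ 0 := by
    intro j
    induction h.irred 0 j with
    | refl => rw [hQ0]; simpa [hr] using hρ0 _
    | @tail a c _ hab ih =>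
      intro hz
      have := hstep a c
      rw [hz] at this
      exact (mul_ne_zero ih hab) (le_bot_iff.1 this)
  refine ⟨fun j => (Q j).toNNReal, fun j => ENNReal.toNNReal_pos (hpos j) (hfin j), fun j => ?_, ?_⟩
  · simp_rw [ENNReal.coe_toNNReal (hfin _)]
    exact hinv j
  · rw [Finset.sum_range]
    apply NNReal.coe_injective
    push_cast
    rw [← hρ1]
    refine Finset.sum_congr rfl fun i _ => ?_
    rw [hQlow]
    exact ENNReal.toReal_ofReal (hρ0 i).le

/-- The averaged drift at the boundary points inwards. -/
theorem mean_pos (h : IsBoundaryChain R q s) {π : ℕ → ℝ≥0}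
    (hπ : IsNormalizedInvariant R (fun i j => q i j) π)
    (hintg : ∀ i < R, Integrable (fun j : ℕ => (j : ℝ)) (q i).toMeasure) :
    0 < ∑ i : Fin R, (π i : ℝ) * (∫ j, (j : ℝ) ∂(q i).toMeasure - (i : ℕ)) := by
  -- The bounded harmonic extension of the height is at most `R - 1`, hence lies below the height
  -- everywhere and strictly below from `R` on. Subtracting the stationarity identity for `u` turns
  -- the averaged drift into the mean of this gap after one step.
  set u : Fin R → ℝ := fun i => (i : ℕ) with hu
  have hg := h.sum_gen_of_invariant hπ.invariant u
  obtain ⟨C, hC⟩ := harm_bdd (q := q) u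
  have hle : ∀ y, harm q u y ≤ (R : ℝ) - 1 :=
    h.max_principle hC (fun i hi => by
      have := harm_apply (q := q) u ⟨i, hi⟩
      simp only at this
      rw [this]
      have : (i : ℝ) + 1 ≤ R := by exact_mod_cast hi
      simp only [hu]; linarith) (fun i hi => (harm_harmonic u hi).ge)
  have hd : ∀ j : ℕ, 0 ≤ (j : ℝ) - harm q u j ∧ (R ≤ j → 0 < (j : ℝ) - harm q u j) := by
    intro j
    have h1 := hle j
    have h3 : R ≤ j → 0 < (j : ℝ) - harm q u j := fun hj => by
      have : (R : ℝ) ≤ j := by exact_mod_cast hj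
      linarith
    refine ⟨?_, h3⟩
    by_cases hj : j < R
    · have := harm_apply (q := q) u ⟨j, hj⟩
      simp only at this
      rw [this]; simp [hu]
    · exact (h3 (by omega)).le
  have e : ∑ i : Fin R, (π i : ℝ) * (∫ j, (j : ℝ) ∂(q i).toMeasure - (i : ℕ))
      = ∑ i : Fin R, (π i : ℝ) * ∫ j : ℕ, ((j : ℝ) - harm q u j) ∂(q i).toMeasure := by
    rw [← sub_zero (∑ i : Fin R, (π i : ℝ) * (∫ j, (j : ℝ) ∂(q i).toMeasure - (i : ℕ))), ← hg,
      ← Finset.sum_sub_distrib]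
    refine Finset.sum_congr rfl fun i _ => ?_
    rw [integral_sub (hintg i i.2) (harm_integrable u i), gen_apply]
    simp only [hu]; ring
  rw [e]
  -- Irreducibility forces some jump out of the finite set, which makes the mean gap strictly
  -- positive.
  have hex : ∃ i : Fin R, ∃ j, R ≤ j ∧ q i j ≠ 0 := by
    by_contra hcon
    push Not at hcon
    have : ∀ b, Relation.ReflTransGen (fun a b => q a b ≠ 0) 0 b → b < R := by
      intro b hb
      induction hb with
      | refl => exact h.pos
      | @tail b c _ hbc ih =>
        by_contra hc
        exact hbc (hcon ⟨b, ih⟩ c (by omega))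
    exact lt_irrefl _ (this R (h.irred 0 R))
  obtain ⟨i, j, hj, hij⟩ := hex
  refine Finset.sum_pos' (fun k _ => mul_nonneg (π k).2 (integral_nonneg fun j => (hd j).1))
    ⟨i, Finset.mem_univ i, mul_pos (hπ.pos i) ?_⟩
  have hI := (hintg i i.2).sub (harm_integrable u i)
  refine lt_of_le_of_ne (integral_nonneg fun j => (hd j).1) fun h0 => ?_
  have := pmf_eq_zero_of_integral_nonpos hI (fun j _ => (hd j).1) h0.symm.le hij
  have h2 := (hd j).2 hj
  simp only [Pi.sub_apply] at this
  linarith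

end IsBoundaryChain

namespace IsBoundaryChain

variable {R : ℕ} {q : ℕ → PMF ℕ} {s : PMF ℤ}

/-! ### Correctors -/

/-- A bounded function on `ℤ` which is harmonic for the walk with increment law `s` far to the
right is asymptotically invariant under the steps of the walk: one-sided bound. -/
lemma limsup_diff_nonpos (s : PMF ℤ) {r : ℕ} (hs : ∀ j, s j ≠ 0 → -(r : ℤ) ≤ j) {K : ℤ → ℝ} {C : ℝ}
    (hC : ∀ y, |K y| ≤ C) {N : ℤ} (hK : ∀ y, N ≤ y → ∫ j, K (y + j) ∂s.toMeasure = K y) {k : ℤ}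
    (hk : s k ≠ 0) : Filter.limsup (fun y => K (y + k) - K y) Filter.atTop ≤ 0 := by
  set g : ℤ → ℝ := fun y => K (y + k) - K y with hg
  have hgC : ∀ y, |g y| ≤ C + C := fun y => (abs_sub _ _).trans (add_le_add (hC _) (hC _))
  have hbdd : Filter.IsBoundedUnder (· ≤ ·) Filter.atTop g :=
    Filter.isBoundedUnder_of ⟨C + C, fun y => (abs_le.1 (hgC y)).2⟩
  have hcobdd : Filter.IsCoboundedUnder (· ≤ ·) Filter.atTop g :=
    (Filter.isBoundedUnder_of ⟨-(C + C), fun y => (abs_le.1 (hgC y)).1⟩ :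
      Filter.IsBoundedUnder (· ≥ ·) Filter.atTop g).isCoboundedUnder_le
  -- If σ were positive, harmonicity of `g` would force a near-maximal increment at `y` to be
  -- followed by one at `y + k`; many such increments add up to more than the bound on `K` permits.
  set σ := Filter.limsup g Filter.atTop with hσ
  by_contra hpos
  push Not at hpos
  set p := (s k).toReal with hp
  have hp0 : 0 < p := ENNReal.toReal_pos hk (s.apply_ne_top k)
  have hharm : ∀ y, N + |k| ≤ y → ∫ j, g (y + j) ∂s.toMeasure = g y := by
    intro y hy
    simp only [hg]
    rw [integral_sub (integrable_bdd _ fun _ => hC _) (integrable_bdd _ fun _ => hC _),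
      hK y (by have := abs_nonneg k; omega), ← hK (y + k) (by have := neg_abs_le k; omega)]
    simp_rw [show ∀ j, y + j + k = y + k + j by intro j; ring]
  have hstep : ∀ δ > 0, ∃ δ' > 0, ∃ N' : ℤ, ∀ y, N' ≤ y → σ - δ' ≤ g y → σ - δ ≤ g (y + k) := by
    intro δ hδ
    have hev : ∀ᶠ y in Filter.atTop, g y < σ + p * δ / 2 :=
      Filter.eventually_lt_of_limsup_lt (by rw [← hσ]; linarith [mul_pos hp0 hδ]) hbdd
    obtain ⟨N₁, hN₁⟩ := Filter.eventually_atTop.1 hev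
    -- Steps are at least `-r`, so after one step `g` is still below σ + pδ/2. A mean deficit of at
    -- most pδ leaves a deficit of at most δ at the atom `k` of mass `p`.
    refine ⟨p * δ / 2, by positivity, max (N₁ + r) (N + |k|), fun y hy hgy => ?_⟩
    have hi : Integrable (fun j => g (y + j)) s.toMeasure := integrable_bdd _ fun _ => hgC _
    have := pmf_atom_le_integral (p := s) (f := fun j => σ + p * δ / 2 - g (y + j))
      ((integrable_const _).sub hi) (fun j hj => by
        have h1 := hs j hj
        have := hN₁ (y + j) (by have := le_max_left (N₁ + r) (N + |k|); omega)
        linarith) k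
    rw [integral_sub (integrable_const _) hi, hharm y ((le_max_right _ _).trans hy)] at this
    simp only [integral_const, probReal_univ, smul_eq_mul, one_mul, ← hp] at this
    have h3 : p * (σ + p * δ / 2 - g (y + k)) ≤ p * δ := by linarith
    have h4 := le_of_mul_le_mul_left h3 hp0
    linarith [mul_pos hp0 hδ]
  have hmany : ∀ m : ℕ, ∀ δ > 0, ∃ δ' > 0, ∃ N' : ℤ, ∀ y, N' ≤ y → σ - δ' ≤ g y →
      m * (σ - δ) ≤ K (y + m * k) - K y := by
    intro m
    induction m with
    | zero => intro δ _; exact ⟨1, one_pos, 0, fun y _ _ => by simp⟩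
    | succ m ih =>
      intro δ hδ
      obtain ⟨δ₁, h₁, N₁, hN₁⟩ := ih δ hδ
      obtain ⟨δ₂, h₂, N₂, hN₂⟩ := hstep δ₁ h₁
      refine ⟨min δ₂ δ, lt_min h₂ hδ, max N₂ (N₁ + |k|), fun y hy hgy => ?_⟩
      have e1 := hN₂ y ((le_max_left _ _).trans hy) (by linarith [min_le_left δ₂ δ])
      have e2 := hN₁ (y + k)
        (by have := neg_abs_le k; have := le_max_right N₂ (N₁ + |k|); omega) e1
      have e3 : σ - δ ≤ g y := by linarith [min_le_right δ₂ δ]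
      simp only [hg] at e3
      have e4 : y + ((m + 1 : ℕ) : ℤ) * k = y + k + m * k := by push_cast; ring
      rw [e4]; push_cast; linarith
  obtain ⟨m, hm⟩ := exists_nat_gt ((C + C) / (σ / 2))
  obtain ⟨δ', h', N', hN'⟩ := hmany m (σ / 2) (by linarith)
  have hfreq : ∃ᶠ y in Filter.atTop, σ - δ' < g y :=
    Filter.frequently_lt_of_lt_limsup hcobdd (by rw [← hσ]; linarith)
  obtain ⟨y, hy, hyN⟩ := (hfreq.and_eventually (Filter.eventually_ge_atTop N')).exists
  have h1 := hN' y hyN hy.le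
  have h2 := (abs_le.1 ((abs_sub (K (y + m * k)) (K y)).trans (add_le_add (hC _) (hC _)))).2
  rw [div_lt_iff₀ (by linarith)] at hm
  linarith

lemma tendsto_diff_zero (s : PMF ℤ) {r : ℕ} (hs : ∀ j, s j ≠ 0 → -(r : ℤ) ≤ j) {K : ℤ → ℝ} {C : ℝ}
    (hC : ∀ y, |K y| ≤ C) {N : ℤ} (hK : ∀ y, N ≤ y → ∫ j, K (y + j) ∂s.toMeasure = K y) {k : ℤ}
    (hk : s k ≠ 0) : Filter.Tendsto (fun y => K (y + k) - K y) Filter.atTop (nhds 0) := by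
  have one : ∀ {K : ℤ → ℝ}, (∀ y, |K y| ≤ C) →
      (∀ y, N ≤ y → ∫ j, K (y + j) ∂s.toMeasure = K y) →
      ∀ ε > 0, ∀ᶠ y in Filter.atTop, K (y + k) - K y < ε := by
    intro K hC hK ε hε
    refine Filter.eventually_lt_of_limsup_lt ((limsup_diff_nonpos s hs hC hK hk).trans_lt hε)
      (Filter.isBoundedUnder_of ⟨C + C, fun y => ?_⟩)
    exact (abs_le.1 ((abs_sub (K (y + k)) (K y)).trans (add_le_add (hC _) (hC _)))).2
  rw [Metric.tendsto_nhds]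
  intro ε hε
  filter_upwards [one hC hK ε hε, one (K := fun y => -K y) (fun y => by rw [abs_neg]; exact hC y)
    (fun y hy => by rw [integral_neg, hK y hy]) ε hε] with y h1 h2
  rw [Real.dist_eq, sub_zero, abs_lt]
  constructor <;> linarith

/-! ### Strictly superharmonic functions near the boundary -/

/-- Probability that the chain stays above `R` for `k` steps. -/
def stay (R : ℕ) (q : ℕ → PMF ℕ) : ℕ → ℕ → ℝ
  | 0 => fun y => if y < R then 0 else 1
  | k + 1 => fun y => if y < R then 0 else ∫ j, stay R q k j ∂(q y).toMeasure

lemma stay_nonneg (k : ℕ) : ∀ y, 0 ≤ stay R q k y := by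
  induction k with
  | zero => intro y; simp only [stay]; split_ifs <;> norm_num
  | succ k ih => intro y; simp only [stay]; split_ifs
                 · exact le_rfl
                 · exact integral_nonneg ih

lemma stay_le_one (k : ℕ) : ∀ y, stay R q k y ≤ 1 := by
  induction k with
  | zero => intro y; simp only [stay]; split_ifs <;> norm_num
  | succ k ih =>
    intro y; simp only [stay]; split_ifs
    · norm_num
    · calc _ ≤ ∫ j, (1 : ℝ) ∂(q y).toMeasure := integral_mono (integrable_bdd (C := 1) _ fun j => by
            rw [abs_of_nonneg (stay_nonneg k j)]; exact ih j) (integrable_const _) ih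
        _ = 1 := by simp

lemma stay_abs_le (k y : ℕ) : |stay R q k y| ≤ 1 := by
  rw [abs_of_nonneg (stay_nonneg k y)]; exact stay_le_one k y

lemma stay_integrable (k i : ℕ) : Integrable (stay R q k) (q i).toMeasure :=
  integrable_bdd _ (stay_abs_le k)

lemma stay_antitone (k : ℕ) : ∀ y, stay R q (k + 1) y ≤ stay R q k y := by
  induction k with
  | zero =>
    intro y
    by_cases hy : y < R
    · simp [stay, hy]
    · have := stay_le_one (R := R) (q := q) 1 y
      simpa [stay, hy] using this
  | succ k ih =>
    intro y
    by_cases hy : y < R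
    · simp [stay, hy]
    · rw [stay, stay]
      simp only [hy, if_false]
      exact integral_mono (stay_integrable (R := R) (q := q) (k + 1) y)
        (stay_integrable (R := R) (q := q) k y) ih

lemma stay_of_lt (k : ℕ) {y : ℕ} (hy : y < R) : stay R q k y = 0 := by
  cases k <;> simp [stay, hy]

lemma exists_stay_lt_one (h : IsBoundaryChain R q s) (y : ℕ) : ∃ k, stay R q k y < 1 := by
  induction h.irred y 0 using Relation.ReflTransGen.head_induction_on with
  | refl => exact ⟨0, by simp [stay, h.pos]⟩
  | @head a c hac _ ih =>
    obtain ⟨k, hk⟩ := ih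
    refine ⟨k + 1, ?_⟩
    by_cases ha : a < R
    · simp [stay, ha]
    · refine lt_of_le_of_ne (stay_le_one _ _) fun h1 => ?_
      simp only [stay, ha, if_false] at h1
      have := pmf_eq_zero_of_integral_nonpos (p := q a) (f := fun j => 1 - stay R q k j)
        ((integrable_const _).sub (stay_integrable _ _))
        (fun j _ => by have := stay_le_one (R := R) (q := q) k j; linarith)
        (by rw [integral_sub (integrable_const _) (stay_integrable _ _), h1]; simp) hac
      linarith

lemma exists_uniform_stay (h : IsBoundaryChain R q s) (M : ℕ) :
    ∃ m : ℕ, ∃ δ > 0, ∀ y ≤ M, stay R q m y ≤ 1 - δ := by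
  induction M with
  | zero => exact ⟨0, 1, one_pos, fun y hy => by simp [stay, show y < R by have := h.pos; omega]⟩
  | succ M ih =>
    obtain ⟨m, δ, hδ, hm⟩ := ih
    obtain ⟨k, hk⟩ := h.exists_stay_lt_one (M + 1)
    have hanti : ∀ y, Antitone fun k => stay R q k y := fun y =>
      antitone_nat_of_succ_le fun k => stay_antitone k y
    refine ⟨max m k, min δ (1 - stay R q k (M + 1)), lt_min hδ (by linarith), fun y hy => ?_⟩
    rcases Nat.lt_or_ge M y with h1 | h1
    · obtain rfl : y = M + 1 := by omega
      have := hanti (M + 1) (le_max_right m k)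
      simp only at this
      linarith [min_le_right δ (1 - stay R q k (M + 1))]
    · have := hanti y (le_max_left m k)
      simp only at this
      linarith [min_le_left δ (1 - stay R q k (M + 1)), hm y h1]

/-- A bounded superharmonic function off `{0, …, R - 1}`, strictly so below height `M`. -/
lemma exists_strict_super (h : IsBoundaryChain R q s) (M : ℕ) : ∃ l : ℕ → ℝ, ∃ C δ : ℝ,
    0 < C ∧ 0 < δ ∧ (∀ y, |l y| ≤ C) ∧ (∀ y < R, l y = 0) ∧
    (∀ y, R ≤ y → ∫ j, l j ∂(q y).toMeasure ≤ l y) ∧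
    (∀ y, R ≤ y → y ≤ M → ∫ j, l j ∂(q y).toMeasure ≤ l y - δ) := by
  obtain ⟨m, δ, hδ, hm⟩ := h.exists_uniform_stay M
  -- The sum of survival probabilities is the expected lifetime truncated at `m`. One step shifts
  -- the index, so the sum loses exactly the probability of exit within `m` steps.
  have hstep : ∀ y, R ≤ y → ∫ j, ∑ k ∈ Finset.range m, stay R q k j ∂(q y).toMeasure
      = ∑ k ∈ Finset.range m, stay R q k y - (1 - stay R q m y) := by
    intro y hy
    rw [integral_finsetSum _ fun k _ => stay_integrable (R := R) (q := q) k y]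
    have e1 : ∀ k, ∫ j, stay R q k j ∂(q y).toMeasure = stay R q (k + 1) y := fun k => by
      conv_rhs => rw [stay]
      simp [show ¬ y < R by omega]
    simp_rw [e1]
    have e2 := Finset.sum_range_succ' (fun k => stay R q k y) m
    have e3 := Finset.sum_range_succ (fun k => stay R q k y) m
    have e4 : stay R q 0 y = 1 := by simp [stay, show ¬ y < R by omega]
    rw [e4] at e2
    linarith
  refine ⟨fun y => ∑ k ∈ Finset.range m, stay R q k y, m + 1, δ, by positivity, hδ, fun y => ?_,
    fun y hy => Finset.sum_eq_zero fun k _ => stay_of_lt k hy, fun y hy => ?_, fun y hy hyM => ?_⟩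
  · refine (Finset.abs_sum_le_sum_abs _ _).trans ?_
    calc _ ≤ ∑ k ∈ Finset.range m, (1 : ℝ) := Finset.sum_le_sum fun k _ => stay_abs_le k y
      _ ≤ _ := by simp
  · rw [hstep y hy]; linarith [stay_le_one (R := R) (q := q) m y]
  · rw [hstep y hy]; linarith [hm y hyM]

/-- A bounded corrector: it turns a boundary drift of negative average into a negative one, is
superharmonic elsewhere, strictly so near the boundary, and has small weighted oscillation away from
the boundary. -/
theorem exists_corrector (h : IsBoundaryChain R q s) {π : ℕ → ℝ≥0}
    (hπ : IsNormalizedInvariant R (fun i j => q i j) π) {t : Fin R → ℝ}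
    (ht : ∑ i : Fin R, (π i : ℝ) * t i < 0) {α : Type*} [MeasurableSpace α] [Countable α]
    [MeasurableSingletonClass α] (m : PMF α) {w : α → ℝ} (hw : ∀ a, 0 ≤ w a)
    (hwi : Integrable w m.toMeasure) (d : α → ℤ) (hd : ∀ a, m a ≠ 0 → s (d a) ≠ 0)
    {ε : ℝ} (hε : 0 < ε) :
    ∃ K : ℕ → ℝ, ∃ C δ : ℝ, ∃ M : ℕ, 0 < δ ∧ (∀ y, |K y| ≤ C) ∧
      (∀ i : Fin R, t i + (∫ j, K j ∂(q i).toMeasure - K i) ≤ -δ) ∧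
      (∀ y, R ≤ y → ∫ j, K j ∂(q y).toMeasure ≤ K y) ∧
      (∀ y, R ≤ y → y ≤ M → ∫ j, K j ∂(q y).toMeasure ≤ K y - δ) ∧
      (∀ y : ℕ, M < y → ∫ a, w a * |K (y + d a).toNat - K y| ∂m.toMeasure ≤ ε) := by
  obtain ⟨ρ, -, hρ1, -, hρ⟩ := h.exists_stationary
  have hsum1 : ∑ i : Fin R, (π i : ℝ) = 1 := by
    have := hπ.normalized
    rw [Finset.sum_range] at this
    exact_mod_cast this
  set β := ∑ i : Fin R, (π i : ℝ) * t i with hβ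
  have hπρ : ∀ i : Fin R, ρ i = π i := by
    classical
    intro i
    obtain ⟨u, hu⟩ := hρ (fun j => (Pi.single i 1 : Fin R → ℝ) j - ρ i) (by
      simp only [mul_sub, Finset.sum_sub_distrib, ← Finset.sum_mul, hρ1]
      simp [Pi.single_apply])
    have h1 := h.sum_gen_of_invariant hπ.invariant u
    rw [hu] at h1
    simp only [mul_sub, Finset.sum_sub_distrib, ← Finset.sum_mul, hsum1] at h1
    simp [Pi.single_apply] at h1
    linarith
  -- The Poisson solution replaces every `t i` by the common average β.
  obtain ⟨u, hu⟩ := hρ (fun i => β - t i) (by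
    simp only [hπρ, mul_sub, Finset.sum_sub_distrib, ← Finset.sum_mul, hsum1]
    simp [hβ])
  set k := harm q u with hk
  obtain ⟨C, hC⟩ := harm_bdd (q := q) u
  have hC0 : 0 ≤ C := (abs_nonneg _).trans (hC 0)
  -- oscillation of the harmonic part
  have hKZ : ∀ y : ℤ, (R : ℤ) ≤ y → ∫ j, k (y + j).toNat ∂s.toMeasure = k y.toNat := by
    intro y hy
    have hy' : R ≤ y.toNat := by omega
    rw [← h.integral_shift hy' (fun j => k (y + j).toNat), hk, ← harm_harmonic u hy']
    congr 1
    ext j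
    congr 1
    omega
  -- The differences vanish at infinity for each possible step by `tendsto_diff_zero`; the
  -- integrable weight `w` dominates.
  have hosc : Filter.Tendsto (fun y : ℕ => ∫ a, w a * |k (y + d a).toNat - k y| ∂m.toMeasure)
      Filter.atTop (nhds 0) := by
    have := tendsto_integral_filter_of_dominated_convergence (μ := m.toMeasure)
      (l := (Filter.atTop : Filter ℕ)) (F := fun y a => w a * |k (y + d a).toNat - k y|)
      (f := fun _ => (0 : ℝ)) (fun a => w a * (C + C))
      (Filter.Eventually.of_forall fun y => aesm _ _)
      (Filter.Eventually.of_forall fun y => Filter.Eventually.of_forall fun a => by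
        rw [Real.norm_eq_abs, abs_mul, abs_of_nonneg (hw a), abs_abs]
        exact mul_le_mul_of_nonneg_left
          ((abs_sub _ _).trans (add_le_add (hC _) (hC _))) (hw a))
      (hwi.mul_const _)
      (pmf_ae_iff.2 fun a ha => by
        have h1 := tendsto_diff_zero s (fun j hj => h.support_ge hj) (K := fun y => k y.toNat)
          (fun y => hC _) hKZ (hd a ha)
        have h2 := (h1.comp (tendsto_natCast_atTop_atTop (R := ℤ))).abs.const_mul (w a)
        simpa using h2)
    simpa using this
  -- The height `M` depends only on the harmonic part `k` and is fixed before `l`, which must be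
  -- strict up to `M`.
  obtain ⟨M, hM⟩ := Filter.eventually_atTop.1 (hosc.eventually_lt_const (half_pos hε))
  obtain ⟨l, Cl, δ, hCl, hδ, hlC, hl0, hl1, hl2⟩ := h.exists_strict_super M
  set W := ∫ a, w a ∂m.toMeasure with hW
  have hW0 : 0 ≤ W := integral_nonneg hw
  -- The multiple of `l` must cost no more than half of the negative average at the boundary and
  -- half of the permitted oscillation beyond `M`.
  set κ := min (-β / (2 * Cl)) (ε / (4 * Cl * (W + 1))) with hκ
  have hκ0 : 0 < κ := lt_min (by have : 0 < -β := by linarith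
                                 positivity) (by positivity)
  have hκ1 : κ * Cl ≤ -β / 2 := by
    calc κ * Cl ≤ -β / (2 * Cl) * Cl := by gcongr; exact min_le_left _ _
      _ = _ := by field_simp
  have hκ2 : κ * (2 * Cl) * W ≤ ε / 2 := by
    calc κ * (2 * Cl) * W ≤ ε / (4 * Cl * (W + 1)) * (2 * Cl) * (W + 1) := by
          gcongr
          · exact min_le_right _ _
          · linarith
      _ = _ := by field_simp; ring
  have hki : ∀ y, Integrable k (q y).toMeasure := harm_integrable u
  have hli : ∀ y, Integrable (fun j => κ * l j) (q y).toMeasure := fun y =>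
    (integrable_bdd _ hlC).const_mul κ
  have hintg : ∀ y, ∫ j, (k j + κ * l j) ∂(q y).toMeasure
      = ∫ j, k j ∂(q y).toMeasure + κ * ∫ j, l j ∂(q y).toMeasure := fun y => by
    rw [integral_add (hki y) (hli y), integral_const_mul]
  refine ⟨fun y => k y + κ * l y, C + κ * Cl, min (-β / 2) (κ * δ), M,
    lt_min (by linarith) (by positivity), fun y => ?_, fun i => ?_, fun y hy => ?_,
    fun y hy hyM => ?_, fun y hy => ?_⟩
  · refine (abs_add_le _ _).trans (add_le_add (hC y) ?_)
    rw [abs_mul, abs_of_pos hκ0]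
    gcongr
    exact hlC y
  · change t i + (∫ j, (k j + κ * l j) ∂(q i).toMeasure - (k i + κ * l i)) ≤ _
    rw [hintg, hl0 i i.2]
    have e1 := congrFun hu i
    rw [gen_apply] at e1
    have e2 := harm_apply (q := q) u i
    have e3 : ∫ j, l j ∂(q i).toMeasure ≤ Cl := by
      calc _ ≤ ∫ j, Cl ∂(q i).toMeasure := integral_mono (integrable_bdd _ hlC) (integrable_const _)
            fun j => (abs_le.1 (hlC j)).2
        _ = Cl := by simp
    have e4 := mul_le_mul_of_nonneg_left e3 hκ0.le
    have := min_le_left (-β / 2) (κ * δ)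
    rw [hk, e2]
    linarith
  · rw [hintg, hk, harm_harmonic u hy]
    have := mul_le_mul_of_nonneg_left (hl1 y hy) hκ0.le
    linarith
  · rw [hintg, hk, harm_harmonic u hy]
    have := mul_le_mul_of_nonneg_left (hl2 y hy hyM) hκ0.le
    have := min_le_right (-β / 2) (κ * δ)
    rw [mul_sub] at *
    linarith
  · have hkI : Integrable (fun a => w a * |k (y + d a).toNat - k y|) m.toMeasure := by
      refine (hwi.mul_const (C + C)).mono' (aesm _ _) (Filter.Eventually.of_forall fun a => ?_)
      rw [Real.norm_eq_abs, abs_mul, abs_of_nonneg (hw a), abs_abs]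
      exact mul_le_mul_of_nonneg_left ((abs_sub _ _).trans (add_le_add (hC _) (hC _))) (hw a)
    have hlI : Integrable (fun a => w a * (κ * (2 * Cl))) m.toMeasure := hwi.mul_const _
    have hpt : ∀ a, w a * |k (y + d a).toNat + κ * l (y + d a).toNat - (k y + κ * l y)|
        ≤ w a * |k (y + d a).toNat - k y| + w a * (κ * (2 * Cl)) := by
      intro a
      rw [← mul_add]
      refine mul_le_mul_of_nonneg_left ?_ (hw a)
      have e1 : |κ * (l (y + d a).toNat - l y)| ≤ κ * (2 * Cl) := by
        rw [abs_mul, abs_of_pos hκ0]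
        gcongr
        have := (abs_sub (l (y + d a).toNat) (l y)).trans (add_le_add (hlC _) (hlC _))
        linarith
      have e2 : k (y + d a).toNat + κ * l (y + d a).toNat - (k y + κ * l y)
        = (k (y + d a).toNat - k y) + κ * (l (y + d a).toNat - l y) := by ring
      rw [e2]
      exact (abs_add_le _ _).trans (add_le_add_right e1 _)
    have hLI : Integrable (fun a => w a *
        |k (y + d a).toNat + κ * l (y + d a).toNat - (k y + κ * l y)|) m.toMeasure :=
      (hkI.add hlI).mono' (aesm _ _) (Filter.Eventually.of_forall fun a => by
        rw [Real.norm_eq_abs, abs_mul, abs_of_nonneg (hw a), abs_abs]; exact hpt a)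
    refine (integral_mono hLI (hkI.add hlI) hpt).trans ?_
    have e5 : ∫ a, ((fun a => w a * |k (y + d a).toNat - k y|) + fun a => w a * (κ * (2 * Cl))) a
        ∂m.toMeasure = ∫ a, w a * |k (y + d a).toNat - k y| ∂m.toMeasure + W * (κ * (2 * Cl)) := by
      rw [integral_add' hkI hlI, integral_mul_const]
    have := hM y hy.le
    rw [e5]
    linarith

end IsBoundaryChain

/-! ### Survival probabilities -/

lemma lt_passageTime_iff {Ω : Type*} {Z : ℕ → Ω → ℕ × ℕ} {B : Set (ℕ × ℕ)} {n : ℕ} {ω : Ω} :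
    (n : ℕ∞) < passageTime Z B ω ↔ ∀ i ≤ n, Z i ω ∉ B := by
  constructor
  · intro h i hi hB
    have : passageTime Z B ω ≤ i := sInf_le ⟨i, rfl, hB⟩
    have h2 := h.trans_le this
    have : n < i := by exact_mod_cast h2
    omega
  · intro h
    have h1 : ((n + 1 : ℕ) : ℕ∞) ≤ passageTime Z B ω := by
      refine le_sInf ?_
      rintro t ⟨i, rfl, hi⟩
      have : n + 1 ≤ i := by
        by_contra hc
        exact h i (by omega) hi
      exact_mod_cast this
    refine lt_of_lt_of_le ?_ h1
    exact_mod_cast Nat.lt_succ_self n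

/-- The chain killed on entering `B`, acting on functions. -/
def killed (p : ℕ × ℕ → PMF (ℕ × ℕ)) (B : Set (ℕ × ℕ)) (f : ℕ × ℕ → ℝ≥0∞) (z : ℕ × ℕ) : ℝ≥0∞ :=
  ∑' w, p z w * Bᶜ.indicator f w

/-! ### The killed kernel -/

section Killed

variable {p : ℕ × ℕ → PMF (ℕ × ℕ)} {B : Set (ℕ × ℕ)}

lemma killed_mono {f g : ℕ × ℕ → ℝ≥0∞} (h : ∀ z ∉ B, f z ≤ g z) (z : ℕ × ℕ) :
    killed p B f z ≤ killed p B g z := by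
  unfold killed
  refine ENNReal.tsum_le_tsum fun w => ?_
  by_cases hw : w ∈ B
  · simp [hw]
  · rw [Set.indicator_of_mem (by exact hw), Set.indicator_of_mem (by exact hw)]
    gcongr
    exact h w hw

lemma killed_add (f g : ℕ × ℕ → ℝ≥0∞) :
    killed p B (fun z => f z + g z) = fun z => killed p B f z + killed p B g z := by
  ext z
  unfold killed
  rw [← ENNReal.tsum_add]
  refine tsum_congr fun w => ?_
  rw [← mul_add]
  congr 1
  by_cases hw : w ∈ B <;> simp [hw]

lemma killed_const_mul (c : ℝ≥0∞) (f : ℕ × ℕ → ℝ≥0∞) :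
    killed p B (fun z => c * f z) = fun z => c * killed p B f z := by
  ext z
  unfold killed
  rw [← ENNReal.tsum_mul_left]
  refine tsum_congr fun w => ?_
  by_cases hw : w ∈ B
  · simp [hw]
  · simp [hw]; ring

lemma killed_iterate_mono {f g : ℕ × ℕ → ℝ≥0∞} (h : ∀ z ∉ B, f z ≤ g z) (n : ℕ) :
    ∀ z ∉ B, (killed p B)^[n] f z ≤ (killed p B)^[n] g z := by
  induction n with
  | zero => simpa using h
  | succ n ih =>
    intro z _
    rw [Function.iterate_succ_apply', Function.iterate_succ_apply']
    exact killed_mono ih z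

lemma killed_iterate_add (f g : ℕ × ℕ → ℝ≥0∞) (n : ℕ) :
    (killed p B)^[n] (fun z => f z + g z)
      = fun z => (killed p B)^[n] f z + (killed p B)^[n] g z := by
  induction n with
  | zero => rfl
  | succ n ih => simp only [Function.iterate_succ_apply', ih, killed_add]

lemma killed_iterate_const_mul (c : ℝ≥0∞) (f : ℕ × ℕ → ℝ≥0∞) (n : ℕ) :
    (killed p B)^[n] (fun z => c * f z) = fun z => c * (killed p B)^[n] f z := by
  induction n with
  | zero => rfl
  | succ n ih => simp only [Function.iterate_succ_apply', ih, killed_const_mul]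

lemma killed_eq_lintegral (f : ℕ × ℕ → ℝ≥0∞) (z : ℕ × ℕ) :
    killed p B f z = ∫⁻ w in Bᶜ, f w ∂(p z).toMeasure := by
  rw [← lintegral_indicator (Set.to_countable _).measurableSet, pmf_lintegral]
  rfl

lemma killed_le_full (f : ℕ × ℕ → ℝ≥0∞) (z : ℕ × ℕ) : killed p B f z ≤ ∑' w, p z w * f w := by
  unfold killed
  gcongr with w
  exact Set.indicator_le_self _ _ _

lemma killed_one_le (z : ℕ × ℕ) : killed p B (fun _ => 1) z ≤ 1 := by
  refine (killed_le_full _ _).trans ?_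
  simp [PMF.tsum_coe]

lemma killed_iterate_one_le (n : ℕ) : ∀ z ∉ B, (killed p B)^[n] (fun _ => 1) z ≤ 1 := by
  induction n with
  | zero => intro z _; exact le_rfl
  | succ n ih =>
    intro z _
    rw [Function.iterate_succ_apply']
    exact (killed_mono ih z).trans (killed_one_le z)

lemma killed_iterate_one_antitone (z : ℕ × ℕ) (hz : z ∉ B) :
    Antitone fun n => (killed p B)^[n] (fun _ => 1) z := by
  refine antitone_nat_of_succ_le fun n => ?_
  rw [Function.iterate_succ_apply]
  exact killed_iterate_mono (fun w _ => killed_one_le w) n z hz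

lemma killed_holder {θ : ℝ} (h0 : 0 ≤ θ) (h1 : θ ≤ 1) (f g : ℕ × ℕ → ℝ≥0∞) (z : ℕ × ℕ) :
    killed p B (fun w => f w ^ θ * g w ^ (1 - θ)) z
      ≤ killed p B f z ^ θ * killed p B g z ^ (1 - θ) := by
  simp only [killed_eq_lintegral]
  exact ENNReal.lintegral_mul_norm_pow_le (measurable_of_countable _).aemeasurable
    (measurable_of_countable _).aemeasurable h0 (by linarith) (by ring)

lemma killed_iterate_holder {θ : ℝ} (h0 : 0 ≤ θ) (h1 : θ ≤ 1) (f g : ℕ × ℕ → ℝ≥0∞) (n : ℕ) :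
    ∀ z ∉ B, (killed p B)^[n] (fun w => f w ^ θ * g w ^ (1 - θ)) z
      ≤ (killed p B)^[n] f z ^ θ * (killed p B)^[n] g z ^ (1 - θ) := by
  induction n with
  | zero => intro z _; exact le_rfl
  | succ n ih =>
    intro z _
    simp only [Function.iterate_succ_apply']
    exact (killed_mono ih z).trans (killed_holder h0 h1 _ _ z)

end Killed

/-! ### Laws of finite paths -/

section Paths

variable {Ω : Type*} [MeasurableSpace Ω] {p : ℕ × ℕ → PMF (ℕ × ℕ)} {P : ℕ × ℕ → Measure Ω}
  {Z : ℕ → Ω → ℕ × ℕ}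

/-- The first `n + 1` positions. -/
def history (Z : ℕ → Ω → ℕ × ℕ) (n : ℕ) (ω : Ω) : Fin (n + 1) → ℕ × ℕ := fun i => Z i ω

lemma measurable_history (hZ : IsMarkovChain p P Z) (n : ℕ) : Measurable (history Z n) :=
  measurable_pi_lambda _ fun i => hZ.measurable i

open Classical in
/-- The probability of a finite path. -/
def pathWeight (p : ℕ × ℕ → PMF (ℕ × ℕ)) {n : ℕ} (z : ℕ × ℕ) (h : Fin (n + 1) → ℕ × ℕ) : ℝ≥0∞ :=
  if h 0 = z then ∏ i : Fin n, p (h i.castSucc) (h i.succ) else 0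

lemma history_law (hZ : IsMarkovChain p P Z) (n : ℕ) (z : ℕ × ℕ) (h : Fin (n + 1) → ℕ × ℕ) :
    (P z).map (history Z n) {h} = pathWeight p z h := by
  classical
  rw [Measure.map_apply (measurable_history hZ n) (measurableSet_singleton _)]
  have := hZ.law z n (fun i => if hi : i < n + 1 then h ⟨i, hi⟩ else z)
  have e1 : {ω | ∀ i ≤ n, Z i ω = if hi : i < n + 1 then h ⟨i, hi⟩ else z}
      = history Z n ⁻¹' {h} := by
    ext ω
    simp only [Set.mem_ofPred_eq, Set.mem_preimage, Set.mem_singleton_iff]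
    constructor
    · intro hω
      funext i
      have := hω i (by omega)
      rw [dif_pos i.2] at this
      exact this
    · intro hω i hi
      have := congrFun hω ⟨i, by omega⟩
      rw [dif_pos (by omega : i < n + 1)]
      exact this
  rw [e1] at this
  rw [this, pathWeight]
  simp only [Nat.zero_lt_succ, dif_pos]
  congr 1
  rw [Finset.prod_range]
  refine Finset.prod_congr rfl fun i _ => ?_
  rw [dif_pos (by omega : (i : ℕ) < n + 1), dif_pos (by omega : (i : ℕ) + 1 < n + 1)]
  rfl

-- Splitting off the first position and step of a path matches one application of the killed kernel.
open Classical in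
lemma tsum_pathWeight (B : Set (ℕ × ℕ)) (n : ℕ) : ∀ z,
    ∑' h : Fin (n + 1) → ℕ × ℕ, (if ∀ i, h i ∉ B then pathWeight p z h else 0)
      = if z ∈ B then 0 else (killed p B)^[n] (fun _ => 1) z := by
  induction n with
  | zero =>
    intro z
    rw [tsum_eq_single (fun _ => z)]
    · by_cases hz : z ∈ B <;> simp [pathWeight, hz]
    · intro h hh
      have : h 0 ≠ z := fun e => hh (funext fun i => by rw [show i = 0 from Fin.fin_one_eq_zero i, e])
      simp [pathWeight, this]
  | succ n ih =>
    intro z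
    rw [← (Fin.consEquiv fun _ : Fin (n + 2) => ℕ × ℕ).tsum_eq, ENNReal.tsum_prod']
    have e1 : ∀ (a : ℕ × ℕ) (h : Fin (n + 1) → ℕ × ℕ),
        (if ∀ i, (Fin.consEquiv fun _ : Fin (n + 2) => ℕ × ℕ) (a, h) i ∉ B
          then pathWeight p z ((Fin.consEquiv fun _ : Fin (n + 2) => ℕ × ℕ) (a, h)) else 0)
        = if a = z then (if z ∈ B then 0 else p z (h 0) *
            (if ∀ i, h i ∉ B then pathWeight p (h 0) h else 0)) else 0 := by
      intro a h
      simp only [Fin.consEquiv, Equiv.coe_fn_mk, Fin.forall_fin_succ (n := n + 1), Fin.cons_zero,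
        Fin.cons_succ]
      by_cases ha : a = z
      · subst ha
        by_cases hB : a ∈ B
        · simp [hB]
        · by_cases hh : ∀ i, h i ∉ B
          · simp only [hB, not_false_eq_true, true_and, hh, implies_true, if_true, if_false,
              pathWeight, Fin.cons_zero]
            rw [Fin.prod_univ_succ]
            rfl
          · simp [hB, hh]
      · simp [ha, pathWeight]
    simp_rw [e1]
    rw [tsum_eq_single z (fun a ha => by simp [ha])]
    simp only [if_true]
    by_cases hz : z ∈ B
    · simp [hz]
    · simp only [hz, if_false]
      have e2 : ∀ h : Fin (n + 1) → ℕ × ℕ,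
          p z (h 0) * (if ∀ i, h i ∉ B then pathWeight p (h 0) h else 0)
          = ∑' w, p z w * (if ∀ i, h i ∉ B then pathWeight p w h else 0) := by
        intro h
        rw [tsum_eq_single (h 0)]
        intro w hw
        simp [pathWeight, hw.symm]
      simp_rw [e2]
      rw [ENNReal.tsum_comm, Function.iterate_succ_apply']
      simp only [ENNReal.tsum_mul_left, ih, killed]
      refine tsum_congr fun w => ?_
      by_cases hw : w ∈ B <;> simp [hw]

open Classical in
lemma prob_lt_passageTime_eq_ite (hZ : IsMarkovChain p P Z) (B : Set (ℕ × ℕ)) (n : ℕ) (z : ℕ × ℕ) :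
    P z {ω | (n : ℕ∞) < passageTime Z B ω}
      = if z ∈ B then 0 else (killed p B)^[n] (fun _ => 1) z := by
  rw [← tsum_pathWeight (p := p) B n z]
  have hS : MeasurableSet {h : Fin (n + 1) → ℕ × ℕ | ∀ i, h i ∉ B} :=
    (Set.to_countable _).measurableSet
  have e : {ω | (n : ℕ∞) < passageTime Z B ω}
      = history Z n ⁻¹' {h : Fin (n + 1) → ℕ × ℕ | ∀ i, h i ∉ B} := by
    ext ω
    simp only [Set.mem_ofPred_eq, Set.mem_preimage, lt_passageTime_iff, history]
    exact ⟨fun h i => h i (by omega), fun h i hi => h ⟨i, by omega⟩⟩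
  rw [e, ← Measure.map_apply (measurable_history hZ n) hS,
    ← Measure.tsum_indicator_apply_singleton _ _ hS]
  refine tsum_congr fun h => ?_
  simp only [Set.indicator, Set.mem_ofPred_eq, history_law hZ]

/-- The survival probability is given by the killed chain. -/
theorem prob_lt_passageTime (hZ : IsMarkovChain p P Z) (B : Set (ℕ × ℕ)) (n : ℕ) {z : ℕ × ℕ}
    (hz : z ∉ B) :
    P z {ω | (n : ℕ∞) < passageTime Z B ω} = (killed p B)^[n] (fun _ => 1) z := by
  rw [prob_lt_passageTime_eq_ite hZ, if_neg hz]

lemma prob_lt_passageTime_of_mem {B : Set (ℕ × ℕ)} (hZ : IsMarkovChain p P Z) (n : ℕ) {z : ℕ × ℕ}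
    (hz : z ∈ B) : P z {ω | (n : ℕ∞) < passageTime Z B ω} = 0 := by
  rw [prob_lt_passageTime_eq_ite hZ, if_pos hz]

/-- One step of positive probability that stays off `S`. -/
def StepOff (p : ℕ × ℕ → PMF (ℕ × ℕ)) (S : Set (ℕ × ℕ)) (a b : ℕ × ℕ) : Prop :=
  p a b ≠ 0 ∧ a ∉ S ∧ b ∉ S

/-- There are countably many histories, so an event of positive probability contains one of positive
weight; every factor of that weight is a possible step. -/
lemma exists_path_of_pos (hZ : IsMarkovChain p P Z) {S : Set (ℕ × ℕ)} {n : ℕ} {z w : ℕ × ℕ}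
    (h : 0 < P z {ω | Z n ω = w ∧ (n : ℕ∞) < passageTime Z S ω}) :
    Relation.ReflTransGen (StepOff p S) z w := by
  set T : Set (Fin (n + 1) → ℕ × ℕ) := {h | h (Fin.last n) = w ∧ ∀ i, h i ∉ S} with hT
  have hTm : MeasurableSet T := (Set.to_countable _).measurableSet
  have e : {ω | Z n ω = w ∧ (n : ℕ∞) < passageTime Z S ω} = history Z n ⁻¹' T := by
    ext ω
    simp only [hT, Set.mem_ofPred_eq, Set.mem_preimage, lt_passageTime_iff, history, Fin.val_last]
    exact and_congr_right fun _ => ⟨fun h i => h i (by omega), fun h i hi => h ⟨i, by omega⟩⟩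
  rw [e, ← Measure.map_apply (measurable_history hZ n) hTm,
    ← Measure.tsum_indicator_apply_singleton _ _ hTm] at h
  have : ∃ x, T.indicator (fun x => (P z).map (history Z n) {x}) x ≠ 0 := by
    by_contra hc
    push Not at hc
    rw [ENNReal.tsum_eq_zero.2 hc] at h
    exact lt_irrefl _ h
  obtain ⟨x, hx⟩ := this
  have hxT : x ∈ T := Set.mem_of_indicator_ne_zero hx
  rw [Set.indicator_of_mem hxT, history_law hZ, pathWeight] at hx
  have hx0 : x 0 = z := by
    by_contra hc
    rw [if_neg hc] at hx
    exact hx rfl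
  rw [if_pos hx0, Finset.prod_ne_zero_iff] at hx
  have key : ∀ i : Fin (n + 1), Relation.ReflTransGen (StepOff p S) z (x i) := by
    intro i
    induction i using Fin.induction with
    | zero => rw [hx0]
    | succ i ih =>
      exact ih.tail ⟨hx i (Finset.mem_univ i), hxT.2 _, hxT.2 _⟩
  have := key (Fin.last n)
  rwa [hxT.1] at this

end Paths

/-! ### Lyapunov function criteria for the killed chain -/

/-- A nonnegative sequence with `u (n + 1) ≤ u n - c (u n) ^ (1 + β)` decays like `n ^ (-1 / β)`. -/
lemma mul_rpow_le_one_of_decay {u : ℕ → ℝ} {c β : ℝ} (hu : ∀ n, 0 ≤ u n) (hc : 0 ≤ c) (hβ : 0 < β)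
    (h : ∀ n, u (n + 1) + c * u n ^ (1 + β) ≤ u n) (n : ℕ) : β * c * n * u n ^ β ≤ 1 := by
  induction n with
  | zero => simp
  | succ n ih =>
    rcases (hu n).eq_or_lt with h0 | h0
    · have h1 := h n
      rw [← h0, Real.zero_rpow (by linarith)] at h1
      have : u (n + 1) = 0 := le_antisymm (by linarith) (hu _)
      rw [this, Real.zero_rpow hβ.ne']
      simp
    · set x := c * u n ^ β with hx
      have hx0 : 0 ≤ x := by positivity
      have h1 := h n
      rw [Real.rpow_add h0, Real.rpow_one] at h1
      have h2 : u (n + 1) ≤ u n * (1 - x) := by rw [hx]; linarith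
      have hx1 : 0 ≤ 1 - x := by
        have : 0 ≤ u n * (1 - x) := (hu _).trans h2
        exact nonneg_of_mul_nonneg_right this h0
      have h3 : u (n + 1) ^ β ≤ u n ^ β * (1 - x) ^ β := by
        rw [← Real.mul_rpow h0.le hx1]
        exact Real.rpow_le_rpow (hu _) h2 hβ.le
      -- Both factors are compared with exponentials. This is the discrete counterpart of the fact
      -- that u^(-β) grows at least at rate βc under u' ≤ -c u^(1+β).
      have h4 : (1 - x) ^ β * (1 + β * x) ≤ 1 := by
        have e1 : (1 - x) ^ β ≤ Real.exp (-x) ^ β :=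
          Real.rpow_le_rpow hx1 (Real.one_sub_le_exp_neg x) hβ.le
        rw [← Real.exp_mul] at e1
        have e2 : 1 + β * x ≤ Real.exp (β * x) := by linarith [Real.add_one_le_exp (β * x)]
        calc (1 - x) ^ β * (1 + β * x) ≤ Real.exp (-x * β) * Real.exp (β * x) := by gcongr
          _ = 1 := by rw [← Real.exp_add]; simp [mul_comm]
      have h5 : β * c * (n + 1) * u n ^ β ≤ 1 + β * x := by
        rw [hx]; nlinarith
      push_cast
      calc β * c * (n + 1) * u (n + 1) ^ β
          ≤ β * c * (n + 1) * (u n ^ β * (1 - x) ^ β) := by gcongr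
        _ = (β * c * (n + 1) * u n ^ β) * (1 - x) ^ β := by ring
        _ ≤ (1 + β * x) * (1 - x) ^ β := by gcongr
        _ ≤ 1 := by linarith

section Lyapunov

variable {p : ℕ × ℕ → PMF (ℕ × ℕ)} {B : Set (ℕ × ℕ)}

/-- Optional stopping for a superharmonic function which is at least `1` on the target. -/
lemma one_le_survival_add {f : ℕ × ℕ → ℝ≥0∞} (hf : ∀ z ∉ B, ∑' w, p z w * f w ≤ f z)
    (hB : ∀ z ∈ B, 1 ≤ f z) (n : ℕ) : ∀ z ∉ B, 1 ≤ (killed p B)^[n] (fun _ => 1) z + f z := by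
  induction n with
  | zero => intro z _; simp
  | succ n ih =>
    intro z hz
    rw [Function.iterate_succ_apply']
    calc (1 : ℝ≥0∞) = ∑' w, p z w := (PMF.tsum_coe _).symm
      _ ≤ ∑' w, (p z w * Bᶜ.indicator ((killed p B)^[n] (fun _ => 1)) w + p z w * f w) := by
          refine ENNReal.tsum_le_tsum fun w => ?_
          rw [← mul_add]
          refine le_mul_of_one_le_right' ?_
          by_cases hw : w ∈ B
          · exact (hB w hw).trans le_add_self
          · rw [Set.indicator_of_mem (by exact hw)]
            exact ih w hw
      _ = killed p B ((killed p B)^[n] (fun _ => 1)) z + ∑' w, p z w * f w := ENNReal.tsum_add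
      _ ≤ _ := by gcongr; exact hf z hz

lemma killed_iterate_le {g : ℕ × ℕ → ℝ≥0∞} (hg : ∀ z ∉ B, killed p B g z ≤ g z) (n : ℕ) :
    ∀ z ∉ B, (killed p B)^[n] g z ≤ g z := by
  induction n with
  | zero => intro z _; exact le_rfl
  | succ n ih =>
    intro z hz
    rw [Function.iterate_succ_apply]
    exact (killed_iterate_mono hg n z hz).trans (ih z hz)

/-- Polynomial decay of the survival probability. -/
theorem survival_upper_bound {V : ℕ × ℕ → ℝ} (hV : ∀ z ∉ B, 0 < V z) {γ γ' c : ℝ} {C : ℝ≥0∞}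
    (hγ : γ < γ') (hc : 0 < c) (hC : C ≠ ⊤) {f g : ℕ × ℕ → ℝ≥0∞} (hft : ∀ z ∉ B, f z ≠ ⊤)
    (hgt : ∀ z ∉ B, g z ≠ ⊤)
    (hf : ∀ z ∉ B, killed p B f z + ENNReal.ofReal (c * V z ^ (γ - 2)) ≤ f z)
    (hf1 : ∀ z ∉ B, 1 ≤ C * f z) (hfC : ∀ z ∉ B, f z ≤ C * ENNReal.ofReal (V z ^ γ))
    (hg : ∀ z ∉ B, killed p B g z ≤ g z) (hgC : ∀ z ∉ B, ENNReal.ofReal (V z ^ γ') ≤ C * g z)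
    {z : ℕ × ℕ} (hz : z ∉ B) :
    ∃ D : ℝ, 0 ≤ D ∧ ∀ n : ℕ, 1 ≤ n →
      (killed p B)^[n] (fun _ => 1) z ≤ ENNReal.ofReal (D * (n : ℝ) ^ (-(γ' - γ) / 2)) := by
  set Q := killed p B with hQ
  set e : ℕ × ℕ → ℝ≥0∞ := fun w => ENNReal.ofReal (V w ^ (γ - 2)) with he
  set e' : ℕ × ℕ → ℝ≥0∞ := fun w => ENNReal.ofReal (V w ^ γ') with he'
  -- With θ = 1/(1 + β) one has γ = θ(γ - 2) + (1 - θ)γ': the order of `f` interpolates between that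
  -- of its drift and that of `g`.
  set β := 2 / (γ' - γ) with hβdef
  have hγ0 : 0 < γ' - γ := by linarith
  have hβ : 0 < β := by positivity
  set θ := (1 + β)⁻¹ with hθ
  have hθ0 : 0 < θ := by positivity
  have hθ1 : θ ≤ 1 := inv_le_one_of_one_le₀ (by linarith)
  have hfinf : ∀ n, ∀ w ∉ B, Q^[n] f w ≠ ⊤ := fun n w hw => ne_top_of_le_ne_top (hft w hw)
    (killed_iterate_le (fun v hv => le_self_add.trans (hf v hv)) n w hw)
  have hintg : ∀ w ∉ B, f w ≤ C * (e w ^ θ * e' w ^ (1 - θ)) := by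
    intro w hw
    refine (hfC w hw).trans (le_of_eq ?_)
    congr 1
    have hp := hV w hw
    rw [he, he', ENNReal.ofReal_rpow_of_pos (by positivity),
      ENNReal.ofReal_rpow_of_pos (by positivity), ← ENNReal.ofReal_mul (by positivity),
      ← Real.rpow_mul hp.le, ← Real.rpow_mul hp.le, ← Real.rpow_add hp]
    congr 2
    rw [hθ, hβdef]
    field_simp
    ring
  set A : ℝ≥0∞ := C * (C * g z) ^ (1 - θ) with hA
  have hCg : C * g z ≠ ⊤ := ENNReal.mul_ne_top hC (hgt z hz)
  have hA1 : A ≠ ⊤ := ENNReal.mul_ne_top hC (ENNReal.rpow_ne_top_of_nonneg (by linarith) hCg)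
  have hun : ∀ n, Q^[n] f z ≤ A * Q^[n] e z ^ θ := by
    intro n
    calc Q^[n] f z ≤ Q^[n] (fun w => C * (e w ^ θ * e' w ^ (1 - θ))) z :=
          killed_iterate_mono hintg n z hz
      _ = C * Q^[n] (fun w => e w ^ θ * e' w ^ (1 - θ)) z := by rw [hQ, killed_iterate_const_mul]
      _ ≤ C * (Q^[n] e z ^ θ * Q^[n] e' z ^ (1 - θ)) := by
          gcongr
          exact killed_iterate_holder hθ0.le hθ1 e e' n z hz
      _ ≤ C * (Q^[n] e z ^ θ * (C * g z) ^ (1 - θ)) := by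
          have : Q^[n] e' z ≤ C * g z := by
            refine (killed_iterate_mono hgC n z hz).trans ?_
            rw [killed_iterate_const_mul]
            exact mul_le_mul' le_rfl (killed_iterate_le hg n z hz)
          have h1 : Q^[n] e' z ^ (1 - θ) ≤ (C * g z) ^ (1 - θ) :=
            ENNReal.rpow_le_rpow this (by linarith)
          gcongr
      _ = A * Q^[n] e z ^ θ := by rw [hA]; ring
  have hstep : ∀ n, Q^[n + 1] f z + ENNReal.ofReal c * Q^[n] e z ≤ Q^[n] f z := by
    intro n
    have := killed_iterate_mono (p := p) hf n z hz
    rw [killed_iterate_add] at this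
    simp only [ENNReal.ofReal_mul hc.le, killed_iterate_const_mul] at this
    rw [Function.iterate_succ_apply]
    exact this
  set u : ℕ → ℝ := fun n => (Q^[n] f z).toReal with hu
  have het : ∀ n, Q^[n] e z ≠ ⊤ := by
    intro n
    have h1 : ENNReal.ofReal c * Q^[n] e z ≠ ⊤ :=
      ne_top_of_le_ne_top (hfinf n z hz) (le_add_self.trans (hstep n))
    intro h2
    rw [h2, ENNReal.mul_top (by simpa using hc)] at h1
    exact h1 rfl
  set a := A.toReal + 1 with ha
  have ha0 : 0 < a := by have : 0 ≤ A.toReal := ENNReal.toReal_nonneg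
                         linarith
  -- The interpolation inequality `hun`, with the moment of order γ' bounded through `g`, bounds the
  -- expected drift below by a power of the current mean.
  have hdec : ∀ n, u (n + 1) + c * a⁻¹ ^ (1 + β) * u n ^ (1 + β) ≤ u n := by
    intro n
    have h1 := ENNReal.toReal_mono (hfinf n z hz) (hstep n)
    rw [ENNReal.toReal_add (hfinf (n + 1) z hz)
      (ENNReal.mul_ne_top ENNReal.ofReal_ne_top (het n)), ENNReal.toReal_mul,
      ENNReal.toReal_ofReal hc.le] at h1
    have h2 := ENNReal.toReal_mono (ENNReal.mul_ne_top hA1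
      (ENNReal.rpow_ne_top_of_nonneg hθ0.le (het n))) (hun n)
    rw [ENNReal.toReal_mul, ← ENNReal.toReal_rpow] at h2
    set v := (Q^[n] e z).toReal with hv
    have hv0 : 0 ≤ v := ENNReal.toReal_nonneg
    have hu0 : 0 ≤ u n := ENNReal.toReal_nonneg
    have h3 : a⁻¹ * u n ≤ v ^ θ := by
      have : u n ≤ a * v ^ θ := h2.trans (by gcongr; linarith)
      rw [inv_mul_le_iff₀ ha0]; exact this
    have h4 : (a⁻¹ * u n) ^ (1 + β) ≤ v := by
      calc (a⁻¹ * u n) ^ (1 + β) ≤ (v ^ θ) ^ (1 + β) :=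
            Real.rpow_le_rpow (by positivity) h3 (by linarith)
        _ = v := by
          rw [← Real.rpow_mul hv0, hθ, inv_mul_cancel₀ (by linarith), Real.rpow_one]
    rw [Real.mul_rpow (by positivity) hu0] at h4
    have h5 := mul_le_mul_of_nonneg_left h4 hc.le
    calc u (n + 1) + c * a⁻¹ ^ (1 + β) * u n ^ (1 + β)
        = u (n + 1) + c * (a⁻¹ ^ (1 + β) * u n ^ (1 + β)) := by ring
      _ ≤ u (n + 1) + c * v := by linarith
      _ ≤ u n := h1
  have hkey := mul_rpow_le_one_of_decay (u := u) (fun n => ENNReal.toReal_nonneg)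
    (show 0 ≤ c * a⁻¹ ^ (1 + β) by positivity) hβ hdec
  set k := β * (c * a⁻¹ ^ (1 + β)) with hk
  have hk0 : 0 < k := by positivity
  refine ⟨C.toReal * k ^ (-β⁻¹), by positivity, fun n hn => ?_⟩
  have hn0 : (0 : ℝ) < n := by exact_mod_cast hn
  have hu0 : 0 ≤ u n := ENNReal.toReal_nonneg
  have h1 : u n ≤ (k * n) ^ (-β⁻¹) := by
    have h2 : u n ^ β ≤ (k * n)⁻¹ := by
      rw [← one_div, le_div_iff₀ (by positivity)]
      have := hkey n
      linarith
    calc u n = (u n ^ β) ^ β⁻¹ := by rw [← Real.rpow_mul hu0, mul_inv_cancel₀ hβ.ne', Real.rpow_one]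
      _ ≤ ((k * n)⁻¹) ^ β⁻¹ := Real.rpow_le_rpow (Real.rpow_nonneg hu0 _) h2 (by positivity)
      _ = _ := by rw [Real.inv_rpow (by positivity), Real.rpow_neg (by positivity)]
  have h2 : Q^[n] (fun _ => 1) z ≤ C * Q^[n] f z := by
    have := killed_iterate_mono (p := p) hf1 n z hz
    rwa [killed_iterate_const_mul] at this
  refine h2.trans ?_
  rw [← ENNReal.ofReal_toReal (ENNReal.mul_ne_top hC (hfinf n z hz)), ENNReal.toReal_mul]
  apply ENNReal.ofReal_le_ofReal
  calc C.toReal * u n ≤ C.toReal * (k * n) ^ (-β⁻¹) := by gcongr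
    _ = _ := by
      rw [Real.mul_rpow hk0.le hn0.le, mul_assoc, hβdef, inv_div]
      congr 3
      ring

/-- A function with a drift condition off a finite set has a bounded perturbation with the drift
condition everywhere, if the chain can be killed from the finite set. -/
theorem exists_drift_extension {B' : Set (ℕ × ℕ)} (hfin : (B' \ B).Finite)
    {f e : ℕ × ℕ → ℝ≥0∞} (hf : ∀ z ∉ B', z ∉ B → killed p B f z + e z ≤ f z)
    (hft : ∀ z ∈ B' \ B, killed p B f z ≠ ⊤) (het : ∀ z ∈ B' \ B, e z ≠ ⊤)
    (hkill : ∀ z ∈ B' \ B, ∃ m, (killed p B)^[m] (fun _ => 1) z < 1) :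
    ∃ (f' : ℕ × ℕ → ℝ≥0∞) (D : ℝ≥0∞), D ≠ ⊤ ∧ ∀ z ∉ B, f z ≤ f' z ∧ f' z ≤ f z + D ∧
      killed p B f' z + e z ≤ f' z := by
  set Q := killed p B with hQ
  choose! m hm using hkill
  set F := hfin.toFinset with hF
  set M := F.sup m with hM
  set s : ℕ × ℕ → ℝ≥0∞ := Q^[M] (fun _ => 1) with hs
  have hs1 : ∀ z ∈ B' \ B, s z < 1 := fun z hz =>
    (killed_iterate_one_antitone z hz.2 (Finset.le_sup (by simpa [hF] using hz))).trans_lt (hm z hz)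
  set L : ℝ≥0∞ := ∑ z ∈ F, (Q f z + e z) / (1 - s z) with hL
  have hLt : L ≠ ⊤ := by
    rw [hL, ENNReal.sum_ne_top]
    intro z hz
    have hz' : z ∈ B' \ B := by simpa [hF] using hz
    exact ENNReal.div_ne_top (ENNReal.add_ne_top.2 ⟨hft z hz', het z hz'⟩)
      (tsub_pos_iff_lt.2 (hs1 z hz')).ne'
  -- The truncated expected lifetime is bounded by `M` and drops in one step by the probability `1 -
  -- s` of being killed within `M` steps. This is positive on the finite exceptional set, so a large
  -- multiple of `g` pays for the missing drift there.
  set g : ℕ × ℕ → ℝ≥0∞ := fun z => ∑ k ∈ Finset.range M, Q^[k] (fun _ => 1) z with hg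
  have hQsum : ∀ N z, Q (fun z => ∑ k ∈ Finset.range N, Q^[k] (fun _ => 1) z) z + 1
      = (∑ k ∈ Finset.range N, Q^[k] (fun _ => 1) z) + Q^[N] (fun _ => 1) z := by
    intro N z
    induction N with
    | zero => simp [hQ, killed]
    | succ N ih =>
      simp only [Finset.sum_range_succ]
      rw [hQ, killed_add]
      simp only [← hQ]
      rw [← Function.iterate_succ_apply' Q N, add_right_comm, ih]
  have hQg : ∀ z ∉ B, Q g z + (1 - s z) = g z := by
    intro z hz
    have hle : s z ≤ 1 := killed_iterate_one_le M z hz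
    have h1 : Q g z + (1 - s z) + s z = g z + s z := by
      rw [add_assoc, tsub_add_cancel_of_le hle]
      exact hQsum M z
    exact (ENNReal.add_left_inj (ne_top_of_le_ne_top ENNReal.one_ne_top hle)).1 h1
  have hgM : ∀ z ∉ B, g z ≤ M := by
    intro z hz
    calc g z ≤ ∑ k ∈ Finset.range M, 1 :=
          Finset.sum_le_sum fun k _ => killed_iterate_one_le k z hz
      _ = M := by simp
  refine ⟨fun z => f z + L * g z, L * M, ENNReal.mul_ne_top hLt (ENNReal.natCast_ne_top M),
    fun z hz => ⟨le_self_add, add_le_add le_rfl (mul_le_mul' le_rfl (hgM z hz)), ?_⟩⟩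
  rw [hQ, killed_add, killed_const_mul]
  simp only [← hQ]
  by_cases hzF : z ∈ B'
  · have hz' : z ∈ B' \ B := ⟨hzF, hz⟩
    have h1 : Q f z + e z ≤ L * (1 - s z) := by
      have hpos := tsub_pos_iff_lt.2 (hs1 z hz')
      rw [← ENNReal.div_le_iff_le_mul (Or.inl hpos.ne')
        (Or.inl (ne_top_of_le_ne_top ENNReal.one_ne_top tsub_le_self))]
      exact Finset.single_le_sum (f := fun z => (Q f z + e z) / (1 - s z)) (fun _ _ => zero_le)
        (by simpa [hF] using hz')
    calc Q f z + L * Q g z + e z = (Q f z + e z) + L * Q g z := by ring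
      _ ≤ L * (1 - s z) + L * Q g z := by gcongr
      _ = L * g z := by rw [← mul_add, add_comm, hQg z hz]
      _ ≤ _ := le_add_self
  · calc Q f z + L * Q g z + e z = (Q f z + e z) + L * Q g z := by ring
      _ ≤ f z + L * g z := by
        gcongr
        · exact hf z hzF hz
        · rw [← hQg z hz]; exact le_self_add

lemma killed_iterate_ne_top {k : ℕ × ℕ → ℝ≥0∞} {M : ℝ≥0∞} (hM : M ≠ ⊤)
    (hk : ∀ z ∉ B, k z ≠ ⊤) (h : ∀ z ∉ B, killed p B k z ≤ M * k z) (n : ℕ) :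
    ∀ z ∉ B, (killed p B)^[n] k z ≠ ⊤ := by
  have : ∀ z ∉ B, (killed p B)^[n] k z ≤ M ^ n * k z := by
    induction n with
    | zero => intro z _; simp
    | succ n ih =>
      intro z hz
      rw [Function.iterate_succ_apply']
      refine (killed_mono ih z).trans ?_
      rw [killed_const_mul, pow_succ, mul_assoc]
      exact mul_le_mul' le_rfl (h z hz)
  exact fun z hz => ne_top_of_le_ne_top
    (ENNReal.mul_ne_top (ENNReal.pow_ne_top hM) (hk z hz)) (this z hz)

/-- Telescoped form of a drift inequality. -/
lemma telescope {a k e E : ℕ × ℕ → ℝ≥0∞} {b : ℝ≥0∞} (hb : b ≠ ⊤)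
    (h : ∀ z ∉ B, a z + killed p B k z + b * killed p B (fun _ => 1) z
      ≤ killed p B a z + b + k z + e z)
    (he : ∀ n, ∀ z ∉ B, (killed p B)^[n] e z ≤ E z)
    (ha : ∀ n, ∀ z ∉ B, (killed p B)^[n] a z ≠ ⊤) (hk : ∀ n, ∀ z ∉ B, (killed p B)^[n] k z ≠ ⊤)
    (n : ℕ) : ∀ z ∉ B,
      a z + (killed p B)^[n] k z + b * (killed p B)^[n] (fun _ => 1) z
        ≤ (killed p B)^[n] a z + b + k z + n * E z := by
  set Q := killed p B with hQ
  induction n with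
  | zero =>
    intro z hz
    simp only [Function.iterate_zero, id_eq, mul_one, Nat.cast_zero, zero_mul, add_zero]
    exact le_of_eq (by ring)
  | succ n ih =>
    intro z hz
    have h1 : Q^[n] a z + Q^[n + 1] k z + b * Q^[n + 1] (fun _ => 1) z
        ≤ Q^[n + 1] a z + b * Q^[n] (fun _ => 1) z + Q^[n] k z + E z := by
      have h2 := killed_iterate_mono (p := p) h n z hz
      have e1 : (fun z => killed p B a z + b + k z + e z)
          = fun z => killed p B a z + b * (fun _ => 1) z + k z + e z := by simp
      rw [e1] at h2
      simp only [killed_iterate_add, killed_iterate_const_mul] at h2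
      simp only [Function.iterate_succ_apply]
      exact h2.trans (by gcongr; exact he n z hz)
    -- The intermediate terms occur on both sides after adding the two inequalities and may be
    -- cancelled because they are finite.
    have hX : Q^[n] k z + b * Q^[n] (fun _ => 1) z + Q^[n] a z ≠ ⊤ := by
      refine ENNReal.add_ne_top.2 ⟨ENNReal.add_ne_top.2 ⟨hk n z hz, ?_⟩, ha n z hz⟩
      exact ENNReal.mul_ne_top hb
        (ne_top_of_le_ne_top ENNReal.one_ne_top (killed_iterate_one_le n z hz))
    rw [← ENNReal.add_le_add_iff_right hX]
    have h3 := add_le_add (ih z hz) h1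
    calc _ = a z + Q^[n] k z + b * Q^[n] (fun _ => 1) z
            + (Q^[n] a z + Q^[n + 1] k z + b * Q^[n + 1] (fun _ => 1) z) := by ring
      _ ≤ _ := h3
      _ = _ := by push_cast; ring

/-- The real function `f` is of order `V ^ γ` off `B`. -/
def Comparable (B : Set (ℕ × ℕ)) (V : ℕ × ℕ → ℝ) (γ : ℝ) (f : ℕ × ℕ → ℝ) : Prop :=
  ∃ c C : ℝ, 0 < c ∧ 0 < C ∧ ∀ z ∉ B, c * V z ^ γ ≤ f z ∧ f z ≤ C * V z ^ γ

set_option maxHeartbeats 1000000 in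
/-- Polynomial lower bound for the survival probability, from a superharmonic function of order
`γ₁`, a submartingale of order `γ` and a bound on moments of order `γ₂`. -/
theorem survival_lower_bound {V : ℕ × ℕ → ℝ} (hV : ∀ z ∉ B, 1 ≤ V z) {γ γ₁ γ₂ c C b : ℝ}
    (h₂ : γ₁ ≤ γ) (h₃ : 0 < γ) (h₄ : γ < γ₂) (h₅ : γ₂ ≤ γ₁ + 2)
    (hc : 0 < c) (hC : 0 < C) (hb : 0 ≤ b) {a g k : ℕ × ℕ → ℝ}
    (haV : Comparable B V γ a) (hgV : Comparable B V γ₁ g) (hkV : Comparable B V γ₂ k)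
    (hg : ∀ z ∉ B, killed p B (fun w => ENNReal.ofReal (g w)) z ≤ ENNReal.ofReal (g z))
    (hk : ∀ z ∉ B, killed p B (fun w => ENNReal.ofReal (k w)) z
      ≤ ENNReal.ofReal (k z) + ENNReal.ofReal (C * V z ^ (γ₂ - 2)))
    (ha : ∀ z ∉ B, ENNReal.ofReal (a z) + ENNReal.ofReal (c * V z ^ (γ - 2))
        + ENNReal.ofReal b * killed p B (fun _ => 1) z
      ≤ killed p B (fun w => ENNReal.ofReal (a w)) z + ENNReal.ofReal b) :
    ∃ d ρ : ℝ, 0 < d ∧ ∀ z ∉ B, ρ ≤ V z → ∀ n : ℕ, 1 ≤ n →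
      ENNReal.ofReal (d * (n : ℝ) ^ (-(γ / (2 - (γ - γ₁)))))
        ≤ (killed p B)^[n] (fun _ => 1) z := by
  obtain ⟨ca, Ca, hca, hCa, haV⟩ := haV
  obtain ⟨cg, Cg, hcg, hCg, hgV⟩ := hgV
  obtain ⟨ck, Ck, hck, hCk, hkV⟩ := hkV
  -- The process `a - κ' k`, with κ' of order N^(γ - γ₂), is almost a submartingale and is bounded
  -- above by a multiple of N^γ. Starting from about `V z ^ γ`, it can keep its mean only if the
  -- survival probability is at least of order (V z / N)^γ.
  set Q := killed p B with hQ
  set σ := 2 - (γ - γ₁) with hσ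
  have hσ0 : 0 < σ := by linarith
  set κ := c / C with hκ
  have hκ0 : 0 < κ := by positivity
  have hkk : 0 < γ₂ - γ := by linarith
  -- the threshold beyond which the cap dominates
  obtain ⟨M, hM1, hM⟩ : ∃ M : ℝ, 1 ≤ M ∧ Ca ≤ κ * ck * M ^ (γ₂ - γ) := by
    have := (tendsto_rpow_atTop hkk).eventually_ge_atTop (Ca / (κ * ck))
    obtain ⟨M, h1, h2⟩ := (this.and (Filter.eventually_ge_atTop 1)).exists
    exact ⟨M, h2, by rwa [div_le_iff₀' (by positivity)] at h1⟩
  -- `K` makes the initial cap and the accumulated error each at most a quarter of the initial value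
  -- of `a`; the threshold ρ below does the same for `b`, so a quarter survives.
  obtain ⟨K, hK1, hK2, hK3⟩ : ∃ K : ℝ, 1 ≤ K ∧ κ * Ck * K ^ (γ - γ₂) ≤ ca / 4 ∧
      c * (Cg / cg) * K ^ (-σ) ≤ ca / 4 := by
    have t1 : Filter.Tendsto (fun K : ℝ => κ * Ck * K ^ (γ - γ₂)) Filter.atTop (nhds 0) := by
      have := (tendsto_rpow_neg_atTop hkk).const_mul (κ * Ck)
      simpa using this
    have t2 : Filter.Tendsto (fun K : ℝ => c * (Cg / cg) * K ^ (-σ)) Filter.atTop (nhds 0) := by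
      have := (tendsto_rpow_neg_atTop hσ0).const_mul (c * (Cg / cg))
      simpa using this
    have hp : 0 < ca / 4 := by positivity
    obtain ⟨K, hh⟩ := ((t1.eventually_le_const hp).and
      ((t2.eventually_le_const hp).and (Filter.eventually_ge_atTop 1))).exists
    exact ⟨K, hh.2.2, hh.1, hh.2.1⟩
  obtain ⟨ρ, hρ⟩ : ∃ ρ : ℝ, ∀ x ≥ ρ, b ≤ ca / 4 * x ^ γ := by
    have := ((tendsto_rpow_atTop h₃).const_mul_atTop (show 0 < ca / 4 by positivity)
      ).eventually_ge_atTop b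
    rwa [Filter.eventually_atTop] at this
  set D := Ca * M ^ γ with hD
  have hM0 : 0 < M := by linarith
  have hD0 : 0 < D := by positivity
  refine ⟨ca / (4 * D) * (2 * K)⁻¹ ^ γ, ρ, by positivity, fun z hz hzρ n hn => ?_⟩
  have hn1 : (1 : ℝ) ≤ n := by exact_mod_cast hn
  have hn0 : (0 : ℝ) < n := by linarith
  have hVz := hV z hz
  have hVz0 : 0 < V z := by linarith
  -- The error per step is of order N^(-σ) V^γ₁; over `n` steps it is under control once `N` is at
  -- least of order n^(1/σ).
  set m := (n : ℝ) ^ σ⁻¹ with hm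
  have hm1 : 1 ≤ m := Real.one_le_rpow hn1 (by positivity)
  set N := K * (V z + m) with hN
  have hN0 : 0 < N := by positivity
  set κ' := κ * N ^ (γ - γ₂) with hκ'
  have hκ'0 : 0 < κ' := by positivity
  set A : ℕ × ℕ → ℝ≥0∞ := fun w => ENNReal.ofReal (a w) with hA
  set G : ℕ × ℕ → ℝ≥0∞ := fun w => ENNReal.ofReal (g w) with hG
  set k0 : ℕ × ℕ → ℝ≥0∞ := fun w => ENNReal.ofReal (k w) with hk0
  set k' : ℕ × ℕ → ℝ≥0∞ := fun w => ENNReal.ofReal κ' * k0 w with hk'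
  -- The error is expressed through the superharmonic `g`, so its iterates under the killed kernel
  -- do not grow.
  set e : ℕ × ℕ → ℝ≥0∞ := fun w => ENNReal.ofReal (c * N ^ (γ - 2 - γ₁) / cg) * G w with he
  -- drift bound for the cap
  have hcap : ∀ w ∉ B, Q k' w ≤ k' w + ENNReal.ofReal (c * V w ^ (γ - 2)) + e w := by
    intro w hw
    have hVw : 0 < V w := by linarith [hV w hw]
    rw [hk', hQ, killed_const_mul]
    refine (mul_le_mul' le_rfl (hk w hw)).trans ?_
    rw [mul_add, add_assoc]
    gcongr
    rw [← ENNReal.ofReal_mul hκ'0.le, he, hG]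
    simp only
    rw [← ENNReal.ofReal_mul (by positivity), ← ENNReal.ofReal_add (by positivity)
      (mul_nonneg (by positivity) (le_trans (by positivity) (hgV w hw).1))]
    apply ENNReal.ofReal_le_ofReal
    have hge : c * N ^ (γ - 2 - γ₁) * V w ^ γ₁ ≤ c * N ^ (γ - 2 - γ₁) / cg * g w := by
      rw [div_mul_eq_mul_div, le_div_iff₀ hcg]
      calc _ = c * N ^ (γ - 2 - γ₁) * (cg * V w ^ γ₁) := by ring
        _ ≤ _ := by gcongr; exact (hgV w hw).1
    refine le_trans ?_ (add_le_add le_rfl hge)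
    have hκC : κ' * (C * V w ^ (γ₂ - 2)) = c * (N ^ (γ - γ₂) * V w ^ (γ₂ - 2)) := by
      rw [hκ', hκ]; field_simp
    rw [hκC]
    -- Within distance `N` the drift of `a` pays for the cap, because γ < γ₂. Beyond it the error
    -- term `e` does, because γ₂ ≤ γ₁ + 2.
    rcases le_total (V w) N with h | h
    · have : N ^ (γ - γ₂) * V w ^ (γ₂ - 2) ≤ V w ^ (γ - 2) := by
        have h6 : N ^ (γ - γ₂) ≤ V w ^ (γ - γ₂) :=
          Real.rpow_le_rpow_of_nonpos hVw h (by linarith)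
        calc _ ≤ V w ^ (γ - γ₂) * V w ^ (γ₂ - 2) := by gcongr
          _ = _ := by rw [← Real.rpow_add hVw]; congr 1; ring
      have h7 : 0 ≤ c * N ^ (γ - 2 - γ₁) * V w ^ γ₁ := by positivity
      nlinarith
    · have : N ^ (γ - γ₂) * V w ^ (γ₂ - 2) ≤ N ^ (γ - 2 - γ₁) * V w ^ γ₁ := by
        have h6 : V w ^ (γ₂ - 2 - γ₁) ≤ N ^ (γ₂ - 2 - γ₁) :=
          Real.rpow_le_rpow_of_nonpos hN0 h (by linarith)
        calc N ^ (γ - γ₂) * V w ^ (γ₂ - 2)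
            = N ^ (γ - γ₂) * (V w ^ (γ₂ - 2 - γ₁) * V w ^ γ₁) := by
              rw [← Real.rpow_add hVw]; congr 2; ring
          _ ≤ N ^ (γ - γ₂) * (N ^ (γ₂ - 2 - γ₁) * V w ^ γ₁) := by gcongr
          _ = _ := by rw [← mul_assoc, ← Real.rpow_add hN0]; congr 2; ring
      have h7 : 0 ≤ c * V w ^ (γ - 2) := by positivity
      nlinarith
  -- one-step inequality
  have hone : ∀ w ∉ B, A w + Q k' w + ENNReal.ofReal b * Q (fun _ => 1) w
      ≤ Q A w + ENNReal.ofReal b + k' w + e w := by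
    intro w hw
    rw [← ENNReal.add_le_add_iff_right (ENNReal.ofReal_ne_top (r := c * V w ^ (γ - 2)))]
    calc _ = (A w + ENNReal.ofReal (c * V w ^ (γ - 2)) + ENNReal.ofReal b * Q (fun _ => 1) w)
            + Q k' w := by ring
      _ ≤ (Q A w + ENNReal.ofReal b) + (k' w + ENNReal.ofReal (c * V w ^ (γ - 2)) + e w) :=
          add_le_add (ha w hw) (hcap w hw)
      _ = _ := by ring
  have hk0t : ∀ j, ∀ w ∉ B, Q^[j] k0 w ≠ ⊤ := by
    refine killed_iterate_ne_top (M := 1 + ENNReal.ofReal (C / ck)) (by simp)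
      (fun w _ => ENNReal.ofReal_ne_top) fun w hw => (hk w hw).trans ?_
    rw [add_mul, one_mul, hk0]
    simp only
    rw [← ENNReal.ofReal_mul (by positivity)]
    refine add_le_add le_rfl (ENNReal.ofReal_le_ofReal ?_)
    have hVw := hV w hw
    have : V w ^ (γ₂ - 2) ≤ V w ^ γ₂ := Real.rpow_le_rpow_of_exponent_le hVw (by linarith)
    rw [div_mul_eq_mul_div, le_div_iff₀ hck]
    calc C * V w ^ (γ₂ - 2) * ck ≤ C * V w ^ γ₂ * ck := by gcongr
      _ = C * (ck * V w ^ γ₂) := by ring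
      _ ≤ C * k w := by gcongr; exact (hkV w hw).1
  have hk't : ∀ j, ∀ w ∉ B, Q^[j] k' w ≠ ⊤ := by
    intro j w hw
    rw [hk', hQ, killed_iterate_const_mul]
    exact ENNReal.mul_ne_top ENNReal.ofReal_ne_top (hk0t j w hw)
  -- the cap dominates at infinity
  have hdom : ∀ w ∉ B, A w ≤ k' w + ENNReal.ofReal (D * N ^ γ) * 1 := by
    intro w hw
    have hVw : 0 < V w := by linarith [hV w hw]
    have hkw : 0 ≤ k w := le_trans (by positivity) (hkV w hw).1
    rw [mul_one, hA, hk', hk0]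
    simp only
    rw [← ENNReal.ofReal_mul hκ'0.le, ← ENNReal.ofReal_add (by positivity) (by positivity)]
    apply ENNReal.ofReal_le_ofReal
    rcases le_total (V w) (M * N) with h | h
    · calc a w ≤ Ca * V w ^ γ := (haV w hw).2
        _ ≤ Ca * (M * N) ^ γ := by gcongr
        _ = D * N ^ γ := by rw [Real.mul_rpow hM0.le hN0.le, hD]; ring
        _ ≤ _ := by have : 0 ≤ κ' * k w := by positivity
                    linarith
    · have h6 : M ^ (γ₂ - γ) * N ^ (γ₂ - γ) ≤ V w ^ (γ₂ - γ) := by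
        rw [← Real.mul_rpow hM0.le hN0.le]
        exact Real.rpow_le_rpow (by positivity) h hkk.le
      have h7 : Ca ≤ κ' * ck * V w ^ (γ₂ - γ) := by
        calc Ca ≤ κ * ck * M ^ (γ₂ - γ) := hM
          _ = κ' * ck * (M ^ (γ₂ - γ) * N ^ (γ₂ - γ)) := by
            rw [hκ', show γ - γ₂ = -(γ₂ - γ) by ring, Real.rpow_neg hN0.le]
            field_simp
          _ ≤ _ := by gcongr
      calc a w ≤ Ca * V w ^ γ := (haV w hw).2
        _ ≤ κ' * ck * V w ^ (γ₂ - γ) * V w ^ γ := by gcongr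
        _ = κ' * (ck * V w ^ γ₂) := by
          rw [mul_assoc (κ' * ck), ← Real.rpow_add hVw, sub_add_cancel, mul_assoc]
        _ ≤ κ' * k w := by gcongr; exact (hkV w hw).1
        _ ≤ _ := by have : 0 ≤ D * N ^ γ := by positivity
                    linarith
  have hAj : ∀ j, ∀ w ∉ B, Q^[j] A w
      ≤ Q^[j] k' w + ENNReal.ofReal (D * N ^ γ) * Q^[j] (fun _ => 1) w := by
    intro j w hw
    have h6 := killed_iterate_mono (p := p) hdom j w hw
    rw [killed_iterate_add] at h6
    have h8 := congrFun (killed_iterate_const_mul (p := p) (B := B) (ENNReal.ofReal (D * N ^ γ))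
      (fun _ => 1) j) w
    simp only at h6 h8
    rw [h8] at h6
    exact h6
  have hQ1t : ∀ j, ∀ w ∉ B, Q^[j] (fun _ => 1) w ≠ ⊤ := fun j w hw =>
    ne_top_of_le_ne_top ENNReal.one_ne_top (killed_iterate_one_le j w hw)
  have hAt : ∀ j, ∀ w ∉ B, Q^[j] A w ≠ ⊤ := fun j w hw => ne_top_of_le_ne_top
    (ENNReal.add_ne_top.2 ⟨hk't j w hw, ENNReal.mul_ne_top ENNReal.ofReal_ne_top (hQ1t j w hw)⟩)
    (hAj j w hw)
  have hej : ∀ j, ∀ w ∉ B, Q^[j] e w ≤ e w := by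
    intro j w hw
    rw [he, hQ, killed_iterate_const_mul]
    exact mul_le_mul' le_rfl (killed_iterate_le hg j w hw)
  have htel := telescope ENNReal.ofReal_ne_top hone hej hAt hk't n z hz
  have hfin : A z ≤ ENNReal.ofReal (D * N ^ γ) * Q^[n] (fun _ => 1) z
      + (ENNReal.ofReal b + k' z + n * e z) := by
    rw [← ENNReal.add_le_add_iff_right (hk't n z hz)]
    calc A z + Q^[n] k' z ≤ A z + Q^[n] k' z + ENNReal.ofReal b * Q^[n] (fun _ => 1) z :=
          le_self_add
      _ ≤ _ := htel
      _ ≤ (Q^[n] k' z + ENNReal.ofReal (D * N ^ γ) * Q^[n] (fun _ => 1) z)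
          + ENNReal.ofReal b + k' z + n * e z := by gcongr; exact hAj n z hz
      _ = _ := by ring
  set P := (Q^[n] (fun _ => 1) z).toReal with hP
  have hPe : Q^[n] (fun _ => 1) z = ENNReal.ofReal P :=
    (ENNReal.ofReal_toReal (hQ1t n z hz)).symm
  have hP0 : 0 ≤ P := ENNReal.toReal_nonneg
  have hkz : 0 ≤ k z := le_trans (by positivity) (hkV z hz).1
  have hgz : 0 ≤ g z := le_trans (by positivity) (hgV z hz).1
  have hreal : a z ≤ D * N ^ γ * P + (b + κ' * k z + n * (c * N ^ (γ - 2 - γ₁) / cg * g z)) := by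
    rw [hPe, hA, hk', he, hk0, hG] at hfin
    simp only at hfin
    rw [← ENNReal.ofReal_natCast n] at hfin
    rw [← ENNReal.ofReal_mul (by positivity), ← ENNReal.ofReal_mul (by positivity),
      ← ENNReal.ofReal_mul (by positivity), ← ENNReal.ofReal_mul (by positivity),
      ← ENNReal.ofReal_add hb (by positivity), ← ENNReal.ofReal_add (by positivity) (by positivity),
      ← ENNReal.ofReal_add (by positivity) (by positivity)] at hfin
    exact (ENNReal.ofReal_le_ofReal_iff (by positivity)).1 hfin
  have hVN : K * V z ≤ N := by rw [hN]; gcongr; linarith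
  have hmN : K * m ≤ N := by rw [hN]; gcongr; linarith
  have hA1 : ca * V z ^ γ ≤ a z := (haV z hz).1
  have ht1 : b ≤ ca / 4 * V z ^ γ := hρ _ hzρ
  have ht2 : κ' * k z ≤ ca / 4 * V z ^ γ := by
    have h6 : N ^ (γ - γ₂) ≤ (K * V z) ^ (γ - γ₂) :=
      Real.rpow_le_rpow_of_nonpos (by positivity) hVN (by linarith)
    calc κ' * k z ≤ κ * (K * V z) ^ (γ - γ₂) * (Ck * V z ^ γ₂) := by
          rw [hκ']; gcongr; exact (hkV z hz).2
      _ = (κ * Ck * K ^ (γ - γ₂)) * (V z ^ (γ - γ₂) * V z ^ γ₂) := by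
          rw [Real.mul_rpow (by positivity) hVz0.le]; ring
      _ = (κ * Ck * K ^ (γ - γ₂)) * V z ^ γ := by rw [← Real.rpow_add hVz0, sub_add_cancel]
      _ ≤ _ := by gcongr
  have ht3 : n * (c * N ^ (γ - 2 - γ₁) / cg * g z) ≤ ca / 4 * V z ^ γ := by
    have h6 : N ^ (γ - 2 - γ₁) ≤ K ^ (-σ) * (n : ℝ)⁻¹ := by
      rw [show γ - 2 - γ₁ = -σ by rw [hσ]; ring]
      refine (Real.rpow_le_rpow_of_nonpos (by positivity) hmN (by linarith)).trans (le_of_eq ?_)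
      rw [Real.mul_rpow (by positivity) (by positivity), hm, ← Real.rpow_mul hn0.le,
        mul_neg, inv_mul_cancel₀ hσ0.ne', Real.rpow_neg_one]
    have h7 : V z ^ γ₁ ≤ V z ^ γ := Real.rpow_le_rpow_of_exponent_le hVz h₂
    calc n * (c * N ^ (γ - 2 - γ₁) / cg * g z)
        ≤ n * (c * (K ^ (-σ) * (n : ℝ)⁻¹) / cg * (Cg * V z ^ γ)) := by
          gcongr
          exact (hgV z hz).2.trans (by gcongr)
      _ = (c * (Cg / cg) * K ^ (-σ)) * V z ^ γ := by field_simp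
      _ ≤ _ := by gcongr
  have hmain : ca / 4 * V z ^ γ ≤ D * N ^ γ * P := by linarith
  rw [hPe]
  apply ENNReal.ofReal_le_ofReal
  have hNle : N ≤ 2 * K * m * V z := by
    have : V z + m ≤ 2 * m * V z := by nlinarith
    calc N ≤ K * (2 * m * V z) := by rw [hN]; gcongr
      _ = _ := by ring
  have hNγ : N ^ γ ≤ (2 * K) ^ γ * (m ^ γ * V z ^ γ) := by
    calc N ^ γ ≤ (2 * K * m * V z) ^ γ := by gcongr
      _ = _ := by
        rw [Real.mul_rpow (by positivity) (by positivity),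
          Real.mul_rpow (by positivity) (by positivity)]; ring
  have hmγ : (n : ℝ) ^ (-(γ / σ)) = (m ^ γ)⁻¹ := by
    rw [hm, ← Real.rpow_mul hn0.le, ← Real.rpow_neg hn0.le]
    congr 1; field_simp
  rw [hmγ, Real.inv_rpow (by positivity)]
  have hVγ : 0 < V z ^ γ := by positivity
  have h8 : ca / 4 * V z ^ γ ≤ D * ((2 * K) ^ γ * (m ^ γ * V z ^ γ)) * P :=
    hmain.trans (by gcongr)
  have h9 : ca / 4 ≤ D * ((2 * K) ^ γ * m ^ γ) * P := by
    refine le_of_mul_le_mul_right ?_ hVγ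
    linarith
  have hq : 0 < (2 * K) ^ γ := by positivity
  have hq2 : 0 < m ^ γ := by positivity
  rw [← div_eq_mul_inv, ← div_eq_mul_inv, div_div, div_div, div_le_iff₀ (by positivity)]
  nlinarith

end Lyapunov

/-! ### Asymptotics far from the origin -/

/-- Going to infinity inside `S`. -/
def far (e₁ e₂ : ℂ) (S : Set (ℕ × ℕ)) : Filter (ℕ × ℕ) :=
  Filter.comap (fun z => ‖lin e₁ e₂ z‖) Filter.atTop ⊓ Filter.principal S

/-- `g` is negligible with respect to the power `β` of the norm, far away in `S`. -/
def Small (e₁ e₂ : ℂ) (S : Set (ℕ × ℕ)) (β : ℝ) (g : ℕ × ℕ → ℝ) : Prop :=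
  ∀ ε > 0, ∀ᶠ z in far e₁ e₂ S, |g z| ≤ ε * ‖lin e₁ e₂ z‖ ^ β

section Small

variable {e₁ e₂ : ℂ} {S : Set (ℕ × ℕ)} {β : ℝ} {g h : ℕ × ℕ → ℝ}

lemma eventually_far {P : ℕ × ℕ → Prop} :
    (∀ᶠ z in far e₁ e₂ S, P z) ↔ ∃ ρ : ℝ, ∀ z ∈ S, ρ ≤ ‖lin e₁ e₂ z‖ → P z := by
  rw [far, Filter.eventually_inf_principal, Filter.eventually_comap, Filter.eventually_atTop]
  exact ⟨fun ⟨a, h⟩ => ⟨a, fun z hz hzρ => h _ hzρ z rfl hz⟩,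
    fun ⟨a, h⟩ => ⟨a, fun b hb z hzb hz => h z hz (hzb ▸ hb)⟩⟩

lemma far_ge (ρ : ℝ) : ∀ᶠ z in far e₁ e₂ S, ρ ≤ ‖lin e₁ e₂ z‖ :=
  eventually_far.2 ⟨ρ, fun _ _ h => h⟩

lemma far_mem : ∀ᶠ z in far e₁ e₂ S, z ∈ S := eventually_far.2 ⟨0, fun _ h _ => h⟩

lemma tendsto_far : Filter.Tendsto (fun z => ‖lin e₁ e₂ z‖) (far e₁ e₂ S) Filter.atTop :=
  Filter.tendsto_comap.mono_left inf_le_left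

lemma Small.add (hg : Small e₁ e₂ S β g) (hh : Small e₁ e₂ S β h) :
    Small e₁ e₂ S β fun z => g z + h z := by
  intro ε hε
  filter_upwards [hg (ε / 2) (by positivity), hh (ε / 2) (by positivity)] with z h1 h2
  have := abs_add_le (g z) (h z)
  linarith

lemma Small.of_le (hg : Small e₁ e₂ S β g) (h' : ∀ᶠ z in far e₁ e₂ S, |h z| ≤ |g z|) :
    Small e₁ e₂ S β h := by
  intro ε hε
  filter_upwards [hg ε hε, h'] with z h1 h2 using h2.trans h1

lemma Small.bdd_mul {k : ℕ × ℕ → ℝ} {C : ℝ} (hg : Small e₁ e₂ S β g) (hk : ∀ z, |k z| ≤ C) :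
    Small e₁ e₂ S β fun z => k z * g z := by
  have hC : 0 ≤ C := (abs_nonneg _).trans (hk 0)
  intro ε hε
  filter_upwards [hg (ε / (C + 1)) (by positivity), far_ge 0] with z h1 _
  rw [abs_mul]
  calc |k z| * |g z| ≤ C * (ε / (C + 1) * ‖lin e₁ e₂ z‖ ^ β) := by gcongr; exact hk z
    _ ≤ (C + 1) * (ε / (C + 1) * ‖lin e₁ e₂ z‖ ^ β) := by gcongr; linarith
    _ = _ := by field_simp

lemma small_rpow {a : ℝ} (ha : a < β) (C : ℝ) :
    Small e₁ e₂ S β fun z => C * ‖lin e₁ e₂ z‖ ^ a := by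
  intro ε hε
  have h1 : Filter.Tendsto (fun x : ℝ => |C| * x ^ (-(β - a))) Filter.atTop (nhds 0) := by
    simpa using (tendsto_rpow_neg_atTop (sub_pos.2 ha)).const_mul |C|
  have h2 := (h1.eventually_le_const hε)
  filter_upwards [(tendsto_far (e₁ := e₁) (e₂ := e₂) (S := S)).eventually h2, far_ge 1] with z h h0
  have hp : 0 < ‖lin e₁ e₂ z‖ := by linarith
  rw [abs_mul, abs_of_nonneg (Real.rpow_nonneg hp.le a)]
  calc |C| * ‖lin e₁ e₂ z‖ ^ a
      = (|C| * ‖lin e₁ e₂ z‖ ^ (-(β - a))) * ‖lin e₁ e₂ z‖ ^ β := by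
        rw [mul_assoc, ← Real.rpow_add hp]; congr 2; ring
    _ ≤ _ := by gcongr

lemma small_of_bound {a b C : ℝ} (ha : a < β) (hb : b < β) (hC : 0 ≤ C)
    (h : ∀ z ∈ S, z ≠ 0 → |g z| ≤ C * (‖lin e₁ e₂ z‖ ^ a + ‖lin e₁ e₂ z‖ ^ b)) :
    Small e₁ e₂ S β g := by
  refine ((small_rpow ha C).add (small_rpow hb C)).of_le ?_
  filter_upwards [far_mem, far_ge 1] with z hz h1
  have hz0 : z ≠ 0 := by
    rintro rfl
    simp [lin] at h1
    linarith
  refine (h z hz hz0).trans (le_of_eq ?_)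
  rw [abs_of_nonneg (by positivity)]
  ring

end Small

/-- Integration of an expansion with error term. -/
lemma integral_expansion {α : Type*} [MeasurableSpace α] [Countable α] [MeasurableSingletonClass α]
    {μ : Measure α} [IsProbabilityMeasure μ] {f g e : α → ℝ} {f₀ C : ℝ} (hg : Integrable g μ)
    (he : Integrable e μ) (h : ∀ w, |f w - f₀ - g w| ≤ C * e w) :
    Integrable f μ ∧ |∫ w, f w ∂μ - f₀ - ∫ w, g w ∂μ| ≤ C * ∫ w, e w ∂μ := by
  have h1 : Integrable (fun w => f w - f₀ - g w) μ :=
    (he.const_mul C).mono' (aesm _ _) (Filter.Eventually.of_forall h)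
  have h2 : Integrable f μ := by
    have := (h1.add hg).add (integrable_const f₀)
    refine this.congr (Filter.Eventually.of_forall fun w => ?_)
    simp
  refine ⟨h2, ?_⟩
  have h3 : ∫ w, (f w - f₀ - g w) ∂μ = ∫ w, f w ∂μ - f₀ - ∫ w, g w ∂μ := by
    have h4 : Integrable (fun w => f w - f₀) μ := h2.sub (integrable_const _)
    rw [integral_sub h4 hg, integral_sub h2 (integrable_const _)]
    simp
  rw [← h3, ← integral_const_mul]
  exact (abs_integral_le_integral_abs).trans
    (integral_mono h1.abs (he.const_mul C) h)

lemma JumpMoment.integrable_jump {e₁ e₂ : ℂ} {μ : Measure (ℕ × ℕ)} [IsProbabilityMeasure μ]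
    {z : ℕ × ℕ} {ν M : ℝ} (h : JumpMoment e₁ e₂ μ z ν M) (hν : 1 ≤ ν) :
    Integrable (fun w => lin e₁ e₂ w - lin e₁ e₂ z) μ := by
  have := (h.mono zero_le_one hν).1
  simp only [Real.rpow_one] at this
  exact (integrable_norm_iff (aesm _ _)).1 this

/-! ### One-step drift of homogeneous functions -/

section Drift

variable {p : ℕ × ℕ → PMF (ℕ × ℕ)} {e₁ e₂ : ℂ} {S : Set (ℕ × ℕ)} {ν M₀ : ℝ}
  {γ Γ : ℝ} {f : ℂ → ℝ} {A B : ℂ → ℂ} {Λ : ℂ → ℝ}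

lemma re_integral_mul {α : Type*} [MeasurableSpace α] {μ : Measure α} {φ : α → ℂ} (a : ℂ)
    (hφ : Integrable φ μ) : ∫ w, (a * φ w).re ∂μ = (a * ∫ w, φ w ∂μ).re := by
  rw [← integral_const_mul]
  exact integral_re (hφ.const_mul a)

/-- Zeroth-order expansion of the drift. -/
lemma TaylorData.drift_zero (hf : TaylorData γ f A B Λ) (he : IsCone e₁ e₂)
    (hS : ∀ z ∈ S, JumpMoment e₁ e₂ (p z).toMeasure z ν M₀) (hν : 1 ≤ ν)
    (hΓ : 0 ≤ Γ) (hγΓ : γ ≤ Γ) (hΓν : Γ ≤ ν) :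
    ∃ C : ℝ, 0 ≤ C ∧ ∀ z ∈ S, z ≠ 0 → Integrable (fun w => f (lin e₁ e₂ w)) (p z).toMeasure ∧
      ∫ w, |f (lin e₁ e₂ w) - f (lin e₁ e₂ z)| ∂(p z).toMeasure
        ≤ C * (‖lin e₁ e₂ z‖ ^ (γ - 1) + ‖lin e₁ e₂ z‖ ^ (Γ - ν)) := by
  obtain ⟨C, hC0, hC⟩ := hf.jump_zero he hΓ hγΓ hΓν
  refine ⟨C * (1 + |M₀|), by positivity, fun z hz hz0 => ?_⟩
  obtain ⟨h1, h2⟩ := integral_jumpError_le (hS z hz) (γ := γ) (s := 1) (Γ := Γ) zero_le_one hν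
  have h3 := integral_expansion (f := fun w => f (lin e₁ e₂ w)) (g := fun _ => 0)
    (f₀ := f (lin e₁ e₂ z)) (integrable_zero _ _ _) h1 (C := C)
    (fun w => by simpa using hC z w hz0)
  refine ⟨h3.1, ?_⟩
  calc _ ≤ ∫ w, C * jumpError γ 1 Γ ν (lin e₁ e₂ z) (lin e₁ e₂ w - lin e₁ e₂ z)
          ∂(p z).toMeasure :=
        integral_mono (h3.1.sub (integrable_const _)).abs (h1.const_mul C) fun w => hC z w hz0
    _ = C * ∫ w, jumpError γ 1 Γ ν (lin e₁ e₂ z) (lin e₁ e₂ w - lin e₁ e₂ z)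
          ∂(p z).toMeasure := integral_const_mul _ _
    _ ≤ C * ((1 + |M₀|) * (‖lin e₁ e₂ z‖ ^ (γ - 1) + ‖lin e₁ e₂ z‖ ^ (Γ - ν))) := by
        have := le_abs_self M₀
        refine mul_le_mul_of_nonneg_left (h2.trans ?_) hC0
        gcongr
    _ = _ := by ring

/-- First-order expansion of the drift. -/
lemma TaylorData.drift_one (hf : TaylorData γ f A B Λ) (he : IsCone e₁ e₂)
    (hS : ∀ z ∈ S, JumpMoment e₁ e₂ (p z).toMeasure z ν M₀)
    (hΓ : 0 ≤ Γ) (hγΓ : γ ≤ Γ) (hΓν : Γ ≤ ν) {s : ℝ} (h1s : 1 ≤ s) (hs2 : s ≤ 2) (hsν : s ≤ ν) :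
    ∃ C : ℝ, 0 ≤ C ∧ ∀ z ∈ S, z ≠ 0 →
      |∫ w, f (lin e₁ e₂ w) ∂(p z).toMeasure - f (lin e₁ e₂ z)
        - (A (lin e₁ e₂ z) * ∫ w, (lin e₁ e₂ w - lin e₁ e₂ z) ∂(p z).toMeasure).re|
        ≤ C * (‖lin e₁ e₂ z‖ ^ (γ - s) + ‖lin e₁ e₂ z‖ ^ (Γ - ν)) := by
  obtain ⟨C, hC0, hC⟩ := hf.jump_one he hΓ hγΓ hΓν h1s hs2
  refine ⟨C * (1 + |M₀|), by positivity, fun z hz hz0 => ?_⟩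
  obtain ⟨h1, h2⟩ := integral_jumpError_le (hS z hz) (γ := γ) (s := s) (Γ := Γ) (by linarith) hsν
  have hi := (hS z hz).integrable_jump (by linarith)
  have h3 := integral_expansion (f := fun w => f (lin e₁ e₂ w)) (f₀ := f (lin e₁ e₂ z))
    (g := fun w => (A (lin e₁ e₂ z) * (lin e₁ e₂ w - lin e₁ e₂ z)).re)
    (hi.const_mul _).re h1 (fun w => hC z w hz0)
  rw [re_integral_mul _ hi] at h3
  refine h3.2.trans ?_
  have := le_abs_self M₀
  rw [mul_assoc]
  refine mul_le_mul_of_nonneg_left (h2.trans ?_) hC0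
  gcongr

/-- Second-order expansion of the drift, for centred jumps with identity covariance. -/
lemma TaylorData.drift_two (hf : TaylorData γ f A B Λ) (he : IsCone e₁ e₂)
    (hS : ∀ z ∈ S, JumpMoment e₁ e₂ (p z).toMeasure z ν M₀)
    (hmean : ∀ z ∈ S, ∫ w, (lin e₁ e₂ w - lin e₁ e₂ z) ∂(p z).toMeasure = 0)
    (hsq : ∀ z ∈ S, ∫ w, (lin e₁ e₂ w - lin e₁ e₂ z) ^ 2 ∂(p z).toMeasure = 0)
    (hnorm : ∀ z ∈ S, ∫ w, ‖lin e₁ e₂ w - lin e₁ e₂ z‖ ^ 2 ∂(p z).toMeasure = 2)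
    (hΓ : 0 ≤ Γ) (hγΓ : γ ≤ Γ) (hΓν : Γ ≤ ν) {s : ℝ} (h2s : 2 ≤ s) (hs3 : s ≤ 3) (hsν : s ≤ ν) :
    ∃ C : ℝ, 0 ≤ C ∧ ∀ z ∈ S, z ≠ 0 →
      |∫ w, f (lin e₁ e₂ w) ∂(p z).toMeasure - f (lin e₁ e₂ z) - 2 * Λ (lin e₁ e₂ z)|
        ≤ C * (‖lin e₁ e₂ z‖ ^ (γ - s) + ‖lin e₁ e₂ z‖ ^ (Γ - ν)) := by
  obtain ⟨C, hC0, hC⟩ := hf.jump_two he hΓ hγΓ hΓν h2s hs3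
  refine ⟨C * (1 + |M₀|), by positivity, fun z hz hz0 => ?_⟩
  obtain ⟨h1, h2⟩ := integral_jumpError_le (hS z hz) (γ := γ) (s := s) (Γ := Γ) (by linarith) hsν
  have hi := (hS z hz).integrable_jump (by linarith)
  have hn : Integrable (fun w => ‖lin e₁ e₂ w - lin e₁ e₂ z‖ ^ 2) (p z).toMeasure := by
    have := ((hS z hz).mono (s := 2) (by norm_num) (by linarith)).1
    simpa using this
  have hq : Integrable (fun w => (lin e₁ e₂ w - lin e₁ e₂ z) ^ 2) (p z).toMeasure := by
    refine (integrable_norm_iff (aesm _ _)).1 ?_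
    simpa using hn
  have i1 : Integrable (fun w => (A (lin e₁ e₂ z) * (lin e₁ e₂ w - lin e₁ e₂ z)).re)
      (p z).toMeasure := (hi.const_mul (A (lin e₁ e₂ z))).re
  have i2 : Integrable (fun w => (B (lin e₁ e₂ z) * (lin e₁ e₂ w - lin e₁ e₂ z) ^ 2).re)
      (p z).toMeasure := (hq.const_mul (B (lin e₁ e₂ z))).re
  have i12 : Integrable (fun w => (A (lin e₁ e₂ z) * (lin e₁ e₂ w - lin e₁ e₂ z)).re
      + (B (lin e₁ e₂ z) * (lin e₁ e₂ w - lin e₁ e₂ z) ^ 2).re) (p z).toMeasure := i1.add i2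
  have i3 : Integrable (fun w => (A (lin e₁ e₂ z) * (lin e₁ e₂ w - lin e₁ e₂ z)).re
      + (B (lin e₁ e₂ z) * (lin e₁ e₂ w - lin e₁ e₂ z) ^ 2).re
      + Λ (lin e₁ e₂ z) * ‖lin e₁ e₂ w - lin e₁ e₂ z‖ ^ 2) (p z).toMeasure :=
    i12.add (hn.const_mul _)
  have h5 := (integral_expansion (f := fun w => f (lin e₁ e₂ w)) (f₀ := f (lin e₁ e₂ z))
    i3 h1 (fun w => hC z w hz0)).2
  -- Centring kills the gradient term and isotropy the trace-free Hessian term; the mean square 2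
  -- leaves twice Λ.
  rw [integral_add i12 (hn.const_mul _), integral_add i1 i2, re_integral_mul _ hi,
    re_integral_mul _ hq, integral_const_mul, hmean z hz, hsq z hz, hnorm z hz, mul_zero, mul_zero,
    Complex.zero_re, zero_add, zero_add, mul_comm (Λ _)] at h5
  refine h5.trans ?_
  have := le_abs_self M₀
  rw [mul_assoc]
  refine mul_le_mul_of_nonneg_left (h2.trans ?_) hC0
  gcongr

end Drift

/-! ### Drift of the boundary correctors -/

/-- A bounded function of the transverse coordinate `c`, superharmonic on `S`, strictly so near the
axis, and with small oscillation along the jumps away from the axis. -/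
structure IsCorrector (p : ℕ × ℕ → PMF (ℕ × ℕ)) (e₁ e₂ : ℂ) (S : Set (ℕ × ℕ)) (c : ℕ × ℕ → ℕ)
    (K : ℕ → ℝ) (C δ : ℝ) (M : ℕ) (ε : ℝ) : Prop where
  bdd : ∀ y, |K y| ≤ C
  pos : 0 < δ
  eps_nonneg : 0 ≤ ε
  super : ∀ z ∈ S, ∫ w, K (c w) ∂(p z).toMeasure ≤ K (c z)
  strict : ∀ z ∈ S, c z ≤ M → ∫ w, K (c w) ∂(p z).toMeasure ≤ K (c z) - δ
  osc : ∀ z ∈ S, M < c z →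
    ∫ w, ‖lin e₁ e₂ w - lin e₁ e₂ z‖ * |K (c w) - K (c z)| ∂(p z).toMeasure ≤ ε

lemma Integrable.mul_bdd_discrete {α : Type*} [MeasurableSpace α] [Countable α]
    [MeasurableSingletonClass α] {μ : Measure α} {g k : α → ℝ} (hg : Integrable g μ) {C : ℝ}
    (hk : ∀ a, |k a| ≤ C) : Integrable (fun a => g a * k a) μ :=
  hg.mul_bdd (aesm _ _) (Filter.Eventually.of_forall hk)

section Corrector

variable {p : ℕ × ℕ → PMF (ℕ × ℕ)} {e₁ e₂ : ℂ} {S : Set (ℕ × ℕ)} {ν M₀ : ℝ}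
  {γ : ℝ} {G : ℂ → ℝ} {A B : ℂ → ℂ} {Λ : ℂ → ℝ} {c : ℕ × ℕ → ℕ}

lemma ne_zero_of_one_le {z : ℕ × ℕ} (h : 1 ≤ ‖lin e₁ e₂ z‖) : z ≠ 0 := by
  rintro rfl
  simp [lin] at h
  linarith

/-- Drift of a corrector in the interior. -/
theorem TaylorData.corrector_drift (hG : TaylorData (γ - 1) G A B Λ) (he : IsCone e₁ e₂)
    (hS : ∀ z ∈ S, JumpMoment e₁ e₂ (p z).toMeasure z ν M₀)
    (hmean : ∀ z ∈ S, ∫ w, (lin e₁ e₂ w - lin e₁ e₂ z) ∂(p z).toMeasure = 0)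
    (hν : 2 < ν) (hγν : 2 - ν < γ) (hγ : γ ≤ ν) (hpos : ∀ z, z ≠ 0 → 0 ≤ G (lin e₁ e₂ z))
    (haxis : ∀ M : ℕ, ∃ κ > 0, ∀ᶠ z in far e₁ e₂ S, c z ≤ M →
      κ * ‖lin e₁ e₂ z‖ ^ (γ - 1) ≤ G (lin e₁ e₂ z)) :
    ∃ D : ℝ, 0 ≤ D ∧ ∀ K C δ M ε, IsCorrector p e₁ e₂ S c K C δ M ε → ∀ η > 0,
      ∀ᶠ z in far e₁ e₂ S, ∫ w, G (lin e₁ e₂ w) * K (c w) ∂(p z).toMeasure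
        - G (lin e₁ e₂ z) * K (c z) ≤ (D * ε + η) * ‖lin e₁ e₂ z‖ ^ (γ - 2) := by
  -- Jumps may land near 0, where a negative degree is of no use, hence the truncation at 0. The
  -- assumptions on ν make the resulting error order Γ - ν less than γ - 2.
  set Γ := max (γ - 1) 0 with hΓ
  have hΓ0 : 0 ≤ Γ := le_max_right _ _
  have hΓ1 : γ - 1 ≤ Γ := le_max_left _ _
  have hΓν : Γ ≤ ν := max_le (by linarith) (by linarith)
  have hΓ2 : Γ - ν < γ - 2 := by
    rcases max_choice (γ - 1) 0 with h | h <;> rw [hΓ, h] <;> linarith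
  obtain ⟨D, hD0, hD⟩ := hG.jump_zero he hΓ0 hΓ1 hΓν
  obtain ⟨C₁, hC₁0, hC₁⟩ := hG.drift_zero he hS (by linarith) hΓ0 hΓ1 hΓν
  obtain ⟨C₂, hC₂0, hC₂⟩ := hG.drift_one he hS hΓ0 hΓ1 hΓν one_le_two le_rfl hν.le
  refine ⟨D, hD0, fun K C δ M ε hK η hη => ?_⟩
  have hC0 : 0 ≤ C := (abs_nonneg _).trans (hK.bdd 0)
  obtain ⟨κ, hκ, haxis⟩ := haxis M
  have hδ := hK.pos
  -- negligible terms
  have hT2 : Small e₁ e₂ S (γ - 2) fun z => K (c z) *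
      (∫ w, G (lin e₁ e₂ w) ∂(p z).toMeasure - G (lin e₁ e₂ z)) := by
    refine Small.bdd_mul (C := C) ?_ (fun z => hK.bdd _)
    refine small_of_bound (a := γ - 1 - 2) (b := Γ - ν) (by linarith) hΓ2 hC₂0 fun z hz hz0 => ?_
    have := hC₂ z hz hz0
    rwa [hmean z hz, mul_zero, Complex.zero_re, sub_zero] at this
  have hT1 : Small e₁ e₂ S (γ - 2) fun z => D * (2 * C) * |M₀| * ‖lin e₁ e₂ z‖ ^ (Γ - ν) :=
    small_rpow hΓ2 _
  have hT3 : Small e₁ e₂ S (γ - 1) fun z => 2 * C * C₁ * ‖lin e₁ e₂ z‖ ^ (γ - 1 - 1) +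
      2 * C * C₁ * ‖lin e₁ e₂ z‖ ^ (Γ - ν) :=
    (small_rpow (by linarith) _).add (small_rpow (by linarith) _)
  have hT4 : Small e₁ e₂ S (γ - 1) fun z => η * ‖lin e₁ e₂ z‖ ^ (γ - 2) :=
    small_rpow (by linarith) _
  filter_upwards [hT2 (η / 2) (by positivity), hT1 (η / 2) (by positivity),
    hT3 (δ * κ / 2) (by positivity), hT4 (δ * κ / 2) (by positivity), haxis, far_mem,
    far_ge 1] with z t2 t1 t3 t4 hax hz hV
  have hz0 : z ≠ 0 := ne_zero_of_one_le hV
  set V := ‖lin e₁ e₂ z‖ with hVdef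
  have hV0 : 0 < V := by linarith
  set μ := (p z).toMeasure with hμ
  obtain ⟨hGi, hGd⟩ := hC₁ z hz hz0
  have hGs : Integrable (fun w => G (lin e₁ e₂ w) - G (lin e₁ e₂ z)) μ :=
    hGi.sub (integrable_const _)
  have hKi : Integrable (fun w => K (c w)) μ := integrable_bdd _ (fun w => hK.bdd (c w))
  have hΔ : ∀ w, |K (c w) - K (c z)| ≤ 2 * C := fun w => by
    have := abs_sub (K (c w)) (K (c z))
    have := hK.bdd (c w); have := hK.bdd (c z); linarith
  have hprod : Integrable (fun w => (G (lin e₁ e₂ w) - G (lin e₁ e₂ z)) * (K (c w) - K (c z))) μ :=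
    Integrable.mul_bdd_discrete hGs hΔ
  -- Discrete product rule. The term with the increment of `G` alone is negligible by centring; the
  -- term with the increment of `K` alone has a sign; only the product of increments needs the
  -- oscillation bound.
  have hsplit : ∫ w, G (lin e₁ e₂ w) * K (c w) ∂μ - G (lin e₁ e₂ z) * K (c z)
      = ∫ w, (G (lin e₁ e₂ w) - G (lin e₁ e₂ z)) * (K (c w) - K (c z)) ∂μ
        + K (c z) * (∫ w, G (lin e₁ e₂ w) ∂μ - G (lin e₁ e₂ z))
        + G (lin e₁ e₂ z) * (∫ w, K (c w) ∂μ - K (c z)) := by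
    have e1 : ∀ w, G (lin e₁ e₂ w) * K (c w)
        = (G (lin e₁ e₂ w) - G (lin e₁ e₂ z)) * (K (c w) - K (c z))
          + (K (c z) * (G (lin e₁ e₂ w) - G (lin e₁ e₂ z)) + G (lin e₁ e₂ z) * K (c w)) :=
      fun w => by ring
    rw [integral_congr_ae (Filter.Eventually.of_forall e1)]
    have i2 := hGs.const_mul (K (c z))
    have i3 := hKi.const_mul (G (lin e₁ e₂ z))
    have i23 : Integrable (fun w => K (c z) * (G (lin e₁ e₂ w) - G (lin e₁ e₂ z))
        + G (lin e₁ e₂ z) * K (c w)) μ := i2.add i3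
    rw [integral_add hprod i23, integral_add i2 i3, integral_const_mul, integral_const_mul,
      integral_sub hGi (integrable_const _)]
    simp
    ring
  rw [hsplit]
  have hT2' := le_of_abs_le t2
  -- Near the axis the strict decrease of `K`, multiplied by `G` of order γ - 1, absorbs everything
  -- of order γ - 2. Away from it the product of increments is of size ε by `osc`; the part from
  -- long jumps is bounded by the ν-th moment.
  by_cases hM : c z ≤ M
  · have h3 : G (lin e₁ e₂ z) * (∫ w, K (c w) ∂μ - K (c z)) ≤ -(δ * κ) * V ^ (γ - 1) := by
      have e1 := hax hM
      have e2 := hK.strict z hz hM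
      have e3 : 0 ≤ κ * V ^ (γ - 1) := by positivity
      nlinarith
    have h1 : ∫ w, (G (lin e₁ e₂ w) - G (lin e₁ e₂ z)) * (K (c w) - K (c z)) ∂μ
        ≤ δ * κ / 2 * V ^ (γ - 1) := by
      refine le_trans ?_ (le_of_abs_le t3)
      calc _ ≤ ∫ w, |G (lin e₁ e₂ w) - G (lin e₁ e₂ z)| * (2 * C) ∂μ := by
            refine integral_mono hprod (hGs.abs.mul_const _) fun w => ?_
            refine (le_abs_self _).trans ?_
            rw [abs_mul]
            exact mul_le_mul_of_nonneg_left (hΔ w) (abs_nonneg _)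
        _ = (∫ w, |G (lin e₁ e₂ w) - G (lin e₁ e₂ z)| ∂μ) * (2 * C) := integral_mul_const _ _
        _ ≤ (C₁ * (V ^ (γ - 1 - 1) + V ^ (Γ - ν))) * (2 * C) := by gcongr
        _ = _ := by ring
    have h4 := le_of_abs_le t4
    have h5 : 0 ≤ D * ε * V ^ (γ - 2) := by
      have := hK.eps_nonneg
      positivity
    have h6 : 0 ≤ η * V ^ (γ - 2) := by positivity
    linarith
  · have h3 : G (lin e₁ e₂ z) * (∫ w, K (c w) ∂μ - K (c z)) ≤ 0 :=
      mul_nonpos_of_nonneg_of_nonpos (hpos z hz0) (by linarith [hK.super z hz])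
    have hm := hS z hz
    have hj : Integrable (fun w => ‖lin e₁ e₂ w - lin e₁ e₂ z‖ * |K (c w) - K (c z)|) μ :=
      Integrable.mul_bdd_discrete (hm.integrable_jump (by linarith)).norm
        (fun w => by rw [abs_abs]; exact hΔ w)
    have h1 : ∫ w, (G (lin e₁ e₂ w) - G (lin e₁ e₂ z)) * (K (c w) - K (c z)) ∂μ
        ≤ D * ε * V ^ (γ - 2) + η / 2 * V ^ (γ - 2) := by
      calc _ ≤ ∫ w, (D * V ^ (γ - 2) * (‖lin e₁ e₂ w - lin e₁ e₂ z‖ * |K (c w) - K (c z)|)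
            + D * V ^ (Γ - ν) * (2 * C) * ‖lin e₁ e₂ w - lin e₁ e₂ z‖ ^ ν) ∂μ := by
            refine integral_mono hprod ((hj.const_mul _).add (hm.1.const_mul _)) fun w => ?_
            refine (le_abs_self _).trans ?_
            rw [abs_mul]
            refine (mul_le_mul_of_nonneg_right (hD z w hz0) (abs_nonneg _)).trans ?_
            rw [jumpError, Real.rpow_one, show γ - 1 - 1 = γ - 2 by ring, ← hVdef]
            have e2 : V ^ (Γ - ν) * ‖lin e₁ e₂ w - lin e₁ e₂ z‖ ^ ν * |K (c w) - K (c z)|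
                ≤ V ^ (Γ - ν) * ‖lin e₁ e₂ w - lin e₁ e₂ z‖ ^ ν * (2 * C) := by
              gcongr
              exact hΔ w
            have e3 := mul_le_mul_of_nonneg_left e2 hD0
            linarith
        _ = D * V ^ (γ - 2) * ∫ w, ‖lin e₁ e₂ w - lin e₁ e₂ z‖ * |K (c w) - K (c z)| ∂μ
            + D * V ^ (Γ - ν) * (2 * C) * ∫ w, ‖lin e₁ e₂ w - lin e₁ e₂ z‖ ^ ν ∂μ := by
            rw [integral_add (hj.const_mul _) (hm.1.const_mul _), integral_const_mul,
              integral_const_mul]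
        _ ≤ D * V ^ (γ - 2) * ε + D * V ^ (Γ - ν) * (2 * C) * |M₀| := by
            gcongr
            · exact hK.osc z hz (by omega)
            · exact hm.2.trans (le_abs_self _)
        _ ≤ _ := by
            have := le_of_abs_le t1
            linarith
    linarith

end Corrector

/-- A homogeneous function near a ray. -/
lemma TaylorData.near_axis {β : ℝ} {H : ℂ → ℝ} {A B : ℂ → ℂ} {Λ : ℂ → ℝ}
    (hH : TaylorData β H A B Λ) {e : ℂ} (he : e ∈ upper) (C₀ : ℝ) :
    ∃ C : ℝ, 0 ≤ C ∧ ∀ (x : ℝ) (ζ : ℂ), 0 < x → ζ ∈ upper → ‖ζ - x * e‖ ≤ C₀ →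
      2 * C₀ ≤ x * ‖e‖ → |H ζ - x ^ β * H e| ≤ C * x ^ (β - 1) ∧
        ‖A ζ - (x ^ (β - 1) : ℝ) * A e‖ ≤ C * x ^ (β - 2) := by
  obtain ⟨C₁, h₁, hC₁⟩ := hH.lipschitz
  obtain ⟨C₂, h₂, hC₂⟩ := hH.gradient_lipschitz
  have hn : 0 < ‖e‖ := norm_pos_iff.2 (upper_ne_zero he)
  refine ⟨C₁ * ‖e‖ ^ (β - 1) * |C₀| + C₂ * ‖e‖ ^ (β - 2) * |C₀|, by positivity,
    fun x ζ hx hζ hd hx2 => ?_⟩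
  have hnx : ‖(x : ℂ) * e‖ = x * ‖e‖ := by rw [norm_mul, Complex.norm_of_nonneg hx.le]
  have hs : SmallStep (x * e) (ζ - x * e) :=
    ⟨upper_smul he hx, by simpa using hζ, by rw [hnx]; linarith⟩
  have e1 := hC₁ _ _ hs
  have e2 := hC₂ _ _ hs
  rw [add_sub_cancel, hnx, Real.mul_rpow hx.le hn.le] at e1 e2
  rw [hH.homogeneous e he x hx] at e1
  rw [hH.gradient_homogeneous e he x hx] at e2
  have hd' : ‖ζ - x * e‖ ≤ |C₀| := hd.trans (le_abs_self _)
  constructor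
  · refine e1.trans ?_
    calc C₁ * (x ^ (β - 1) * ‖e‖ ^ (β - 1)) * ‖ζ - x * e‖
        ≤ C₁ * (x ^ (β - 1) * ‖e‖ ^ (β - 1)) * |C₀| := by gcongr
      _ = C₁ * ‖e‖ ^ (β - 1) * |C₀| * x ^ (β - 1) := by ring
      _ ≤ _ := by gcongr; exact le_add_of_nonneg_right (by positivity)
  · refine e2.trans ?_
    calc C₂ * (x ^ (β - 2) * ‖e‖ ^ (β - 2)) * ‖ζ - x * e‖
        ≤ C₂ * (x ^ (β - 2) * ‖e‖ ^ (β - 2)) * |C₀| := by gcongr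
      _ = C₂ * ‖e‖ ^ (β - 2) * |C₀| * x ^ (β - 2) := by ring
      _ ≤ _ := by gcongr; exact le_add_of_nonneg_left (by positivity)

/-! ### Drift at the two boundaries -/

section Boundary

variable {p : ℕ × ℕ → PMF (ℕ × ℕ)} {e₁ e₂ : ℂ} {S : Set (ℕ × ℕ)}

/-- Comparison of the norm with the longitudinal coordinate near an axis. -/
lemma near_axis_comparable {e : ℂ} (he : e ≠ 0) {x : ℕ × ℕ → ℕ} {C₀ : ℝ}
    (hx : ∀ z ∈ S, ‖lin e₁ e₂ z - x z * e‖ ≤ C₀) (a : ℝ) :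
    ∃ κ C : ℝ, 0 < κ ∧ 0 < C ∧ ∀ᶠ z in far e₁ e₂ S, 0 < (x z : ℝ) ∧ 2 * C₀ ≤ x z * ‖e‖ ∧
      κ * ‖lin e₁ e₂ z‖ ^ a ≤ (x z : ℝ) ^ a ∧ (x z : ℝ) ^ a ≤ C * ‖lin e₁ e₂ z‖ ^ a := by
  have hn : 0 < ‖e‖ := norm_pos_iff.2 he
  refine ⟨(2 ^ |a| * ‖e‖ ^ a)⁻¹, 2 ^ |a| * (‖e‖ ^ a)⁻¹, by positivity, by positivity, ?_⟩
  filter_upwards [far_mem, far_ge (4 * |C₀| + 1)] with z hz hV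
  have hd := (hx z hz).trans (le_abs_self C₀)
  set V := ‖lin e₁ e₂ z‖ with hVd
  have hxe : ‖(x z : ℂ) * e‖ = x z * ‖e‖ := by rw [norm_mul, Complex.norm_natCast]
  have h1 : V ≤ x z * ‖e‖ + |C₀| := by
    have := norm_add_le ((x z : ℂ) * e) (lin e₁ e₂ z - x z * e)
    rw [add_sub_cancel, hxe] at this
    linarith
  have h2 : x z * ‖e‖ ≤ V + |C₀| := by
    have := norm_sub_le (lin e₁ e₂ z) (lin e₁ e₂ z - x z * e)
    rw [sub_sub_cancel, hxe] at this
    linarith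
  have hC := abs_nonneg C₀
  have hy : 0 < x z * ‖e‖ := by linarith
  have hx0 : 0 < (x z : ℝ) := pos_of_mul_pos_left hy hn.le
  have h3 := rpow_le_of_comparable (x := V) (y := x z * ‖e‖) (by linarith) (by linarith)
    (by linarith) a
  have h4 := rpow_le_of_comparable (x := x z * ‖e‖) (y := V) hy (by linarith) (by linarith) a
  rw [Real.mul_rpow hx0.le hn.le] at h3 h4
  have hea : 0 < ‖e‖ ^ a := by positivity
  refine ⟨hx0, by linarith [le_abs_self C₀], ?_, ?_⟩
  · rw [inv_mul_le_iff₀ (by positivity)]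
    linarith
  · rw [mul_assoc, inv_mul_eq_div, mul_div_assoc', le_div_iff₀ hea]
    exact h3

lemma TaylorData.small_near_axis {β : ℝ} {H : ℂ → ℝ} {A B : ℂ → ℂ} {Λ : ℂ → ℝ}
    (hH : TaylorData β H A B Λ) (hc : IsCone e₁ e₂) {e : ℂ} (he : e ∈ upper) {x : ℕ × ℕ → ℕ}
    {C₀ : ℝ} (hx : ∀ z ∈ S, ‖lin e₁ e₂ z - x z * e‖ ≤ C₀) :
    Small e₁ e₂ S β (fun z => H (lin e₁ e₂ z) - (x z : ℝ) ^ β * H e) ∧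
    Small e₁ e₂ S (β - 1)
      (fun z => ‖A (lin e₁ e₂ z) - (((x z : ℝ) ^ (β - 1) : ℝ) : ℂ) * A e‖) := by
  obtain ⟨C, hC0, hC⟩ := hH.near_axis he C₀
  obtain ⟨κ₁, D₁, _, hD₁, h₁⟩ := near_axis_comparable (upper_ne_zero he) hx (β - 1)
  obtain ⟨κ₂, D₂, _, hD₂, h₂⟩ := near_axis_comparable (upper_ne_zero he) hx (β - 2)
  constructor
  · refine (small_rpow (show β - 1 < β by linarith) (C * D₁)).of_le ?_
    filter_upwards [h₁, far_mem, far_ge 1] with z h hz hV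
    have := (hC (x z) _ h.1 (lin_mem_upper hc (ne_zero_of_one_le hV)) (by exact_mod_cast hx z hz)
      h.2.1).1
    rw [abs_of_nonneg (a := C * D₁ * _) (by positivity), mul_assoc]
    exact this.trans (mul_le_mul_of_nonneg_left h.2.2.2 hC0)
  · refine (small_rpow (show β - 2 < β - 1 by linarith) (C * D₂)).of_le ?_
    filter_upwards [h₂, far_mem, far_ge 1] with z h hz hV
    have := (hC (x z) _ h.1 (lin_mem_upper hc (ne_zero_of_one_le hV)) (by exact_mod_cast hx z hz)
      h.2.1).2
    rw [abs_of_nonneg (a := C * D₂ * _) (by positivity), mul_assoc, abs_norm]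
    exact this.trans (mul_le_mul_of_nonneg_left h.2.2.2 hC0)

/-- The drift at a boundary is negative of order `γ - 1`. -/
theorem boundary_drift {ν M₀ γ : ℝ} {F G G' : ℂ → ℝ} {A B A₁ B₁ A₂ B₂ : ℂ → ℂ} {Λ Λ₁ Λ₂ : ℂ → ℝ}
    (he : IsCone e₁ e₂) (hS : ∀ z ∈ S, JumpMoment e₁ e₂ (p z).toMeasure z ν M₀)
    (hν : 1 < ν) (hγν : 1 - ν < γ) (hγ : γ ≤ ν) (hF : TaylorData γ F A B Λ)
    (hG : TaylorData (γ - 1) G A₁ B₁ Λ₁) (hG' : TaylorData (γ - 1) G' A₂ B₂ Λ₂)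
    {e : ℂ} (heU : e ∈ upper) {x : ℕ × ℕ → ℕ} {C₀ : ℝ}
    (hx : ∀ z ∈ S, ‖lin e₁ e₂ z - x z * e‖ ≤ C₀) {K K' : ℕ × ℕ → ℝ} {C : ℝ}
    (hK : ∀ z, |K z| ≤ C) (hK' : ∀ z, |K' z| ≤ C)
    {v : ℕ × ℕ → ℂ} {Cv : ℝ} (hv : ∀ z ∈ S, ∫ w, (lin e₁ e₂ w - lin e₁ e₂ z) ∂(p z).toMeasure = v z)
    (hvC : ∀ z, ‖v z‖ ≤ Cv) {δ : ℝ} (hδ : 0 < δ)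
    (hdr : ∀ z ∈ S, (A e * v z).re + G e * (∫ w, K w ∂(p z).toMeasure - K z) ≤ -δ)
    (hG'e : G' e = 0) :
    ∃ κ > 0, ∀ᶠ z in far e₁ e₂ S,
      ∫ w, (F (lin e₁ e₂ w) + G (lin e₁ e₂ w) * K w + G' (lin e₁ e₂ w) * K' w) ∂(p z).toMeasure
        - (F (lin e₁ e₂ z) + G (lin e₁ e₂ z) * K z + G' (lin e₁ e₂ z) * K' z)
        ≤ -κ * ‖lin e₁ e₂ z‖ ^ (γ - 1) := by
  have hC0 : 0 ≤ C := (abs_nonneg _).trans (hK 0)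
  have hCv0 : 0 ≤ Cv := (norm_nonneg _).trans (hvC 0)
  set Γ := max γ 0 with hΓ
  have hΓ0 : 0 ≤ Γ := le_max_right _ _
  have hΓν : Γ ≤ ν := max_le (by linarith) (by linarith)
  have hΓ2 : Γ - ν < γ - 1 := by
    rcases max_choice γ 0 with h | h <;> rw [hΓ, h] <;> linarith
  set Γ' := max (γ - 1) 0 with hΓ'
  have hΓ'0 : 0 ≤ Γ' := le_max_right _ _
  have hΓ'1 : γ - 1 ≤ Γ' := le_max_left _ _
  have hΓ'ν : Γ' ≤ ν := max_le (by linarith) (by linarith)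
  have hΓ'2 : Γ' - ν < γ - 1 := by
    rcases max_choice (γ - 1) 0 with h | h <;> rw [hΓ', h] <;> linarith
  -- Only a moment of order ν > 1 is available at the boundary; any s > 1 makes the first-order
  -- error γ - s smaller than γ - 1.
  set s := min 2 ν with hs
  have hs1 : 1 < s := lt_min (by norm_num) hν
  obtain ⟨CF, hCF0, hCF⟩ := hF.drift_one he hS hΓ0 (le_max_left _ _) hΓν hs1.le (min_le_left _ _)
    (min_le_right _ _)
  obtain ⟨CF', hCF'0, hCF'⟩ := hF.drift_zero he hS hν.le hΓ0 (le_max_left _ _) hΓν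
  obtain ⟨CG, hCG0, hCG⟩ := hG.drift_zero he hS hν.le hΓ'0 hΓ'1 hΓ'ν
  obtain ⟨CG', hCG'0, hCG'⟩ := hG'.drift_zero he hS hν.le hΓ'0 hΓ'1 hΓ'ν
  have t1 : Small e₁ e₂ S (γ - 1) fun z => ∫ w, F (lin e₁ e₂ w) ∂(p z).toMeasure
      - F (lin e₁ e₂ z) - (A (lin e₁ e₂ z) * v z).re := by
    refine small_of_bound (a := γ - s) (b := Γ - ν) (by linarith) hΓ2 hCF0 fun z hz hz0 => ?_
    rw [← hv z hz]
    exact hCF z hz hz0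
  have t2 := ((hF.small_near_axis he heU hx).2).bdd_mul (k := fun _ => Cv) (C := Cv)
    (fun _ => by rw [abs_of_nonneg hCv0])
  have t3 : Small e₁ e₂ S (γ - 1) fun z =>
      C * ∫ w, |G (lin e₁ e₂ w) - G (lin e₁ e₂ z)| ∂(p z).toMeasure := by
    refine Small.bdd_mul (C := C) ?_ (fun _ => by rw [abs_of_nonneg hC0])
    refine small_of_bound (a := γ - 1 - 1) (b := Γ' - ν) (by linarith) hΓ'2 hCG0 fun z hz hz0 => ?_
    rw [abs_of_nonneg (integral_nonneg fun _ => abs_nonneg _)]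
    exact (hCG z hz hz0).2
  have t4 : Small e₁ e₂ S (γ - 1) fun z =>
      C * ∫ w, |G' (lin e₁ e₂ w) - G' (lin e₁ e₂ z)| ∂(p z).toMeasure := by
    refine Small.bdd_mul (C := C) ?_ (fun _ => by rw [abs_of_nonneg hC0])
    refine small_of_bound (a := γ - 1 - 1) (b := Γ' - ν) (by linarith) hΓ'2 hCG'0 fun z hz hz0 => ?_
    rw [abs_of_nonneg (integral_nonneg fun _ => abs_nonneg _)]
    exact (hCG' z hz hz0).2
  have hKd : ∀ (L : ℕ × ℕ → ℝ), (∀ z, |L z| ≤ C) → ∀ z,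
      |∫ w, L w ∂(p z).toMeasure - L z| ≤ 2 * C := by
    intro L hL z
    have h1 : |∫ w, L w ∂(p z).toMeasure| ≤ C := by
      have := norm_integral_le_of_norm_le_const (μ := (p z).toMeasure) (f := L) (C := C)
        (Filter.Eventually.of_forall fun w => hL w)
      simpa using this
    have := abs_sub (∫ w, L w ∂(p z).toMeasure) (L z)
    linarith [hL z]
  have t5 := ((hG.small_near_axis he heU hx).1).bdd_mul (hKd K hK)
  -- The other corrector is harmless here: its factor `G'` vanishes on this axis and is therefore of
  -- lower order along it.
  have t6 := ((hG'.small_near_axis he heU hx).1).bdd_mul (hKd K' hK')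
  obtain ⟨κ, D, hκ, hD, hcomp⟩ := near_axis_comparable (upper_ne_zero heU) hx (γ - 1)
  refine ⟨δ * κ / 2, by positivity, ?_⟩
  have hε : 0 < δ * κ / 12 := by positivity
  filter_upwards [t1 _ hε, t2 _ hε, t3 _ hε, t4 _ hε, t5 _ hε, t6 _ hε, hcomp, far_mem,
    far_ge 1] with z u1 u2 u3 u4 u5 u6 hcz hz hV
  have hz0 : z ≠ 0 := ne_zero_of_one_le hV
  have hFi := (hCF' z hz hz0).1
  have hGi := (hCG z hz hz0).1
  have hG'i := (hCG' z hz hz0).1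
  have main : ∀ {H : ℂ → ℝ} {L : ℕ × ℕ → ℝ}, Integrable (fun w => H (lin e₁ e₂ w)) (p z).toMeasure →
      (∀ z, |L z| ≤ C) → Integrable (fun w => H (lin e₁ e₂ w) * L w) (p z).toMeasure ∧
      ∫ w, H (lin e₁ e₂ w) * L w ∂(p z).toMeasure - H (lin e₁ e₂ z) * L z
        ≤ C * ∫ w, |H (lin e₁ e₂ w) - H (lin e₁ e₂ z)| ∂(p z).toMeasure
          + (∫ w, L w ∂(p z).toMeasure - L z) * H (lin e₁ e₂ z) := by
    intro H L hH hL
    have i1 : Integrable (fun w => H (lin e₁ e₂ w) * L w) (p z).toMeasure :=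
      Integrable.mul_bdd_discrete hH hL
    have i2 : Integrable L (p z).toMeasure := integrable_bdd _ hL
    have i3 : Integrable (fun w => H (lin e₁ e₂ w) - H (lin e₁ e₂ z)) (p z).toMeasure :=
      hH.sub (integrable_const _)
    refine ⟨i1, ?_⟩
    have h1 : ∫ w, H (lin e₁ e₂ w) * L w ∂(p z).toMeasure
        ≤ ∫ w, (C * |H (lin e₁ e₂ w) - H (lin e₁ e₂ z)| + H (lin e₁ e₂ z) * L w)
          ∂(p z).toMeasure := by
      refine integral_mono i1 ((i3.abs.const_mul C).add (i2.const_mul _)) fun w => ?_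
      have h2 : (H (lin e₁ e₂ w) - H (lin e₁ e₂ z)) * L w
          ≤ C * |H (lin e₁ e₂ w) - H (lin e₁ e₂ z)| := by
        refine (le_abs_self _).trans ?_
        rw [abs_mul, mul_comm]
        exact mul_le_mul_of_nonneg_right (hL w) (abs_nonneg _)
      show H (lin e₁ e₂ w) * L w ≤ C * |H (lin e₁ e₂ w) - H (lin e₁ e₂ z)| + H (lin e₁ e₂ z) * L w
      linarith
    rw [integral_add (i3.abs.const_mul C) (i2.const_mul _), integral_const_mul,
      integral_const_mul] at h1
    linarith
  obtain ⟨j1, m1⟩ := main hGi hK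
  obtain ⟨j2, m2⟩ := main hG'i hK'
  have j3 : Integrable (fun w => F (lin e₁ e₂ w) + G (lin e₁ e₂ w) * K w) (p z).toMeasure :=
    hFi.add j1
  rw [integral_add j3 j2, integral_add hFi j1]
  have hd := hdr z hz
  have hxp : 0 < (x z : ℝ) ^ (γ - 1) := Real.rpow_pos_of_pos hcz.1 _
  set X := (x z : ℝ) ^ (γ - 1) with hX
  have h1 : (A (lin e₁ e₂ z) * v z).re ≤ X * (A e * v z).re
      + Cv * ‖A (lin e₁ e₂ z) - (X : ℂ) * A e‖ := by
    have e1 : A (lin e₁ e₂ z) * v z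
        = (X : ℂ) * (A e * v z) + (A (lin e₁ e₂ z) - (X : ℂ) * A e) * v z := by ring
    rw [e1, Complex.add_re, Complex.re_ofReal_mul]
    have e2 : ((A (lin e₁ e₂ z) - (X : ℂ) * A e) * v z).re
        ≤ ‖A (lin e₁ e₂ z) - (X : ℂ) * A e‖ * ‖v z‖ := by
      rw [← norm_mul]; exact Complex.re_le_norm _
    have e3 : ‖A (lin e₁ e₂ z) - (X : ℂ) * A e‖ * ‖v z‖
        ≤ ‖A (lin e₁ e₂ z) - (X : ℂ) * A e‖ * Cv := by gcongr; exact hvC z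
    linarith
  have h2 : X * ((A e * v z).re + G e * (∫ w, K w ∂(p z).toMeasure - K z)) ≤ X * -δ :=
    mul_le_mul_of_nonneg_left hd hxp.le
  have h3 : δ * (κ * ‖lin e₁ e₂ z‖ ^ (γ - 1)) ≤ δ * X :=
    mul_le_mul_of_nonneg_left hcz.2.2.1 hδ.le
  rw [hG'e, mul_zero, sub_zero] at u6
  have w1 := le_of_abs_le u1
  have w2 := le_of_abs_le u2
  have w3 := le_of_abs_le u3
  have w4 := le_of_abs_le u4
  have w5 := le_of_abs_le u5
  have w6 := le_of_abs_le u6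
  nlinarith

/-- Changing a function on a bounded set has a negligible effect on the drift. -/
lemma small_modification {ν M₀ β : ℝ} (hS : ∀ z ∈ S, JumpMoment e₁ e₂ (p z).toMeasure z ν M₀)
    (hν : 0 < ν) (hβ : -ν < β) {d : ℕ × ℕ → ℝ} {C ρ : ℝ} (hd : ∀ z, |d z| ≤ C)
    (hρ : ∀ z, ρ ≤ ‖lin e₁ e₂ z‖ → d z = 0) :
    Small e₁ e₂ S β fun z => ∫ w, d w ∂(p z).toMeasure := by
  have hC0 : 0 ≤ C := (abs_nonneg _).trans (hd 0)
  refine (small_rpow hβ (C * 2 ^ ν * |M₀|)).of_le ?_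
  filter_upwards [far_mem, far_ge (2 * |ρ| + 1)] with z hz hV
  set V := ‖lin e₁ e₂ z‖ with hVd
  have hV0 : 0 < V := by linarith [abs_nonneg ρ]
  -- Markov's inequality in pointwise form: reaching the bounded set from distance `V` takes a jump
  -- of size at least V/2.
  have hle : ∀ w, |d w| ≤ C * 2 ^ ν * V ^ (-ν) * ‖lin e₁ e₂ w - lin e₁ e₂ z‖ ^ ν := by
    intro w
    rcases le_or_gt ρ ‖lin e₁ e₂ w‖ with h | h
    · rw [hρ w h, abs_zero]; positivity
    · have h1 : V / 2 ≤ ‖lin e₁ e₂ w - lin e₁ e₂ z‖ := by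
        have := norm_sub_le (lin e₁ e₂ w) (lin e₁ e₂ w - lin e₁ e₂ z)
        rw [sub_sub_cancel] at this
        have := le_abs_self ρ
        linarith
      have h2 : 1 ≤ 2 ^ ν * V ^ (-ν) * ‖lin e₁ e₂ w - lin e₁ e₂ z‖ ^ ν := by
        rw [Real.rpow_neg hV0.le, ← Real.inv_rpow hV0.le, ← Real.mul_rpow (by norm_num) (by positivity),
          ← Real.mul_rpow (by positivity) (by positivity)]
        refine Real.one_le_rpow ?_ hν.le
        rw [mul_assoc, inv_mul_eq_div, mul_div_assoc', le_div_iff₀ hV0]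
        linarith
      refine (hd w).trans ?_
      calc C = C * 1 := (mul_one _).symm
        _ ≤ C * (2 ^ ν * V ^ (-ν) * ‖lin e₁ e₂ w - lin e₁ e₂ z‖ ^ ν) := by gcongr
        _ = _ := by ring
  have hm := hS z hz
  calc |∫ w, d w ∂(p z).toMeasure| ≤ ∫ w, |d w| ∂(p z).toMeasure := abs_integral_le_integral_abs
    _ ≤ ∫ w, C * 2 ^ ν * V ^ (-ν) * ‖lin e₁ e₂ w - lin e₁ e₂ z‖ ^ ν ∂(p z).toMeasure :=
        integral_mono (integrable_bdd _ hd).abs (hm.1.const_mul _) hle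
    _ = C * 2 ^ ν * V ^ (-ν) * ∫ w, ‖lin e₁ e₂ w - lin e₁ e₂ z‖ ^ ν ∂(p z).toMeasure :=
        integral_const_mul _ _
    _ ≤ C * 2 ^ ν * V ^ (-ν) * |M₀| := by
        gcongr; exact hm.2.trans (le_abs_self _)
    _ = C * 2 ^ ν * |M₀| * V ^ (-ν) := by ring
    _ ≤ _ := le_abs_self _

end Boundary

/-! ### The transformed walk -/

/-- The walk in the coordinates in which the interior covariance is the identity: the axes are
`e₁`, `e₂`, the boundary drifts are `v₁`, `v₂`, and the transverse coordinate near the boundaries is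
governed by `q₁`, `q₂`. -/
structure IsWalk (R : ℕ) (p : ℕ × ℕ → PMF (ℕ × ℕ)) (p₀ : PMF (ℤ × ℤ)) (q₁ q₂ : ℕ → PMF ℕ)
    (e₁ e₂ : ℂ) (v₁ v₂ : ℕ → ℂ) (ν₀ ν : ℝ) : Prop where
  cone : IsCone e₁ e₂
  two_lt : 2 < ν₀
  one_lt : 1 < ν
  le : ν ≤ ν₀
  increment : ∀ z ∈ interiorRegion R, p₀ = (p z).map fun w => toInt w - toInt z
  chain₁ : IsBoundaryChain R q₁ (p₀.map Prod.snd)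
  chain₂ : IsBoundaryChain R q₂ (p₀.map Prod.fst)
  law₁ : ∀ z : ℕ × ℕ, R ≤ z.1 → (p z).map Prod.snd = q₁ z.2
  law₂ : ∀ z : ℕ × ℕ, R ≤ z.2 → (p z).map Prod.fst = q₂ z.1
  moment : ∃ M, ∀ z ∈ interiorRegion R, JumpMoment e₁ e₂ (p z).toMeasure z ν₀ M
  mean : ∀ z ∈ interiorRegion R, ∫ w, (lin e₁ e₂ w - lin e₁ e₂ z) ∂(p z).toMeasure = 0
  mean_sq : ∀ z ∈ interiorRegion R, ∫ w, (lin e₁ e₂ w - lin e₁ e₂ z) ^ 2 ∂(p z).toMeasure = 0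
  mean_norm_sq : ∀ z ∈ interiorRegion R,
    ∫ w, ‖lin e₁ e₂ w - lin e₁ e₂ z‖ ^ 2 ∂(p z).toMeasure = 2
  moment₁ : ∃ M, ∀ z ∈ horizontalBoundary R, JumpMoment e₁ e₂ (p z).toMeasure z ν M
  mean₁ : ∀ z ∈ horizontalBoundary R,
    ∫ w, (lin e₁ e₂ w - lin e₁ e₂ z) ∂(p z).toMeasure = v₁ z.2
  moment₂ : ∃ M, ∀ z ∈ verticalBoundary R, JumpMoment e₁ e₂ (p z).toMeasure z ν M
  mean₂ : ∀ z ∈ verticalBoundary R,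
    ∫ w, (lin e₁ e₂ w - lin e₁ e₂ z) ∂(p z).toMeasure = v₂ z.1

lemma lin_sub_lin (e₁ e₂ : ℂ) (w z : ℕ × ℕ) : lin e₁ e₂ w - lin e₁ e₂ z
    = ((toInt w - toInt z).1 : ℂ) * e₁ + ((toInt w - toInt z).2 : ℂ) * e₂ := by
  simp [lin, toInt]; ring

/-- Correctors for a transverse coordinate `c` whose law is given by a boundary chain. -/
lemma exists_isCorrector {R : ℕ} {p : ℕ × ℕ → PMF (ℕ × ℕ)} {p₀ : PMF (ℤ × ℤ)} {q : ℕ → PMF ℕ}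
    {e₁ e₂ : ℂ} {S S' : Set (ℕ × ℕ)} {c : ℕ × ℕ → ℕ} {d : ℤ × ℤ → ℤ}
    (h : IsBoundaryChain R q (p₀.map d)) {π : ℕ → ℝ≥0}
    (hπ : IsNormalizedInvariant R (fun i j => q i j) π)
    (hcd : ∀ z w, (c w : ℤ) = c z + d (toInt w - toInt z))
    (hp₀ : ∀ z ∈ S, p₀ = (p z).map fun w => toInt w - toInt z) (hSne : S.Nonempty)
    (hintg : ∀ z ∈ S, Integrable (fun w => lin e₁ e₂ w - lin e₁ e₂ z) (p z).toMeasure)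
    (hS : ∀ z ∈ S, R ≤ c z ∧ (p z).map c = q (c z))
    (hS' : ∀ z ∈ S', c z < R ∧ (p z).map c = q (c z)) {t : ℕ → ℝ}
    (ht : ∑ i : Fin R, (π i : ℝ) * t i < 0) {ε : ℝ} (hε : 0 < ε) :
    ∃ K C δ M, IsCorrector p e₁ e₂ S c K C δ M ε ∧
      ∀ z ∈ S', t (c z) + (∫ w, K (c w) ∂(p z).toMeasure - K (c z)) ≤ -δ := by
  have hwi : Integrable (fun a : ℤ × ℤ => ‖(a.1 : ℂ) * e₁ + (a.2 : ℂ) * e₂‖) p₀.toMeasure := by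
    obtain ⟨z, hz⟩ := hSne
    rw [hp₀ z hz, pmf_integrable_map _ _ .of_discrete]
    refine (hintg z hz).norm.congr (Filter.Eventually.of_forall fun w => ?_)
    simp only [lin_sub_lin]
  obtain ⟨K, C, δ, M, hδ, hC, h1, h2, h3, h4⟩ := h.exists_corrector hπ (t := fun i => t i) ht p₀
    (w := fun a : ℤ × ℤ => ‖(a.1 : ℂ) * e₁ + (a.2 : ℂ) * e₂‖) (fun _ => norm_nonneg _) hwi d
    (fun a ha => by
      rw [← PMF.mem_support_iff, PMF.mem_support_map_iff]
      exact ⟨a, by rwa [PMF.mem_support_iff], rfl⟩) hε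
  have hlaw : ∀ z, (p z).map c = q (c z) →
      ∫ w, K (c w) ∂(p z).toMeasure = ∫ j, K j ∂(q (c z)).toMeasure := by
    intro z hz
    rw [← hz, pmf_integral_map _ _ .of_discrete]
  refine ⟨K, C, δ, M, ⟨hC, hδ, hε.le, fun z hz => ?_, fun z hz hM => ?_, fun z hz hM => ?_⟩,
    fun z hz => ?_⟩
  · rw [hlaw z (hS z hz).2]; exact h2 _ (hS z hz).1
  · rw [hlaw z (hS z hz).2]; exact h3 _ (hS z hz).1 hM
  · have := h4 (c z) hM
    rw [hp₀ z hz, pmf_integral_map _ _ .of_discrete] at this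
    refine le_trans (le_of_eq (integral_congr_ae (Filter.Eventually.of_forall fun w => ?_))) this
    simp only
    rw [lin_sub_lin, ← hcd z w, Int.toNat_natCast]
  · rw [hlaw z (hS' z hz).2]
    exact h1 ⟨c z, (hS' z hz).1⟩

lemma finite_norm_lin_lt {e₁ e₂ : ℂ} (he : IsCone e₁ e₂) (ρ : ℝ) :
    {z : ℕ × ℕ | ‖lin e₁ e₂ z‖ < ρ}.Finite := by
  obtain ⟨c, hc, h⟩ := exists_norm_lin_ge he
  obtain ⟨N, hN⟩ := exists_nat_ge (ρ / c)
  refine (Set.finite_Iic ((N, N) : ℕ × ℕ)).subset fun z hz => ?_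
  have h1 := (h z).trans_lt hz
  have h2 : (z.1 + z.2 : ℝ) < N := by
    refine lt_of_lt_of_le ?_ hN
    rw [lt_div_iff₀ hc]; linarith
  have h3 : z.1 + z.2 < N := by exact_mod_cast h2
  exact ⟨by simp only; omega, by simp only; omega⟩

lemma bddAbove_abs_of_finite {d : ℕ × ℕ → ℝ} (h : {z | d z ≠ 0}.Finite) : ∃ C, ∀ z, |d z| ≤ C := by
  refine ⟨∑ z ∈ h.toFinset, |d z|, fun z => ?_⟩
  by_cases hz : d z = 0
  · rw [hz, abs_zero]
    exact Finset.sum_nonneg fun _ _ => abs_nonneg _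
  · exact Finset.single_le_sum (f := fun z => |d z|) (fun _ _ => abs_nonneg _) (by simpa using hz)

/-- The function `‖ζ‖ ^ (γ - 2) * Re (c ζ)`. -/
lemma re_epow_half (c : ℂ) (γ : ℝ) {ζ : ℂ} (hζ : ζ ≠ 0) :
    (c * epow (γ / 2 : ℝ) ((γ / 2 : ℝ) - 1) ζ).re = ‖ζ‖ ^ (γ - 2) * (c * ζ).re := by
  have h1 := epow_sub_one_left (γ / 2 : ℝ) ((γ / 2 : ℝ) - 1) ζ hζ
  have h2 := epow_eq_polar ((γ / 2 : ℝ) - 1) ((γ / 2 : ℝ) - 1) ζ hζ (γ - 2) (by push_cast; ring)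
  have h3 : epow (γ / 2 : ℝ) ((γ / 2 : ℝ) - 1) ζ = ((‖ζ‖ ^ (γ - 2) : ℝ) : ℂ) * ζ := by
    rw [h1, sub_self] at h2
    simp only [zero_mul, Complex.exp_zero, mul_one] at h2
    rw [← h2]; field_simp
  rw [h3, show c * (((‖ζ‖ ^ (γ - 2) : ℝ) : ℂ) * ζ) = ((‖ζ‖ ^ (γ - 2) : ℝ) : ℂ) * (c * ζ) by ring,
    Complex.re_ofReal_mul]

lemma TaylorData.pos_near_axis {e₁ e₂ : ℂ} {S : Set (ℕ × ℕ)} {β : ℝ} {G : ℂ → ℝ} {A B : ℂ → ℂ}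
    {Λ : ℂ → ℝ} (hG : TaylorData β G A B Λ) (hc : IsCone e₁ e₂) {e e' : ℂ} (he : e ∈ upper)
    (hGe : 0 < G e) {x c : ℕ × ℕ → ℕ} (hlin : ∀ z, lin e₁ e₂ z - x z * e = c z * e') (M : ℕ) :
    ∃ κ > 0, ∀ᶠ z in far e₁ e₂ S, c z ≤ M →
      κ * ‖lin e₁ e₂ z‖ ^ β ≤ G (lin e₁ e₂ z) := by
  have hx : ∀ z ∈ {z ∈ S | c z ≤ M}, ‖lin e₁ e₂ z - x z * e‖ ≤ M * ‖e'‖ := by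
    intro z hz
    rw [hlin, norm_mul, Complex.norm_natCast]
    gcongr
    exact hz.2
  obtain ⟨κ, C, hκ, -, h1⟩ := near_axis_comparable (upper_ne_zero he) hx β
  have h2 := (hG.small_near_axis hc he hx).1 (κ * G e / 2) (by positivity)
  refine ⟨κ * G e / 2, by positivity, ?_⟩
  obtain ⟨ρ, hρ⟩ := eventually_far.1 (h1.and h2)
  refine eventually_far.2 ⟨ρ, fun z hz hzρ hM => ?_⟩
  obtain ⟨a, b⟩ := hρ z ⟨hz, hM⟩ hzρ
  have b' := neg_le_of_abs_le b
  have := mul_le_mul_of_nonneg_right a.2.2.1 hGe.le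
  linarith

namespace IsWalk

variable {R : ℕ} {p : ℕ × ℕ → PMF (ℕ × ℕ)} {p₀ : PMF (ℤ × ℤ)} {q₁ q₂ : ℕ → PMF ℕ}
  {e₁ e₂ : ℂ} {v₁ v₂ : ℕ → ℂ} {ν₀ ν : ℝ}

/-- A homogeneous function with negative oblique derivatives on both axes and controlled Laplacian
has a perturbation of lower order with controlled drift. -/
theorem exists_perturbation (hW : IsWalk R p p₀ q₁ q₂ e₁ e₂ v₁ v₂ ν₀ ν) {π₁ π₂ : ℕ → ℝ≥0}
    (hπ₁ : IsNormalizedInvariant R (fun i j => q₁ i j) π₁)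
    (hπ₂ : IsNormalizedInvariant R (fun i j => q₂ i j) π₂) {γ lam lam' : ℝ} {F : ℂ → ℝ}
    {A B : ℂ → ℂ} {Λ : ℂ → ℝ} (hF : TaylorData γ F A B Λ)
    (h₁ : (A e₁ * ∑ i : Fin R, (π₁ i : ℂ) * v₁ i).re < 0)
    (h₂ : (A e₂ * ∑ i : Fin R, (π₂ i : ℂ) * v₂ i).re < 0)
    (hΛ : ∀ ζ ∈ upper, 2 * Λ ζ ≤ lam * ‖ζ‖ ^ (γ - 2)) (hγ : γ ≤ ν) (hγ₀ : 2 - ν₀ < γ)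
    (hγ₁ : 1 - ν < γ) (hlam : lam < lam') :
    ∃ h : ℕ × ℕ → ℝ,
      (∃ C, ∀ z, z ≠ 0 → |h z - F (lin e₁ e₂ z)| ≤ C * ‖lin e₁ e₂ z‖ ^ (γ - 1)) ∧
      ∀ (f : ℕ × ℕ → ℝ) (ρ₁ : ℝ), (∀ z, ρ₁ ≤ ‖lin e₁ e₂ z‖ → f z = h z) →
        (∀ z ∉ corner R, Integrable f (p z).toMeasure) ∧
        ∃ ρ₂, ∀ z, ρ₂ ≤ ‖lin e₁ e₂ z‖ →
          ∫ w, f w ∂(p z).toMeasure ≤ f z + lam' * ‖lin e₁ e₂ z‖ ^ (γ - 2) := by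
  have he := hW.cone
  have hν0 := hW.two_lt
  have hν1 := hW.one_lt
  have hνν := hW.le
  obtain ⟨M₀, hM₀⟩ := hW.moment
  obtain ⟨M₁, hM₁⟩ := hW.moment₁
  obtain ⟨M₂, hM₂⟩ := hW.moment₂
  have hab : ((γ / 2 : ℝ) : ℂ) + (((γ / 2 : ℝ) : ℂ) - 1) = ((γ - 1 : ℝ) : ℂ) := by
    push_cast; ring
  -- With these constants `G₁` and `G₂` are ‖ζ‖^(γ-2) times positive multiples of the first and
  -- second lattice coordinates. Each is non-negative on the cone, positive on its own axis and zero
  -- on the other.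
  set c₁ : ℂ := Complex.I * (starRingEnd ℂ) e₂ with hc₁
  set c₂ : ℂ := -Complex.I with hc₂
  set G₁ : ℂ → ℝ := fun ζ => (c₁ * epow (γ / 2 : ℝ) ((γ / 2 : ℝ) - 1) ζ).re with hG₁
  set G₂ : ℂ → ℝ := fun ζ => (c₂ * epow (γ / 2 : ℝ) ((γ / 2 : ℝ) - 1) ζ).re with hG₂
  have hT₁ := taylorData_re_epow c₁ (γ / 2 : ℝ) ((γ / 2 : ℝ) - 1) (γ - 1) hab
  have hT₂ := taylorData_re_epow c₂ (γ / 2 : ℝ) ((γ / 2 : ℝ) - 1) (γ - 1) hab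
  have hG₁v : ∀ ζ, ζ ≠ 0 → G₁ ζ = ‖ζ‖ ^ (γ - 2) * (e₂.im * ζ.re - e₂.re * ζ.im) := by
    intro ζ hζ
    rw [hG₁]; simp only; rw [re_epow_half _ _ hζ]; simp [hc₁]
  have hG₂v : ∀ ζ, ζ ≠ 0 → G₂ ζ = ‖ζ‖ ^ (γ - 2) * ζ.im := by
    intro ζ hζ
    rw [hG₂]; simp only; rw [re_epow_half _ _ hζ]; simp [hc₂]
  have hl0 : ∀ z : ℕ × ℕ, z ≠ 0 → lin e₁ e₂ z ≠ 0 := fun z hz => upper_ne_zero (lin_mem_upper he hz)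
  have hi2 := he.im₂
  have hr1 := he.re₁
  have hn1 := norm_pos_iff.2 (upper_ne_zero he.mem₁)
  have hn2 := norm_pos_iff.2 (upper_ne_zero he.mem₂)
  have hp₁ : ∀ z : ℕ × ℕ, z ≠ 0 → 0 ≤ G₁ (lin e₁ e₂ z) := by
    intro z hz
    rw [hG₁v _ (hl0 z hz), lin_im he, lin_re]
    have : e₂.im * (z.1 * e₁.re + z.2 * e₂.re) - e₂.re * (z.2 * e₂.im) = e₂.im * e₁.re * z.1 := by
      ring
    rw [this]; positivity
  have hp₂ : ∀ z : ℕ × ℕ, z ≠ 0 → 0 ≤ G₂ (lin e₁ e₂ z) := by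
    intro z hz
    rw [hG₂v _ (hl0 z hz), lin_im he]
    positivity
  have hG₁1 : 0 < G₁ e₁ := by
    rw [hG₁v _ (upper_ne_zero he.mem₁), he.im₁, mul_zero, sub_zero]; positivity
  have hG₂2 : 0 < G₂ e₂ := by
    rw [hG₂v _ (upper_ne_zero he.mem₂)]; positivity
  have hG₁2 : G₁ e₂ = 0 := by
    rw [hG₁v _ (upper_ne_zero he.mem₂), mul_comm e₂.im, sub_self, mul_zero]
  have hG₂1 : G₂ e₁ = 0 := by
    rw [hG₂v _ (upper_ne_zero he.mem₁), he.im₁, mul_zero]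
  have hlin₁ : ∀ z : ℕ × ℕ, lin e₁ e₂ z - z.1 * e₁ = z.2 * e₂ := fun z => by simp [lin]
  have hlin₂ : ∀ z : ℕ × ℕ, lin e₁ e₂ z - z.2 * e₂ = z.1 * e₁ := fun z => by simp [lin]
  obtain ⟨D₁, hD₁, hcor₁⟩ := hT₁.corrector_drift (c := Prod.snd) he hM₀ hW.mean hν0 hγ₀
    (hγ.trans hνν) hp₁ (hT₁.pos_near_axis he he.mem₁ hG₁1 (x := Prod.fst) hlin₁)
  obtain ⟨D₂, hD₂, hcor₂⟩ := hT₂.corrector_drift (c := Prod.fst) he hM₀ hW.mean hν0 hγ₀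
    (hγ.trans hνν) hp₂ (hT₂.pos_near_axis he he.mem₂ hG₂2 (x := Prod.snd) hlin₂)
  set τ := lam' - lam with hτ
  have hτ0 : 0 < τ := by linarith
  -- The oscillation allowed to the correctors is such that their combined interior cost stays well
  -- below the margin τ between `lam` and `lam'`.
  set ε := τ / (8 * (D₁ + D₂ + 1)) with hε
  have hε0 : 0 < ε := by positivity
  have hεD : (D₁ + D₂) * ε ≤ τ / 8 := by
    rw [hε, mul_div_assoc', div_le_div_iff₀ (by positivity) (by norm_num)]
    nlinarith
  have hne : (interiorRegion R).Nonempty := ⟨(R, R), le_rfl, le_rfl⟩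
  have hintg : ∀ z ∈ interiorRegion R,
      Integrable (fun w => lin e₁ e₂ w - lin e₁ e₂ z) (p z).toMeasure :=
    fun z hz => (hM₀ z hz).integrable_jump (by linarith)
  -- correctors
  have hsum : ∀ {π : ℕ → ℝ≥0} {v : ℕ → ℂ} {a : ℂ} {g : ℝ}, 0 < g →
      (a * ∑ i : Fin R, (π i : ℂ) * v i).re < 0 →
      ∑ i : Fin R, (π i : ℝ) * ((a * v i).re / g) < 0 := by
    intro π v a g hg h
    have : ∑ i : Fin R, (π i : ℝ) * ((a * v i).re / g)
        = (a * ∑ i : Fin R, (π i : ℂ) * v i).re / g := by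
      rw [Finset.mul_sum, Complex.re_sum, Finset.sum_div]
      refine Finset.sum_congr rfl fun i _ => ?_
      rw [show a * ((π i : ℂ) * v i) = (((π i : ℝ) : ℝ) : ℂ) * (a * v i) by ring,
        Complex.re_ofReal_mul]
      ring
    rw [this]
    exact div_neg_of_neg_of_pos h hg
  -- The corrector enters multiplied by `G₁ e₁` on the axis, so the boundary drift to be levelled is
  -- divided by that value.
  obtain ⟨K₁, C₁, δ₁, N₁, hK₁, hb₁⟩ := exists_isCorrector (e₁ := e₁) (e₂ := e₂) (c := Prod.snd)
    (S := interiorRegion R) (S' := horizontalBoundary R)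
    (t := fun i => (A e₁ * v₁ i).re / G₁ e₁) hW.chain₁ hπ₁
    (fun z w => by simp [toInt]) hW.increment hne hintg
    (fun z hz => ⟨hz.2, hW.law₁ z hz.1⟩) (fun z hz => ⟨hz.2, hW.law₁ z hz.1⟩)
    (hsum hG₁1 h₁) hε0
  obtain ⟨K₂, C₂, δ₂, N₂, hK₂, hb₂⟩ := exists_isCorrector (e₁ := e₁) (e₂ := e₂) (c := Prod.fst)
    (S := interiorRegion R) (S' := verticalBoundary R)
    (t := fun i => (A e₂ * v₂ i).re / G₂ e₂) hW.chain₂ hπ₂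
    (fun z w => by simp [toInt]) hW.increment hne hintg
    (fun z hz => ⟨hz.1, hW.law₂ z hz.2⟩) (fun z hz => ⟨hz.1, hW.law₂ z hz.2⟩)
    (hsum hG₂2 h₂) hε0
  set C := max C₁ C₂ with hC
  have hKC₁ : ∀ z : ℕ × ℕ, |K₁ z.2| ≤ C := fun z => (hK₁.bdd _).trans (le_max_left _ _)
  have hKC₂ : ∀ z : ℕ × ℕ, |K₂ z.1| ≤ C := fun z => (hK₂.bdd _).trans (le_max_right _ _)
  have hC0 : 0 ≤ C := (abs_nonneg _).trans (hKC₁ 0)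
  set h : ℕ × ℕ → ℝ := fun z =>
    F (lin e₁ e₂ z) + G₁ (lin e₁ e₂ z) * K₁ z.2 + G₂ (lin e₁ e₂ z) * K₂ z.1 with hh
  refine ⟨h, ?_, ?_⟩
  · obtain ⟨E₁, hE₁, hE₁'⟩ := hT₁.growth
    obtain ⟨E₂, hE₂, hE₂'⟩ := hT₂.growth
    refine ⟨(E₁ + E₂) * C, fun z hz => ?_⟩
    have hu := lin_mem_upper he hz
    have e1 : h z - F (lin e₁ e₂ z) = G₁ (lin e₁ e₂ z) * K₁ z.2 + G₂ (lin e₁ e₂ z) * K₂ z.1 := by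
      rw [hh]; ring
    rw [e1]
    refine (abs_add_le _ _).trans ?_
    rw [abs_mul, abs_mul]
    calc _ ≤ E₁ * ‖lin e₁ e₂ z‖ ^ (γ - 1) * C + E₂ * ‖lin e₁ e₂ z‖ ^ (γ - 1) * C := by
          gcongr
          · exact hE₁' _ hu
          · exact hKC₁ z
          · exact hE₂' _ hu
          · exact hKC₂ z
      _ = _ := by ring
  · intro f ρ₁ hf
    -- The freedom to change `h` on a finite set is what later makes the Lyapunov function positive
    -- everywhere; the moments make it negligible.
    set d : ℕ × ℕ → ℝ := fun z => f z - h z with hd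
    have hdz : ∀ z, ρ₁ ≤ ‖lin e₁ e₂ z‖ → d z = 0 := fun z hz => by rw [hd]; simp [hf z hz]
    obtain ⟨Cd, hCd⟩ : ∃ C, ∀ z, |d z| ≤ C := bddAbove_abs_of_finite
      ((finite_norm_lin_lt he ρ₁).subset fun z hz => by
        by_contra hc
        exact hz (hdz z (not_lt.1 hc)))
    set Γ := max γ 0 with hΓ
    have hΓ0 : 0 ≤ Γ := le_max_right _ _
    have hΓν : Γ ≤ ν := max_le (by linarith) (by linarith)
    set Γ' := max (γ - 1) 0 with hΓ'
    have hΓ'0 : 0 ≤ Γ' := le_max_right _ _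
    have hΓ'1 : γ - 1 ≤ Γ' := le_max_left _ _
    have hΓ'ν : Γ' ≤ ν := max_le (by linarith) (by linarith)
    have hΓ2 : Γ - ν₀ < γ - 2 := by
      rcases max_choice γ 0 with h | h <;> rw [hΓ, h] <;> linarith
    have hinth : ∀ {S : Set (ℕ × ℕ)} {M ν' : ℝ}, ν ≤ ν' →
        (∀ z ∈ S, JumpMoment e₁ e₂ (p z).toMeasure z ν' M) → ∀ z ∈ S, z ≠ 0 →
        Integrable (fun w => F (lin e₁ e₂ w)) (p z).toMeasure ∧
        Integrable (fun w => G₁ (lin e₁ e₂ w) * K₁ w.2) (p z).toMeasure ∧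
        Integrable (fun w => G₂ (lin e₁ e₂ w) * K₂ w.1) (p z).toMeasure := by
      intro S M ν' hν' hS z hz hz0
      obtain ⟨_, _, a1⟩ := hF.drift_zero he hS (by linarith) hΓ0 (le_max_left _ _) (hΓν.trans hν')
      obtain ⟨_, _, a2⟩ := hT₁.drift_zero he hS (by linarith) hΓ'0 hΓ'1 (hΓ'ν.trans hν')
      obtain ⟨_, _, a3⟩ := hT₂.drift_zero he hS (by linarith) hΓ'0 hΓ'1 (hΓ'ν.trans hν')
      exact ⟨(a1 z hz hz0).1, Integrable.mul_bdd_discrete (a2 z hz hz0).1 hKC₁,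
        Integrable.mul_bdd_discrete (a3 z hz hz0).1 hKC₂⟩
    have hf' : f = fun z => h z + d z := by funext z; rw [hd]; ring
    have hdi : ∀ z, Integrable d (p z).toMeasure := fun z => integrable_bdd _ hCd
    have hhi : ∀ z ∉ corner R, Integrable h (p z).toMeasure := by
      intro z hz
      have hRpos := hW.chain₁.pos
      have hz0 : z ≠ 0 := by
        rintro rfl
        exact hz ⟨hRpos, hRpos⟩
      have : Integrable (fun w => F (lin e₁ e₂ w)) (p z).toMeasure ∧
        Integrable (fun w => G₁ (lin e₁ e₂ w) * K₁ w.2) (p z).toMeasure ∧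
        Integrable (fun w => G₂ (lin e₁ e₂ w) * K₂ w.1) (p z).toMeasure := by
        by_cases hx : R ≤ z.1 <;> by_cases hy : R ≤ z.2
        · exact hinth hνν hM₀ z ⟨hx, hy⟩ hz0
        · exact hinth le_rfl hM₁ z ⟨hx, not_le.1 hy⟩ hz0
        · exact hinth le_rfl hM₂ z ⟨not_le.1 hx, hy⟩ hz0
        · exact absurd ⟨not_le.1 hx, not_le.1 hy⟩ hz
      exact (this.1.add this.2.1).add this.2.2
    refine ⟨fun z hz => by rw [hf']; exact (hhi z hz).add (hdi z), ?_⟩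
    have hred : ∀ z ∉ corner R, ρ₁ ≤ ‖lin e₁ e₂ z‖ → ∫ w, f w ∂(p z).toMeasure - f z
        = (∫ w, h w ∂(p z).toMeasure - h z) + ∫ w, d w ∂(p z).toMeasure := by
      intro z hz hρ
      rw [hf z hρ, hf', integral_add (hhi z hz) (hdi z)]
      ring
    -- interior
    have hI : ∀ᶠ z in far e₁ e₂ (interiorRegion R),
        ∫ w, f w ∂(p z).toMeasure ≤ f z + lam' * ‖lin e₁ e₂ z‖ ^ (γ - 2) := by
      obtain ⟨CF, hCF0, hCF⟩ := hF.drift_two he hM₀ hW.mean hW.mean_sq hW.mean_norm_sq hΓ0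
        (le_max_left _ _) (hΓν.trans hνν) (s := min 3 ν₀) (le_min (by norm_num) hν0.le)
        (min_le_left _ _) (min_le_right _ _)
      have hs2 : 2 < min 3 ν₀ := lt_min (by norm_num) hν0
      have t1 := small_of_bound (e₁ := e₁) (e₂ := e₂) (β := γ - 2)
        (show γ - min 3 ν₀ < γ - 2 by linarith) hΓ2 hCF0 hCF
      have t2 := small_modification hM₀ (by linarith) (show -ν₀ < γ - 2 by linarith) hCd hdz
      filter_upwards [t1 (τ / 8) (by positivity), t2 (τ / 8) (by positivity),
        hcor₁ K₁ C₁ δ₁ N₁ ε hK₁ (τ / 8) (by positivity),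
        hcor₂ K₂ C₂ δ₂ N₂ ε hK₂ (τ / 8) (by positivity), far_mem, far_ge (max 1 ρ₁)]
        with z u1 u2 u3 u4 hz hV
      have hV1 : 1 ≤ ‖lin e₁ e₂ z‖ := (le_max_left _ _).trans hV
      have hz0 := ne_zero_of_one_le hV1
      have hzc : z ∉ corner R := fun hc => absurd hc.1 (not_lt.2 hz.1)
      obtain ⟨i1, i2, i3⟩ := hinth hνν hM₀ z hz hz0
      have hr := hred z hzc ((le_max_right _ _).trans hV)
      have i12 : Integrable (fun w => F (lin e₁ e₂ w) + G₁ (lin e₁ e₂ w) * K₁ w.2)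
        (p z).toMeasure := i1.add i2
      have hs : ∫ w, h w ∂(p z).toMeasure = ∫ w, F (lin e₁ e₂ w) ∂(p z).toMeasure
          + ∫ w, G₁ (lin e₁ e₂ w) * K₁ w.2 ∂(p z).toMeasure
          + ∫ w, G₂ (lin e₁ e₂ w) * K₂ w.1 ∂(p z).toMeasure := by
        rw [hh]
        simp only
        rw [integral_add i12 i3, integral_add i1 i2]
      have hhz : h z = F (lin e₁ e₂ z) + G₁ (lin e₁ e₂ z) * K₁ z.2 + G₂ (lin e₁ e₂ z) * K₂ z.1 :=
        rfl
      have hL := hΛ _ (lin_mem_upper he hz0)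
      have w1 := le_of_abs_le u1
      have w2 := le_of_abs_le u2
      have hVp : 0 < ‖lin e₁ e₂ z‖ ^ (γ - 2) := by positivity
      have e1 := mul_le_mul_of_nonneg_right hεD hVp.le
      have e2 : lam' = lam + τ := by rw [hτ]; ring
      have u3' : ∫ w, G₁ (lin e₁ e₂ w) * K₁ w.2 ∂(p z).toMeasure - G₁ (lin e₁ e₂ z) * K₁ z.2
        ≤ (D₁ * ε + τ / 8) * ‖lin e₁ e₂ z‖ ^ (γ - 2) := u3
      have u4' : ∫ w, G₂ (lin e₁ e₂ w) * K₂ w.1 ∂(p z).toMeasure - G₂ (lin e₁ e₂ z) * K₂ z.1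
        ≤ (D₂ * ε + τ / 8) * ‖lin e₁ e₂ z‖ ^ (γ - 2) := u4
      have e3 : 0 < τ * ‖lin e₁ e₂ z‖ ^ (γ - 2) := by positivity
      rw [e2]
      linarith
    -- boundaries
    have hvb : ∀ v : ℕ → ℂ, ∃ Cv, ∀ i, ‖if i < R then v i else 0‖ ≤ Cv := by
      intro v
      refine ⟨∑ i ∈ Finset.range R, ‖v i‖, fun i => ?_⟩
      split_ifs with hi
      · exact Finset.single_le_sum (f := fun i => ‖v i‖) (fun _ _ => norm_nonneg _)
          (Finset.mem_range.2 hi)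
      · rw [norm_zero]; exact Finset.sum_nonneg fun _ _ => norm_nonneg _
    -- A negative drift of order γ - 1 beats any term of order γ - 2, whatever the sign of `lam'`.
    have hfinish : ∀ {S : Set (ℕ × ℕ)} {M κ : ℝ}, 0 < κ → (∀ z ∈ S, z ∉ corner R) →
        (∀ z ∈ S, JumpMoment e₁ e₂ (p z).toMeasure z ν M) →
        (∀ᶠ z in far e₁ e₂ S, ∫ w, h w ∂(p z).toMeasure - h z ≤ -κ * ‖lin e₁ e₂ z‖ ^ (γ - 1)) →
        ∀ᶠ z in far e₁ e₂ S,
          ∫ w, f w ∂(p z).toMeasure ≤ f z + lam' * ‖lin e₁ e₂ z‖ ^ (γ - 2) := by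
      intro S M κ hκ hSc hS hev
      have t1 := small_modification hS (by linarith) (show -ν < γ - 1 by linarith) hCd hdz
      have t2 := small_rpow (e₁ := e₁) (e₂ := e₂) (S := S)
        (show γ - 2 < γ - 1 by linarith) (-lam')
      filter_upwards [t1 (κ / 2) (by positivity), t2 (κ / 2) (by positivity), hev, far_mem,
        far_ge ρ₁] with z u1 u2 u3 hz hV
      have hr := hred z (hSc z hz) hV
      have w1 := le_of_abs_le u1
      have w2 := le_of_abs_le u2
      linarith
    obtain ⟨Cv₁, hCv₁⟩ := hvb v₁
    obtain ⟨Cv₂, hCv₂⟩ := hvb v₂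
    obtain ⟨κ₁, hκ₁, hB₁⟩ := boundary_drift (K := fun w => K₁ w.2) (K' := fun w => K₂ w.1)
      (C₀ := R * ‖e₂‖) (x := Prod.fst) (δ := δ₁ * G₁ e₁) he hM₁ hν1 hγ₁ hγ hF hT₁ hT₂ he.mem₁
      (fun z hz => by
        rw [hlin₁, norm_mul, Complex.norm_natCast]
        gcongr
        exact hz.2.le) hKC₁ hKC₂ (v := fun z => if z.2 < R then v₁ z.2 else 0)
      (fun z hz => by rw [hW.mean₁ z hz, if_pos hz.2]) (fun z => hCv₁ z.2)
      (mul_pos hK₁.pos hG₁1) (fun z hz => by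
        have := mul_le_mul_of_nonneg_right (hb₁ z hz) hG₁1.le
        rw [if_pos hz.2]
        rw [add_mul, div_mul_cancel₀ _ hG₁1.ne'] at this
        linarith) hG₂1
    obtain ⟨κ₂, hκ₂, hB₂⟩ := boundary_drift (K := fun w => K₂ w.1) (K' := fun w => K₁ w.2)
      (C₀ := R * ‖e₁‖) (x := Prod.snd) (δ := δ₂ * G₂ e₂) he hM₂ hν1 hγ₁ hγ hF hT₂ hT₁ he.mem₂
      (fun z hz => by
        rw [hlin₂, norm_mul, Complex.norm_natCast]
        gcongr
        exact hz.1.le) hKC₂ hKC₁ (v := fun z => if z.1 < R then v₂ z.1 else 0)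
      (fun z hz => by rw [hW.mean₂ z hz, if_pos hz.1]) (fun z => hCv₂ z.1)
      (mul_pos hK₂.pos hG₂2) (fun z hz => by
        have := mul_le_mul_of_nonneg_right (hb₂ z hz) hG₂2.le
        rw [if_pos hz.1]
        rw [add_mul, div_mul_cancel₀ _ hG₂2.ne'] at this
        linarith) hG₁2
    have hJ₁ := hfinish hκ₁ (fun z hz hc => absurd hc.1 (not_lt.2 hz.1)) hM₁ hB₁
    have hJ₂ := hfinish hκ₂ (fun z hz hc => absurd hc.2 (not_lt.2 hz.2)) hM₂ (by
      filter_upwards [hB₂] with z hz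
      refine le_trans (le_of_eq ?_) hz
      rw [hh]
      congr 1
      · congr 1; funext w; ring
      · ring)
    obtain ⟨r0, hr0⟩ := eventually_far.1 hI
    obtain ⟨r1, hr1⟩ := eventually_far.1 hJ₁
    obtain ⟨r2, hr2⟩ := eventually_far.1 hJ₂
    -- The last entry exceeds the norm of every state in the corner, so far away only three regions
    -- remain.
    refine ⟨max (max r0 r1) (max r2 ((‖e₁‖ + ‖e₂‖) * (2 * R) + 1)), fun z hz => ?_⟩
    have b0 : r0 ≤ ‖lin e₁ e₂ z‖ := (le_max_left _ _).trans ((le_max_left _ _).trans hz)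
    have b1 : r1 ≤ ‖lin e₁ e₂ z‖ := (le_max_right _ _).trans ((le_max_left _ _).trans hz)
    have b2 : r2 ≤ ‖lin e₁ e₂ z‖ := (le_max_left _ _).trans ((le_max_right _ _).trans hz)
    have b3 : (‖e₁‖ + ‖e₂‖) * (2 * R) + 1 ≤ ‖lin e₁ e₂ z‖ :=
      (le_max_right _ _).trans ((le_max_right _ _).trans hz)
    by_cases hx : R ≤ z.1 <;> by_cases hy : R ≤ z.2
    · exact hr0 z ⟨hx, hy⟩ b0
    · exact hr1 z ⟨hx, not_le.1 hy⟩ b1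
    · exact hr2 z ⟨not_le.1 hx, hy⟩ b2
    · exfalso
      have h1 : (z.1 : ℝ) ≤ R := by exact_mod_cast (not_le.1 hx).le
      have h2 : (z.2 : ℝ) ≤ R := by exact_mod_cast (not_le.1 hy).le
      have h3 := norm_lin_le e₁ e₂ z
      have h4 : (‖e₁‖ + ‖e₂‖) * (z.1 + z.2 : ℝ) ≤ (‖e₁‖ + ‖e₂‖) * (2 * R) := by
        gcongr; linarith
      linarith

end IsWalk

/-! ### Lyapunov functions -/

/-- The sign of the sine of the angle from `e₂` to the point is that of a determinant, which equals
-z.1 e₁.re e₂.im and cannot be positive. -/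
lemma arg_lin_mem {e₁ e₂ : ℂ} (he : IsCone e₁ e₂) {z : ℕ × ℕ} (hz : z ≠ 0) :
    0 ≤ (lin e₁ e₂ z).arg ∧ (lin e₁ e₂ z).arg ≤ e₂.arg := by
  have hi := he.im₂
  have hr := he.re₁
  have h0 : 0 ≤ (lin e₁ e₂ z).arg := by
    rw [Complex.arg_nonneg_iff, lin_im he]; positivity
  refine ⟨h0, ?_⟩
  by_contra hc
  push Not at hc
  have hζ := norm_pos_iff.2 (upper_ne_zero (lin_mem_upper he hz))
  have hn := norm_pos_iff.2 (upper_ne_zero he.mem₂)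
  have h2 : 0 ≤ e₂.arg := by rw [Complex.arg_nonneg_iff]; exact hi.le
  have h3 := Complex.arg_le_pi (lin e₁ e₂ z)
  have h4 : 0 < e₂.arg := by
    refine lt_of_le_of_ne h2 fun h => ?_
    have := (Complex.arg_eq_zero_iff.1 h.symm).2
    linarith
  have h5 : 0 < Real.sin ((lin e₁ e₂ z).arg - e₂.arg) :=
    Real.sin_pos_of_pos_of_lt_pi (by linarith) (by linarith)
  rw [Real.sin_sub] at h5
  have a1 := Complex.norm_mul_cos_arg (lin e₁ e₂ z)
  have a2 := Complex.norm_mul_sin_arg (lin e₁ e₂ z)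
  have a3 := Complex.norm_mul_cos_arg e₂
  have a4 := Complex.norm_mul_sin_arg e₂
  have h6 : 0 < (‖lin e₁ e₂ z‖ * Real.sin (lin e₁ e₂ z).arg) * (‖e₂‖ * Real.cos e₂.arg)
      - (‖lin e₁ e₂ z‖ * Real.cos (lin e₁ e₂ z).arg) * (‖e₂‖ * Real.sin e₂.arg) := by
    have := mul_pos (mul_pos hζ hn) h5
    nlinarith
  rw [a1, a2, a3, a4, lin_im he, lin_re] at h6
  have h7 : (z.2 * e₂.im) * e₂.re - (z.1 * e₁.re + z.2 * e₂.re) * e₂.im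
      = -(z.1 * e₁.re * e₂.im) := by ring
  rw [h7] at h6
  have : 0 ≤ z.1 * e₁.re * e₂.im := by positivity
  linarith

/-- The derivative of `Re (c * epow a b)` in polar coordinates. -/
lemma re_gradE_mul_polar (c : ℂ) (a b : ℝ) {e v : ℂ} (he : e ≠ 0) {s β : ℝ}
    (hv : v = s * Complex.exp (β * Complex.I)) :
    (gradE c a b e * v).re = ‖e‖ ^ (a + b - 1) * s *
      (c * Complex.exp (((a - b) * e.arg : ℝ) * Complex.I) *
        (a * Complex.exp ((β - e.arg : ℝ) * Complex.I)
          + b * Complex.exp ((-(β - e.arg) : ℝ) * Complex.I))).re := by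
  have hn : 0 < ‖e‖ := norm_pos_iff.2 he
  have hnc : (‖e‖ : ℂ) ≠ 0 := by exact_mod_cast hn.ne'
  have hq : v * e⁻¹ = (s / ‖e‖ : ℝ) * Complex.exp ((β - e.arg : ℝ) * Complex.I) := by
    conv_lhs => rw [← Complex.norm_mul_exp_arg_mul_I e]
    rw [hv, mul_inv, ← Complex.exp_neg]
    push_cast
    rw [sub_mul, sub_eq_add_neg, Complex.exp_add]
    field_simp
  have hq' : (starRingEnd ℂ) v * ((starRingEnd ℂ) e)⁻¹
      = (s / ‖e‖ : ℝ) * Complex.exp ((-(β - e.arg) : ℝ) * Complex.I) := by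
    rw [← map_inv₀, ← map_mul, hq, map_mul, Complex.conj_ofReal, ← Complex.exp_conj, map_mul,
      Complex.conj_ofReal, Complex.conj_I]
    congr 2
    push_cast; ring
  have hE : epowD a b v e = ((‖e‖ ^ (a + b - 1) * s : ℝ) : ℂ) *
      (Complex.exp (((a - b) * e.arg : ℝ) * Complex.I) *
        (a * Complex.exp ((β - e.arg : ℝ) * Complex.I)
          + b * Complex.exp ((-(β - e.arg) : ℝ) * Complex.I))) := by
    rw [epowD, epow_sub_one_left _ _ _ he, epow_sub_one_right _ _ _ he,
      epow_eq_polar a b e he (a + b) (by push_cast; ring)]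
    calc _ = ((‖e‖ ^ (a + b) : ℝ) : ℂ) * Complex.exp ((a - b) * Complex.I * e.arg) *
          (a * (v * e⁻¹) + b * ((starRingEnd ℂ) v * ((starRingEnd ℂ) e)⁻¹)) := by ring
      _ = _ := by
        rw [hq, hq', Real.rpow_sub_one hn.ne']
        push_cast
        rw [show ((a : ℂ) - b) * Complex.I * e.arg = (a - b) * e.arg * Complex.I by ring]
        field_simp
  rw [← re_mul_epowD, hE, show ∀ x y : ℂ, c * (x * y) = x * (c * y) from fun x y => by ring,
    Complex.re_ofReal_mul, mul_assoc c]

namespace IsWalk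

variable {R : ℕ} {p : ℕ × ℕ → PMF (ℕ × ℕ)} {p₀ : PMF (ℤ × ℤ)} {q₁ q₂ : ℕ → PMF ℕ}
  {e₁ e₂ : ℂ} {v₁ v₂ : ℕ → ℂ} {ν₀ ν : ℝ}

/-- From a homogeneous function of constant sign `σ` to a positive function on the state space. -/
theorem exists_lyapunov (hW : IsWalk R p p₀ q₁ q₂ e₁ e₂ v₁ v₂ ν₀ ν) {π₁ π₂ : ℕ → ℝ≥0}
    (hπ₁ : IsNormalizedInvariant R (fun i j => q₁ i j) π₁)
    (hπ₂ : IsNormalizedInvariant R (fun i j => q₂ i j) π₂) {γ lam lam' : ℝ} {F : ℂ → ℝ}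
    {A B : ℂ → ℂ} {Λ : ℂ → ℝ} (hF : TaylorData γ F A B Λ)
    (h₁ : (A e₁ * ∑ i : Fin R, (π₁ i : ℂ) * v₁ i).re < 0)
    (h₂ : (A e₂ * ∑ i : Fin R, (π₂ i : ℂ) * v₂ i).re < 0)
    (hΛ : ∀ ζ ∈ upper, 2 * Λ ζ ≤ lam * ‖ζ‖ ^ (γ - 2)) (hγ : γ ≤ ν) (hγ₀ : 2 - ν₀ < γ)
    (hγ₁ : 1 - ν < γ) (hlam : lam < lam') {σ c₀ C₀ : ℝ} (hσ : σ * σ = 1) (hc₀ : 0 < c₀)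
    (hlow : ∀ z : ℕ × ℕ, z ≠ 0 → c₀ * ‖lin e₁ e₂ z‖ ^ γ ≤ σ * F (lin e₁ e₂ z))
    (hupp : ∀ z : ℕ × ℕ, z ≠ 0 → σ * F (lin e₁ e₂ z) ≤ C₀ * ‖lin e₁ e₂ z‖ ^ γ) :
    ∃ (f : ℕ × ℕ → ℝ) (ρ : ℝ), 1 ≤ ρ ∧ (∀ z, 0 < f z) ∧
      Comparable {z | ‖lin e₁ e₂ z‖ < ρ} (fun z => ‖lin e₁ e₂ z‖) γ f ∧
      (∀ z ∉ corner R, Integrable f (p z).toMeasure) ∧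
      ∀ z, ρ ≤ ‖lin e₁ e₂ z‖ →
        σ * ∫ w, f w ∂(p z).toMeasure ≤ σ * f z + lam' * ‖lin e₁ e₂ z‖ ^ (γ - 2) := by
  obtain ⟨h, ⟨C, hC⟩, hh⟩ := hW.exists_perturbation hπ₁ hπ₂ hF h₁ h₂ hΛ hγ hγ₀ hγ₁ hlam
  have hsm := small_rpow (e₁ := e₁) (e₂ := e₂) (S := Set.univ) (show γ - 1 < γ by linarith) C
    (c₀ / 2) (by positivity)
  obtain ⟨ρ₀, hρ₀⟩ := eventually_far.1 hsm
  set ρ₁ := max 1 ρ₀ with hρ₁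
  have hσ1 : |σ| = 1 := by
    have : |σ| * |σ| = 1 := by rw [← abs_mul, hσ, abs_one]
    nlinarith [abs_nonneg σ]
  have hcmp : ∀ z, ρ₁ ≤ ‖lin e₁ e₂ z‖ → c₀ / 2 * ‖lin e₁ e₂ z‖ ^ γ ≤ σ * h z ∧
      σ * h z ≤ (|C₀| + c₀) * ‖lin e₁ e₂ z‖ ^ γ := by
    intro z hz
    have hz1 : 1 ≤ ‖lin e₁ e₂ z‖ := (le_max_left _ _).trans hz
    have hz0 := ne_zero_of_one_le hz1
    have e1 := (hC z hz0).trans ((le_abs_self _).trans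
      (hρ₀ z (Set.mem_univ _) ((le_max_right _ _).trans hz)))
    have e2 : |σ * h z - σ * F (lin e₁ e₂ z)| ≤ c₀ / 2 * ‖lin e₁ e₂ z‖ ^ γ := by
      rw [← mul_sub, abs_mul, hσ1, one_mul]; exact e1
    have e3 := abs_le.1 e2
    have e4 := hlow z hz0
    have e5 := hupp z hz0
    have e6 : 0 < ‖lin e₁ e₂ z‖ ^ γ := by positivity
    have e7 := mul_le_mul_of_nonneg_right (le_abs_self C₀) e6.le
    constructor <;> nlinarith
  classical
  -- Near the origin the perturbed function may lose its sign and is replaced by 1.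
  set f : ℕ × ℕ → ℝ := fun z => if ρ₁ ≤ ‖lin e₁ e₂ z‖ then σ * h z else 1 with hf
  have hf1 : ∀ z, ρ₁ ≤ ‖lin e₁ e₂ z‖ → f z = σ * h z := fun z hz => if_pos hz
  obtain ⟨hintg, ρ₂, hρ₂⟩ := hh (fun z => σ * f z) ρ₁ fun z hz => by
    simp only [hf1 z hz]
    rw [← mul_assoc, hσ, one_mul]
  refine ⟨f, max ρ₁ ρ₂, (le_max_left _ _).trans (le_max_left _ _), fun z => ?_,
    ⟨c₀ / 2, |C₀| + c₀, by positivity, by positivity, fun z hz => ?_⟩, fun z hz => ?_,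
    fun z hz => ?_⟩
  · by_cases hz : ρ₁ ≤ ‖lin e₁ e₂ z‖
    · have hz1 : 0 < ‖lin e₁ e₂ z‖ := lt_of_lt_of_le one_pos ((le_max_left _ _).trans hz)
      rw [hf1 z hz]
      exact lt_of_lt_of_le (by positivity) (hcmp z hz).1
    · simp only [hf, if_neg hz]
      exact one_pos
  · have hz' : ρ₁ ≤ ‖lin e₁ e₂ z‖ := (le_max_left _ _).trans (not_lt.1 hz)
    rw [hf1 z hz']
    exact hcmp z hz'
  · have := (hintg z hz).const_mul σ
    refine this.congr (Filter.Eventually.of_forall fun w => ?_)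
    simp only
    rw [← mul_assoc, hσ, one_mul]
  · have := hρ₂ z ((le_max_right _ _).trans hz)
    rwa [integral_const_mul] at this

/-- Angular data of the walk: the opening of the cone, and the effective drifts in polar
coordinates. -/
structure IsPolar (R : ℕ) (e₂ : ℂ) (v₁ v₂ : ℕ → ℂ) (π₁ π₂ : ℕ → ℝ≥0) (φ₁ φ₂ χ : ℝ) : Prop where
  drift₁ : ∃ s : ℝ, 0 < s ∧ ∑ i : Fin R, (π₁ i : ℂ) * v₁ i
    = s * Complex.exp ((Real.pi / 2 + φ₁ : ℝ) * Complex.I)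
  drift₂ : ∃ s : ℝ, 0 < s ∧ ∑ i : Fin R, (π₂ i : ℂ) * v₂ i
    = s * Complex.exp ((e₂.arg - Real.pi / 2 - φ₂ : ℝ) * Complex.I)
  abs₁ : |φ₁| < Real.pi / 2
  abs₂ : |φ₂| < Real.pi / 2
  eq : φ₁ + φ₂ = χ * e₂.arg

lemma _root_.QuadrantWalk.IsCone.arg_pos {e₁ e₂ : ℂ} (he : IsCone e₁ e₂) : 0 < e₂.arg := by
  refine lt_of_le_of_ne (Complex.arg_nonneg_iff.2 he.im₂.le) fun h => ?_
  have := (Complex.arg_eq_zero_iff.1 h.symm).2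
  linarith [he.im₂]

lemma _root_.QuadrantWalk.IsCone.arg₁ {e₁ e₂ : ℂ} (he : IsCone e₁ e₂) : e₁.arg = 0 :=
  Complex.arg_eq_zero_iff.2 ⟨he.re₁.le, he.im₁⟩

lemma re_exp_mul (k a b : ℝ) (x y : ℝ) :
    (((k : ℂ) * Complex.exp (x * Complex.I)) * Complex.exp (y * Complex.I) *
      (a * Complex.exp (b * Complex.I))).re = k * a * Real.cos (x + y + b) := by
  have : ((k : ℂ) * Complex.exp (x * Complex.I)) * Complex.exp (y * Complex.I) *
      (a * Complex.exp (b * Complex.I))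
      = ((k * a : ℝ) : ℂ) * Complex.exp ((x + y + b : ℝ) * Complex.I) := by
    push_cast
    rw [add_mul, add_mul, Complex.exp_add, Complex.exp_add]
    ring
  rw [this, Complex.re_ofReal_mul, Complex.exp_ofReal_mul_I_re]

/-- The Lyapunov function of order `γ`, whose drift has sign `-σ`. -/
theorem exists_lyapunov_radial (hW : IsWalk R p p₀ q₁ q₂ e₁ e₂ v₁ v₂ ν₀ ν) {π₁ π₂ : ℕ → ℝ≥0}
    (hπ₁ : IsNormalizedInvariant R (fun i j => q₁ i j) π₁)
    (hπ₂ : IsNormalizedInvariant R (fun i j => q₂ i j) π₂) {φ₁ φ₂ χ : ℝ}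
    (hP : IsPolar R e₂ v₁ v₂ π₁ π₂ φ₁ φ₂ χ) {γ σ : ℝ} (hσ : σ * σ = 1)
    (hsign : σ * γ * Real.sin ((γ - χ) * e₂.arg / 2) < 0)
    (hangle : |φ₁ - φ₂| / 2 + |γ| * e₂.arg / 2 < Real.pi / 2)
    (hγ : γ ≤ ν) (hγ₀ : 2 - ν₀ < γ) (hγ₁ : 1 - ν < γ) :
    ∃ (f : ℕ × ℕ → ℝ) (ρ c : ℝ), 1 ≤ ρ ∧ 0 < c ∧ (∀ z, 0 < f z) ∧
      Comparable {z | ‖lin e₁ e₂ z‖ < ρ} (fun z => ‖lin e₁ e₂ z‖) γ f ∧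
      (∀ z ∉ corner R, Integrable f (p z).toMeasure) ∧
      ∀ z, ρ ≤ ‖lin e₁ e₂ z‖ →
        σ * ∫ w, f w ∂(p z).toMeasure ≤ σ * f z - c * ‖lin e₁ e₂ z‖ ^ (γ - 2) := by
  have he := hW.cone
  set φ := e₂.arg with hφ
  have hφ0 : 0 < φ := he.arg_pos
  obtain ⟨s₁, hs₁, hd₁⟩ := hP.drift₁
  obtain ⟨s₂, hs₂, hd₂⟩ := hP.drift₂
  have hγ0 : γ ≠ 0 := by rintro rfl; simp at hsign
  -- The leading function is ‖ζ‖^γ (σ cos(γ arg ζ - α) - ε). This phase makes both oblique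
  -- derivatives of the harmonic part positive multiples of σγ sin((γ - χ)φ/2).
  set α := (φ₁ - φ₂) / 2 + γ * φ / 2 with hα
  -- `b` bounds |γ θ - α| over all angles θ in the cone; being less than π/2, it keeps the cosine
  -- away from zero.
  set b := |φ₁ - φ₂| / 2 + |γ| * φ / 2 with hb
  have hb0 : 0 ≤ b := by positivity
  set c₀ := Real.cos b with hc₀
  have hc₀0 : 0 < c₀ := Real.cos_pos_of_mem_Ioo ⟨by linarith, hangle⟩
  set m := -(σ * γ * Real.sin ((γ - χ) * φ / 2)) with hm
  have hm0 : 0 < m := by rw [hm]; linarith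
  -- Small enough to keep the sign of the function and at most half of the oblique derivative.
  set ε := min (c₀ / 2) (m / (2 * |γ|)) with hε
  have hγabs : 0 < |γ| := abs_pos.2 hγ0
  have hε0 : 0 < ε := lt_min (by positivity) (by positivity)
  have hεc : ε ≤ c₀ / 2 := min_le_left _ _
  have hεm : ε * |γ| ≤ m / 2 := by
    have : ε ≤ m / (2 * |γ|) := min_le_right _ _
    rw [le_div_iff₀ (by positivity)] at this
    linarith
  set cc : ℂ := (σ : ℂ) * Complex.exp ((-α : ℝ) * Complex.I) with hcc
  have hT₁ := taylorData_re_epow cc (γ : ℝ) (0 : ℝ) γ (by simp)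
  have hT₂ := taylorData_re_epow ((-ε : ℝ) : ℂ) (γ / 2 : ℝ) (γ / 2 : ℝ) γ (by push_cast; ring)
  have hT := hT₁.add hT₂
  have hσ1 : |σ| = 1 := by
    have : |σ| * |σ| = 1 := by rw [← abs_mul, hσ, abs_one]
    nlinarith [abs_nonneg σ]
  -- values
  have hval : ∀ ζ : ℂ, ζ ≠ 0 → (cc * epow (γ : ℝ) (0 : ℝ) ζ).re
      + (((-ε : ℝ) : ℂ) * epow (γ / 2 : ℝ) (γ / 2 : ℝ) ζ).re
      = ‖ζ‖ ^ γ * (σ * Real.cos (γ * ζ.arg - α) - ε) := by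
    intro ζ hζ
    rw [epow_eq_polar _ _ ζ hζ γ (by simp), epow_eq_polar _ _ ζ hζ γ (by push_cast; ring)]
    have e1 : cc * (((‖ζ‖ ^ γ : ℝ) : ℂ) * Complex.exp ((((γ : ℝ) : ℂ) - ((0 : ℝ) : ℂ)) *
        Complex.I * ζ.arg))
        = ((σ * ‖ζ‖ ^ γ : ℝ) : ℂ) * Complex.exp ((γ * ζ.arg - α : ℝ) * Complex.I) := by
      rw [hcc]
      push_cast
      rw [sub_zero, show (γ : ℂ) * Complex.I * ζ.arg = γ * ζ.arg * Complex.I by ring,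
        show ((γ : ℂ) * ζ.arg - α) * Complex.I = γ * ζ.arg * Complex.I + -α * Complex.I by ring,
        Complex.exp_add]
      ring
    rw [e1, sub_self, zero_mul, zero_mul, Complex.exp_zero, mul_one, Complex.re_ofReal_mul,
      Complex.exp_ofReal_mul_I_re, ← Complex.ofReal_mul, Complex.ofReal_re]
    ring
  have hcos : ∀ z : ℕ × ℕ, z ≠ 0 → c₀ ≤ Real.cos (γ * (lin e₁ e₂ z).arg - α) := by
    intro z hz
    obtain ⟨ha0, ha1⟩ := arg_lin_mem he hz
    rw [← Real.cos_abs (γ * _ - α)]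
    refine Real.cos_le_cos_of_nonneg_of_le_pi (abs_nonneg _) (by linarith [Real.pi_pos]) ?_
    have e1 : γ * (lin e₁ e₂ z).arg - α
        = γ * ((lin e₁ e₂ z).arg - φ / 2) - (φ₁ - φ₂) / 2 := by rw [hα]; ring
    rw [e1]
    refine (abs_sub _ _).trans ?_
    rw [abs_mul, abs_div, abs_of_pos (two_pos : (0 : ℝ) < 2)]
    have e2 : |(lin e₁ e₂ z).arg - φ / 2| ≤ φ / 2 := by
      rw [abs_le]; constructor <;> linarith
    have e3 := mul_le_mul_of_nonneg_left e2 (abs_nonneg γ)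
    rw [hb]
    linarith
  have hlow : ∀ z : ℕ × ℕ, z ≠ 0 → c₀ / 2 * ‖lin e₁ e₂ z‖ ^ γ
      ≤ σ * ((cc * epow (γ : ℝ) (0 : ℝ) (lin e₁ e₂ z)).re
      + (((-ε : ℝ) : ℂ) * epow (γ / 2 : ℝ) (γ / 2 : ℝ) (lin e₁ e₂ z)).re) := by
    intro z hz
    have hζ := upper_ne_zero (lin_mem_upper he hz)
    have hp : 0 < ‖lin e₁ e₂ z‖ := norm_pos_iff.2 hζ
    rw [hval _ hζ]
    have e1 := hcos z hz
    have e2 : σ * ε ≤ c₀ / 2 := by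
      have := le_abs_self σ
      rw [hσ1] at this
      nlinarith
    have e3 : 0 < ‖lin e₁ e₂ z‖ ^ γ := by positivity
    have e4 : σ * (‖lin e₁ e₂ z‖ ^ γ * (σ * Real.cos (γ * (lin e₁ e₂ z).arg - α) - ε))
        = ‖lin e₁ e₂ z‖ ^ γ * (σ * σ * Real.cos (γ * (lin e₁ e₂ z).arg - α) - σ * ε) := by ring
    rw [e4, hσ, one_mul, mul_comm]
    gcongr
    linarith
  have hupp : ∀ z : ℕ × ℕ, z ≠ 0 → σ * ((cc * epow (γ : ℝ) (0 : ℝ) (lin e₁ e₂ z)).re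
      + (((-ε : ℝ) : ℂ) * epow (γ / 2 : ℝ) (γ / 2 : ℝ) (lin e₁ e₂ z)).re)
      ≤ (1 + ε) * ‖lin e₁ e₂ z‖ ^ γ := by
    intro z hz
    have hζ := upper_ne_zero (lin_mem_upper he hz)
    have hp : 0 < ‖lin e₁ e₂ z‖ := norm_pos_iff.2 hζ
    rw [hval _ hζ]
    have e1 := Real.cos_le_one (γ * (lin e₁ e₂ z).arg - α)
    have e2 : -ε ≤ σ * ε := by
      have := neg_abs_le σ
      rw [hσ1] at this
      nlinarith
    have e3 : 0 < ‖lin e₁ e₂ z‖ ^ γ := by positivity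
    have e4 : σ * (‖lin e₁ e₂ z‖ ^ γ * (σ * Real.cos (γ * (lin e₁ e₂ z).arg - α) - ε))
        = (σ * σ * Real.cos (γ * (lin e₁ e₂ z).arg - α) - σ * ε) * ‖lin e₁ e₂ z‖ ^ γ := by ring
    rw [e4, hσ, one_mul]
    gcongr
    linarith
  -- oblique derivatives
  have hcosabs : ∀ x : ℝ, -(ε * γ * Real.cos x) ≤ m / 2 := by
    intro x
    have e1 := Real.abs_cos_le_one x
    have e2 : |ε * γ * Real.cos x| ≤ ε * |γ| := by
      rw [abs_mul, abs_mul, abs_of_pos hε0]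
      have : 0 ≤ ε * |γ| := by positivity
      nlinarith
    linarith [neg_abs_le (ε * γ * Real.cos x)]
  have hderiv : ∀ {e v : ℂ} {s β : ℝ}, e ≠ 0 → 0 < s → v = s * Complex.exp (β * Complex.I) →
      σ * γ * Real.cos (-α + γ * e.arg + (β - e.arg)) = -m →
      ((gradE cc (γ : ℝ) (0 : ℝ) e + gradE ((-ε : ℝ) : ℂ) (γ / 2 : ℝ) (γ / 2 : ℝ) e) * v).re
        < 0 := by
    intro e v s β he0 hs hv hc
    have hn : 0 < ‖e‖ := norm_pos_iff.2 he0
    rw [add_mul, Complex.add_re, re_gradE_mul_polar cc γ 0 he0 hv,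
      re_gradE_mul_polar ((-ε : ℝ) : ℂ) (γ / 2) (γ / 2) he0 hv, add_zero, add_halves, sub_zero,
      Complex.ofReal_zero, zero_mul, add_zero, hcc, re_exp_mul, hc, sub_self, zero_mul,
      Complex.ofReal_zero, zero_mul, Complex.exp_zero, mul_one, Complex.re_ofReal_mul,
      Complex.add_re, Complex.re_ofReal_mul, Complex.re_ofReal_mul, Complex.exp_ofReal_mul_I_re,
      Complex.exp_ofReal_mul_I_re, Real.cos_neg, ← mul_add]
    refine mul_neg_of_pos_of_neg (by positivity) ?_
    have := hcosabs (β - e.arg)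
    linarith
  have hχ := hP.eq
  have h₁ := hderiv (upper_ne_zero he.mem₁) hs₁ hd₁ (by
    rw [he.arg₁, hm, neg_neg]
    congr 1
    rw [← Real.cos_pi_div_two_sub]
    congr 1
    rw [hα]
    linear_combination (1 / 2 : ℝ) * hχ)
  have h₂ := hderiv (upper_ne_zero he.mem₂) hs₂ hd₂ (by
    rw [hm, neg_neg]
    congr 1
    rw [← Real.cos_pi_div_two_sub, ← Real.cos_neg]
    congr 1
    rw [hα]
    linear_combination (1 / 2 : ℝ) * hχ)
  -- The first summand is the real part of a holomorphic function, so the Laplacian comes from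
  -- -ε‖ζ‖^γ alone. Half of this strictly negative drift is later given up to the perturbation.
  have hΛ : ∀ ζ ∈ upper, 2 * (lapE cc (γ : ℝ) (0 : ℝ) ζ
      + lapE ((-ε : ℝ) : ℂ) (γ / 2 : ℝ) (γ / 2 : ℝ) ζ) ≤ -(ε * γ ^ 2 / 2) * ‖ζ‖ ^ (γ - 2) := by
    intro ζ hζ
    have hζ0 := upper_ne_zero hζ
    rw [lapE, lapE, epow_eq_polar (((γ / 2 : ℝ) : ℂ) - 1) (((γ / 2 : ℝ) : ℂ) - 1) ζ hζ0 (γ - 2)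
      (by push_cast; ring)]
    rw [sub_self, zero_mul, zero_mul, Complex.exp_zero, mul_one, Complex.ofReal_zero, mul_zero,
      zero_mul, Complex.zero_re, ← Complex.ofReal_mul, ← Complex.ofReal_mul, ← Complex.ofReal_mul,
      Complex.ofReal_re]
    exact le_of_eq (by ring)
  have hγ2 : 0 < γ ^ 2 := by positivity
  obtain ⟨f, ρ, hρ, hf0, hfc, hfi, hfd⟩ := hW.exists_lyapunov hπ₁ hπ₂ hT h₁ h₂ hΛ hγ hγ₀ hγ₁
    (lam' := -(ε * γ ^ 2 / 4)) (by nlinarith) hσ (half_pos hc₀0) hlow hupp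
  refine ⟨f, ρ, ε * γ ^ 2 / 4, hρ, by positivity, hf0, hfc, hfi, fun z hz => ?_⟩
  have := hfd z hz
  linarith

/-- A function of arbitrary positive order `g` whose drift is at most of order `g - 2`. -/
theorem exists_lyapunov_cap (hW : IsWalk R p p₀ q₁ q₂ e₁ e₂ v₁ v₂ ν₀ ν) {π₁ π₂ : ℕ → ℝ≥0}
    (hπ₁ : IsNormalizedInvariant R (fun i j => q₁ i j) π₁)
    (hπ₂ : IsNormalizedInvariant R (fun i j => q₂ i j) π₂) {φ₁ φ₂ χ : ℝ}
    (hP : IsPolar R e₂ v₁ v₂ π₁ π₂ φ₁ φ₂ χ) {g : ℝ} (hg : 0 < g) (hgν : g ≤ ν) :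
    ∃ (f : ℕ × ℕ → ℝ) (ρ C : ℝ), 1 ≤ ρ ∧ 0 < C ∧ (∀ z, 0 < f z) ∧
      Comparable {z | ‖lin e₁ e₂ z‖ < ρ} (fun z => ‖lin e₁ e₂ z‖) g f ∧
      (∀ z ∉ corner R, Integrable f (p z).toMeasure) ∧
      ∀ z, ρ ≤ ‖lin e₁ e₂ z‖ →
        ∫ w, f w ∂(p z).toMeasure ≤ f z + C * ‖lin e₁ e₂ z‖ ^ (g - 2) := by
  have he := hW.cone
  set φ := e₂.arg with hφ
  have hφ0 : 0 < φ := he.arg_pos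
  obtain ⟨s₁, hs₁, hd₁⟩ := hP.drift₁
  obtain ⟨s₂, hs₂, hd₂⟩ := hP.drift₂
  have hcos₁ : 0 < Real.cos φ₁ := Real.cos_pos_of_mem_Ioo (abs_lt.1 hP.abs₁)
  have hcos₂ : 0 < Real.cos φ₂ := Real.cos_pos_of_mem_Ioo (abs_lt.1 hP.abs₂)
  -- The function is ‖ζ‖^g (2 - sin(m arg ζ)). With mφ an odd multiple of π it decreases steeply
  -- inwards at both axes, and for large m this angular derivative outweighs the radial one. The
  -- Laplacian is merely bounded.
  obtain ⟨k, hk⟩ := exists_nat_ge (max (2 * g / Real.cos φ₁) (2 * g / Real.cos φ₂) * φ)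
  set m := (2 * k + 1) * Real.pi / φ with hm
  have hmφ : m * φ = (2 * k + 1) * Real.pi := by rw [hm]; field_simp
  have hmgt : max (2 * g / Real.cos φ₁) (2 * g / Real.cos φ₂) < m := by
    rw [hm, lt_div_iff₀ hφ0]
    refine lt_of_le_of_lt hk ?_
    have h1 := Real.pi_gt_three
    have h2 : (0 : ℝ) ≤ k := Nat.cast_nonneg k
    nlinarith
  have hm₁ : 2 * g < m * Real.cos φ₁ :=
    (div_lt_iff₀ hcos₁).1 (lt_of_le_of_lt (le_max_left _ _) hmgt)
  have hm₂ : 2 * g < m * Real.cos φ₂ :=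
    (div_lt_iff₀ hcos₂).1 (lt_of_le_of_lt (le_max_right _ _) hmgt)
  have hT₁ := taylorData_re_epow ((2 : ℝ) : ℂ) (g / 2 : ℝ) (g / 2 : ℝ) g (by push_cast; ring)
  have hT₂ := taylorData_re_epow Complex.I ((g + m) / 2 : ℝ) ((g - m) / 2 : ℝ) g
    (by push_cast; ring)
  have hT := hT₁.add hT₂
  have hval : ∀ ζ : ℂ, ζ ≠ 0 → (((2 : ℝ) : ℂ) * epow (g / 2 : ℝ) (g / 2 : ℝ) ζ).re
      + (Complex.I * epow ((g + m) / 2 : ℝ) ((g - m) / 2 : ℝ) ζ).re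
      = ‖ζ‖ ^ g * (2 - Real.sin (m * ζ.arg)) := by
    intro ζ hζ
    rw [epow_eq_polar _ _ ζ hζ g (by push_cast; ring), epow_eq_polar _ _ ζ hζ g (by push_cast; ring)]
    have e1 : ((((g + m) / 2 : ℝ) : ℂ) - (((g - m) / 2 : ℝ) : ℂ)) * Complex.I * ζ.arg
        = (m * ζ.arg : ℝ) * Complex.I := by push_cast; ring
    rw [e1, sub_self, zero_mul, zero_mul, Complex.exp_zero, mul_one, ← Complex.ofReal_mul,
      Complex.ofReal_re, Complex.I_mul_re, Complex.im_ofReal_mul, Complex.exp_ofReal_mul_I_im]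
    ring
  have hlow : ∀ z : ℕ × ℕ, z ≠ 0 → 1 * ‖lin e₁ e₂ z‖ ^ g
      ≤ 1 * ((((2 : ℝ) : ℂ) * epow (g / 2 : ℝ) (g / 2 : ℝ) (lin e₁ e₂ z)).re
      + (Complex.I * epow ((g + m) / 2 : ℝ) ((g - m) / 2 : ℝ) (lin e₁ e₂ z)).re) := by
    intro z hz
    rw [hval _ (upper_ne_zero (lin_mem_upper he hz)), one_mul, one_mul]
    have := Real.sin_le_one (m * (lin e₁ e₂ z).arg)
    exact le_mul_of_one_le_right (by positivity) (by linarith)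
  have hupp : ∀ z : ℕ × ℕ, z ≠ 0 →
      1 * ((((2 : ℝ) : ℂ) * epow (g / 2 : ℝ) (g / 2 : ℝ) (lin e₁ e₂ z)).re
      + (Complex.I * epow ((g + m) / 2 : ℝ) ((g - m) / 2 : ℝ) (lin e₁ e₂ z)).re)
      ≤ 3 * ‖lin e₁ e₂ z‖ ^ g := by
    intro z hz
    rw [hval _ (upper_ne_zero (lin_mem_upper he hz)), one_mul, mul_comm]
    have := Real.neg_one_le_sin (m * (lin e₁ e₂ z).arg)
    gcongr
    linarith
  have hderiv : ∀ {e v : ℂ} {s β : ℝ}, e ≠ 0 → 0 < s → v = s * Complex.exp (β * Complex.I) →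
      2 * g * Real.cos (β - e.arg) - m * (Real.cos (m * e.arg) * Real.sin (β - e.arg))
        - g * (Real.sin (m * e.arg) * Real.cos (β - e.arg)) < 0 →
      ((gradE ((2 : ℝ) : ℂ) (g / 2 : ℝ) (g / 2 : ℝ) e
        + gradE Complex.I ((g + m) / 2 : ℝ) ((g - m) / 2 : ℝ) e) * v).re < 0 := by
    intro e v s β he0 hs hv hc
    have hn : 0 < ‖e‖ := norm_pos_iff.2 he0
    have ea : (g + m) / 2 + (g - m) / 2 = g := by ring
    have eb : (g + m) / 2 - (g - m) / 2 = m := by ring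
    rw [add_mul, Complex.add_re, re_gradE_mul_polar ((2 : ℝ) : ℂ) (g / 2) (g / 2) he0 hv,
      re_gradE_mul_polar Complex.I ((g + m) / 2) ((g - m) / 2) he0 hv, add_halves, sub_self,
      zero_mul, Complex.ofReal_zero, zero_mul, Complex.exp_zero, mul_one, Complex.re_ofReal_mul,
      Complex.add_re, Complex.re_ofReal_mul, Complex.re_ofReal_mul, Complex.exp_ofReal_mul_I_re,
      Complex.exp_ofReal_mul_I_re, Real.cos_neg, ea, eb, ← mul_add]
    refine mul_neg_of_pos_of_neg (by positivity) ?_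
    simp only [Complex.mul_re, Complex.mul_im, Complex.add_re, Complex.add_im, Complex.I_re,
      Complex.I_im, Complex.exp_ofReal_mul_I_re, Complex.exp_ofReal_mul_I_im, Complex.ofReal_re,
      Complex.ofReal_im, Real.cos_neg, Real.sin_neg]
    linarith
  have h₁ := hderiv (upper_ne_zero he.mem₁) hs₁ hd₁ (by
    rw [he.arg₁, mul_zero, Real.cos_zero, Real.sin_zero, sub_zero, add_comm (Real.pi / 2),
      Real.cos_add_pi_div_two, Real.sin_add_pi_div_two]
    have := Real.neg_one_le_sin φ₁
    nlinarith)
  have h₂ := hderiv (upper_ne_zero he.mem₂) hs₂ hd₂ (by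
    rw [← hφ, hmφ, show φ - Real.pi / 2 - φ₂ - φ = -(φ₂ + Real.pi / 2) by ring, Real.cos_neg,
      Real.sin_neg, Real.cos_add_pi_div_two, Real.sin_add_pi_div_two,
      show (2 * (k : ℝ) + 1) * Real.pi = (k : ℝ) * (2 * Real.pi) + Real.pi by ring,
      Real.cos_nat_mul_two_pi_add_pi, Real.sin_add_pi, Real.sin_periodic.nat_mul_eq]
    have := Real.neg_one_le_sin φ₂
    simp
    nlinarith)
  obtain ⟨CΛ, hCΛ0, hCΛ⟩ := hT.growth_laplacian
  obtain ⟨f, ρ, hρ, hf0, hfc, hfi, hfd⟩ := hW.exists_lyapunov hπ₁ hπ₂ hT h₁ h₂ (lam := 2 * CΛ)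
    (fun ζ hζ => by
      have := (le_abs_self _).trans (hCΛ ζ hζ)
      linarith) hgν (by linarith [hW.two_lt]) (by linarith [hW.one_lt])
    (lam' := 2 * CΛ + 1) (by linarith) (one_mul 1) one_pos hlow hupp
  refine ⟨f, ρ, 2 * CΛ + 1, hρ, by positivity, hf0, hfc, hfi, fun z hz => ?_⟩
  have := hfd z hz
  linarith

end IsWalk

/-! ### Survival estimates for the walk -/

section Chain

variable {p : ℕ × ℕ → PMF (ℕ × ℕ)} {B B' : Set (ℕ × ℕ)}

lemma killed_lt_one {g : ℕ × ℕ → ℝ≥0∞} (hg : ∀ z ∉ B, g z ≤ 1) {z z' : ℕ × ℕ} (hp : p z z' ≠ 0)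
    (hz' : z' ∈ B ∨ g z' < 1) : killed p B g z < 1 := by
  have hle : ∀ w, p z w * Bᶜ.indicator g w ≤ p z w := by
    intro w
    by_cases hw : w ∈ B
    · simp [hw]
    · rw [Set.indicator_of_mem (by exact hw)]
      exact mul_le_of_le_one_right' (hg w hw)
  have h1 : ∑' w, p z w = 1 := PMF.tsum_coe _
  rw [← h1]
  refine ENNReal.tsum_lt_tsum (i := z') ?_ hle ?_
  · exact ne_top_of_le_ne_top (PMF.tsum_coe_ne_top (p z)) (ENNReal.tsum_le_tsum hle)
  · by_cases hB : z' ∈ B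
    · simpa [hB] using pos_iff_ne_zero.2 hp
    · rw [Set.indicator_of_mem (by exact hB)]
      have h2 := hz'.resolve_left hB
      calc p z z' * g z' < p z z' * 1 :=
            ENNReal.mul_lt_mul_right hp (PMF.apply_ne_top _ _) h2
        _ = p z z' := mul_one _

/-- If the chain can reach `B`, then it is killed with positive probability. -/
lemma exists_survival_lt_one {z w : ℕ × ℕ}
    (h : Relation.ReflTransGen (fun a b => p a b ≠ 0) z w) (hw : w ∈ B) (hz : z ∉ B) :
    ∃ m, (killed p B)^[m] (fun _ => 1) z < 1 := by
  induction h using Relation.ReflTransGen.head_induction_on with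
  | refl => exact absurd hw hz
  | @head a b hab _ ih =>
    by_cases hb : b ∈ B
    · exact ⟨1, killed_lt_one (fun _ _ => le_rfl) hab (Or.inl hb)⟩
    · obtain ⟨m, hm⟩ := ih hb
      refine ⟨m + 1, ?_⟩
      rw [Function.iterate_succ_apply']
      exact killed_lt_one (fun w hw => killed_iterate_one_le m w hw) hab (Or.inr hm)

lemma survival_anti (h : B ⊆ B') (n : ℕ) : ∀ z ∉ B',
    (killed p B')^[n] (fun _ => 1) z ≤ (killed p B)^[n] (fun _ => 1) z := by
  induction n with
  | zero => intro z _; exact le_rfl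
  | succ n ih =>
    intro z _
    rw [Function.iterate_succ_apply', Function.iterate_succ_apply']
    refine ENNReal.tsum_le_tsum fun w => mul_le_mul' le_rfl ?_
    by_cases hw : w ∈ B'
    · simp [hw]
    · rw [Set.indicator_of_mem (by exact hw), Set.indicator_of_mem (by exact fun hc => hw (h hc))]
      exact ih w hw

/-- Survival from a state from which another one can be reached. -/
lemma exists_survival_ge {z w : ℕ × ℕ} (h : Relation.ReflTransGen (StepOff p B) z w) :
    ∃ c : ℝ≥0∞, c ≠ 0 ∧ c ≠ ⊤ ∧ ∃ k, ∀ n,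
      c * (killed p B)^[n] (fun _ => 1) w ≤ (killed p B)^[n + k] (fun _ => 1) z := by
  induction h using Relation.ReflTransGen.head_induction_on with
  | refl => exact ⟨1, one_ne_zero, ENNReal.one_ne_top, 0, fun n => by simp⟩
  | @head a b hab _ ih =>
    obtain ⟨c, hc, hct, k, hk⟩ := ih
    refine ⟨p a b * c, mul_ne_zero hab.1 hc, ENNReal.mul_ne_top (PMF.apply_ne_top _ _) hct, k + 1,
      fun n => ?_⟩
    rw [← add_assoc, Function.iterate_succ_apply', mul_assoc]
    refine (mul_le_mul' le_rfl (hk n)).trans ?_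
    refine le_trans (le_of_eq ?_) (ENNReal.le_tsum b)
    rw [Set.indicator_of_mem (by exact hab.2.2)]

lemma tsum_ofReal_eq {f : ℕ × ℕ → ℝ} (hf : ∀ z, 0 ≤ f z) {z : ℕ × ℕ}
    (hi : Integrable f (p z).toMeasure) :
    ∑' w, p z w * ENNReal.ofReal (f w) = ENNReal.ofReal (∫ w, f w ∂(p z).toMeasure) := by
  rw [← pmf_lintegral, ofReal_integral_eq_lintegral_ofReal hi (Filter.Eventually.of_forall hf)]

lemma exists_bound_of_finite {α : Type*} {s : Set α} (hs : s.Finite) (g : α → ℝ) :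
    ∃ S : ℝ, 0 ≤ S ∧ ∀ z ∈ s, g z ≤ S := by
  obtain ⟨S, hS⟩ := (hs.image g).bddAbove
  exact ⟨max S 0, le_max_right _ _, fun z hz =>
    (hS (Set.mem_image_of_mem g hz)).trans (le_max_left _ _)⟩

/-- Only finitely many non-zero states are added, and there both `f` and the power of the norm are
positive. -/
lemma Comparable.extend {e₁ e₂ : ℂ} (he : IsCone e₁ e₂) {ρ γ : ℝ} {f : ℕ × ℕ → ℝ}
    (h : Comparable {z | ‖lin e₁ e₂ z‖ < ρ} (fun z => ‖lin e₁ e₂ z‖) γ f) (hf : ∀ z, 0 < f z) :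
    Comparable {0} (fun z => ‖lin e₁ e₂ z‖) γ f := by
  obtain ⟨c, C, hc, hC, h⟩ := h
  obtain ⟨S, hS0, hS⟩ := exists_bound_of_finite (finite_norm_lin_lt he ρ)
    fun z => f z / ‖lin e₁ e₂ z‖ ^ γ
  obtain ⟨S', hS'0, hS'⟩ := exists_bound_of_finite (finite_norm_lin_lt he ρ)
    fun z => ‖lin e₁ e₂ z‖ ^ γ / f z
  refine ⟨(c⁻¹ + S')⁻¹, C + S, by positivity, by positivity, fun z hz => ?_⟩
  have hz : z ≠ 0 := hz
  have hp : 0 < ‖lin e₁ e₂ z‖ := norm_pos_iff.2 (upper_ne_zero (lin_mem_upper he hz))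
  have hpγ : 0 < ‖lin e₁ e₂ z‖ ^ γ := by positivity
  have hfz := hf z
  have h3 : 0 ≤ c⁻¹ * f z := by positivity
  have h5 : 0 ≤ S' * f z := by positivity
  have h6 : 0 ≤ C * ‖lin e₁ e₂ z‖ ^ γ := by positivity
  have h7 : 0 ≤ S * ‖lin e₁ e₂ z‖ ^ γ := by positivity
  show (c⁻¹ + S')⁻¹ * ‖lin e₁ e₂ z‖ ^ γ ≤ f z ∧ f z ≤ (C + S) * ‖lin e₁ e₂ z‖ ^ γ
  rw [inv_mul_le_iff₀ (by positivity), add_mul, add_mul]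
  by_cases hzρ : ‖lin e₁ e₂ z‖ < ρ
  · have h1 := (div_le_iff₀ hpγ).1 (hS z hzρ)
    have h2 := (div_le_iff₀ hfz).1 (hS' z hzρ)
    constructor <;> linarith
  · have := h z hzρ
    have h4 : ‖lin e₁ e₂ z‖ ^ γ ≤ c⁻¹ * f z := by
      rw [le_inv_mul_iff₀ hc]; exact this.1
    constructor <;> linarith

end Chain

/-! ### Balls -/

lemma stateNorm_eq (z : ℕ × ℕ) : stateNorm z = √((z.1 : ℝ) ^ 2 + (z.2 : ℝ) ^ 2) := by
  simp [stateNorm, vec, toInt, EuclideanSpace.norm_eq]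

lemma fst_le_stateNorm (z : ℕ × ℕ) : (z.1 : ℝ) ≤ stateNorm z := by
  rw [stateNorm_eq]; exact Real.le_sqrt_of_sq_le (by nlinarith [sq_nonneg (z.2 : ℝ)])

lemma snd_le_stateNorm (z : ℕ × ℕ) : (z.2 : ℝ) ≤ stateNorm z := by
  rw [stateNorm_eq]; exact Real.le_sqrt_of_sq_le (by nlinarith [sq_nonneg (z.1 : ℝ)])

lemma stateNorm_le_add (z : ℕ × ℕ) : stateNorm z ≤ z.1 + z.2 := by
  rw [stateNorm_eq]
  refine Real.sqrt_le_iff.2 ⟨by positivity, ?_⟩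
  have : (0 : ℝ) ≤ z.1 * z.2 := by positivity
  nlinarith

lemma finite_ball (r : ℝ) : (ball r).Finite := by
  obtain ⟨N, hN⟩ := exists_nat_ge r
  refine (Set.finite_Iic ((N, N) : ℕ × ℕ)).subset fun z hz => ?_
  have h1 := (fst_le_stateNorm z).trans (le_trans hz hN)
  have h2 := (snd_le_stateNorm z).trans (le_trans hz hN)
  exact ⟨by exact_mod_cast h1, by exact_mod_cast h2⟩

lemma zero_mem_ball {r : ℝ} (hr : 0 ≤ r) : (0 : ℕ × ℕ) ∈ ball r := by
  show stateNorm 0 ≤ r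
  rw [stateNorm_eq]; simpa using hr

lemma ball_mono {r s : ℝ} (h : r ≤ s) : ball r ⊆ ball s := fun _ hz => le_trans hz h

lemma exists_ball_of_norm {e₁ e₂ : ℂ} (he : IsCone e₁ e₂) (ρ : ℝ) :
    ∃ r : ℝ, ∀ z ∉ ball r, ρ ≤ ‖lin e₁ e₂ z‖ := by
  obtain ⟨c, hc, h⟩ := exists_norm_lin_ge he
  refine ⟨ρ / c, fun z hz => ?_⟩
  have h1 : ρ / c < stateNorm z := not_le.1 hz
  rw [div_lt_iff₀ hc] at h1
  have := h z
  have := stateNorm_le_add z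
  nlinarith

lemma corner_subset_ball {R : ℕ} {r : ℝ} (hr : R * √2 < r) : corner R ⊆ ball r := by
  intro z hz
  have h1 : (z.1 : ℝ) ≤ R := by exact_mod_cast hz.1.le
  have h2 : (z.2 : ℝ) ≤ R := by exact_mod_cast hz.2.le
  refine le_trans ?_ hr.le
  rw [stateNorm_eq]
  refine Real.sqrt_le_iff.2 ⟨by positivity, ?_⟩
  rw [mul_pow, Real.sq_sqrt (by norm_num)]
  have h3 : (0 : ℝ) ≤ z.1 := Nat.cast_nonneg _
  have h4 : (0 : ℝ) ≤ z.2 := Nat.cast_nonneg _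
  nlinarith

namespace IsWalk

variable {R : ℕ} {p : ℕ × ℕ → PMF (ℕ × ℕ)} {p₀ : PMF (ℤ × ℤ)} {q₁ q₂ : ℕ → PMF ℕ}
  {e₁ e₂ : ℂ} {v₁ v₂ : ℕ → ℂ} {ν₀ ν : ℝ} {π₁ π₂ : ℕ → ℝ≥0} {φ₁ φ₂ χ : ℝ}

/-- Half the sum of |φ₁ - φ₂| and |φ₁ + φ₂| is the larger of |φ₁| and |φ₂|, which is less than π/2.
The inequality is the positivity condition for the order χ itself and, being strict, leaves room
slightly beyond it. -/
lemma IsPolar.angle_lt (hP : IsPolar R e₂ v₁ v₂ π₁ π₂ φ₁ φ₂ χ) :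
    |φ₁ - φ₂| / 2 + |χ * e₂.arg| / 2 < Real.pi / 2 := by
  rw [← hP.eq]
  have h1 := abs_lt.1 hP.abs₁
  have h2 := abs_lt.1 hP.abs₂
  rcases abs_cases (φ₁ - φ₂) with h | h <;> rcases abs_cases (φ₁ + φ₂) with h' | h' <;>
    rw [h.1, h'.1] <;> linarith

/-- A supermartingale of any order strictly between `0` and `χ`. -/
theorem exists_super (hW : IsWalk R p p₀ q₁ q₂ e₁ e₂ v₁ v₂ ν₀ ν)
    (hπ₁ : IsNormalizedInvariant R (fun i j => q₁ i j) π₁)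
    (hπ₂ : IsNormalizedInvariant R (fun i j => q₂ i j) π₂)
    (hP : IsPolar R e₂ v₁ v₂ π₁ π₂ φ₁ φ₂ χ) {γ : ℝ} (hγχ : (0 < γ ∧ γ < χ) ∨ (χ < γ ∧ γ < 0))
    (hγ : γ ≤ ν) (hγ₀ : 2 - ν₀ < γ) (hγ₁ : 1 - ν < γ) :
    ∃ (f : ℕ × ℕ → ℝ) (ρ c : ℝ), 1 ≤ ρ ∧ 0 < c ∧ (∀ z, 0 < f z) ∧
      Comparable {z | ‖lin e₁ e₂ z‖ < ρ} (fun z => ‖lin e₁ e₂ z‖) γ f ∧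
      (∀ z ∉ corner R, Integrable f (p z).toMeasure) ∧
      ∀ z, ρ ≤ ‖lin e₁ e₂ z‖ →
        ∫ w, f w ∂(p z).toMeasure ≤ f z - c * ‖lin e₁ e₂ z‖ ^ (γ - 2) := by
  have hφ := hW.cone.arg_pos
  have hlt := hP.angle_lt
  have hab : |γ| < |χ| := by
    rcases hγχ with ⟨h1, h2⟩ | ⟨h1, h2⟩
    · rw [abs_of_pos h1, abs_of_pos (h1.trans h2)]; exact h2
    · rw [abs_of_neg h2, abs_of_neg (h1.trans h2)]; linarith
  rw [abs_mul, abs_of_pos hφ] at hlt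
  have hn := abs_nonneg (φ₁ - φ₂)
  have hpi := Real.pi_pos
  have h1 : |γ| * e₂.arg < |χ| * e₂.arg := by gcongr
  have hsign : 1 * γ * Real.sin ((γ - χ) * e₂.arg / 2) < 0 := by
    rcases hγχ with ⟨h1, h2⟩ | ⟨h1, h2⟩
    · rw [abs_of_pos (h1.trans h2)] at hlt
      have h3 : 0 < (χ - γ) * e₂.arg := mul_pos (by linarith) hφ
      have h4 : (χ - γ) * e₂.arg ≤ χ * e₂.arg := by gcongr; linarith
      have : 0 < Real.sin ((χ - γ) * e₂.arg / 2) :=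
        Real.sin_pos_of_pos_of_lt_pi (by linarith) (by linarith)
      rw [show (γ - χ) * e₂.arg / 2 = -((χ - γ) * e₂.arg / 2) by ring, Real.sin_neg]
      nlinarith
    · rw [abs_of_neg (h1.trans h2)] at hlt
      have h3 : 0 < (γ - χ) * e₂.arg := mul_pos (by linarith) hφ
      have h4 : (γ - χ) * e₂.arg ≤ -χ * e₂.arg := by gcongr; linarith
      have : 0 < Real.sin ((γ - χ) * e₂.arg / 2) :=
        Real.sin_pos_of_pos_of_lt_pi (by linarith) (by linarith)
      nlinarith
  obtain ⟨f, ρ, c, h⟩ := hW.exists_lyapunov_radial hπ₁ hπ₂ hP (one_mul 1) hsign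
    (by linarith) hγ hγ₀ hγ₁
  exact ⟨f, ρ, c, by simpa using h⟩

/-- Extension of the drift condition to the complement of a ball containing the corner. -/
lemma exists_super_extension (hW : IsWalk R p p₀ q₁ q₂ e₁ e₂ v₁ v₂ ν₀ ν) {r : ℝ}
    (hr : R * √2 < r)
    (hreach : ∀ z ∉ ball r, ∃ w ∈ ball r, Relation.ReflTransGen (fun a b => p a b ≠ 0) z w)
    {γ c ρ : ℝ} {f : ℕ × ℕ → ℝ} (hf0 : ∀ z, 0 < f z)
    (hfi : ∀ z ∉ corner R, Integrable f (p z).toMeasure)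
    (hfd : ∀ z, ρ ≤ ‖lin e₁ e₂ z‖ →
        ∫ w, f w ∂(p z).toMeasure ≤ f z - c * ‖lin e₁ e₂ z‖ ^ (γ - 2)) (hc : 0 < c) :
    ∃ (f' : ℕ × ℕ → ℝ≥0∞) (D : ℝ≥0∞), D ≠ ⊤ ∧ ∀ z ∉ ball r, ENNReal.ofReal (f z) ≤ f' z ∧
      f' z ≤ ENNReal.ofReal (f z) + D ∧
      killed p (ball r) f' z + ENNReal.ofReal (c * ‖lin e₁ e₂ z‖ ^ (γ - 2)) ≤ f' z := by
  have hkf : ∀ z ∉ ball r, killed p (ball r) (fun w => ENNReal.ofReal (f w)) z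
      ≤ ENNReal.ofReal (∫ w, f w ∂(p z).toMeasure) := fun z hz => by
    rw [← tsum_ofReal_eq (fun w => (hf0 w).le) (hfi z fun h => hz (corner_subset_ball hr h))]
    exact killed_le_full _ _
  refine exists_drift_extension (B' := {z | ‖lin e₁ e₂ z‖ < ρ})
    ((finite_norm_lin_lt hW.cone ρ).subset Set.sdiff_subset) (fun z hz hzB => ?_)
    (fun z hz => ne_top_of_le_ne_top ENNReal.ofReal_ne_top (hkf z hz.2))
    (fun z _ => ENNReal.ofReal_ne_top) (fun z hz => ?_)
  · have h1 := hfd z (not_lt.1 hz)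
    have h2 : 0 ≤ c * ‖lin e₁ e₂ z‖ ^ (γ - 2) := by positivity
    have h3 : 0 ≤ ∫ w, f w ∂(p z).toMeasure := integral_nonneg fun w => (hf0 w).le
    refine (add_le_add (hkf z hzB) le_rfl).trans ?_
    rw [← ENNReal.ofReal_add h3 h2]
    exact ENNReal.ofReal_le_ofReal (by linarith)
  · obtain ⟨w, hw, hzw⟩ := hreach z hz.2
    exact exists_survival_lt_one hzw hw hz.2

/-- Upper bound for the survival probability in the recurrent case. -/
theorem survival_upper (hW : IsWalk R p p₀ q₁ q₂ e₁ e₂ v₁ v₂ ν₀ ν)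
    (hπ₁ : IsNormalizedInvariant R (fun i j => q₁ i j) π₁)
    (hπ₂ : IsNormalizedInvariant R (fun i j => q₂ i j) π₂)
    (hP : IsPolar R e₂ v₁ v₂ π₁ π₂ φ₁ φ₂ χ) (hχ : 0 < χ) {r : ℝ} (hr : R * √2 < r)
    (hreach : ∀ z ∉ ball r, ∃ w ∈ ball r, Relation.ReflTransGen (fun a b => p a b ≠ 0) z w)
    {ε : ℝ} (hε : 0 < ε) {z : ℕ × ℕ} (hz : z ∉ ball r) :
    ∃ D : ℝ, 0 ≤ D ∧ ∀ n : ℕ, 1 ≤ n →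
      (killed p (ball r))^[n] (fun _ => 1) z
        ≤ ENNReal.ofReal (D * (n : ℝ) ^ (-(min ν χ) / 2 + ε)) := by
  have hν := hW.one_lt
  have hν0 := hW.two_lt
  have hr0 : 0 ≤ r := le_trans (by positivity) hr.le
  set m := min ν χ with hm
  have hm0 : 0 < m := lt_min (by linarith) hχ
  have hmν : m ≤ ν := min_le_left _ _
  have hmχ : m ≤ χ := min_le_right _ _
  -- The supermartingales have orders η and m - η; their difference m - 2η loses at most ε in the
  -- decay exponent.
  set η := min (ε / 2) (m / 4) with hη
  have hη0 : 0 < η := lt_min (by positivity) (by positivity)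
  have hηε : η ≤ ε / 2 := min_le_left _ _
  have hηm : η ≤ m / 4 := min_le_right _ _
  obtain ⟨f, ρ, c, hρ, hc, hf0, hfc, hfi, hfd⟩ := hW.exists_super hπ₁ hπ₂ hP (γ := η)
    (Or.inl ⟨hη0, by linarith⟩) (by linarith) (by linarith) (by linarith)
  obtain ⟨g, ρ', c', hρ', hc', hg0, hgc, hgi, hgd⟩ := hW.exists_super hπ₁ hπ₂ hP (γ := m - η)
    (Or.inl ⟨by linarith, by linarith⟩) (by linarith) (by linarith) (by linarith)
  obtain ⟨f', D, hD, hf'⟩ := hW.exists_super_extension hr hreach hf0 hfi hfd hc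
  obtain ⟨g', D', hD', hg'⟩ := hW.exists_super_extension hr hreach hg0 hgi hgd hc'
  obtain ⟨a, A, ha, hA, hfA⟩ := hfc.extend hW.cone hf0
  obtain ⟨b, B, hb, hB, hgB⟩ := hgc.extend hW.cone hg0
  obtain ⟨v, hv, hvz⟩ := exists_norm_lin_ge' hW.cone
  have hne : ∀ w ∉ ball r, w ≠ 0 := fun w hw h => hw (h ▸ zero_mem_ball hr0)
  have hvη : 0 < v ^ η := by positivity
  set C : ℝ≥0∞ := ENNReal.ofReal (a * v ^ η)⁻¹ + ENNReal.ofReal b⁻¹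
    + (ENNReal.ofReal A + D * ENNReal.ofReal (v ^ η)⁻¹) with hC
  have hCt : C ≠ ⊤ := by
    simp only [hC, ne_eq, ENNReal.add_eq_top, ENNReal.ofReal_ne_top, false_or]
    exact ENNReal.mul_ne_top hD ENNReal.ofReal_ne_top
  have hlow : ∀ w ∉ ball r, v ^ η ≤ ‖lin e₁ e₂ w‖ ^ η := fun w hw =>
    Real.rpow_le_rpow hv.le (hvz w (hne w hw)) hη0.le
  obtain ⟨E, hE0, hE⟩ := survival_upper_bound (p := p) (B := ball r)
    (V := fun z => ‖lin e₁ e₂ z‖) (γ := η) (γ' := m - η) (c := c) (C := C) (f := f') (g := g')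
    (fun w hw => lt_of_lt_of_le hv (hvz w (hne w hw))) (by linarith) hc hCt
    (fun w hw => ne_top_of_le_ne_top (ENNReal.add_ne_top.2 ⟨ENNReal.ofReal_ne_top, hD⟩)
      (hf' w hw).2.1)
    (fun w hw => ne_top_of_le_ne_top (ENNReal.add_ne_top.2 ⟨ENNReal.ofReal_ne_top, hD'⟩)
      (hg' w hw).2.1)
    (fun w hw => (hf' w hw).2.2)
    (fun w hw => by
      calc (1 : ℝ≥0∞) = ENNReal.ofReal 1 := ENNReal.ofReal_one.symm
        _ ≤ ENNReal.ofReal ((a * v ^ η)⁻¹ * f w) := by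
          apply ENNReal.ofReal_le_ofReal
          rw [le_inv_mul_iff₀ (by positivity), mul_one]
          exact (mul_le_mul_of_nonneg_left (hlow w hw) ha.le).trans
            (hfA w (by simpa using hne w hw)).1
        _ = ENNReal.ofReal (a * v ^ η)⁻¹ * ENNReal.ofReal (f w) :=
          ENNReal.ofReal_mul (by positivity)
        _ ≤ C * f' w := by
          refine mul_le_mul' ?_ (hf' w hw).1
          rw [hC, add_assoc]; exact le_self_add)
    (fun w hw => by
      refine (hf' w hw).2.1.trans ?_
      have hw0 : 0 ≤ ‖lin e₁ e₂ w‖ ^ η := by positivity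
      calc ENNReal.ofReal (f w) + D
          ≤ ENNReal.ofReal A * ENNReal.ofReal (‖lin e₁ e₂ w‖ ^ η)
            + D * (ENNReal.ofReal (v ^ η)⁻¹ * ENNReal.ofReal (‖lin e₁ e₂ w‖ ^ η)) := by
            refine add_le_add ?_ (le_mul_of_one_le_right' ?_)
            · rw [← ENNReal.ofReal_mul hA.le]
              exact ENNReal.ofReal_le_ofReal (hfA w (by simpa using hne w hw)).2
            · rw [← ENNReal.ofReal_mul (by positivity), ENNReal.one_le_ofReal,
                le_inv_mul_iff₀ hvη, mul_one]
              exact hlow w hw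
        _ = (ENNReal.ofReal A + D * ENNReal.ofReal (v ^ η)⁻¹)
            * ENNReal.ofReal (‖lin e₁ e₂ w‖ ^ η) := by ring
        _ ≤ _ := by
          refine mul_le_mul' ?_ le_rfl
          rw [hC]; exact le_add_self)
    (fun w hw => le_self_add.trans (hg' w hw).2.2)
    (fun w hw => by
      calc ENNReal.ofReal (‖lin e₁ e₂ w‖ ^ (m - η)) ≤ ENNReal.ofReal (b⁻¹ * g w) := by
            apply ENNReal.ofReal_le_ofReal
            rw [le_inv_mul_iff₀ hb]
            exact (hgB w (by simpa using hne w hw)).1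
        _ = ENNReal.ofReal b⁻¹ * ENNReal.ofReal (g w) := ENNReal.ofReal_mul (by positivity)
        _ ≤ C * g' w := by
          refine mul_le_mul' ?_ (hg' w hw).1
          rw [hC, add_comm (ENNReal.ofReal (a * v ^ η)⁻¹), add_assoc]; exact le_self_add)
    hz
  refine ⟨E, hE0, fun n hn => (hE n hn).trans (ENNReal.ofReal_le_ofReal ?_)⟩
  have hn1 : (1 : ℝ) ≤ n := by exact_mod_cast hn
  have : (n : ℝ) ^ (-(m - η - η) / 2) ≤ (n : ℝ) ^ (-m / 2 + ε) :=
    Real.rpow_le_rpow_of_exponent_le hn1 (by linarith)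
  gcongr

/-- In the transient case the survival probability is bounded below far away. -/
theorem survival_transient (hW : IsWalk R p p₀ q₁ q₂ e₁ e₂ v₁ v₂ ν₀ ν)
    (hπ₁ : IsNormalizedInvariant R (fun i j => q₁ i j) π₁)
    (hπ₂ : IsNormalizedInvariant R (fun i j => q₂ i j) π₂)
    (hP : IsPolar R e₂ v₁ v₂ π₁ π₂ φ₁ φ₂ χ) (hχ : χ < 0) (r : ℝ) :
    ∃ r₀ : ℝ, r < r₀ ∧ ∀ z ∉ ball r₀, ∀ n, 2⁻¹ ≤ (killed p (ball r))^[n] (fun _ => 1) z := by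
  have hν := hW.one_lt
  have hν0 := hW.two_lt
  -- A negative order above χ gives a supermartingale that tends to zero at infinity; the other two
  -- bounds are what the moments allow.
  obtain ⟨γ, hγ1, hγ2⟩ : ∃ γ, max (max χ (2 - ν₀)) (1 - ν) < γ ∧ γ < 0 :=
    exists_between (max_lt (max_lt hχ (by linarith)) (by linarith))
  have g1 : χ < γ := lt_of_le_of_lt ((le_max_left _ _).trans (le_max_left _ _)) hγ1
  have g2 : 2 - ν₀ < γ := lt_of_le_of_lt ((le_max_right _ _).trans (le_max_left _ _)) hγ1
  have g3 : 1 - ν < γ := lt_of_le_of_lt (le_max_right _ _) hγ1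
  obtain ⟨f, ρ, c, hρ, hc, hf0, ⟨a, A, ha, hA, hfA⟩, hfi, hfd⟩ :=
    hW.exists_super hπ₁ hπ₂ hP (Or.inr ⟨g1, hγ2⟩) (by linarith) g2 g3
  obtain ⟨r₁, hr₁⟩ := exists_ball_of_norm hW.cone ρ
  set s := max (max r r₁) (R * √2 + 1) with hs
  have hsR : R * √2 < s := lt_of_lt_of_le (by linarith) (le_max_right _ _)
  have hs0 : 0 ≤ s := le_trans (by positivity) hsR.le
  set B := ball s with hB
  -- Dividing by the minimum over the finite ball makes the function at least 1 on the target; far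
  -- away it is at most 1/2, which leaves survival probability at least 1/2.
  obtain ⟨z₀, hz₀, hmin⟩ := (finite_ball s).exists_minimalFor f _ ⟨0, zero_mem_ball hs0⟩
  have hmin' : ∀ z ∈ B, f z₀ ≤ f z := fun z hz => by
    rcases le_total (f z₀) (f z) with h | h
    · exact h
    · exact hmin hz h
  set m := f z₀ with hm
  have hm0 : 0 < m := hf0 z₀
  have hsup : ∀ z ∉ B, ∑' w, p z w * ENNReal.ofReal (f w / m) ≤ ENNReal.ofReal (f z / m) := by
    intro z hz
    have hzc : z ∉ corner R := fun h => hz (corner_subset_ball hsR h)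
    have hzρ : ρ ≤ ‖lin e₁ e₂ z‖ := hr₁ z fun h =>
      hz (ball_mono ((le_max_right _ _).trans (le_max_left _ _)) h)
    rw [tsum_ofReal_eq (fun w => (div_pos (hf0 w) hm0).le) ((hfi z hzc).div_const m),
      integral_div]
    apply ENNReal.ofReal_le_ofReal
    have := hfd z hzρ
    have h2 : 0 ≤ c * ‖lin e₁ e₂ z‖ ^ (γ - 2) := by positivity
    gcongr
    linarith
  have hone : ∀ z ∈ B, 1 ≤ ENNReal.ofReal (f z / m) := by
    intro z hz
    rw [ENNReal.one_le_ofReal, le_div_iff₀ hm0, one_mul]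
    exact hmin' z hz
  have hT : Filter.Tendsto (fun x : ℝ => A * x ^ γ) Filter.atTop (nhds 0) := by
    have := (tendsto_rpow_neg_atTop (neg_pos.2 hγ2)).const_mul A
    simpa using this
  obtain ⟨ρ₂, hρ₂⟩ := Filter.eventually_atTop.1 (hT.eventually_le_const (half_pos hm0))
  obtain ⟨r₂, hr₂⟩ := exists_ball_of_norm hW.cone (max ρ ρ₂)
  refine ⟨max (s + 1) r₂, ?_, fun z hz n => ?_⟩
  · have : r ≤ s := (le_max_left _ _).trans (le_max_left _ _)
    exact lt_of_lt_of_le (by linarith) (le_max_left _ _)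
  · have hzB : z ∉ B := fun h => hz (ball_mono (le_trans (by linarith) (le_max_left _ _)) h)
    have hzV := hr₂ z fun h => hz (ball_mono (le_max_right _ _) h)
    have h1 := one_le_survival_add hsup hone n z hzB
    have h2 : ENNReal.ofReal (f z / m) ≤ 2⁻¹ := by
      have e1 : f z / m ≤ 2⁻¹ := by
        rw [div_le_iff₀ hm0]
        have e2 := (hfA z (not_lt.2 ((le_max_left _ _).trans hzV))).2
        have e3 := hρ₂ _ ((le_max_right _ _).trans hzV)
        linarith
      refine (ENNReal.ofReal_le_ofReal e1).trans (le_of_eq ?_)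
      rw [ENNReal.ofReal_inv_of_pos two_pos, ENNReal.ofReal_ofNat]
    have h3 : (killed p B)^[n] (fun _ => 1) z ≤ (killed p (ball r))^[n] (fun _ => 1) z :=
      survival_anti (ball_mono ((le_max_left _ _).trans (le_max_left _ _))) n z hzB
    refine le_trans ?_ h3
    have h4 : (1 : ℝ≥0∞) ≤ (killed p B)^[n] (fun _ => 1) z + 2⁻¹ := h1.trans (by gcongr)
    have h5 : (2⁻¹ : ℝ≥0∞) + 2⁻¹ ≤ (killed p B)^[n] (fun _ => 1) z + 2⁻¹ := by
      rwa [ENNReal.inv_two_add_inv_two]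
    exact (ENNReal.add_le_add_iff_right (by simp)).1 h5

end IsWalk

/-! ### The lower bound for the survival probability -/

/-- Killing loses at most `b` times the probability of entering `B`. That loss is written with the
survival term on the other side, since subtraction is truncated in `ℝ≥0∞`. -/
lemma full_add_le_killed_add {p : ℕ × ℕ → PMF (ℕ × ℕ)} {B : Set (ℕ × ℕ)} {f : ℕ × ℕ → ℝ≥0∞}
    {b : ℝ≥0∞} (hb : ∀ z ∈ B, f z ≤ b) (z : ℕ × ℕ) :
    ∑' w, p z w * f w + b * killed p B (fun _ => 1) z ≤ killed p B f z + b := by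
  have h1 : b = ∑' w, b * p z w := by rw [ENNReal.tsum_mul_left, PMF.tsum_coe, mul_one]
  calc ∑' w, p z w * f w + b * killed p B (fun _ => 1) z
      = ∑' w, (p z w * f w + b * (p z w * Bᶜ.indicator (fun _ => 1) w)) := by
        rw [ENNReal.tsum_add, ENNReal.tsum_mul_left]; rfl
    _ ≤ ∑' w, (p z w * Bᶜ.indicator f w + b * p z w) := by
        refine ENNReal.tsum_le_tsum fun w => ?_
        by_cases hw : w ∈ B
        · rw [Set.indicator_of_notMem (by simpa using hw),
            Set.indicator_of_notMem (by simpa using hw), mul_zero, mul_zero, zero_add,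
            add_zero, mul_comm]
          gcongr
          exact hb w hw
        · rw [Set.indicator_of_mem (by exact hw), Set.indicator_of_mem (by exact hw), mul_one]
    _ = killed p B f z + b := by rw [ENNReal.tsum_add, ← h1]; rfl

lemma Comparable.anti {B B' : Set (ℕ × ℕ)} {V f : ℕ × ℕ → ℝ} {γ : ℝ} (h : Comparable B V γ f)
    (hB : ∀ z ∉ B', z ∉ B) : Comparable B' V γ f := by
  obtain ⟨c, C, hc, hC, h⟩ := h
  exact ⟨c, C, hc, hC, fun z hz => h z (hB z hz)⟩

namespace IsWalk

variable {R : ℕ} {p : ℕ × ℕ → PMF (ℕ × ℕ)} {p₀ : PMF (ℤ × ℤ)} {q₁ q₂ : ℕ → PMF ℕ}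
  {e₁ e₂ : ℂ} {v₁ v₂ : ℕ → ℂ} {ν₀ ν : ℝ} {π₁ π₂ : ℕ → ℝ≥0} {φ₁ φ₂ χ : ℝ}

/-- A supermartingale of an order just below `χ ≥ 0`. -/
lemma exists_super_near (hW : IsWalk R p p₀ q₁ q₂ e₁ e₂ v₁ v₂ ν₀ ν)
    (hπ₁ : IsNormalizedInvariant R (fun i j => q₁ i j) π₁)
    (hπ₂ : IsNormalizedInvariant R (fun i j => q₂ i j) π₂)
    (hP : IsPolar R e₂ v₁ v₂ π₁ π₂ φ₁ φ₂ χ) (hχ : 0 ≤ χ) (hν : χ < ν) {δ : ℝ} (hδ : 0 < δ) :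
    ∃ (γ : ℝ) (f : ℕ × ℕ → ℝ) (ρ : ℝ), 0 ≤ γ ∧ γ ≤ χ ∧ χ - δ ≤ γ ∧ 1 ≤ ρ ∧ (∀ z, 0 < f z) ∧
      Comparable {z | ‖lin e₁ e₂ z‖ < ρ} (fun z => ‖lin e₁ e₂ z‖) γ f ∧
      (∀ z ∉ corner R, Integrable f (p z).toMeasure) ∧
      ∀ z, ρ ≤ ‖lin e₁ e₂ z‖ → ∫ w, f w ∂(p z).toMeasure ≤ f z := by
  -- For χ = 0 no positive order lies below χ; the constant function, of order zero, is
  -- superharmonic and takes the place.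
  rcases hχ.eq_or_lt with rfl | hχ
  · refine ⟨0, fun _ => 1, 1, le_rfl, le_rfl, by linarith, le_rfl, fun _ => one_pos,
      ⟨1, 1, one_pos, one_pos, fun z _ => by simp⟩, fun z _ => integrable_const _, fun z _ => ?_⟩
    simp
  · have h1 : min δ (χ / 2) ≤ δ := min_le_left _ _
    have h2 : min δ (χ / 2) ≤ χ / 2 := min_le_right _ _
    have h3 : 0 < min δ (χ / 2) := lt_min hδ (by linarith)
    have hν0 := hW.two_lt
    have hν1 := hW.one_lt
    obtain ⟨f, ρ, c, hρ, hc, hf0, hfc, hfi, hfd⟩ := hW.exists_super hπ₁ hπ₂ hP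
      (γ := χ - min δ (χ / 2)) (Or.inl ⟨by linarith, by linarith⟩) (by linarith) (by linarith)
      (by linarith)
    refine ⟨_, f, ρ, by linarith, by linarith, by linarith, hρ, hf0, hfc, hfi, fun z hz => ?_⟩
    have h4 := hfd z hz
    have h5 : 0 ≤ c * ‖lin e₁ e₂ z‖ ^ (χ - min δ (χ / 2) - 2) := by positivity
    linarith

/-- Lower bound for the survival probability. -/
theorem survival_lower (hW : IsWalk R p p₀ q₁ q₂ e₁ e₂ v₁ v₂ ν₀ ν)
    (hπ₁ : IsNormalizedInvariant R (fun i j => q₁ i j) π₁)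
    (hπ₂ : IsNormalizedInvariant R (fun i j => q₂ i j) π₂)
    (hP : IsPolar R e₂ v₁ v₂ π₁ π₂ φ₁ φ₂ χ) (hχ : 0 ≤ χ) (hν : max 2 χ < ν) (r : ℝ)
    {ε : ℝ} (hε : 0 < ε) :
    ∃ d ρ : ℝ, 0 < d ∧ r ≤ ρ ∧ ∀ z ∉ ball ρ, ∀ n : ℕ, 1 ≤ n →
      ENNReal.ofReal (d * (n : ℝ) ^ (-χ / 2 - ε)) ≤ (killed p (ball r))^[n] (fun _ => 1) z := by
  have hν2 : 2 < ν := lt_of_le_of_lt (le_max_left _ _) hν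
  have hνχ : χ < ν := lt_of_le_of_lt (le_max_right _ _) hν
  have hν0 := hW.two_lt
  have hφ := hW.cone.arg_pos
  have hφπ := Complex.arg_le_pi e₂
  have hpi := Real.pi_pos
  have hang := hP.angle_lt
  rw [abs_of_nonneg (mul_nonneg hχ hφ.le)] at hang
  -- All conditions are open and hold at δ = 0. The orders χ + δ and at least χ - δ differ by at
  -- most 2δ, so the final exponent is at most (χ + δ)/(2 - 2δ), close to χ/2.
  obtain ⟨δ, hδ0, hδ1, hδν, hδang, hδε⟩ : ∃ δ : ℝ, 0 < δ ∧ δ < 1 / 2 ∧ χ + δ < ν ∧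
      |φ₁ - φ₂| / 2 + (χ + δ) * e₂.arg / 2 < Real.pi / 2 ∧ (χ + δ) / (2 - 2 * δ) < χ / 2 + ε := by
    have c1 : ContinuousAt (fun δ : ℝ => χ + δ) 0 := by fun_prop
    have c2 : ContinuousAt (fun δ : ℝ => |φ₁ - φ₂| / 2 + (χ + δ) * e₂.arg / 2) 0 := by fun_prop
    have c3 : ContinuousAt (fun δ : ℝ => (χ + δ) / (2 - 2 * δ)) 0 :=
      ContinuousAt.div (by fun_prop) (by fun_prop) (by norm_num)
    have c4 : ContinuousAt (fun δ : ℝ => δ) 0 := by fun_prop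
    have e1 := c1.eventually_lt (continuousAt_const (y := ν)) (by simpa using hνχ)
    have e2 := c2.eventually_lt (continuousAt_const (y := Real.pi / 2)) (by simpa using hang)
    have e3 := c3.eventually_lt (continuousAt_const (y := χ / 2 + ε)) (by simpa using hε)
    have e4 := c4.eventually_lt (continuousAt_const (y := (1 / 2 : ℝ))) (by norm_num)
    have := ((e1.and e2).and (e3.and e4)).filter_mono
      (nhdsWithin_le_nhds (s := Set.Ioi (0 : ℝ)))
    obtain ⟨δ, ⟨⟨h1, h2⟩, h3, h4⟩, h5⟩ := (this.and self_mem_nhdsWithin).exists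
    exact ⟨δ, h5, h4, h1, h2, h3⟩
  set γ := χ + δ with hγ
  obtain ⟨γ₁, g, ρg, hγ₁0, hγ₁χ, hγ₁δ, hρg, hg0, hgc, hgi, hgd⟩ :=
    hW.exists_super_near hπ₁ hπ₂ hP hχ hνχ hδ0
  obtain ⟨a, ρa, c, hρa, hc, ha0, hac, hai, had⟩ := hW.exists_lyapunov_radial hπ₁ hπ₂ hP
    (γ := γ) (σ := -1) (by norm_num) (by
      have : 0 < Real.sin ((γ - χ) * e₂.arg / 2) := by
        have e : γ - χ = δ := by rw [hγ]; ring
        rw [e]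
        have h1 : 0 < δ * e₂.arg := mul_pos hδ0 hφ
        exact Real.sin_pos_of_pos_of_lt_pi (by linarith) (by nlinarith)
      nlinarith) (by rw [abs_of_pos (show 0 < γ by linarith)]; exact hδang) (by linarith) (by linarith)
    (by linarith)
  -- The order of the cap is limited by the available moments and by the requirement that the drift
  -- of the cap be at most of the order of `g`.
  set γ₂ := min ν (γ₁ + 2) with hγ₂
  have hγγ₂ : γ < γ₂ := lt_min hδν (by linarith)
  obtain ⟨k, ρk, C, hρk, hC, hk0, hkc, hki, hkd⟩ := hW.exists_lyapunov_cap hπ₁ hπ₂ hP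
    (g := γ₂) (by linarith) (min_le_left _ _)
  obtain ⟨r₁, hr₁⟩ := exists_ball_of_norm hW.cone (max ρg (max ρa ρk))
  -- The drift conditions hold only off a larger ball containing the corner; survival off it is less
  -- likely than off the ball of radius `r`, so a lower bound transfers.
  set s := max (max r r₁) (R * √2 + 1) with hs
  have hsR : R * √2 < s := lt_of_lt_of_le (by linarith) (le_max_right _ _)
  have hrs : r ≤ s := (le_max_left _ _).trans (le_max_left _ _)
  have hV : ∀ z ∉ ball s, max ρg (max ρa ρk) ≤ ‖lin e₁ e₂ z‖ := fun z hz =>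
    hr₁ z fun h => hz (ball_mono ((le_max_right _ _).trans (le_max_left _ _)) h)
  have hVg : ∀ z ∉ ball s, ρg ≤ ‖lin e₁ e₂ z‖ := fun z hz => (le_max_left _ _).trans (hV z hz)
  have hVa : ∀ z ∉ ball s, ρa ≤ ‖lin e₁ e₂ z‖ := fun z hz =>
    ((le_max_left _ _).trans (le_max_right _ _)).trans (hV z hz)
  have hVk : ∀ z ∉ ball s, ρk ≤ ‖lin e₁ e₂ z‖ := fun z hz =>
    ((le_max_right _ _).trans (le_max_right _ _)).trans (hV z hz)
  have hcor : ∀ z ∉ ball s, z ∉ corner R := fun z hz h => hz (corner_subset_ball hsR h)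
  obtain ⟨b, hb0, hb⟩ := exists_bound_of_finite (finite_ball s) a
  obtain ⟨d, ρ, hd, hdρ⟩ := survival_lower_bound (p := p) (B := ball s)
    (V := fun z => ‖lin e₁ e₂ z‖) (γ := γ) (γ₁ := γ₁) (γ₂ := γ₂) (c := c) (C := C) (b := b)
    (a := a) (g := g) (k := k) (fun z hz => hρg.trans (hVg z hz)) (by linarith) (by linarith)
    hγγ₂ (min_le_right _ _) hc hC hb0 (hac.anti fun z hz => not_lt.2 (hVa z hz))
    (hgc.anti fun z hz => not_lt.2 (hVg z hz)) (hkc.anti fun z hz => not_lt.2 (hVk z hz))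
    (fun z hz => by
      refine (killed_le_full _ _).trans ?_
      rw [tsum_ofReal_eq (fun w => (hg0 w).le) (hgi z (hcor z hz))]
      exact ENNReal.ofReal_le_ofReal (hgd z (hVg z hz)))
    (fun z hz => by
      refine (killed_le_full _ _).trans ?_
      rw [tsum_ofReal_eq (fun w => (hk0 w).le) (hki z (hcor z hz)),
        ← ENNReal.ofReal_add (hk0 z).le (by positivity)]
      exact ENNReal.ofReal_le_ofReal (hkd z (hVk z hz)))
    (fun z hz => by
      refine le_trans ?_ (full_add_le_killed_add (fun w hw => ENNReal.ofReal_le_ofReal (hb w hw)) z)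
      rw [tsum_ofReal_eq (fun w => (ha0 w).le) (hai z (hcor z hz)),
        ← ENNReal.ofReal_add (ha0 z).le (by positivity)]
      refine add_le_add (ENNReal.ofReal_le_ofReal ?_) le_rfl
      have := had z (hVa z hz)
      linarith)
  obtain ⟨r₂, hr₂⟩ := exists_ball_of_norm hW.cone ρ
  refine ⟨d, max s r₂, hd, hrs.trans (le_max_left _ _), fun z hz n hn => ?_⟩
  have hzs : z ∉ ball s := fun h => hz (ball_mono (le_max_left _ _) h)
  have hn1 : (1 : ℝ) ≤ n := by exact_mod_cast hn
  refine le_trans (ENNReal.ofReal_le_ofReal ?_) ((hdρ z hzs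
    (hr₂ z fun h => hz (ball_mono (le_max_right _ _) h)) n hn).trans
    (survival_anti (ball_mono hrs) n z hzs))
  refine mul_le_mul_of_nonneg_left (Real.rpow_le_rpow_of_exponent_le hn1 ?_) hd.le
  have h1 : γ / (2 - (γ - γ₁)) ≤ (χ + δ) / (2 - 2 * δ) := by
    apply div_le_div_of_nonneg_left <;> linarith
  linarith

end IsWalk

/-! ### The plane as the complex line -/

/-- The Euclidean plane as the complex line. -/
def toC : Plane ≃ₗᵢ[ℝ] ℂ := Complex.orthonormalBasisOneI.repr.symm

lemma toC_apply (v : Plane) : toC v = v 0 + v 1 * Complex.I :=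
  Complex.orthonormalBasisOneI_repr_symm_apply v

lemma re_toC (v : Plane) : (toC v).re = v 0 := by simp [toC_apply]

lemma im_toC (v : Plane) : (toC v).im = v 1 := by simp [toC_apply]

lemma toC_rot (θ : ℝ) (v : Plane) : toC (rot θ v) = Complex.exp (θ * Complex.I) * toC v := by
  apply Complex.ext
  · rw [re_toC, Complex.mul_re, Complex.exp_ofReal_mul_I_re, Complex.exp_ofReal_mul_I_im, re_toC,
      im_toC]
    simp [rot]; ring
  · rw [im_toC, Complex.mul_im, Complex.exp_ofReal_mul_I_re, Complex.exp_ofReal_mul_I_im, re_toC,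
      im_toC]
    simp [rot]; ring

/-- The image of the first basis vector. -/
def axis₁ (T : Matrix (Fin 2) (Fin 2) ℝ) : ℂ := ⟨T 0 0, T 1 0⟩

/-- The image of the second basis vector. -/
def axis₂ (T : Matrix (Fin 2) (Fin 2) ℝ) : ℂ := ⟨T 0 1, T 1 1⟩

lemma toC_toEuclideanLin (T : Matrix (Fin 2) (Fin 2) ℝ) (v : Plane) :
    toC (T.toEuclideanLin v) = v 0 * axis₁ T + v 1 * axis₂ T := by
  apply Complex.ext
  · rw [re_toC]
    simp [axis₁, axis₂, Matrix.toLpLin_apply]; ring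
  · rw [im_toC]
    simp [axis₁, axis₂, Matrix.toLpLin_apply]; ring

/-- The linear map on increments with given images of the axes. -/
def zlin (e₁ e₂ : ℂ) (a : ℤ × ℤ) : ℂ := a.1 * e₁ + a.2 * e₂

lemma lin_sub_lin' (e₁ e₂ : ℂ) (w z : ℕ × ℕ) :
    lin e₁ e₂ w - lin e₁ e₂ z = zlin e₁ e₂ (toInt w - toInt z) := lin_sub_lin e₁ e₂ w z

lemma toC_vec (T : Matrix (Fin 2) (Fin 2) ℝ) (a : ℤ × ℤ) :
    toC (T.toEuclideanLin (vec a)) = zlin (axis₁ T) (axis₂ T) a := by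
  rw [toC_toEuclideanLin]; simp [vec, zlin]

lemma abs_fst_le_norm_vec (a : ℤ × ℤ) : |(a.1 : ℝ)| ≤ ‖vec a‖ := by
  rw [EuclideanSpace.norm_eq]
  apply Real.le_sqrt_of_sq_le
  simp [vec, Fin.sum_univ_two]; positivity

lemma abs_snd_le_norm_vec (a : ℤ × ℤ) : |(a.2 : ℝ)| ≤ ‖vec a‖ := by
  rw [EuclideanSpace.norm_eq]
  apply Real.le_sqrt_of_sq_le
  simp [vec, Fin.sum_univ_two]; positivity

lemma norm_zlin_le (e₁ e₂ : ℂ) (a : ℤ × ℤ) : ‖zlin e₁ e₂ a‖ ≤ (‖e₁‖ + ‖e₂‖) * ‖vec a‖ := by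
  have h1 := abs_fst_le_norm_vec a
  have h2 := abs_snd_le_norm_vec a
  calc ‖zlin e₁ e₂ a‖ ≤ |(a.1 : ℝ)| * ‖e₁‖ + |(a.2 : ℝ)| * ‖e₂‖ := by
        refine (norm_add_le _ _).trans (le_of_eq ?_)
        rw [norm_mul, norm_mul, Complex.norm_intCast, Complex.norm_intCast]
    _ ≤ ‖vec a‖ * ‖e₁‖ + ‖vec a‖ * ‖e₂‖ := by gcongr
    _ = _ := by ring

/-! ### Moments of increment distributions -/

section Moments

lemma pmf_integrable_of_summable {α : Type*} [MeasurableSpace α] [Countable α]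
    [MeasurableSingletonClass α] {E : Type*} [NormedAddCommGroup E] (q : PMF α) {f : α → E}
    (h : Summable fun a => ‖f a‖ * (q a).toReal) : Integrable f q.toMeasure := by
  refine ⟨aesm _ _, ?_⟩
  rw [HasFiniteIntegral, pmf_lintegral]
  refine lt_of_le_of_lt (le_of_eq ?_) (lt_top_iff_ne_top.2 h.tsum_ofReal_ne_top)
  refine tsum_congr fun a => ?_
  rw [ENNReal.ofReal_mul (norm_nonneg _), ENNReal.ofReal_toReal (PMF.apply_ne_top _ _),
    ofReal_norm, mul_comm]

variable {q : PMF (ℤ × ℤ)} {ν : ℝ}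

lemma FiniteMoment.integrable (h : FiniteMoment q ν) :
    Integrable (fun a => ‖vec a‖ ^ ν) q.toMeasure := by
  refine pmf_integrable_of_summable q (h.congr fun a => ?_)
  rw [Real.norm_of_nonneg (by positivity)]

lemma FiniteMoment.integrable_of_le (h : FiniteMoment q ν) {s : ℝ} (hs : 0 ≤ s) (hsν : s ≤ ν) :
    Integrable (fun a => ‖vec a‖ ^ s) q.toMeasure := by
  refine ((integrable_const (1 : ℝ)).add h.integrable).mono' (aesm _ _)
    (Filter.Eventually.of_forall fun a => ?_)
  rw [Real.norm_of_nonneg (by positivity)]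
  rcases le_total ‖vec a‖ 1 with h1 | h1
  · have := Real.rpow_le_one (norm_nonneg (vec a)) h1 hs
    have h2 : 0 ≤ ‖vec a‖ ^ ν := by positivity
    simp only [Pi.add_apply]; linarith
  · have := Real.rpow_le_rpow_of_exponent_le h1 hsν
    simp only [Pi.add_apply]; linarith

lemma FiniteMoment.integrable_vec (h : FiniteMoment q ν) (hν : 1 ≤ ν) :
    Integrable vec q.toMeasure := by
  refine (h.integrable_of_le zero_le_one hν).mono' (aesm _ _)
    (Filter.Eventually.of_forall fun a => ?_)
  rw [Real.rpow_one]

lemma FiniteMoment.integral_vec (h : FiniteMoment q ν) (hν : 1 ≤ ν) :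
    ∫ a, vec a ∂q.toMeasure = drift q :=
  PMF.integral_eq_tsum q _ (h.integrable_vec hν)

lemma FiniteMoment.integrable_zlin_rpow (h : FiniteMoment q ν) (e₁ e₂ : ℂ) {s : ℝ}
    (hs : 0 ≤ s) (hsν : s ≤ ν) : Integrable (fun a => ‖zlin e₁ e₂ a‖ ^ s) q.toMeasure := by
  refine ((h.integrable_of_le hs hsν).const_mul ((‖e₁‖ + ‖e₂‖) ^ s)).mono' (aesm _ _)
    (Filter.Eventually.of_forall fun a => ?_)
  rw [Real.norm_of_nonneg (by positivity), ← Real.mul_rpow (by positivity) (by positivity)]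
  exact Real.rpow_le_rpow (norm_nonneg _) (norm_zlin_le e₁ e₂ a) hs

lemma FiniteMoment.integral_zlin (h : FiniteMoment q ν) (hν : 1 ≤ ν)
    (T : Matrix (Fin 2) (Fin 2) ℝ) :
    ∫ a, zlin (axis₁ T) (axis₂ T) a ∂q.toMeasure = toC (T.toEuclideanLin (drift q)) := by
  rw [← h.integral_vec hν]
  have := (toC.toLinearIsometry.toContinuousLinearMap.comp
    (LinearMap.toContinuousLinearMap T.toEuclideanLin)).integral_comp_comm (h.integrable_vec hν)
  refine Eq.trans (integral_congr_ae (Filter.Eventually.of_forall fun a => ?_)) this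
  exact (toC_vec T a).symm

lemma vec_apply_zero (a : ℤ × ℤ) : vec a 0 = a.1 := by simp [vec]

lemma vec_apply_one (a : ℤ × ℤ) : vec a 1 = a.2 := by simp [vec]

lemma FiniteMoment.integrable_fst (h : FiniteMoment q ν) (hν : 1 ≤ ν) :
    Integrable (fun a : ℤ × ℤ => (a.1 : ℝ)) q.toMeasure :=
  (h.integrable_vec hν).norm.mono' (aesm _ _)
    (Filter.Eventually.of_forall fun a => abs_fst_le_norm_vec a)

lemma FiniteMoment.integrable_snd (h : FiniteMoment q ν) (hν : 1 ≤ ν) :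
    Integrable (fun a : ℤ × ℤ => (a.2 : ℝ)) q.toMeasure :=
  (h.integrable_vec hν).norm.mono' (aesm _ _)
    (Filter.Eventually.of_forall fun a => abs_snd_le_norm_vec a)

lemma FiniteMoment.integral_fst (h : FiniteMoment q ν) (hν : 1 ≤ ν) :
    ∫ a, (a.1 : ℝ) ∂q.toMeasure = drift q 0 := by
  rw [← h.integral_vec hν]
  have := (EuclideanSpace.proj (𝕜 := ℝ) (0 : Fin 2)).integral_comp_comm (h.integrable_vec hν)
  refine Eq.trans (integral_congr_ae (Filter.Eventually.of_forall fun a => ?_)) this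
  exact (vec_apply_zero a).symm

lemma FiniteMoment.integral_snd (h : FiniteMoment q ν) (hν : 1 ≤ ν) :
    ∫ a, (a.2 : ℝ) ∂q.toMeasure = drift q 1 := by
  rw [← h.integral_vec hν]
  have := (EuclideanSpace.proj (𝕜 := ℝ) (1 : Fin 2)).integral_comp_comm (h.integrable_vec hν)
  refine Eq.trans (integral_congr_ae (Filter.Eventually.of_forall fun a => ?_)) this
  exact (vec_apply_one a).symm

lemma ZeroDrift.drift_eq_zero (h : ZeroDrift q) : drift q = 0 := h.tsum_eq

lemma FiniteMoment.integrable_mul (h : FiniteMoment q ν) (hν : 2 ≤ ν) (i j : Fin 2) :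
    Integrable (fun a => vec a i * vec a j) q.toMeasure := by
  refine (h.integrable_of_le zero_le_two hν).mono' (aesm _ _)
    (Filter.Eventually.of_forall fun a => ?_)
  rw [norm_mul, Real.rpow_two, sq]
  exact mul_le_mul (PiLp.norm_apply_le _ _) (PiLp.norm_apply_le _ _) (norm_nonneg _) (norm_nonneg _)

lemma FiniteMoment.integral_mul (h : FiniteMoment q ν) (hν : 2 ≤ ν) (i j : Fin 2) :
    ∫ a, vec a i * vec a j ∂q.toMeasure = covMatrix q i j :=
  PMF.integral_eq_tsum q _ (h.integrable_mul hν i j)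

end Moments

/-! ### Second moments after normalization -/

section Whitening

variable {q : PMF (ℤ × ℤ)} {ν : ℝ} {T : Matrix (Fin 2) (Fin 2) ℝ}

lemma covMatrix_symm (q : PMF (ℤ × ℤ)) : covMatrix q 1 0 = covMatrix q 0 1 := by
  simp only [covMatrix, Matrix.of_apply, mul_comm]

lemma IsNormalizingMap.entries (h : IsNormalizingMap (covMatrix q) T) :
    T 0 0 ^ 2 * covMatrix q 0 0 + 2 * (T 0 0 * T 0 1) * covMatrix q 0 1
        + T 0 1 ^ 2 * covMatrix q 1 1 = 1 ∧
      T 0 0 * covMatrix q 0 1 + T 0 1 * covMatrix q 1 1 = 0 ∧ T 1 1 ^ 2 * covMatrix q 1 1 = 1 := by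
  have h00 := congrFun (congrFun h.whiten 0) 0
  have h01 := congrFun (congrFun h.whiten 0) 1
  have h11 := congrFun (congrFun h.whiten 1) 1
  simp only [Matrix.mul_apply, Fin.sum_univ_two, Matrix.transpose_apply, h.zero, Matrix.one_apply,
    covMatrix_symm] at h00 h01 h11
  norm_num at h00 h01 h11
  refine ⟨by linarith, ?_, by linarith⟩
  rcases h01 with h | h1
  · exact h
  · exact absurd h1 h.pos₂.ne'

lemma IsNormalizingMap.isCone {S : Matrix (Fin 2) (Fin 2) ℝ} (h : IsNormalizingMap S T) :
    IsCone (axis₁ T) (axis₂ T) := ⟨h.zero, h.pos₁, h.pos₂⟩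

/-- After whitening, the real and imaginary parts are uncorrelated with equal variances, so the mean
of the complex square vanishes. -/
lemma integral_zlin_sq (hq : FiniteMoment q ν) (hν : 2 ≤ ν)
    (h : IsNormalizingMap (covMatrix q) T) :
    ∫ a, zlin (axis₁ T) (axis₂ T) a ^ 2 ∂q.toMeasure = 0 := by
  obtain ⟨h1, h2, h3⟩ := h.entries
  have e : ∀ a, zlin (axis₁ T) (axis₂ T) a ^ 2 = (((vec a 0 * vec a 0 : ℝ) : ℂ) * axis₁ T ^ 2
      + ((vec a 0 * vec a 1 : ℝ) : ℂ) * (2 * axis₁ T * axis₂ T))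
      + ((vec a 1 * vec a 1 : ℝ) : ℂ) * axis₂ T ^ 2 := fun a => by
    simp only [vec_apply_zero, vec_apply_one, zlin]; push_cast; ring
  have i00 : Integrable (fun a => ((vec a 0 * vec a 0 : ℝ) : ℂ) * axis₁ T ^ 2) q.toMeasure :=
    (hq.integrable_mul hν 0 0).ofReal.mul_const _
  have i01 : Integrable (fun a => ((vec a 0 * vec a 1 : ℝ) : ℂ) * (2 * axis₁ T * axis₂ T))
    q.toMeasure := (hq.integrable_mul hν 0 1).ofReal.mul_const _
  have i11 : Integrable (fun a => ((vec a 1 * vec a 1 : ℝ) : ℂ) * axis₂ T ^ 2) q.toMeasure :=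
    (hq.integrable_mul hν 1 1).ofReal.mul_const _
  have i2 : Integrable (fun a => ((vec a 0 * vec a 0 : ℝ) : ℂ) * axis₁ T ^ 2
      + ((vec a 0 * vec a 1 : ℝ) : ℂ) * (2 * axis₁ T * axis₂ T)) q.toMeasure := i00.add i01
  simp only [e]
  rw [integral_add i2 i11, integral_add i00 i01, integral_mul_const, integral_mul_const,
    integral_mul_const, integral_complex_ofReal, integral_complex_ofReal,
    integral_complex_ofReal, hq.integral_mul hν,
    hq.integral_mul hν, hq.integral_mul hν]
  apply Complex.ext
  · simp [axis₁, axis₂, h.zero, sq]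
    nlinarith
  · simp [axis₁, axis₂, h.zero, sq]
    linear_combination (2 * T 1 1) * h2

lemma integral_norm_zlin_sq (hq : FiniteMoment q ν) (hν : 2 ≤ ν)
    (h : IsNormalizingMap (covMatrix q) T) :
    ∫ a, ‖zlin (axis₁ T) (axis₂ T) a‖ ^ 2 ∂q.toMeasure = 2 := by
  obtain ⟨h1, h2, h3⟩ := h.entries
  have e : ∀ a, ‖zlin (axis₁ T) (axis₂ T) a‖ ^ 2 = (vec a 0 * vec a 0 * T 0 0 ^ 2
      + vec a 0 * vec a 1 * (2 * T 0 0 * T 0 1))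
      + vec a 1 * vec a 1 * (T 0 1 ^ 2 + T 1 1 ^ 2) := fun a => by
    rw [← Complex.normSq_eq_norm_sq, Complex.normSq_apply]
    simp [vec_apply_zero, vec_apply_one, zlin, axis₁, axis₂, h.zero]; ring
  have i00 : Integrable (fun a => vec a 0 * vec a 0 * T 0 0 ^ 2) q.toMeasure :=
    (hq.integrable_mul hν 0 0).mul_const _
  have i01 : Integrable (fun a => vec a 0 * vec a 1 * (2 * T 0 0 * T 0 1)) q.toMeasure :=
    (hq.integrable_mul hν 0 1).mul_const _
  have i11 : Integrable (fun a => vec a 1 * vec a 1 * (T 0 1 ^ 2 + T 1 1 ^ 2)) q.toMeasure :=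
    (hq.integrable_mul hν 1 1).mul_const _
  have i2 : Integrable (fun a => vec a 0 * vec a 0 * T 0 0 ^ 2
      + vec a 0 * vec a 1 * (2 * T 0 0 * T 0 1)) q.toMeasure := i00.add i01
  simp only [e]
  rw [integral_add i2 i11, integral_add i00 i01, integral_mul_const, integral_mul_const,
    integral_mul_const, hq.integral_mul hν, hq.integral_mul hν, hq.integral_mul hν]
  linarith

/-- Normalizing maps exist and are unique. -/
theorem existsUnique_isNormalizingMap {S : Matrix (Fin 2) (Fin 2) ℝ} (hS : S.PosDef) :
    ∃! T : Matrix (Fin 2) (Fin 2) ℝ, IsNormalizingMap S T := by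
  have hsym : S 1 0 = S 0 1 := by
    have := congrFun (congrFun hS.isHermitian 0) 1
    simpa using this
  have hd := hS.det_pos
  rw [Matrix.det_fin_two, hsym] at hd
  have h11 : 0 < S 1 1 := hS.diag_pos
  set a := S 0 0 with ha
  set b := S 0 1 with hb
  set d := S 1 1 with hd'
  have hD : 0 < a - b * b / d := by
    rw [sub_pos, div_lt_iff₀ h11]; linarith
  -- Triangularity lets the whitening equations be solved from the bottom row up; the sign
  -- conditions select the square roots.
  have iff : ∀ T : Matrix (Fin 2) (Fin 2) ℝ, IsNormalizingMap S T ↔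
      T 1 0 = 0 ∧ T 1 1 = (√d)⁻¹ ∧ T 0 0 = (√(a - b * b / d))⁻¹ ∧ T 0 1 = -(T 0 0 * b / d) := by
    intro T
    constructor
    · intro h
      have h00 := congrFun (congrFun h.whiten 0) 0
      have h01 := congrFun (congrFun h.whiten 0) 1
      have h11' := congrFun (congrFun h.whiten 1) 1
      simp only [Matrix.mul_apply, Fin.sum_univ_two, Matrix.transpose_apply, h.zero,
        Matrix.one_apply, hsym, ← ha, ← hb, ← hd'] at h00 h01 h11'
      norm_num at h00 h01 h11'
      have p0 := h.pos₁
      have p1 := h.pos₂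
      have e01 : T 0 0 * b + T 0 1 * d = 0 := h01.resolve_right p1.ne'
      have e2 : T 0 1 = -(T 0 0 * b / d) := by
        field_simp; linarith
      refine ⟨h.zero, ?_, ?_, e2⟩
      · rw [eq_comm, inv_eq_iff_eq_inv, eq_comm]
        have : d = (T 1 1)⁻¹ ^ 2 := by field_simp; linarith
        rw [this, Real.sqrt_sq (by positivity)]
      · rw [eq_comm, inv_eq_iff_eq_inv, eq_comm]
        have : a - b * b / d = (T 0 0)⁻¹ ^ 2 := by
          rw [e2] at h00
          field_simp at h00 ⊢
          linarith
        rw [this, Real.sqrt_sq (by positivity)]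
    · rintro ⟨t10, t11, t00, t01⟩
      have s1 : √d * √d = d := Real.mul_self_sqrt h11.le
      have s2 : √(a - b * b / d) * √(a - b * b / d) = a - b * b / d := Real.mul_self_sqrt hD.le
      have p1 : 0 < √d := Real.sqrt_pos.2 h11
      have p2 : 0 < √(a - b * b / d) := Real.sqrt_pos.2 hD
      refine ⟨?_, by rw [t00]; positivity, by rw [t11]; positivity, t10⟩
      have q1 : T 1 1 * T 1 1 * d = 1 := by
        rw [t11]; nth_rewrite 3 [← s1]; field_simp
      have q0 : T 0 0 * T 0 0 * (a - b * b / d) = 1 := by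
        rw [t00]; rw [← mul_inv, s2, inv_mul_cancel₀ hD.ne']
      have q2 : T 0 0 * b + T 0 1 * d = 0 := by rw [t01]; field_simp; ring
      have q3 : b * b / d * d = b * b := by field_simp
      have q4 : T 0 1 * d = -(T 0 0 * b) := by linarith
      have q5 : T 0 1 * b = -(T 0 0 * (b * b / d)) := by rw [t01]; field_simp
      ext i j
      fin_cases i <;> fin_cases j <;>
        simp only [Matrix.mul_apply, Fin.sum_univ_two, Matrix.transpose_apply, t10,
          Matrix.one_apply, hsym, ← ha, ← hb, ← hd', Fin.zero_eta, Fin.mk_one, Fin.isValue]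
      · norm_num
        linear_combination q0 + T 0 0 * q5 + T 0 1 * q2
      · norm_num
        left; exact q2
      · norm_num
        linear_combination T 1 1 * q2
      · norm_num
        linarith
  refine ⟨!![(√(a - b * b / d))⁻¹, -((√(a - b * b / d))⁻¹ * b / d); 0, (√d)⁻¹], ?_, fun T hT => ?_⟩
  · exact (iff _).2 (by simp)
  · obtain ⟨t10, t11, t00, t01⟩ := (iff T).1 hT
    ext i j
    fin_cases i <;> fin_cases j <;> simp [t10, t11, t00, t01]

end Whitening

/-! ### Projections of the transition law -/

section Map

lemma pmf_map_apply_of_injective {α β : Type*} (q : PMF α) {f : α → β} (hf : Function.Injective f)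
    (a : α) : q.map f (f a) = q a := by
  classical
  rw [PMF.map_apply, tsum_eq_single a fun b hb => if_neg fun h => hb (hf h).symm, if_pos rfl]

lemma pmf_map_injective {α β : Type*} {f : α → β} (hf : Function.Injective f) :
    Function.Injective (PMF.map f) := fun q q' h => by
  ext a
  rw [← pmf_map_apply_of_injective q hf, h, pmf_map_apply_of_injective q' hf]

lemma pmf_map_ne_zero {α β : Type*} {q : PMF α} (f : α → β) {a : α} (h : q a ≠ 0) :
    q.map f (f a) ≠ 0 := by
  rw [← PMF.mem_support_iff, PMF.mem_support_map_iff]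
  exact ⟨a, h, rfl⟩

lemma pmf_map_snd_apply (q : PMF (ℤ × ℤ)) (b : ℤ) : q.map Prod.snd b = ∑' x, q (x, b) := by
  classical
  rw [PMF.map_apply, ENNReal.tsum_prod']
  refine tsum_congr fun x => ?_
  refine (tsum_eq_single b fun c hc => if_neg (by exact hc.symm)).trans (if_pos rfl)

lemma pmf_map_fst_apply (q : PMF (ℤ × ℤ)) (b : ℤ) : q.map Prod.fst b = ∑' y, q (b, y) := by
  classical
  rw [PMF.map_apply, ENNReal.tsum_prod', tsum_eq_single b fun c hc => ?_]
  · simp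
  · simp [hc.symm]

end Map

section Projection

variable {p : ℕ × ℕ → PMF (ℕ × ℕ)} {s : PMF (ℤ × ℤ)} {z : ℕ × ℕ}

lemma toInt_sub_injective (z : ℕ × ℕ) :
    Function.Injective fun w : ℕ × ℕ => toInt w - toInt z := fun a b h => by
  have h1 := congrArg Prod.fst h
  have h2 := congrArg Prod.snd h
  simp only [toInt, Prod.fst_sub, Prod.snd_sub] at h1 h2
  exact Prod.ext (by omega) (by omega)

lemma natCast_sub_injective (i : ℕ) : Function.Injective fun j : ℕ => (j : ℤ) - i :=
  fun a b h => by simpa using h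

lemma map_snd_eq (h : s = (p z).map fun w => toInt w - toInt z) :
    s.map Prod.snd = ((p z).map Prod.snd).map fun j : ℕ => (j : ℤ) - z.2 := by
  rw [h, PMF.map_comp, PMF.map_comp]; rfl

lemma map_fst_eq (h : s = (p z).map fun w => toInt w - toInt z) :
    s.map Prod.fst = ((p z).map Prod.fst).map fun j : ℕ => (j : ℤ) - z.1 := by
  rw [h, PMF.map_comp, PMF.map_comp]; rfl

end Projection

/-! ### Projected chains and partial homogeneity -/

/-- The transition law of the second coordinate away from the vertical axis. -/
def rowChain (R : ℕ) (p : ℕ × ℕ → PMF (ℕ × ℕ)) (y : ℕ) : PMF ℕ := (p (R, y)).map Prod.snd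

/-- The transition law of the first coordinate away from the horizontal axis. -/
def colChain (R : ℕ) (p : ℕ × ℕ → PMF (ℕ × ℕ)) (x : ℕ) : PMF ℕ := (p (x, R)).map Prod.fst

/-- The mean transformed jump from the `i`-th boundary layer. -/
def meanJump {R : ℕ} (q : Fin R → PMF (ℤ × ℤ)) (e₁ e₂ : ℂ) (i : ℕ) : ℂ :=
  if h : i < R then ∫ a, zlin e₁ e₂ a ∂(q ⟨i, h⟩).toMeasure else 0

namespace PartialHomogeneity

variable {R : ℕ} {p : ℕ × ℕ → PMF (ℕ × ℕ)} {p₀ : PMF (ℤ × ℤ)} {p₁ p₂ : Fin R → PMF (ℤ × ℤ)}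

lemma increment (hH : PartialHomogeneity R p p₀ p₁ p₂) {z : ℕ × ℕ} (hz : z ∈ interiorRegion R) :
    p₀ = (p z).map fun w => toInt w - toInt z :=
  pmf_eq_map _ _ _ (toInt_sub_injective z) fun w => hH.interior z w hz

lemma increment₁ (hH : PartialHomogeneity R p p₀ p₁ p₂) {z : ℕ × ℕ} (hz : R ≤ z.1)
    (hz' : z.2 < R) : p₁ ⟨z.2, hz'⟩ = (p z).map fun w => toInt w - toInt z :=
  pmf_eq_map _ _ _ (toInt_sub_injective z) fun w => hH.horizontal z.1 ⟨z.2, hz'⟩ w hz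

lemma increment₂ (hH : PartialHomogeneity R p p₀ p₁ p₂) {z : ℕ × ℕ} (hz : z.1 < R)
    (hz' : R ≤ z.2) : p₂ ⟨z.1, hz⟩ = (p z).map fun w => toInt w - toInt z :=
  pmf_eq_map _ _ _ (toInt_sub_injective z) fun w => hH.vertical ⟨z.1, hz⟩ z.2 w hz'

/-- To the right of the vertical boundary the increment law depends on the second coordinate only,
so this coordinate evolves autonomously and (R, y) may represent its row. -/
lemma map_snd (hH : PartialHomogeneity R p p₀ p₁ p₂) {z : ℕ × ℕ} (hz : R ≤ z.1) :
    (p z).map Prod.snd = rowChain R p z.2 := by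
  apply pmf_map_injective (natCast_sub_injective z.2)
  by_cases h : z.2 < R
  · exact (map_snd_eq (hH.increment₁ hz h)).symm.trans
      (map_snd_eq (hH.increment₁ (z := (R, z.2)) le_rfl h))
  · exact (map_snd_eq (hH.increment ⟨hz, not_lt.1 h⟩)).symm.trans
      (map_snd_eq (hH.increment (z := (R, z.2)) ⟨le_rfl, not_lt.1 h⟩))

lemma map_fst (hH : PartialHomogeneity R p p₀ p₁ p₂) {z : ℕ × ℕ} (hz : R ≤ z.2) :
    (p z).map Prod.fst = colChain R p z.1 := by
  apply pmf_map_injective (natCast_sub_injective z.1)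
  by_cases h : z.1 < R
  · exact (map_fst_eq (hH.increment₂ h hz)).symm.trans
      (map_fst_eq (hH.increment₂ (z := (z.1, R)) h le_rfl))
  · exact (map_fst_eq (hH.increment ⟨not_lt.1 h, hz⟩)).symm.trans
      (map_fst_eq (hH.increment (z := (z.1, R)) ⟨not_lt.1 h, le_rfl⟩))

lemma verticalProjection_eq (hH : PartialHomogeneity R p p₀ p₁ p₂) :
    verticalProjection p₀ p₁ = fun i j => rowChain R p i j := by
  funext i j
  by_cases h : i < R
  · rw [verticalProjection, dif_pos h, ← pmf_map_snd_apply,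
      map_snd_eq (hH.increment₁ (z := (R, i)) le_rfl h)]
    exact pmf_map_apply_of_injective _ (natCast_sub_injective i) j
  · rw [verticalProjection, dif_neg h, ← pmf_map_snd_apply,
      map_snd_eq (hH.increment (z := (R, i)) ⟨le_rfl, not_lt.1 h⟩)]
    exact pmf_map_apply_of_injective _ (natCast_sub_injective i) j

lemma horizontalProjection_eq (hH : PartialHomogeneity R p p₀ p₁ p₂) :
    horizontalProjection p₀ p₂ = fun i j => colChain R p i j := by
  funext i j
  by_cases h : i < R
  · rw [horizontalProjection, dif_pos h, ← pmf_map_fst_apply,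
      map_fst_eq (hH.increment₂ (z := (i, R)) h le_rfl)]
    exact pmf_map_apply_of_injective _ (natCast_sub_injective i) j
  · rw [horizontalProjection, dif_neg h, ← pmf_map_fst_apply,
      map_fst_eq (hH.increment (z := (i, R)) ⟨not_lt.1 h, le_rfl⟩)]
    exact pmf_map_apply_of_injective _ (natCast_sub_injective i) j

/-- The interior increments cannot be supported on the quadrant. -/
lemma pos (hH : PartialHomogeneity R p p₀ p₁ p₂) {ν : ℝ} (hν : 1 ≤ ν) (hM : FiniteMoment p₀ ν)
    (hD : ZeroDrift p₀) (hS : (covMatrix p₀).PosDef) : 0 < R := by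
  rw [Nat.pos_iff_ne_zero]
  -- With `R = 0` the origin would be an interior state, so the first coordinate of an interior jump
  -- would be non-negative. Zero mean would then make it vanish, contradicting positive variance.
  rintro rfl
  have hsupp : ∀ a, p₀ a ≠ 0 → 0 ≤ a.1 := by
    intro a ha
    rw [hH.increment (z := 0) ⟨le_rfl, le_rfl⟩, ← PMF.mem_support_iff, PMF.mem_support_map_iff]
      at ha
    obtain ⟨w, -, rfl⟩ := ha
    simp [toInt]
  have h0 : ∫ a, (a.1 : ℝ) ∂p₀.toMeasure = 0 := by
    rw [hM.integral_fst hν, hD.drift_eq_zero]; simp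
  rw [integral_eq_zero_iff_of_nonneg_ae
    (pmf_ae_iff.2 fun a ha => by have := hsupp a ha; simpa using this) (hM.integrable_fst hν)] at h0
  have h1 : 0 < covMatrix p₀ 0 0 := hS.diag_pos
  refine h1.ne' ?_
  simp only [covMatrix, Matrix.of_apply, vec_apply_zero]
  refine (tsum_congr fun a => ?_).trans tsum_zero
  by_cases ha : p₀ a = 0
  · simp [ha]
  · have := pmf_of_ae h0 ha
    simp only [Pi.zero_apply] at this
    simp [this]

end PartialHomogeneity

/-! ### The original walk in normalised coordinates -/

section Walk

variable {Ω : Type*} [MeasurableSpace Ω] {R : ℕ} {p : ℕ × ℕ → PMF (ℕ × ℕ)} {p₀ : PMF (ℤ × ℤ)}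
  {p₁ p₂ : Fin R → PMF (ℤ × ℤ)} {P : ℕ × ℕ → Measure Ω} {Z : ℕ → Ω → ℕ × ℕ} {ν₀ ν₁ ν₂ : ℝ}

lemma mem_region₁ {R : ℕ} {z : ℕ × ℕ} :
    z ∈ interiorRegion R ∪ horizontalBoundary R ↔ R ≤ z.1 := by
  simp only [interiorRegion, horizontalBoundary, Set.mem_union, Set.mem_ofPred_eq]; omega

lemma mem_region₂ {R : ℕ} {z : ℕ × ℕ} :
    z ∈ interiorRegion R ∪ verticalBoundary R ↔ R ≤ z.2 := by
  simp only [interiorRegion, verticalBoundary, Set.mem_union, Set.mem_ofPred_eq]; omega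

lemma mem_left {R : ℕ} {z : ℕ × ℕ} : z ∉ verticalBoundary R ∪ corner R ↔ R ≤ z.1 := by
  simp only [corner, verticalBoundary, Set.mem_union, Set.mem_ofPred_eq]; omega

lemma mem_bottom {R : ℕ} {z : ℕ × ℕ} : z ∉ horizontalBoundary R ∪ corner R ↔ R ≤ z.2 := by
  simp only [corner, horizontalBoundary, Set.mem_union, Set.mem_ofPred_eq]; omega

lemma exists_path₁ (hZ : IsMarkovChain p P Z) (hI : Irreducibility R P Z) {z w : ℕ × ℕ}
    (hz : R ≤ z.1) (hw : R ≤ w.1) :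
    Relation.ReflTransGen (fun a b => p a b ≠ 0 ∧ R ≤ a.1 ∧ R ≤ b.1) z w := by
  obtain ⟨n, -, hn⟩ := hI.avoid_vertical z (mem_region₁.2 hz) w (mem_region₁.2 hw)
  refine Relation.ReflTransGen.mono (fun a b hab => ?_) _ _ (exists_path_of_pos hZ hn)
  exact ⟨hab.1, mem_left.1 hab.2.1, mem_left.1 hab.2.2⟩

lemma exists_path₂ (hZ : IsMarkovChain p P Z) (hI : Irreducibility R P Z) {z w : ℕ × ℕ}
    (hz : R ≤ z.2) (hw : R ≤ w.2) :
    Relation.ReflTransGen (fun a b => p a b ≠ 0 ∧ R ≤ a.2 ∧ R ≤ b.2) z w := by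
  obtain ⟨n, -, hn⟩ := hI.avoid_horizontal z (mem_region₂.2 hz) w (mem_region₂.2 hw)
  refine Relation.ReflTransGen.mono (fun a b hab => ?_) _ _ (exists_path_of_pos hZ hn)
  exact ⟨hab.1, mem_bottom.1 hab.2.1, mem_bottom.1 hab.2.2⟩

/-- Irreducibility is inherited from paths avoiding the vertical boundary and the corner, where the
second coordinate is a chain of its own. -/
lemma isBoundaryChain₁ (hZ : IsMarkovChain p P Z) (hH : PartialHomogeneity R p p₀ p₁ p₂)
    (hI : Irreducibility R P Z) (hM : BoundedMoments p₀ p₁ p₂ ν₀ ν₁ ν₂) (hD : ZeroDrift p₀)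
    (hS : (covMatrix p₀).PosDef) : IsBoundaryChain R (rowChain R p) (p₀.map Prod.snd) where
  pos := hH.pos (by linarith [hM.two_lt]) hM.interior hD hS
  hom i hi j := by
    rw [map_snd_eq (hH.increment (z := (R, i)) ⟨le_rfl, hi⟩)]
    exact (pmf_map_apply_of_injective _ (natCast_sub_injective i) j).symm
  integrable := by
    rw [pmf_integrable_map _ _ .of_discrete]
    exact hM.interior.integrable_snd (by linarith [hM.two_lt])
  mean := by
    rw [pmf_integral_map _ _ .of_discrete, hM.interior.integral_snd (by linarith [hM.two_lt]),
      hD.drift_eq_zero]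
    simp
  irred i j := by
    refine Relation.ReflTransGen.lift (p := fun a b => rowChain R p a b ≠ 0) Prod.snd
      (fun a b hab => ?_) _ _ (exists_path₁ hZ hI (z := (R, i)) (w := (R, j)) le_rfl le_rfl)
    show rowChain R p a.2 b.2 ≠ 0
    rw [← hH.map_snd hab.2.1]
    exact pmf_map_ne_zero Prod.snd hab.1

lemma isBoundaryChain₂ (hZ : IsMarkovChain p P Z) (hH : PartialHomogeneity R p p₀ p₁ p₂)
    (hI : Irreducibility R P Z) (hM : BoundedMoments p₀ p₁ p₂ ν₀ ν₁ ν₂) (hD : ZeroDrift p₀)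
    (hS : (covMatrix p₀).PosDef) : IsBoundaryChain R (colChain R p) (p₀.map Prod.fst) where
  pos := hH.pos (by linarith [hM.two_lt]) hM.interior hD hS
  hom i hi j := by
    rw [map_fst_eq (hH.increment (z := (i, R)) ⟨hi, le_rfl⟩)]
    exact (pmf_map_apply_of_injective _ (natCast_sub_injective i) j).symm
  integrable := by
    rw [pmf_integrable_map _ _ .of_discrete]
    exact hM.interior.integrable_fst (by linarith [hM.two_lt])
  mean := by
    rw [pmf_integral_map _ _ .of_discrete, hM.interior.integral_fst (by linarith [hM.two_lt]),
      hD.drift_eq_zero]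
    simp
  irred i j := by
    refine Relation.ReflTransGen.lift (p := fun a b => colChain R p a b ≠ 0) Prod.fst
      (fun a b hab => ?_) _ _ (exists_path₂ hZ hI (z := (i, R)) (w := (j, R)) le_rfl le_rfl)
    show colChain R p a.1 b.1 ≠ 0
    rw [← hH.map_fst hab.2.1]
    exact pmf_map_ne_zero Prod.fst hab.1

lemma integral_jump {s : PMF (ℤ × ℤ)} {z : ℕ × ℕ}
    (h : s = (p z).map fun w => toInt w - toInt z) (e₁ e₂ : ℂ) {E : Type*} [NormedAddCommGroup E]
    [NormedSpace ℝ E] (φ : ℂ → E) :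
    ∫ w, φ (lin e₁ e₂ w - lin e₁ e₂ z) ∂(p z).toMeasure
      = ∫ a, φ (zlin e₁ e₂ a) ∂s.toMeasure := by
  rw [h, pmf_integral_map _ _ .of_discrete]
  simp only [lin_sub_lin']

lemma integrable_jump {s : PMF (ℤ × ℤ)} {z : ℕ × ℕ}
    (h : s = (p z).map fun w => toInt w - toInt z) (e₁ e₂ : ℂ) {φ : ℂ → ℝ}
    (hi : Integrable (fun a => φ (zlin e₁ e₂ a)) s.toMeasure) :
    Integrable (fun w => φ (lin e₁ e₂ w - lin e₁ e₂ z)) (p z).toMeasure := by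
  rw [h, pmf_integrable_map _ _ .of_discrete] at hi
  simpa only [lin_sub_lin'] using hi

lemma jumpMoment_of_finiteMoment {s : PMF (ℤ × ℤ)} {z : ℕ × ℕ}
    (h : s = (p z).map fun w => toInt w - toInt z) {ν ν' M : ℝ} (hs : FiniteMoment s ν')
    (hν : 0 ≤ ν) (hνν' : ν ≤ ν') {e₁ e₂ : ℂ} (hM : ∫ a, ‖zlin e₁ e₂ a‖ ^ ν ∂s.toMeasure ≤ M) :
    JumpMoment e₁ e₂ (p z).toMeasure z ν M :=
  ⟨integrable_jump h e₁ e₂ (φ := fun x => ‖x‖ ^ ν) (hs.integrable_zlin_rpow e₁ e₂ hν hνν'),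
    (integral_jump h e₁ e₂ fun x => ‖x‖ ^ ν).le.trans hM⟩

/-- The walk of the theorem, in the coordinates given by the normalizing map. -/
theorem isWalk (hZ : IsMarkovChain p P Z) (hH : PartialHomogeneity R p p₀ p₁ p₂)
    (hI : Irreducibility R P Z) (hM : BoundedMoments p₀ p₁ p₂ ν₀ ν₁ ν₂) (hD : ZeroDrift p₀)
    (hS : (covMatrix p₀).PosDef) {T : Matrix (Fin 2) (Fin 2) ℝ}
    (hT : IsNormalizingMap (covMatrix p₀) T) :
    IsWalk R p p₀ (rowChain R p) (colChain R p) (axis₁ T) (axis₂ T)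
      (meanJump p₁ (axis₁ T) (axis₂ T)) (meanJump p₂ (axis₁ T) (axis₂ T)) ν₀
      (min ν₀ (min ν₁ ν₂)) := by
  have h2 := hM.two_lt
  have h1 := hM.one_lt₁
  have h1' := hM.one_lt₂
  have hν : 1 < min ν₀ (min ν₁ ν₂) := lt_min (by linarith) (lt_min h1 h1')
  have l1 : min ν₀ (min ν₁ ν₂) ≤ ν₁ := (min_le_right _ _).trans (min_le_left _ _)
  have l2 : min ν₀ (min ν₁ ν₂) ≤ ν₂ := (min_le_right _ _).trans (min_le_right _ _)
  refine ⟨hT.isCone, h2, hν, min_le_left _ _, fun z hz => hH.increment hz,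
    isBoundaryChain₁ hZ hH hI hM hD hS, isBoundaryChain₂ hZ hH hI hM hD hS,
    fun z hz => hH.map_snd hz, fun z hz => hH.map_fst hz,
    ⟨_, fun z hz => jumpMoment_of_finiteMoment (hH.increment hz) hM.interior (by linarith) le_rfl
      le_rfl⟩, fun z hz => ?_, fun z hz => ?_, fun z hz => ?_, ?_, fun z hz => ?_, ?_,
    fun z hz => ?_⟩
  · refine (integral_jump (hH.increment hz) _ _ id).trans ?_
    refine (hM.interior.integral_zlin (by linarith) T).trans ?_
    rw [hD.drift_eq_zero, map_zero, map_zero]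
  · refine (integral_jump (hH.increment hz) _ _ fun x => x ^ 2).trans ?_
    exact integral_zlin_sq hM.interior h2.le hT
  · refine (integral_jump (hH.increment hz) _ _ fun x => ‖x‖ ^ 2).trans ?_
    exact integral_norm_zlin_sq hM.interior h2.le hT
  · refine ⟨∑ y, ∫ a, ‖zlin (axis₁ T) (axis₂ T) a‖ ^ (min ν₀ (min ν₁ ν₂)) ∂(p₁ y).toMeasure,
      fun z hz => jumpMoment_of_finiteMoment (hH.increment₁ hz.1 hz.2) (hM.horizontal _)
        (by linarith) l1 ?_⟩
    exact Finset.single_le_sum (f := fun y => ∫ a, ‖zlin (axis₁ T) (axis₂ T) a‖ ^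
      (min ν₀ (min ν₁ ν₂)) ∂(p₁ y).toMeasure) (fun y _ => integral_nonneg fun a => by positivity)
      (Finset.mem_univ _)
  · refine (integral_jump (hH.increment₁ hz.1 hz.2) _ _ id).trans ?_
    rw [meanJump, dif_pos hz.2]; rfl
  · refine ⟨∑ y, ∫ a, ‖zlin (axis₁ T) (axis₂ T) a‖ ^ (min ν₀ (min ν₁ ν₂)) ∂(p₂ y).toMeasure,
      fun z hz => jumpMoment_of_finiteMoment (hH.increment₂ hz.1 hz.2) (hM.vertical _)
        (by linarith) l2 ?_⟩
    exact Finset.single_le_sum (f := fun y => ∫ a, ‖zlin (axis₁ T) (axis₂ T) a‖ ^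
      (min ν₀ (min ν₁ ν₂)) ∂(p₂ y).toMeasure) (fun y _ => integral_nonneg fun a => by positivity)
      (Finset.mem_univ _)
  · refine (integral_jump (hH.increment₂ hz.1 hz.2) _ _ id).trans ?_
    rw [meanJump, dif_pos hz.1]; rfl

end Walk

/-! ### Angles -/

/-- In (-π, π] the oriented angle is the principal argument of the quotient, which gives both its
existence and its uniqueness. -/
lemma isAngle_iff {θ : ℝ} (hθ : θ ∈ Set.Ioc (-Real.pi) Real.pi) {w z : Plane} :
    IsAngle θ w z ↔ toC w ≠ 0 ∧ toC z ≠ 0 ∧ θ = (toC z / toC w).arg := by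
  unfold IsAngle
  rw [map_ne_zero_iff toC toC.injective, map_ne_zero_iff toC toC.injective]
  refine and_congr_right fun hw => and_congr_right fun hz => ?_
  have hw' : toC w ≠ 0 := (map_ne_zero_iff toC toC.injective).2 hw
  have hz' : toC z ≠ 0 := (map_ne_zero_iff toC toC.injective).2 hz
  have nw : 0 < ‖toC w‖ := norm_pos_iff.2 hw'
  have nz : 0 < ‖toC z‖ := norm_pos_iff.2 hz'
  rw [← toC.injective.eq_iff, map_smul, map_smul, toC_rot, ← toC.norm_map w, ← toC.norm_map z]
  have nwc : (‖toC w‖ : ℂ) ≠ 0 := by exact_mod_cast nw.ne'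
  have nzc : (‖toC z‖ : ℂ) ≠ 0 := by exact_mod_cast nz.ne'
  have key : ‖toC w‖⁻¹ • (Complex.exp (θ * Complex.I) * toC w) = ‖toC z‖⁻¹ • toC z ↔
      toC z / toC w = ((‖toC z‖ / ‖toC w‖ : ℝ) : ℂ) * Complex.exp (θ * Complex.I) := by
    rw [Complex.real_smul, Complex.real_smul]
    push_cast
    constructor
    · intro h
      field_simp at h ⊢
      linear_combination -h
    · intro h
      field_simp at h ⊢
      linear_combination -h
  rw [key]
  constructor
  · intro h
    rw [h, Complex.exp_mul_I]
    exact (Complex.arg_mul_cos_add_sin_mul_I (div_pos nz nw) hθ).symm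
  · intro h
    rw [h, ← norm_div]
    exact (Complex.norm_mul_exp_arg_mul_I _).symm

lemma IsAngle.exists_eq {θ : ℝ} {w z : Plane} (h : IsAngle θ w z) :
    ∃ s : ℝ, 0 < s ∧ toC z = s * Complex.exp (θ * Complex.I) * toC w := by
  obtain ⟨hw, hz, h⟩ := h
  have nw : 0 < ‖w‖ := norm_pos_iff.2 hw
  have nz : 0 < ‖z‖ := norm_pos_iff.2 hz
  refine ⟨‖z‖ / ‖w‖, div_pos nz nw, ?_⟩
  have h1 := congrArg toC h
  rw [map_smul, map_smul, toC_rot, Complex.real_smul, Complex.real_smul] at h1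
  have nwc : (‖w‖ : ℂ) ≠ 0 := by exact_mod_cast nw.ne'
  have nzc : (‖z‖ : ℂ) ≠ 0 := by exact_mod_cast nz.ne'
  push_cast at h1 ⊢
  field_simp at h1 ⊢
  linear_combination -h1

/-! ### Effective drifts -/

section Drift

lemma toC_effectiveDrift {R : ℕ} {q : Fin R → PMF (ℤ × ℤ)} {ν : ℝ} (hν : 1 ≤ ν)
    (hq : ∀ i, FiniteMoment (q i) ν) (π : ℕ → ℝ≥0) (T : Matrix (Fin 2) (Fin 2) ℝ) :
    toC (T.toEuclideanLin (effectiveDrift q π))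
      = ∑ i : Fin R, (π i : ℂ) * meanJump q (axis₁ T) (axis₂ T) i := by
  rw [effectiveDrift, map_sum, map_sum]
  refine Finset.sum_congr rfl fun i _ => ?_
  rw [map_smul, map_smul, Complex.real_smul, meanJump, dif_pos i.2, (hq _).integral_zlin hν]

lemma effectiveDrift_apply {R : ℕ} (q : Fin R → PMF (ℤ × ℤ)) (π : ℕ → ℝ≥0) (k : Fin 2) :
    effectiveDrift q π k = ∑ i : Fin R, (π i : ℝ) * drift (q i) k := by
  rw [effectiveDrift, WithLp.ofLp_sum, Finset.sum_apply]
  rfl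

lemma integrable_of_map_eq {s : PMF (ℤ × ℤ)} {d : ℤ × ℤ → ℤ} {q : PMF ℕ} {i : ℕ}
    (h : s.map d = q.map fun j : ℕ => (j : ℤ) - i)
    (hs : Integrable (fun a => (d a : ℝ)) s.toMeasure) :
    Integrable (fun j : ℕ => (j : ℝ)) q.toMeasure ∧
      ∫ j, (j : ℝ) ∂q.toMeasure - i = ∫ a, (d a : ℝ) ∂s.toMeasure := by
  have h1 : Integrable (fun k : ℤ => (k : ℝ)) (s.map d).toMeasure :=
    (pmf_integrable_map _ _ .of_discrete).2 hs
  rw [h, pmf_integrable_map _ _ .of_discrete] at h1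
  have h2 : Integrable (fun j : ℕ => (j : ℝ)) q.toMeasure := by
    refine (h1.add (integrable_const (i : ℝ))).congr (Filter.Eventually.of_forall fun j => ?_)
    simp
  refine ⟨h2, ?_⟩
  have h3 := pmf_integral_map s d .of_discrete fun k : ℤ => (k : ℝ)
  rw [h, pmf_integral_map _ _ .of_discrete] at h3
  rw [← h3]
  push_cast
  rw [integral_sub h2 (integrable_const _)]
  simp

variable {Ω : Type*} [MeasurableSpace Ω] {R : ℕ} {p : ℕ × ℕ → PMF (ℕ × ℕ)} {p₀ : PMF (ℤ × ℤ)}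
  {p₁ p₂ : Fin R → PMF (ℤ × ℤ)} {P : ℕ × ℕ → Measure Ω} {Z : ℕ → Ω → ℕ × ℕ} {ν₀ ν₁ ν₂ : ℝ}

/-- The second component of a boundary drift is the mean increment of the projected chain, whose
stationary average is positive. -/
lemma effectiveDrift_pos₁ (hZ : IsMarkovChain p P Z) (hH : PartialHomogeneity R p p₀ p₁ p₂)
    (hI : Irreducibility R P Z) (hM : BoundedMoments p₀ p₁ p₂ ν₀ ν₁ ν₂) (hD : ZeroDrift p₀)
    (hS : (covMatrix p₀).PosDef) {π : ℕ → ℝ≥0}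
    (hπ : IsNormalizedInvariant R (fun i j => rowChain R p i j) π) :
    0 < effectiveDrift p₁ π 1 := by
  have key : ∀ i (hi : i < R), Integrable (fun j : ℕ => (j : ℝ)) (rowChain R p i).toMeasure ∧
      ∫ j, (j : ℝ) ∂(rowChain R p i).toMeasure - i = drift (p₁ ⟨i, hi⟩) 1 := fun i hi => by
    rw [← (hM.horizontal _).integral_snd hM.one_lt₁.le]
    exact integrable_of_map_eq (map_snd_eq (hH.increment₁ (z := (R, i)) le_rfl hi))
      ((hM.horizontal _).integrable_snd hM.one_lt₁.le)
  have := (isBoundaryChain₁ hZ hH hI hM hD hS).mean_pos hπ fun i hi => (key i hi).1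
  rw [effectiveDrift_apply]
  refine lt_of_lt_of_eq this (Finset.sum_congr rfl fun i _ => ?_)
  rw [(key i i.2).2]

lemma effectiveDrift_pos₂ (hZ : IsMarkovChain p P Z) (hH : PartialHomogeneity R p p₀ p₁ p₂)
    (hI : Irreducibility R P Z) (hM : BoundedMoments p₀ p₁ p₂ ν₀ ν₁ ν₂) (hD : ZeroDrift p₀)
    (hS : (covMatrix p₀).PosDef) {π : ℕ → ℝ≥0}
    (hπ : IsNormalizedInvariant R (fun i j => colChain R p i j) π) :
    0 < effectiveDrift p₂ π 0 := by
  have key : ∀ i (hi : i < R), Integrable (fun j : ℕ => (j : ℝ)) (colChain R p i).toMeasure ∧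
      ∫ j, (j : ℝ) ∂(colChain R p i).toMeasure - i = drift (p₂ ⟨i, hi⟩) 0 := fun i hi => by
    rw [← (hM.vertical _).integral_fst hM.one_lt₂.le]
    exact integrable_of_map_eq (map_fst_eq (hH.increment₂ (z := (i, R)) hi le_rfl))
      ((hM.vertical _).integrable_fst hM.one_lt₂.le)
  have := (isBoundaryChain₂ hZ hH hI hM hD hS).mean_pos hπ fun i hi => (key i hi).1
  rw [effectiveDrift_apply]
  refine lt_of_lt_of_eq this (Finset.sum_congr rfl fun i _ => ?_)
  rw [(key i i.2).2]

/-! ### The characteristic parameter is well defined -/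

lemma toC_axis₁ (T : Matrix (Fin 2) (Fin 2) ℝ) :
    toC (T.toEuclideanLin !₂[1, 0]) = axis₁ T := by
  rw [toC_toEuclideanLin]; simp

lemma toC_axis₂ (T : Matrix (Fin 2) (Fin 2) ℝ) :
    toC (T.toEuclideanLin !₂[0, 1]) = axis₂ T := by
  rw [toC_toEuclideanLin]; simp

/-- Uniqueness holds ingredient by ingredient: the normalising map, the invariant measures on the
boundary layers, and the angles as arguments of quotients. Existence of the angles in (-π/2, π/2)
rests on the effective drifts pointing inwards, which makes two quotients have positive real part.
-/
theorem existsUnique_characteristicParameter (hZ : IsMarkovChain p P Z)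
    (hH : PartialHomogeneity R p p₀ p₁ p₂) (hI : Irreducibility R P Z)
    (hM : BoundedMoments p₀ p₁ p₂ ν₀ ν₁ ν₂) (hD : ZeroDrift p₀) (hS : (covMatrix p₀).PosDef) :
    ∃! χ : ℝ, IsCharacteristicParameter p₀ p₁ p₂ χ := by
  have hc₁ := isBoundaryChain₁ hZ hH hI hM hD hS
  have hc₂ := isBoundaryChain₂ hZ hH hI hM hD hS
  obtain ⟨T, hT, hTu⟩ := existsUnique_isNormalizingMap hS
  obtain ⟨π₁, hπ₁⟩ := hc₁.exists_invariant
  obtain ⟨π₂, hπ₂⟩ := hc₂.exists_invariant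
  have hpos₁ := effectiveDrift_pos₁ hZ hH hI hM hD hS hπ₁
  have hpos₂ := effectiveDrift_pos₂ hZ hH hI hM hD hS hπ₂
  have he : IsCone (axis₁ T) (axis₂ T) := IsNormalizingMap.isCone hT
  set μ₁ := effectiveDrift p₁ π₁ with hμ₁
  set μ₂ := effectiveDrift p₂ π₂ with hμ₂
  have hpi := Real.pi_pos
  have sub : Set.Ioo (-(Real.pi / 2)) (Real.pi / 2) ⊆ Set.Ioc (-Real.pi) Real.pi :=
    fun θ h => ⟨by linarith [h.1], by linarith [h.2]⟩
  have sub₀ : Set.Ioo 0 Real.pi ⊆ Set.Ioc (-Real.pi) Real.pi :=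
    fun θ h => ⟨by linarith [h.1], h.2.le⟩
  set A := toC (T.toEuclideanLin !₂[0, 1]) / toC (T.toEuclideanLin !₂[1, 0]) with hA
  set B := toC (T.toEuclideanLin μ₁) / toC (rot (Real.pi / 2) (T.toEuclideanLin !₂[1, 0])) with hB
  set C := toC (rot (-(Real.pi / 2)) (T.toEuclideanLin !₂[0, 1])) / toC (T.toEuclideanLin μ₂)
    with hC
  have h1re : 0 < (axis₁ T).re := he.re₁
  have h2im : 0 < (axis₂ T).im := he.im₂
  have ax1 : axis₁ T = ((axis₁ T).re : ℂ) := Complex.ext rfl (by simpa using he.im₁)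
  have rot1 : toC (rot (Real.pi / 2) (T.toEuclideanLin !₂[1, 0])) = Complex.I * axis₁ T := by
    rw [toC_rot, toC_axis₁]; push_cast; rw [Complex.exp_pi_div_two_mul_I]
  have rot2 : toC (rot (-(Real.pi / 2)) (T.toEuclideanLin !₂[0, 1])) = -Complex.I * axis₂ T := by
    rw [toC_rot, toC_axis₂]; push_cast
    rw [neg_mul, Complex.exp_neg, Complex.exp_pi_div_two_mul_I, Complex.inv_I]
  have n1 : axis₁ T ≠ 0 := fun h => by rw [h] at h1re; simp at h1re
  have n2 : axis₂ T ≠ 0 := fun h => by rw [h] at h2im; simp at h2im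
  have m1im : 0 < (toC (T.toEuclideanLin μ₁)).im := by
    rw [toC_toEuclideanLin]
    simp only [Complex.add_im, Complex.mul_im, Complex.ofReal_re, Complex.ofReal_im, zero_mul,
      add_zero, he.im₁, mul_zero, zero_add]
    exact mul_pos hpos₁ h2im
  have nm1 : toC (T.toEuclideanLin μ₁) ≠ 0 := fun h => by rw [h] at m1im; simp at m1im
  have m2re : 0 < (-Complex.I * axis₂ T * (starRingEnd ℂ) (toC (T.toEuclideanLin μ₂))).re := by
    rw [toC_toEuclideanLin]
    simp [he.im₁]
    have := mul_pos (mul_pos hpos₂ h1re) h2im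
    nlinarith
  have nm2 : toC (T.toEuclideanLin μ₂) ≠ 0 := fun h => by rw [h] at m2re; simp at m2re
  have hAarg : A.arg ∈ Set.Ioo 0 Real.pi := by
    have : 0 < A.im := by
      rw [hA, toC_axis₁, toC_axis₂, ax1, Complex.div_ofReal_im]
      exact div_pos h2im h1re
    refine ⟨lt_of_le_of_ne (Complex.arg_nonneg_iff.2 this.le) fun h => ?_,
      lt_of_le_of_ne (Complex.arg_le_pi _) fun h => ?_⟩
    · exact this.ne' (Complex.arg_eq_zero_iff.1 h.symm).2
    · exact this.ne' (Complex.arg_eq_pi_iff.1 h).2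
  have hBarg : B.arg ∈ Set.Ioo (-(Real.pi / 2)) (Real.pi / 2) := by
    have : 0 < B.re := by
      rw [hB, rot1, ← div_div, ax1, Complex.div_ofReal_re]
      refine div_pos ?_ h1re
      rw [Complex.div_I]; simpa using m1im
    exact abs_lt.1 (Complex.abs_arg_lt_pi_div_two_iff.2 (Or.inl this))
  have hCarg : C.arg ∈ Set.Ioo (-(Real.pi / 2)) (Real.pi / 2) := by
    have : 0 < C.re := by
      rw [hC, rot2, div_eq_mul_inv, Complex.inv_def, ← mul_assoc, Complex.re_mul_ofReal]
      exact mul_pos m2re (inv_pos.2 (Complex.normSq_pos.2 nm2))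
    exact abs_lt.1 (Complex.abs_arg_lt_pi_div_two_iff.2 (Or.inl this))
  refine ⟨(B.arg + C.arg) / A.arg, ?_, ?_⟩
  · refine ⟨π₁, π₂, T, A.arg, B.arg, C.arg, by rwa [hH.verticalProjection_eq],
      by rwa [hH.horizontalProjection_eq], hT, hAarg, hBarg, hCarg,
      (isAngle_iff (sub₀ hAarg)).2 ⟨?_, ?_, rfl⟩, (isAngle_iff (sub hBarg)).2 ⟨?_, nm1, rfl⟩,
      (isAngle_iff (sub hCarg)).2 ⟨nm2, ?_, rfl⟩, rfl⟩
    · rwa [toC_axis₁]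
    · rwa [toC_axis₂]
    · rw [rot1]; exact mul_ne_zero Complex.I_ne_zero n1
    · rw [rot2]; exact mul_ne_zero (neg_ne_zero.2 Complex.I_ne_zero) n2
  · rintro χ ⟨π₁', π₂', T', φ₀, φ₁, φ₂, hπ₁', hπ₂', hT', hφ₀, hφ₁, hφ₂, ha₀, ha₁, ha₂, rfl⟩
    rw [hH.verticalProjection_eq] at hπ₁'
    rw [hH.horizontalProjection_eq] at hπ₂'
    have e1 : effectiveDrift p₁ π₁' = μ₁ := Finset.sum_congr rfl fun i _ => by
      rw [hc₁.invariant_unique hπ₁' hπ₁ i]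
    have e2 : effectiveDrift p₂ π₂' = μ₂ := Finset.sum_congr rfl fun i _ => by
      rw [hc₂.invariant_unique hπ₂' hπ₂ i]
    rw [hTu T' hT', e1] at ha₁
    rw [hTu T' hT', e2] at ha₂
    rw [hTu T' hT'] at ha₀
    rw [((isAngle_iff (sub₀ hφ₀)).1 ha₀).2.2, ((isAngle_iff (sub hφ₁)).1 ha₁).2.2,
      ((isAngle_iff (sub hφ₂)).1 ha₂).2.2]

/-- The characteristic parameter in polar coordinates. -/
theorem IsCharacteristicParameter.exists_isPolar (hH : PartialHomogeneity R p p₀ p₁ p₂)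
    (hM : BoundedMoments p₀ p₁ p₂ ν₀ ν₁ ν₂) {χ : ℝ}
    (hχ : IsCharacteristicParameter p₀ p₁ p₂ χ) :
    ∃ (T : Matrix (Fin 2) (Fin 2) ℝ) (π₁ π₂ : ℕ → ℝ≥0) (φ₁ φ₂ : ℝ),
      IsNormalizingMap (covMatrix p₀) T ∧
      IsNormalizedInvariant R (fun i j => rowChain R p i j) π₁ ∧
      IsNormalizedInvariant R (fun i j => colChain R p i j) π₂ ∧
      IsWalk.IsPolar R (axis₂ T) (meanJump p₁ (axis₁ T) (axis₂ T))
        (meanJump p₂ (axis₁ T) (axis₂ T)) π₁ π₂ φ₁ φ₂ χ := by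
  obtain ⟨π₁, π₂, T, φ₀, φ₁, φ₂, hπ₁, hπ₂, hT, hφ₀, hφ₁, hφ₂, ha₀, ha₁, ha₂, rfl⟩ := hχ
  rw [hH.verticalProjection_eq] at hπ₁
  rw [hH.horizontalProjection_eq] at hπ₂
  have he : IsCone (axis₁ T) (axis₂ T) := IsNormalizingMap.isCone hT
  have h1re : 0 < (axis₁ T).re := he.re₁
  have ax1 : axis₁ T = ((axis₁ T).re : ℂ) := Complex.ext rfl (by simpa using he.im₁)
  have n2 : axis₂ T ≠ 0 := fun h => by have := he.im₂; rw [h] at this; simp at this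
  have hpi := Real.pi_pos
  have hφ : φ₀ = (axis₂ T).arg := by
    rw [((isAngle_iff ⟨by linarith [hφ₀.1], hφ₀.2.le⟩).1 ha₀).2.2, toC_axis₁, toC_axis₂, ax1,
      div_eq_inv_mul, ← Complex.ofReal_inv, Complex.arg_real_mul _ (inv_pos.2 h1re)]
  refine ⟨T, π₁, π₂, φ₁, φ₂, hT, hπ₁, hπ₂, ?_, ?_, abs_lt.2 hφ₁, abs_lt.2 hφ₂, ?_⟩
  · obtain ⟨s, hs, h⟩ := ha₁.exists_eq
    refine ⟨s * (axis₁ T).re, mul_pos hs h1re, ?_⟩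
    rw [← toC_effectiveDrift hM.one_lt₁.le hM.horizontal, h, toC_rot, toC_axis₁]
    push_cast
    rw [add_mul, Complex.exp_add]
    nth_rewrite 1 [ax1]
    ring
  · obtain ⟨s, hs, h⟩ := ha₂.exists_eq
    refine ⟨s⁻¹ * ‖axis₂ T‖, mul_pos (inv_pos.2 hs) (norm_pos_iff.2 n2), ?_⟩
    rw [← toC_effectiveDrift hM.one_lt₂.le hM.vertical]
    rw [toC_rot, toC_axis₂] at h
    have hsc : (s : ℂ) ≠ 0 := by exact_mod_cast hs.ne'
    have hx := Complex.norm_mul_exp_arg_mul_I (axis₂ T)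
    push_cast at h ⊢
    have e : Complex.exp (((axis₂ T).arg - Real.pi / 2 - φ₂) * Complex.I)
        = Complex.exp ((axis₂ T).arg * Complex.I) * Complex.exp (-(Real.pi / 2) * Complex.I)
          * (Complex.exp (φ₂ * Complex.I))⁻¹ := by
      rw [← Complex.exp_neg, ← Complex.exp_add, ← Complex.exp_add]; ring_nf
    have e0 : Complex.exp (φ₂ * Complex.I) ≠ 0 := Complex.exp_ne_zero _
    rw [e]
    rw [← hx] at h
    generalize Complex.exp (φ₂ * Complex.I) = x at h e0 ⊢
    generalize Complex.exp (-(Real.pi / 2) * Complex.I) = y at h ⊢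
    generalize Complex.exp ((axis₂ T).arg * Complex.I) = t at h ⊢
    field_simp
    linear_combination -h
  · rw [← hφ, div_mul_cancel₀ _ hφ₀.1.ne']

end Drift

/-! ### Reachability -/

section Reach

variable {Ω : Type*} [MeasurableSpace Ω] {R : ℕ} {p : ℕ × ℕ → PMF (ℕ × ℕ)} {p₀ : PMF (ℤ × ℤ)}
  {p₁ p₂ : Fin R → PMF (ℤ × ℤ)} {P : ℕ × ℕ → Measure Ω} {Z : ℕ → Ω → ℕ × ℕ}

/-- Outside a ball containing the corner some coordinate is at least `R`. According to which one it
is, irreducibility off one boundary leads to (R, 0) or to (0, R), both in the ball. -/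
lemma exists_path_to_ball (hZ : IsMarkovChain p P Z) (hI : Irreducibility R P Z) {r : ℝ}
    (hr : R * √2 < r) {z : ℕ × ℕ} (hz : z ∉ ball r) :
    ∃ w ∈ ball r, Relation.ReflTransGen (fun a b => p a b ≠ 0) z w := by
  have hR : (R : ℝ) ≤ r := by
    refine le_trans ?_ hr.le
    refine le_mul_of_one_le_right (Nat.cast_nonneg R) ?_
    exact Real.one_le_sqrt.2 (by norm_num)
  have hcor : R ≤ z.1 ∨ R ≤ z.2 := by
    by_contra h
    push Not at h
    exact hz (corner_subset_ball hr h)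
  rcases hcor with h | h
  · refine ⟨(R, 0), (stateNorm_le_add _).trans (by simpa using hR), ?_⟩
    exact Relation.ReflTransGen.mono (fun a b hab => hab.1) _ _ (exists_path₁ hZ hI h le_rfl)
  · refine ⟨(0, R), (stateNorm_le_add _).trans (by simpa using hR), ?_⟩
    exact Relation.ReflTransGen.mono (fun a b hab => hab.1) _ _ (exists_path₂ hZ hI h le_rfl)

/-- Off the vertical boundary and the corner, transitions are invariant under horizontal
translation, so whole paths can be pushed outwards. -/
lemma PartialHomogeneity.shift₁ (hH : PartialHomogeneity R p p₀ p₁ p₂) (N : ℕ) {a : ℕ × ℕ}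
    (ha : R ≤ a.1) (b : ℕ × ℕ) : p (a.1 + N, a.2) (b.1 + N, b.2) = p a b := by
  have e : toInt (b.1 + N, b.2) - toInt (a.1 + N, a.2) = toInt b - toInt a := by simp [toInt]
  by_cases h : a.2 < R
  · have h1 := hH.horizontal (a.1 + N) ⟨a.2, h⟩ (b.1 + N, b.2) (by omega)
    have h2 := hH.horizontal a.1 ⟨a.2, h⟩ b ha
    rw [h1, e, ← h2]
  · rw [hH.interior (a.1 + N, a.2) _ ⟨by simp only; omega, not_lt.1 h⟩,
      hH.interior a b ⟨ha, not_lt.1 h⟩, e]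

lemma PartialHomogeneity.shift₂ (hH : PartialHomogeneity R p p₀ p₁ p₂) (N : ℕ) {a : ℕ × ℕ}
    (ha : R ≤ a.2) (b : ℕ × ℕ) : p (a.1, a.2 + N) (b.1, b.2 + N) = p a b := by
  have e : toInt (b.1, b.2 + N) - toInt (a.1, a.2 + N) = toInt b - toInt a := by simp [toInt]
  by_cases h : a.1 < R
  · have h1 := hH.vertical ⟨a.1, h⟩ (a.2 + N) (b.1, b.2 + N) (by omega)
    have h2 := hH.vertical ⟨a.1, h⟩ a.2 b ha
    rw [h1, e, ← h2]
  · rw [hH.interior (a.1, a.2 + N) _ ⟨not_lt.1 h, by simp only; omega⟩,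
      hH.interior a b ⟨not_lt.1 h, ha⟩, e]

/-- From every state far enough out, the walk can escape to arbitrarily distant states without
visiting a given ball. -/
lemma exists_path_far (hZ : IsMarkovChain p P Z) (hH : PartialHomogeneity R p p₀ p₁ p₂)
    (hI : Irreducibility R P Z) (r : ℝ) :
    ∃ r₀ : ℝ, r < r₀ ∧ ∀ ρ : ℝ, ∀ z ∉ ball r₀, ∃ w ∉ ball ρ,
      Relation.ReflTransGen (StepOff p (ball r)) z w := by
  obtain ⟨N, hN⟩ := exists_nat_gt r
  -- Beyond this radius one coordinate exceeds `R + N`, so the state can be moved back by `N`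
  -- without meeting the opposite boundary.
  refine ⟨2 * (R + N), ?_, fun ρ z hz => ?_⟩
  · have : (0 : ℝ) ≤ R := Nat.cast_nonneg R
    have : (0 : ℝ) ≤ N := Nat.cast_nonneg N
    linarith
  obtain ⟨K, hK⟩ := exists_nat_gt ρ
  have hfar : ∀ a : ℕ × ℕ, N ≤ a.1 ∨ N ≤ a.2 → a ∉ ball r := by
    rintro a (h | h) (ha : stateNorm a ≤ r)
    · have h1 : (N : ℝ) ≤ a.1 := by exact_mod_cast h
      linarith [fst_le_stateNorm a]
    · have h1 : (N : ℝ) ≤ a.2 := by exact_mod_cast h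
      linarith [snd_le_stateNorm a]
  have hz1 : R + N ≤ z.1 ∨ R + N ≤ z.2 := by
    by_contra h
    push Not at h
    have h1 : (z.1 : ℝ) ≤ R + N := by exact_mod_cast h.1.le
    have h2 : (z.2 : ℝ) ≤ R + N := by exact_mod_cast h.2.le
    exact hz ((stateNorm_le_add z).trans (by linarith))
  rcases hz1 with h | h
  · refine ⟨(R + K + N, z.2), fun hw => ?_, ?_⟩
    · have h1 := (fst_le_stateNorm _).trans hw
      push_cast at h1
      have : (0 : ℝ) ≤ R := Nat.cast_nonneg R
      have : (0 : ℝ) ≤ N := Nat.cast_nonneg N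
      linarith
    -- A path is found for the state moved back by `N` and then translated forward; every first
    -- coordinate is then at least `N`, hence the path avoids the ball.
    · have hp := exists_path₁ hZ hI (z := (z.1 - N, z.2)) (w := (R + K, z.2))
        (by simp only; omega) (by simp only; omega)
      have := Relation.ReflTransGen.lift (p := StepOff p (ball r))
        (fun a : ℕ × ℕ => (a.1 + N, a.2)) (fun a b hab => by
          refine ⟨?_, hfar _ (Or.inl (by simp)), hfar _ (Or.inl (by simp))⟩
          rw [hH.shift₁ N hab.2.1]; exact hab.1) _ _ hp
      simpa only [Function.onFun, Nat.sub_add_cancel (by omega : N ≤ z.1)] using this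
  · refine ⟨(z.1, R + K + N), fun hw => ?_, ?_⟩
    · have h1 := (snd_le_stateNorm _).trans hw
      push_cast at h1
      have : (0 : ℝ) ≤ R := Nat.cast_nonneg R
      have : (0 : ℝ) ≤ N := Nat.cast_nonneg N
      linarith
    · have hp := exists_path₂ hZ hI (z := (z.1, z.2 - N)) (w := (z.1, R + K))
        (by simp only; omega) (by simp only; omega)
      have := Relation.ReflTransGen.lift (p := StepOff p (ball r))
        (fun a : ℕ × ℕ => (a.1, a.2 + N)) (fun a b hab => by
          refine ⟨?_, hfar _ (Or.inr (by simp)), hfar _ (Or.inr (by simp))⟩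
          rw [hH.shift₂ N hab.2.1]; exact hab.1) _ _ hp
      simpa only [Function.onFun, Nat.sub_add_cancel (by omega : N ≤ z.2)] using this

/-- A lower bound for the survival probability far away extends to all states from which the walk
can escape. -/
lemma exists_uniform_lower {r r₀ ρ d : ℝ} {u : ℕ → ℝ} (hr₀ : r < r₀) (hd : 0 < d)
    (hu : ∀ n, 0 ≤ u n)
    (hreach : ∀ z ∉ ball r₀, ∃ w ∉ ball ρ, Relation.ReflTransGen (StepOff p (ball r)) z w)
    (hlow : ∀ z ∉ ball ρ, ∀ n : ℕ, 1 ≤ n →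
      ENNReal.ofReal (d * u n) ≤ (killed p (ball r))^[n] (fun _ => 1) z) :
    ∃ c : ℝ, 0 < c ∧ ∀ z ∉ ball r₀, ∀ n : ℕ, 1 ≤ n →
      ENNReal.ofReal (c * u n) ≤ (killed p (ball r))^[n] (fun _ => 1) z := by
  have h1 : ∀ z : ℕ × ℕ, ∃ c : ℝ, 0 < c ∧ (z ∉ ball r₀ → ∀ n : ℕ, 1 ≤ n →
      ENNReal.ofReal (c * u n) ≤ (killed p (ball r))^[n] (fun _ => 1) z) := by
    intro z
    by_cases hz : z ∈ ball r₀
    · exact ⟨1, one_pos, fun h => absurd hz h⟩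
    obtain ⟨w, hw, hzw⟩ := hreach z hz
    obtain ⟨c, hc, hct, k, hk⟩ := exists_survival_ge hzw
    refine ⟨c.toReal * d, mul_pos (ENNReal.toReal_pos hc hct) hd, fun _ n hn => ?_⟩
    rw [mul_assoc, ENNReal.ofReal_mul ENNReal.toReal_nonneg, ENNReal.ofReal_toReal hct]
    refine (mul_le_mul' le_rfl (hlow w hw n hn)).trans ((hk n).trans ?_)
    -- The k steps spent reaching `w` only lower the survival probability at the later time n + k.
    exact killed_iterate_one_antitone z (fun h => hz (ball_mono hr₀.le h)) (Nat.le_add_right n k)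
  choose c hc hcz using h1
  -- Only finitely many states lie within ρ, so their individual constants have a positive common
  -- lower bound.
  obtain ⟨S, hS0, hS⟩ := exists_bound_of_finite (finite_ball ρ) fun z => (c z)⁻¹
  refine ⟨min d (S + 1)⁻¹, lt_min hd (by positivity), fun z hz n hn => ?_⟩
  by_cases hzρ : z ∈ ball ρ
  · refine (ENNReal.ofReal_le_ofReal ?_).trans (hcz z hz n hn)
    refine mul_le_mul_of_nonneg_right ((min_le_right _ _).trans ?_) (hu n)
    rw [inv_le_comm₀ (by positivity) (hc z)]
    have := hS z hzρ
    linarith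
  · refine (ENNReal.ofReal_le_ofReal ?_).trans (hlow z hzρ n hn)
    exact mul_le_mul_of_nonneg_right (min_le_left _ _) (hu n)

end Reach

/-! ### Infinite passage times -/

section Infinite

lemma setOf_passageTime_eq_top {Ω : Type*} {Z : ℕ → Ω → ℕ × ℕ} {B : Set (ℕ × ℕ)} :
    {ω | passageTime Z B ω = ⊤} = ⋂ n : ℕ, {ω | (n : ℕ∞) < passageTime Z B ω} := by
  ext ω
  simp only [Set.mem_ofPred_eq, Set.mem_iInter]
  constructor
  · intro h n
    rw [h]; exact ENat.natCast_lt_top n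
  · intro h
    by_contra hc
    obtain ⟨n, hn⟩ := ENat.ne_top_iff_exists.1 hc
    exact (h n).ne hn

variable {Ω : Type*} [MeasurableSpace Ω] {p : ℕ × ℕ → PMF (ℕ × ℕ)} {P : ℕ × ℕ → Measure Ω}
  {Z : ℕ → Ω → ℕ × ℕ} {B : Set (ℕ × ℕ)}

lemma measurableSet_lt_passageTime (hZ : IsMarkovChain p P Z) (n : ℕ) :
    MeasurableSet {ω | (n : ℕ∞) < passageTime Z B ω} := by
  have : {ω | (n : ℕ∞) < passageTime Z B ω} = ⋂ i ∈ Finset.range (n + 1), Z i ⁻¹' Bᶜ := by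
    ext ω
    simp [lt_passageTime_iff]
  rw [this]
  exact Finset.measurableSet_biInter _ fun i _ => hZ.measurable i (Set.to_countable _).measurableSet

lemma measurableSet_passageTime_eq_top (hZ : IsMarkovChain p P Z) :
    MeasurableSet {ω | passageTime Z B ω = ⊤} := by
  rw [setOf_passageTime_eq_top]
  exact MeasurableSet.iInter fun n => measurableSet_lt_passageTime hZ n

lemma le_prob_passageTime_eq_top (hZ : IsMarkovChain p P Z) {z : ℕ × ℕ} {c : ℝ≥0∞}
    (h : ∀ n : ℕ, c ≤ P z {ω | (n : ℕ∞) < passageTime Z B ω}) :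
    c ≤ P z {ω | passageTime Z B ω = ⊤} := by
  have := hZ.isProbabilityMeasure z
  rw [setOf_passageTime_eq_top]
  refine ge_of_tendsto (tendsto_measure_iInter_atTop
    (fun n => (measurableSet_lt_passageTime hZ n).nullMeasurableSet) (fun m n hmn ω hω => ?_)
    ⟨0, measure_ne_top _ _⟩) (Filter.Eventually.of_forall h)
  exact lt_of_le_of_lt (Nat.cast_le.2 hmn : (m : ℕ∞) ≤ n) hω

lemma prob_passageTime_lt_top (hZ : IsMarkovChain p P Z) {z : ℕ × ℕ} {D a : ℝ} (ha : a < 0)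
    (h : ∀ n : ℕ, 1 ≤ n →
      P z {ω | (n : ℕ∞) < passageTime Z B ω} ≤ ENNReal.ofReal (D * (n : ℝ) ^ a)) :
    P z {ω | passageTime Z B ω < ⊤} = 1 := by
  have := hZ.isProbabilityMeasure z
  have hT : Filter.Tendsto (fun n : ℕ => ENNReal.ofReal (D * (n : ℝ) ^ a)) Filter.atTop
      (nhds 0) := by
    have h1 := ((tendsto_rpow_neg_atTop (neg_pos.2 ha)).comp
      tendsto_natCast_atTop_atTop).const_mul D
    simp only [neg_neg, mul_zero] at h1
    simpa using ENNReal.tendsto_ofReal h1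
  have h0 : P z {ω | passageTime Z B ω = ⊤} = 0 := by
    refine le_antisymm (ge_of_tendsto hT ?_) zero_le
    filter_upwards [Filter.eventually_ge_atTop 1] with n hn
    refine (measure_mono ?_).trans (h n hn)
    rw [setOf_passageTime_eq_top]
    exact Set.iInter_subset _ n
  have e : {ω | passageTime Z B ω < ⊤} = {ω | passageTime Z B ω = ⊤}ᶜ := by
    ext ω; simp [lt_top_iff_ne_top]
  rw [e, prob_compl_eq_one_iff (measurableSet_passageTime_eq_top hZ), h0]

end Infinite

end QuadrantWalk

end

/-! ### The main theorem -/

open QuadrantWalk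
theorem mainTheorem1 {Ω : Type*} [MeasurableSpace Ω] (R : ℕ)
    (p : ℕ × ℕ → PMF (ℕ × ℕ)) (p₀ : PMF (ℤ × ℤ)) (p₁ p₂ : Fin R → PMF (ℤ × ℤ))
    (P : ℕ × ℕ → Measure Ω) (Z : ℕ → Ω → ℕ × ℕ) (ν₀ ν₁ ν₂ : ℝ)
    (hZ : IsMarkovChain p P Z)
    (hH : PartialHomogeneity R p p₀ p₁ p₂)
    (hI : Irreducibility R P Z)
    (hM : BoundedMoments p₀ p₁ p₂ ν₀ ν₁ ν₂)
    (hD : ZeroDrift p₀)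
    (hS : (covMatrix p₀).PosDef) :
    (∃! χ : ℝ, IsCharacteristicParameter p₀ p₁ p₂ χ) ∧
    ∀ χ ν : ℝ, IsCharacteristicParameter p₀ p₁ p₂ χ → ν = min ν₀ (min ν₁ ν₂) →
      ((0 < χ → Recurrent R P Z) ∧ (χ < 0 → Transient R P Z)) ∧
      (0 < χ → ∀ r ε : ℝ, R * √2 < r → 0 < ε → ∀ z : ℕ × ℕ, ∃ C : ℝ, ∀ n : ℕ, 1 ≤ n →
        (P z).real {ω | (n : ℕ∞) < passageTime Z (ball r) ω} ≤
          C * (n : ℝ) ^ (-(min ν χ) / 2 + ε)) ∧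
      (max 2 χ < ν → ∀ r : ℝ, 0 < r → ∃ r₀ : ℝ, r < r₀ ∧
        ∀ ε : ℝ, 0 < ε → 0 ≤ χ / 2 + ε → ∃ c : ℝ, 0 < c ∧
          ∀ z : ℕ × ℕ, z ∉ ball r₀ → ∀ n : ℕ, 1 ≤ n →
            c * (n : ℝ) ^ (-χ / 2 - ε) ≤
              (P z).real {ω | (n : ℕ∞) < passageTime Z (ball r) ω}) := by
  refine ⟨existsUnique_characteristicParameter hZ hH hI hM hD hS, ?_⟩
  rintro χ ν hχ rfl
  obtain ⟨T, π₁, π₂, φ₁, φ₂, hT, hπ₁, hπ₂, hP⟩ := hχ.exists_isPolar hH hM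
  have hW := isWalk hZ hH hI hM hD hS hT
  have hν := hW.one_lt
  have hupper : 0 < χ → ∀ r ε : ℝ, R * √2 < r → 0 < ε → ∀ z : ℕ × ℕ, ∃ D : ℝ, 0 ≤ D ∧
      ∀ n : ℕ, 1 ≤ n → P z {ω | (n : ℕ∞) < passageTime Z (ball r) ω} ≤
        ENNReal.ofReal (D * (n : ℝ) ^ (-(min (min ν₀ (min ν₁ ν₂)) χ) / 2 + ε)) := by
    intro hχ0 r ε hr hε z
    by_cases hz : z ∈ ball r
    · exact ⟨0, le_rfl, fun n _ => by rw [prob_lt_passageTime_of_mem hZ n hz]; exact zero_le⟩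
    · obtain ⟨D, hD0, hD⟩ := hW.survival_upper hπ₁ hπ₂ hP hχ0 hr
        (fun w hw => exists_path_to_ball hZ hI hr hw) hε hz
      exact ⟨D, hD0, fun n hn => by rw [prob_lt_passageTime hZ _ n hz]; exact hD n hn⟩
  refine ⟨⟨fun hχ0 r hr z => ?_, fun hχ0 r _ => ?_⟩, fun hχ0 r ε hr hε z => ?_,
    fun hmax r _ => ?_⟩
  · have hm : 0 < min (min ν₀ (min ν₁ ν₂)) χ := lt_min (by linarith) hχ0
    -- A quarter of the minimum as ε leaves a negative exponent, and decay of the survival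
    -- probability gives recurrence.
    obtain ⟨D, -, hD⟩ := hupper hχ0 r (min (min ν₀ (min ν₁ ν₂)) χ / 4) hr (by linarith) z
    exact prob_passageTime_lt_top hZ (by linarith) hD
  · obtain ⟨r₀, hr₀, h⟩ := hW.survival_transient hπ₁ hπ₂ hP hχ0 r
    refine ⟨r₀, hr₀, fun z hz => ?_⟩
    refine lt_of_lt_of_le (by simp) (le_prob_passageTime_eq_top hZ (c := 2⁻¹) fun n => ?_)
    rw [prob_lt_passageTime hZ _ n fun hc => hz (ball_mono hr₀.le hc)]
    exact h z hz n
  · obtain ⟨D, hD0, hD⟩ := hupper hχ0 r ε hr hε z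
    refine ⟨D, fun n hn => ENNReal.toReal_le_of_le_ofReal ?_ (hD n hn)⟩
    positivity
  · have hreal : ∀ {c x : ℝ} {z : ℕ × ℕ} {n : ℕ}, z ∉ ball r →
        ENNReal.ofReal (c * x) ≤ (killed p (ball r))^[n] (fun _ => 1) z →
        c * x ≤ (P z).real {ω | (n : ℕ∞) < passageTime Z (ball r) ω} := by
      intro c x z n hz h
      have := hZ.isProbabilityMeasure z
      rw [← prob_lt_passageTime hZ _ n hz] at h
      exact (ENNReal.ofReal_le_iff_le_toReal (measure_ne_top _ _)).1 h
    rcases lt_or_ge χ 0 with hχ0 | hχ0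
    · obtain ⟨r₀, hr₀, h⟩ := hW.survival_transient hπ₁ hπ₂ hP hχ0 r
      refine ⟨r₀, hr₀, fun ε _ hε => ⟨2⁻¹, by norm_num, fun z hz n hn => ?_⟩⟩
      refine hreal (fun hc => hz (ball_mono hr₀.le hc)) (le_trans ?_ (h z hz n))
      have hn1 : (1 : ℝ) ≤ n := by exact_mod_cast hn
      -- For χ < 0 survival is bounded below by 1/2, and the restriction on ε keeps the power at
      -- most 1.
      have h1 := Real.rpow_le_one_of_one_le_of_nonpos hn1 (show -χ / 2 - ε ≤ 0 by linarith)
      refine (ENNReal.ofReal_le_ofReal (mul_le_of_le_one_right (by norm_num) h1)).trans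
        (le_of_eq ?_)
      rw [ENNReal.ofReal_inv_of_pos two_pos, ENNReal.ofReal_ofNat]
    -- The radius comes from reachability alone, so it does not depend on ε; the radius that depends
    -- on ε is reached by paths avoiding the ball.
    · obtain ⟨r₀, hr₀, hreach⟩ := exists_path_far hZ hH hI r
      refine ⟨r₀, hr₀, fun ε hε _ => ?_⟩
      obtain ⟨d, ρ, hd, -, hlow⟩ := hW.survival_lower hπ₁ hπ₂ hP hχ0 hmax r hε
      obtain ⟨c, hc, h⟩ := exists_uniform_lower hr₀ hd (u := fun n => (n : ℝ) ^ (-χ / 2 - ε))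
        (fun n => by positivity) (hreach ρ) hlow
      exact ⟨c, hc, fun z hz n hn => hreal (fun hc => hz (ball_mono hr₀.le hc)) (h z hz n hn)⟩
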